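/- **Setting.** Let $n\ge 1$, $\kappa\in\mathbb R$, $0<\gamma\le 1$, $0<\mu\le n$, $0<\nu\le 1$, and let $\ell_<$ satisfy $0\le \ell_<<n/2$, $\ell_<>n/2-\mu$. Let $\widehat u(\xi)=(2\pi)^{-n/2}\int e^{-ix\cdot\xi}u(x)\,dx$. For $\rho\ge 0$ and $k,\ell\in\mathbb R$ put $f(\xi)=\exp(\rho(|\xi|^\nu\vee 1))$ and $$\|w;K^k_\rho\|^2=\int_{|\xi|>1}|\xi|^{2k}f^2|\widehat w|^2\,d\xi+\int_{|\xi|\le1}f^2|\widehat w|^2\,d\xi,\qquad \|\varphi;Y^\ell_\rho\|^2=\int_{|\xi|>1}|\xi|^{2(\ell+2)}f^2|\widehat\varphi|^2\,d\xi+\int_{|\xi|\le1}|\xi|^{2\ell_<}f^2|\widehat\varphi|^2\,d\xi ;$$ $K^k_\rho$ and $Y^\ell_\rho$ are the spaces of complex $w$, resp. real $\varphi$, with locally integrable Fourier transform and finite norm. Consider the auxiliary system $$\partial_t w=\frac{i}{2t^2}\Delta w+\frac1{2t^2}(2\nabla\varphi\cdot\nabla+(\Delta\varphi))w,\qquad \partial_t\varphi=\frac1{2t^2}|\nabla\varphi|^2+t^{-\gamma}g_0(w,w),\qquad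 g_0(w_1,w_2)=\kappa\,\mathrm{Re}\,|\nabla|^{\mu-n}(w_1\bar w_2).$$ Let $r=|\rho'|$ be a strictly positive, integrable $C^1$ function on $[1,\infty)$ such that $t^{-\gamma}r^{-1}$ is nondecreasing and $t^{-2}r^{-1}$ is nonincreasing and tends to $0$ at infinity. For $t_0\ge1$ let $\rho(t)=\rho(t_0)-\int_{t_0}^t r$ for $t\ge t_0$, with $\rho(t_0)$ so large that $\rho\ge0$ on $[t_0,\infty)$, and let $\rho(\infty)=\lim_{t\to\infty}\rho(t)$. Norms of functions of $t$ are taken with $\rho=\rho(t)$: $|w(t)|_k=\|w(t);K^k_{\rho(t)}\|$, $|\varphi(t)|_\ell=\|\varphi(t);Y^\ell_{\rho(t)}\|$. Let $\mathcal X^{k,\ell}_\rho([T,\infty))$ be the space of pairs $(w,\varphi)$ such that $(F^{-1}f\widehat w,F^{-1}f\widehat\varphi)$ is continuous from $[T,\infty)$ to $K^k_0\oplus Y^\ell_0$ and $$\sup_{t\ge T}|w(t)|_k,\quad \int_T^\infty r\,|w|^2_{k+\nu/2}\,dt,\quad \sup_{t\ge T}|\varphi(t)|_\ell,\quad \int_T^\infty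 r\,|\varphi|^2_{\ell+\nu/2}\,dt$$ are finite, and let $$Z(\varphi;[T,\infty),H,\ell)=\sup_{t\ge T}H(t)^{-1}|\varphi(t)|_\ell\ \vee\ \Big(\int_T^\infty r\,H^{-2}|\varphi|^2_{\ell+\nu/2}\,dt\Big)^{1/2}.$$ Let $h_0,h_1$ be positive $C^1$ functions on $[1,\infty)$ with $h_0$ nondecreasing, $h_1$ nonincreasing and tending to zero at infinity, $h_0\ge t^{-\gamma}r^{-1}$ and $h_1\ge t^{-2}r^{-1}h_0$. **Proposition 7.2.** Let $k\ge0$ and $\ell>n/2-\nu$. There are constants $c,C>0$, depending only on $n,\gamma,\mu,\kappa,\nu,\ell_<,k,\ell$ and $r$, such that the following holds. Let $t_0\le T<\infty$ and let $(w,\varphi)$, $(w',\varphi')$ be two solutions of the auxiliary system on $[T,\infty)$ with $(w,h_0^{-1}\varphi),(w',h_0^{-1}\varphi')\in\mathcal X^{k,\ell}_\rho([T,\infty))$, which are gauge equivalent, i.e. $e^{-i\varphi(t)}w(t)=e^{-i\varphi'(t)}w'(t)$ for all $t\ge T$. Let $b=Z(\varphi;[T,\infty),h_0,\ell)\vee Z(\varphi';[T,\infty),h_0,\ell)$.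 Then: (1) There exists $\omega\in Y^{\ell-1+\nu}_{\rho(\infty)}$ such that, as $t\to\infty$, $\varphi'(t)-\varphi(t)$ converges to $\omega$ strongly in $Y^{\ell'}_{\rho(\infty)}$ for every $\ell'<\ell-1+\nu$ and weakly in $Y^{\ell-1+\nu}_{\rho(\infty)}$. For every $T_1\ge T$ with $b\,h_1(T_1)\le c$ and all $t\ge T_1$, $$\|\varphi'(t)-\varphi(t)-\omega;Y^{\ell-2+\nu}_{\rho(\infty)}\|\le C\,b\,\|\varphi'(T_1)-\varphi(T_1);Y^{\ell-1+\nu}_{\rho(T_1)}\|\,h_1(t).$$ (2) Assume in addition that $1-\nu/2\le k\le\ell+1$. Then $w(t)$, $w'(t)$ have limits $w_+,w_+'\in K^k_{\rho(\infty)}$ as $t\to\infty$, strongly in $K^{k'}_{\rho(\infty)}$ for every $k'<k$ and weakly in $K^k_{\rho(\infty)}$, and $w_+'=w_+e^{i\omega}$. (3) In the situation of (2), let $p\ge0$ be an integer and assume that $w_+,w_+'\in K^{k_+}_{\rho(\infty)}$ with $k_+>n/2$ and $k_+\ge(p+1)\bar\lambda-1$, where $\bar\lambda=(\mu-n+2)\vee1$.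 Let $\phi_p=\sum_{m=0}^p\varphi_m$, where $w_m,\varphi_m$ are defined successively on $[1,\infty)$ by $w_0=w_+$ and $$\partial_tw_{m+1}=\frac1{2t^2}\sum_{0\le j\le m}(2\nabla\varphi_j\cdot\nabla+(\Delta\varphi_j))w_{m-j},\quad w_{m+1}(\infty)=0,$$ $$\partial_t\varphi_m=\frac1{2t^2}\sum_{0\le j\le m-1}\nabla\varphi_j\cdot\nabla\varphi_{m-1-j}+t^{-\gamma}\sum_{0\le j\le m}g_0(w_j,w_{m-j}),\quad \varphi_m(1)=0,$$ and let $\phi_p'$ be defined in the same way from $w_+'$. If the limits $\psi_+=\lim_{t\to\infty}(\varphi(t)-\phi_p(t))$ and $\psi_+'=\lim_{t\to\infty}(\varphi'(t)-\phi'_p(t))$ exist in $L^\infty$, then $\psi_+'=\psi_++\omega$. -/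

import Mathlib

open MeasureTheory Filter Topology Set
open scoped ENNReal FourierTransform SchwartzMap ComplexConjugate Gradient Laplacian

noncomputable section

/-- The space `ℝⁿ` with its Euclidean norm. -/
abbrev Rn (n : ℕ) : Type := EuclideanSpace ℝ (Fin n)

namespace Gevrey

variable {n : ℕ}

/-! ### The Fourier transform, in the convention `û(ξ) = (2π)^{-n/2} ∫ e^{-i x·ξ} u(x) dx` -/

/-- The factor `(2π)^{-n/2}`. -/
def unitFactor (n : ℕ) : ℝ := (2 * Real.pi) ^ (-(n : ℝ) / 2)

/-- The Fourier transform of a Schwartz function, `(2π)^{-n/2} ∫ e^{-i x·ξ} g(x) dx`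
(Mathlib's `𝓕` has the kernel `e^{-2π i x·ξ}`). -/
def schwartzHat (g : 𝓢(Rn n, ℂ)) (ξ : Rn n) : ℂ :=
  (unitFactor n : ℂ) * 𝓕 (g : Rn n → ℂ) ((2 * Real.pi)⁻¹ • ξ)

/-- `u` is a tempered distribution given by a function, and its Fourier transform in the sense
of tempered distributions is the locally integrable function `v`. -/
structure IsFourier (u v : Rn n → ℂ) : Prop where
  locallyIntegrable_left : LocallyIntegrable u volume
  locallyIntegrable_right : LocallyIntegrable v volume
  integrable_left : ∀ g : 𝓢(Rn n, ℂ), Integrable (fun x => u x * schwartzHat g x) volume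
  integrable_right : ∀ g : 𝓢(Rn n, ℂ), Integrable (fun ξ => v ξ * g ξ) volume
  integral_eq : ∀ g : 𝓢(Rn n, ℂ), ∫ x, u x * schwartzHat g x = ∫ ξ, v ξ * g ξ

open Classical in
/-- The locally integrable function `û` (determined almost everywhere; `0` if there is none). -/
def hat (u : Rn n → ℂ) : Rn n → ℂ :=
  if h : ∃ v, IsFourier u v then h.choose else 0

open Classical in
/-- The function with Fourier transform `v` (determined almost everywhere; `0` if there is none). -/
def invHat (v : Rn n → ℂ) : Rn n → ℂ :=
  if h : ∃ u, IsFourier u v then h.choose else 0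

/-! ### Gevrey spaces -/

/-- The weight `f₁(ξ) f(ξ)`, where `f(ξ) = exp (ρ (|ξ|^ν ∨ 1))` and
`f₁(ξ) = |ξ|^a` for `|ξ| > 1`, `f₁(ξ) = |ξ|^b` for `|ξ| ≤ 1`. -/
def weight (ν a b ρ : ℝ) (ξ : Rn n) : ℝ :=
  (if 1 < ‖ξ‖ then ‖ξ‖ ^ a else ‖ξ‖ ^ b) * Real.exp (ρ * max (‖ξ‖ ^ ν) 1)

open Classical in
/-- The norm `‖f₁ f û‖₂`, equal to `∞` if `û` is not a locally integrable function. -/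
def wnorm (ν a b ρ : ℝ) (u : Rn n → ℂ) : ℝ≥0∞ :=
  if ∃ v, IsFourier u v then
    eLpNorm (fun ξ => (weight ν a b ρ ξ : ℂ) * hat u ξ) 2 volume
  else ∞

/-- The norm of `K_ρ^k`; `u ∈ K_ρ^k` means that it is finite. -/
def normK (ν ρ k : ℝ) (u : Rn n → ℂ) : ℝ≥0∞ := wnorm ν k 0 ρ u

/-- The norm of `Y_ρ^ℓ` (`low` is the exponent `ℓ_<` at low frequency); a real function
`φ` belongs to `Y_ρ^ℓ` if it is finite. -/
def normY (ν low ρ ℓ : ℝ) (φ : Rn n → ℝ) : ℝ≥0∞ := wnorm ν (ℓ + 2) low ρ (fun x => (φ x : ℂ))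

/-- Weak convergence `u(t) ⇀ v` as `t → ∞` in the Hilbert space with norm `‖f₁ f û‖₂`:
convergence of the `L²` scalar products of `f₁ f û(t)` with every element of `L²`. -/
def WeakTendsto (ν a b ρ : ℝ) (u : ℝ → Rn n → ℂ) (v : Rn n → ℂ) : Prop :=
  ∀ G : Rn n → ℂ, MemLp G 2 volume →
    Tendsto (fun t => ∫ ξ, conj (G ξ) * ((weight ν a b ρ ξ : ℂ) * hat (u t) ξ)) atTop
      (𝓝 (∫ ξ, conj (G ξ) * ((weight ν a b ρ ξ : ℂ) * hat v ξ)))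

/-! ### Spaces of functions of time, on `[T, ∞)` -/

/-- `Sup_{t ≥ T} H(t)⁻¹ ‖u(t)‖`, the norm being taken with `ρ = ρ(t)`. -/
def supPart (ν a b : ℝ) (ρ : ℝ → ℝ) (T : ℝ) (H : ℝ → ℝ) (u : ℝ → Rn n → ℂ) : ℝ≥0∞ :=
  ⨆ t ∈ Ici T, (ENNReal.ofReal (H t))⁻¹ * wnorm ν a b (ρ t) (u t)

/-- `(∫_T^∞ r(t) H(t)⁻² ‖u(t)‖² dt)^{1/2}` with the norm that has `ν/2` more derivatives, taken
with `ρ = ρ(t)`; the function `r` is `|ρ'|`. -/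
def intPart (ν a b : ℝ) (r ρ : ℝ → ℝ) (T : ℝ) (H : ℝ → ℝ) (u : ℝ → Rn n → ℂ) : ℝ≥0∞ :=
  (∫⁻ t in Ici T, ENNReal.ofReal (r t) *
    ((ENNReal.ofReal (H t))⁻¹ * wnorm ν (a + ν / 2) b (ρ t) (u t)) ^ 2) ^ (1 / 2 : ℝ)

/-- `t ↦ f₁ f û(t)` is continuous from `[T, ∞)` to `L²`, with `f` taken at `ρ = ρ(t)`. -/
def ContinuousInTime (ν a b : ℝ) (ρ : ℝ → ℝ) (T : ℝ) (u : ℝ → Rn n → ℂ) : Prop :=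
  ∀ s ∈ Ici T, Tendsto
    (fun t => eLpNorm (fun ξ => (weight ν a b (ρ t) ξ : ℂ) * hat (u t) ξ
      - (weight ν a b (ρ s) ξ : ℂ) * hat (u s) ξ) 2 volume) (𝓝[Ici T] s) (𝓝 0)

/-- One component of the space `𝒳_ρ^{k,ℓ}([T, ∞))`. -/
structure MemX (ν a b : ℝ) (r ρ : ℝ → ℝ) (T : ℝ) (u : ℝ → Rn n → ℂ) : Prop where
  sup_lt_top : supPart ν a b ρ T (fun _ => 1) u < ∞
  int_lt_top : intPart ν a b r ρ T (fun _ => 1) u < ∞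
  continuousInTime : ContinuousInTime ν a b ρ T u

/-- `(w, φ) ∈ 𝒳_ρ^{k,ℓ}([T, ∞))`. -/
def PairMemX (ν low k ℓ : ℝ) (r ρ : ℝ → ℝ) (T : ℝ)
    (w : ℝ → Rn n → ℂ) (φ : ℝ → Rn n → ℝ) : Prop :=
  MemX ν k 0 r ρ T w ∧ MemX ν (ℓ + 2) low r ρ T (fun t x => (φ t x : ℂ))

/-- `Z(φ; [T, ∞), H, ℓ)`. -/
def normZ (ν low ℓ : ℝ) (r ρ : ℝ → ℝ) (T : ℝ) (H : ℝ → ℝ) (φ : ℝ → Rn n → ℝ) : ℝ≥0∞ :=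
  max (supPart ν (ℓ + 2) low ρ T H (fun t x => (φ t x : ℂ)))
    (intPart ν (ℓ + 2) low r ρ T H (fun t x => (φ t x : ℂ)))

/-! ### The functions `|ρ'|`, `ρ`, `h₀`, `h₁` -/

/-- The conditions on the function `r = |ρ'|`. -/
structure IsRate (γ : ℝ) (r : ℝ → ℝ) : Prop where
  contDiffOn : ContDiffOn ℝ 1 r (Ici 1)
  pos : ∀ t ∈ Ici (1 : ℝ), 0 < r t
  integrableOn : IntegrableOn r (Ici 1) volume
  monotoneOn : MonotoneOn (fun t => t ^ (-γ) * (r t)⁻¹) (Ici 1)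
  antitoneOn : AntitoneOn (fun t => t ^ (-2 : ℝ) * (r t)⁻¹) (Ici 1)
  tendsto_zero : Tendsto (fun t => t ^ (-2 : ℝ) * (r t)⁻¹) atTop (𝓝 0)

/-- `ρ(t) = ρ(t₀) - |∫_{t₀}^t |ρ'||`, with `ρ(t₀) = ρ₀`. -/
def rho (r : ℝ → ℝ) (t₀ ρ₀ t : ℝ) : ℝ := ρ₀ - |∫ s in t₀..t, r s|

/-- `ρ(∞)`. -/
def rhoInf (r : ℝ → ℝ) (t₀ ρ₀ : ℝ) : ℝ := ρ₀ - ∫ s in Ioi t₀, r s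

/-- The conditions on the estimating functions `h₀`, `h₁`. -/
structure IsEstimating (γ : ℝ) (r h₀ h₁ : ℝ → ℝ) : Prop where
  contDiffOn_zero : ContDiffOn ℝ 1 h₀ (Ici 1)
  contDiffOn_one : ContDiffOn ℝ 1 h₁ (Ici 1)
  pos_zero : ∀ t ∈ Ici (1 : ℝ), 0 < h₀ t
  pos_one : ∀ t ∈ Ici (1 : ℝ), 0 < h₁ t
  monotoneOn : MonotoneOn h₀ (Ici 1)
  antitoneOn : AntitoneOn h₁ (Ici 1)
  tendsto_zero : Tendsto h₁ atTop (𝓝 0)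
  le_zero : ∀ t ∈ Ici (1 : ℝ), t ^ (-γ) * (r t)⁻¹ ≤ h₀ t
  le_one : ∀ t ∈ Ici (1 : ℝ), t ^ (-2 : ℝ) * (r t)⁻¹ * h₀ t ≤ h₁ t

/-! ### The auxiliary system -/

/-- `g₀(w₁, w₂) = κ Re |∇|^{μ-n} (w₁ w̄₂)`; in the convention of Mathlib's `𝓕` the operator `|∇|`
is multiplication by `2π|ξ|`. -/
def gZero (κ μ : ℝ) (w₁ w₂ : Rn n → ℂ) (x : Rn n) : ℝ :=
  κ * (𝓕⁻ (fun ξ : Rn n => (((2 * Real.pi * ‖ξ‖) ^ (μ - n) : ℝ) : ℂ) *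
    𝓕 (fun y => w₁ y * conj (w₂ y)) ξ) x).re

/-- `(w, φ)` solves the auxiliary system on `[T, ∞)`:
`∂ₜw = i (2t²)⁻¹ Δw + (2t²)⁻¹ (2∇φ·∇ + Δφ) w`, `∂ₜφ = (2t²)⁻¹ |∇φ|² + t^{-γ} g₀(w, w)`.
For `ρ(t) > 0` and `ν > 0` the elements of `K_ρ^k`, `Y_ρ^ℓ` are (almost everywhere equal to)
smooth functions, and the equations hold pointwise for these. -/
structure IsSolution (γ μ κ T : ℝ) (w : ℝ → Rn n → ℂ) (φ : ℝ → Rn n → ℝ) : Prop where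
  contDiff_w : ∀ t ∈ Ici T, ContDiff ℝ 2 (w t)
  contDiff_φ : ∀ t ∈ Ici T, ContDiff ℝ 2 (φ t)
  eq_w : ∀ t ∈ Ici T, ∀ x, HasDerivWithinAt (fun s => w s x)
    (Complex.I * (((2 * t ^ 2)⁻¹ : ℝ) : ℂ) * Δ (w t) x + (((2 * t ^ 2)⁻¹ : ℝ) : ℂ) *
      (2 * fderiv ℝ (w t) x (∇ (φ t) x) + ((Δ (φ t) x : ℝ) : ℂ) * w t x)) (Ici T) t
  eq_φ : ∀ t ∈ Ici T, ∀ x, HasDerivWithinAt (fun s => φ s x)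
    ((2 * t ^ 2)⁻¹ * ‖∇ (φ t) x‖ ^ 2 + t ^ (-γ) * gZero κ μ (w t) (w t) x) (Ici T) t

/-- Gauge equivalence on `[T, ∞)`: `e^{-iφ} w = e^{-iφ'} w'`. -/
def GaugeEquiv (T : ℝ) (w : ℝ → Rn n → ℂ) (φ : ℝ → Rn n → ℝ)
    (w' : ℝ → Rn n → ℂ) (φ' : ℝ → Rn n → ℝ) : Prop :=
  ∀ t ∈ Ici T, ∀ x, Complex.exp (-Complex.I * (φ t x : ℂ)) * w t x
    = Complex.exp (-Complex.I * (φ' t x : ℂ)) * w' t x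

/-- `v ∈ K_ρ^k` is the limit of `w(t)` as `t → ∞`, strongly in `K_ρ^{k'}` for every `k' < k` and
weakly in `K_ρ^k`. -/
structure IsAmplitudeLimit (ν ρ k : ℝ) (w : ℝ → Rn n → ℂ) (v : Rn n → ℂ) : Prop where
  mem : normK ν ρ k v < ∞
  strong : ∀ k' < k, Tendsto (fun t => normK ν ρ k' (fun x => w t x - v x)) atTop (𝓝 0)
  weak : WeakTendsto ν k 0 ρ w v

/-- `v ∈ Y_ρ^ℓ` is the limit of `φ(t)` as `t → ∞`, strongly in `Y_ρ^{ℓ'}` for every `ℓ' < ℓ` and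
weakly in `Y_ρ^ℓ`. -/
structure IsPhaseLimit (ν low ρ ℓ : ℝ) (φ : ℝ → Rn n → ℝ) (v : Rn n → ℝ) : Prop where
  mem : normY ν low ρ ℓ v < ∞
  strong : ∀ ℓ' < ℓ, Tendsto (fun t => normY ν low ρ ℓ' (fun x => φ t x - v x)) atTop (𝓝 0)
  weak : WeakTendsto ν (ℓ + 2) low ρ (fun t x => (φ t x : ℂ)) (fun x => (v x : ℂ))

/-! ### The asymptotic functions `w_m`, `φ_m`, through their Fourier transforms

Below, `a` and `b` stand for Fourier transforms. -/

/-- Fourier transform of a product. -/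
def mulHat (a b : Rn n → ℂ) (ξ : Rn n) : ℂ := (unitFactor n : ℂ) * ∫ η, a (ξ - η) * b η

/-- Fourier transform of the derivative in the direction of the `j`-th axis. -/
def derivHat (j : Fin n) (a : Rn n → ℂ) (ξ : Rn n) : ℂ := Complex.I * ((ξ j : ℝ) : ℂ) * a ξ

/-- Fourier transform of the Laplacian. -/
def laplaceHat (a : Rn n → ℂ) (ξ : Rn n) : ℂ := -((‖ξ‖ ^ 2 : ℝ) : ℂ) * a ξ

/-- Fourier transform of `∇φ₁·∇φ₂`. -/
def gradDotHat (a b : Rn n → ℂ) (ξ : Rn n) : ℂ := ∑ j, mulHat (derivHat j a) (derivHat j b) ξ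

/-- Fourier transform of `(2∇φ·∇ + Δφ) w`. -/
def transportHat (a b : Rn n → ℂ) (ξ : Rn n) : ℂ :=
  2 * gradDotHat a b ξ + mulHat (laplaceHat a) b ξ

/-- Fourier transform of the complex conjugate. -/
def conjHat (a : Rn n → ℂ) (ξ : Rn n) : ℂ := conj (a (-ξ))

/-- Fourier transform of the real part. -/
def reHat (a : Rn n → ℂ) (ξ : Rn n) : ℂ := (a ξ + conjHat a ξ) / 2

/-- Fourier transform of `g₀(w₁, w₂) = κ Re |∇|^{μ-n} (w₁ w̄₂)`. -/
def gZeroHat (κ μ : ℝ) (a b : Rn n → ℂ) (ξ : Rn n) : ℂ :=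
  (κ : ℂ) * ((‖ξ‖ ^ (μ - n) : ℝ) : ℂ) * reHat (mulHat a (conjHat b)) ξ

mutual

/-- Fourier transform of `w_m(t)`: `w_0 = w₊`, `w_{m+1}(∞) = 0` and
`∂ₜ w_{m+1} = (2t²)⁻¹ ∑_{j ≤ m} (2∇φ_j·∇ + Δφ_j) w_{m-j}`. -/
def amplitudeHat (γ μ κ : ℝ) (wp : Rn n → ℂ) : ℕ → ℝ → Rn n → ℂ
  | 0 => fun _ => hat wp
  | m + 1 => fun t ξ => -∫ s in Ioi t, (((2 * s ^ 2)⁻¹ : ℝ) : ℂ) *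
      ∑ j : Fin (m + 1), transportHat (phaseHat γ μ κ wp j s) (amplitudeHat γ μ κ wp (m - j) s) ξ
termination_by m => 2 * m
decreasing_by all_goals omega

/-- Fourier transform of `φ_m(t)`: `φ_m(1) = 0` and
`∂ₜ φ_m = (2t²)⁻¹ ∑_{j ≤ m-1} ∇φ_j·∇φ_{m-1-j} + t^{-γ} ∑_{j ≤ m} g₀(w_j, w_{m-j})`. -/
def phaseHat (γ μ κ : ℝ) (wp : Rn n → ℂ) : ℕ → ℝ → Rn n → ℂ
  | m => fun t ξ => ∫ s in (1 : ℝ)..t,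
      ((((2 * s ^ 2)⁻¹ : ℝ) : ℂ) * ∑ j : Fin m,
          gradDotHat (phaseHat γ μ κ wp j s) (phaseHat γ μ κ wp (m - 1 - j) s) ξ
        + ((s ^ (-γ) : ℝ) : ℂ) * ∑ j : Fin (m + 1),
          gZeroHat κ μ (amplitudeHat γ μ κ wp j s) (amplitudeHat γ μ κ wp (m - j) s) ξ)
termination_by m => 2 * m + 1
decreasing_by all_goals omega

end

/-- The function `φ_0(t) + … + φ_p(t)` associated with `w₊`. -/
def phaseSum (γ μ κ : ℝ) (wp : Rn n → ℂ) (p : ℕ) (t : ℝ) : Rn n → ℂ :=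
  invHat (fun ξ => ∑ m ∈ Finset.range (p + 1), phaseHat γ μ κ wp m t ξ)

/-- `ψ` is the limit of `φ(t) - (φ_0(t) + … + φ_p(t))` in `L^∞` as `t → ∞`. -/
def IsPhaseState (γ μ κ : ℝ) (wp : Rn n → ℂ) (p : ℕ) (φ : ℝ → Rn n → ℝ) (ψ : Rn n → ℝ) : Prop :=
  Tendsto (fun t => eLpNorm (fun x => (φ t x : ℂ) - phaseSum γ μ κ wp p t x - (ψ x : ℂ)) ∞ volume)
    atTop (𝓝 0)

end Gevrey

end

-- Gauge equivalent amplitudes have the same modulus, and g₀(w, w) depends only on |w|². The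
-- nonlocal source therefore cancels in u = φ' - φ, and with v = φ' + φ one is left with the linear
-- transport equation ∂ₜu = (2t²)⁻¹ ∇v·∇u (`gZero_eq_of_gaugeEquiv`, `phase_evolution`). Everything
-- is done on the Fourier side, in weighted L² norms `wl`; the space Y^ℓ corresponds to the exponent
-- ℓ + 2.
--
-- The equation for u is estimated with the exponent ℓ + 1 + ν, one derivative loss being
-- compensated by two mechanisms. First, the radius ρ(t) decreases, so that differentiating the
-- weight in time produces the dissipative term -r ‖u‖² with ν/2 more derivatives (`wl_sq_add_le`).
-- Second, v is real, so that Re ⟨u, W² ∇v·∇u⟩ can be symmetrized; its kernel W(ξ)² (ξ-η)·η - W(η)²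
-- (ξ-η)·ξ is a commutator, bounded uniformly in ρ ≥ 0 by ν/2 extra derivatives on two of the three
-- factors (`exists_commutator_le`, `exists_trilinear_le`). The condition ℓ > n/2 - ν is what puts
-- the remaining factor in L¹. Since t⁻² h₀ ≤ r h₁, the trilinear term is absorbed by the
-- dissipation as soon as b h₁ is small, and u(t) stays below twice its value at T₁
-- (`exists_wl_sq_le`).
--
-- With u bounded, ∂ₜu measured with one derivative less is at most C b r h₁ times that bound. As r
-- is integrable, u converges at the rate h₁(t) in the weaker norm (`exists_phase_limit`).
-- Boundedness in the strong norm together with convergence in a weak one gives strong convergence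
-- for all smaller exponents and weak convergence at the top one, by a splitting at high frequency;
-- the bound passes to the limit by Fatou's lemma (`exists_limit`, `tendsto_wl_of_bounded`,
-- `tendsto_integral_weight`). Since ρ(t) > 0 at finite times, the exponential weight absorbs all
-- powers of |ξ|, and all the formal manipulations there are justified by absolute convergence.
--
-- The amplitudes are treated in the same way, without symmetrization. In a weak norm t⁻²Δw is
-- integrable in time, and the transport term is bounded by r h₁ times the product of h₀⁻¹‖φ‖ and
-- ‖w‖ with ν/2 extra derivatives, both square integrable for the measure r dt
-- (`exists_amplitude_limit`). The relation between w and w' passes to the limit along a subsequence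
-- converging almost everywhere (`gauge_limit`).
--
-- For the asymptotic phases, |w₊'| = |w₊|, and it suffices that the φ_m depend on w₊ only through
-- |w₊|². Put N_m = ∑ w_j w̄_{m-j}. The operator T = 2∇φ·∇ + Δφ satisfies (Tw₁)w̄₂ + w₁(Tw₂)̄ =
-- 2∇·(w₁w̄₂∇φ), so that ∂ₜN_{m+1} = t⁻² ∑ ∇·(N_{m-j}∇φ_j) with N_{m+1}(∞) = 0. Hence the N_m and
-- φ_m are determined successively from N_0 = |w₊|² (`mulHat_transportHat_add`, `densityHat_succ`,
-- `densityHat_phase_eq`). The condition on k₊ keeps the exponents k₊ - m λ̄, m ≤ p, nonnegative, so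
-- that all the products converge absolutely (`systemBound`). Consequently the two partial sums
-- coincide, and subtracting the two limits leaves ψ₊' - ψ₊ = ω (`phaseSum_eq`, `phaseState_eq`).

noncomputable section

namespace Gevrey

variable {n : ℕ}

-- L² norms of functions with values in [0, ∞]

section LTwo

variable {α β : Type*} [MeasurableSpace α] [MeasurableSpace β]

/-- The `L²` norm of a function with values in `[0, ∞]`. -/
def ltwo (m : Measure α) (F : α → ℝ≥0∞) : ℝ≥0∞ := (∫⁻ x, F x ^ 2 ∂m) ^ (1 / 2 : ℝ)

lemma ltwo_sq (m : Measure α) (F : α → ℝ≥0∞) : ltwo m F ^ 2 = ∫⁻ x, F x ^ 2 ∂m := by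
  rw [ltwo, ← ENNReal.rpow_natCast, ← ENNReal.rpow_mul]; norm_num

lemma eLpNorm_two_eq {E : Type*} [NormedAddCommGroup E] (m : Measure α) (f : α → E) :
    eLpNorm f 2 m = ltwo m (fun x => ‖f x‖ₑ) := by
  rw [eLpNorm_eq_lintegral_rpow_enorm_toReal (by norm_num) (by norm_num), ltwo]
  simp only [ENNReal.toReal_ofNat, ENNReal.rpow_two]

lemma lintegral_mul_le_ltwo {m : Measure α} {F G : α → ℝ≥0∞} (hF : AEMeasurable F m)
    (hG : AEMeasurable G m) : ∫⁻ x, F x * G x ∂m ≤ ltwo m F * ltwo m G := by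
  have h := ENNReal.lintegral_mul_le_Lp_mul_Lq m (p := 2) (q := 2)
    (by constructor <;> norm_num) hF hG
  simpa only [ltwo, ENNReal.rpow_two, Pi.mul_apply, Pi.add_apply] using h

lemma ltwo_mono {m : Measure α} {F G : α → ℝ≥0∞} (h : F ≤ᵐ[m] G) : ltwo m F ≤ ltwo m G := by
  refine ENNReal.rpow_le_rpow (lintegral_mono_ae ?_) (by norm_num)
  filter_upwards [h] with x hx using pow_le_pow_left' hx 2

lemma ltwo_congr {m : Measure α} {F G : α → ℝ≥0∞} (h : F =ᵐ[m] G) : ltwo m F = ltwo m G :=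
  le_antisymm (ltwo_mono h.le) (ltwo_mono h.symm.le)

lemma ltwo_const_mul {m : Measure α} {c : ℝ≥0∞} (hc : c ≠ ∞) (F : α → ℝ≥0∞) :
    ltwo m (fun x => c * F x) = c * ltwo m F := by
  rw [ltwo, ltwo]
  simp_rw [mul_pow]
  rw [lintegral_const_mul' _ _ (by finiteness), ENNReal.mul_rpow_of_nonneg _ _ (by norm_num),
    ← ENNReal.rpow_natCast, ← ENNReal.rpow_mul]
  norm_num

lemma ltwo_add_le {m : Measure α} {F G : α → ℝ≥0∞} (hF : AEMeasurable F m)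
    (hG : AEMeasurable G m) : ltwo m (fun x => F x + G x) ≤ ltwo m F + ltwo m G := by
  have h := ENNReal.lintegral_Lp_add_le (p := 2) hF hG (by norm_num)
  simpa only [ltwo, ENNReal.rpow_two, Pi.mul_apply, Pi.add_apply] using h

lemma measurable_ltwo {m : Measure β} [SFinite m] {g : α → β → ℝ≥0∞}
    (hg : Measurable (Function.uncurry g)) : Measurable fun s => ltwo m (g s) :=
  Measurable.pow_const (Measurable.lintegral_prod_right' (hg.pow_const 2)) _

/-- Minkowski's integral inequality in `L²`. -/
lemma ltwo_lintegral_le {m : Measure α} [SFinite m] {m' : Measure β} [SFinite m']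
    {g : α → β → ℝ≥0∞} (hg : Measurable (Function.uncurry g)) :
    ltwo m' (fun x => ∫⁻ s, g s x ∂m) ≤ ∫⁻ s, ltwo m' (g s) ∂m := by
  have hg1 : ∀ s, Measurable (g s) := fun s => hg.comp measurable_prodMk_left
  have hg2 : ∀ x, Measurable fun s => g s x := fun x => hg.comp measurable_prodMk_right
  have hN := measurable_ltwo (m := m') hg
  -- Both squares are written as double integrals over (s, s'); after Tonelli the comparison is the
  -- Cauchy-Schwarz inequality for each pair.
  rw [← ENNReal.pow_le_pow_left_iff (n := 2) (by norm_num), ltwo_sq]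
  have e1 : ∀ x, (∫⁻ s, g s x ∂m) ^ 2 = ∫⁻ s, ∫⁻ s', g s x * g s' x ∂m ∂m := fun x => by
    rw [sq, ← lintegral_mul_const _ (hg2 x)]
    refine lintegral_congr fun s => ?_
    rw [lintegral_const_mul _ (hg2 x)]
  have e2 : (∫⁻ s, ltwo m' (g s) ∂m) ^ 2
      = ∫⁻ s, ∫⁻ s', ltwo m' (g s) * ltwo m' (g s') ∂m ∂m := by
    rw [sq, ← lintegral_mul_const _ hN]
    refine lintegral_congr fun s => ?_
    rw [lintegral_const_mul _ hN]
  rw [e2]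
  simp_rw [e1]
  have h3 : Measurable fun p : β × α × α => g p.2.1 p.1 * g p.2.2 p.1 :=
    (hg.comp (by fun_prop : Measurable fun p : β × α × α => (p.2.1, p.1))).mul
      (hg.comp (by fun_prop : Measurable fun p : β × α × α => (p.2.2, p.1)))
  rw [lintegral_lintegral_swap]
  · refine lintegral_mono fun s => ?_
    rw [lintegral_lintegral_swap]
    · exact lintegral_mono fun s' =>
        lintegral_mul_le_ltwo (hg1 s).aemeasurable (hg1 s').aemeasurable
    · exact (h3.comp (by fun_prop : Measurable fun p : β × α => (p.1, s, p.2))).aemeasurable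
  · refine Measurable.aemeasurable ?_
    exact Measurable.lintegral_prod_right'
      (f := fun q : (β × α) × α => g q.1.2 q.1.1 * g q.2 q.1.1)
      (h3.comp (by fun_prop : Measurable fun q : (β × α) × α => (q.1.1, q.1.2, q.2)))

end LTwo

-- Convolution and Young's inequalities

section Conv

/-- Convolution of functions with values in `[0, ∞]`. -/
def lconv (F G : Rn n → ℝ≥0∞) (ξ : Rn n) : ℝ≥0∞ := ∫⁻ η, F (ξ - η) * G η

lemma lconv_comm (F G : Rn n → ℝ≥0∞) : lconv F G = lconv G F := by
  funext ξ
  rw [lconv, ← lintegral_sub_left_eq_self _ ξ]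
  simp [lconv, mul_comm]

lemma measurable_lconv {F G : Rn n → ℝ≥0∞} (hF : Measurable F) (hG : Measurable G) :
    Measurable (lconv F G) :=
  Measurable.lintegral_prod_right' (f := fun p : Rn n × Rn n => F (p.1 - p.2) * G p.2)
    (by fun_prop)

lemma lconv_mono {F F' G G' : Rn n → ℝ≥0∞} (hF : F ≤ᵐ[volume] F') (hG : G ≤ᵐ[volume] G')
    (ξ : Rn n) : lconv F G ξ ≤ lconv F' G' ξ := by
  refine lintegral_mono_ae ?_
  filter_upwards [(quasiMeasurePreserving_sub_left volume ξ).ae hF, hG] with η h1 h2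
  exact mul_le_mul' h1 h2

lemma ltwo_comp_sub_left (F : Rn n → ℝ≥0∞) (ξ : Rn n) :
    ltwo volume (fun η => F (ξ - η)) = ltwo volume F := by
  rw [ltwo, ltwo, lintegral_sub_left_eq_self (fun ξ => F ξ ^ 2)]

/-- Young's inequality `L² * L¹ ⊆ L²`. -/
lemma ltwo_lconv_le {F G : Rn n → ℝ≥0∞} (hF : Measurable F) (hG : Measurable G) :
    ltwo volume (lconv F G) ≤ ltwo volume F * ∫⁻ η, G η := by
  have hF2 : Measurable fun p : Rn n × Rn n => F (p.2 - p.1) * G p.1 := by fun_prop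
  refine (ltwo_lintegral_le (g := fun η ξ => F (ξ - η) * G η) hF2).trans ?_
  rw [← lintegral_const_mul _ hG]
  refine lintegral_mono fun η => ?_
  rw [ltwo, ltwo]
  simp_rw [mul_pow]
  rw [lintegral_mul_const _ (by fun_prop), ENNReal.mul_rpow_of_nonneg _ _ (by norm_num),
    lintegral_sub_right_eq_self (fun ξ => F ξ ^ 2), ← ENNReal.rpow_natCast (G η),
    ← ENNReal.rpow_mul]
  norm_num

lemma ltwo_lconv_le' {F G : Rn n → ℝ≥0∞} (hF : Measurable F) (hG : Measurable G) :
    ltwo volume (lconv F G) ≤ (∫⁻ η, F η) * ltwo volume G := by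
  rw [lconv_comm, mul_comm]; exact ltwo_lconv_le hG hF

lemma lconv_le_ltwo {F G : Rn n → ℝ≥0∞} (hF : Measurable F) (hG : Measurable G) (ξ : Rn n) :
    lconv F G ξ ≤ ltwo volume F * ltwo volume G := by
  refine (lintegral_mul_le_ltwo (by fun_prop) hG.aemeasurable).trans ?_
  rw [ltwo_comp_sub_left]

lemma lintegral_lconv {F G : Rn n → ℝ≥0∞} (hF : Measurable F) (hG : Measurable G) :
    ∫⁻ ξ, lconv F G ξ = (∫⁻ ξ, F ξ) * ∫⁻ ξ, G ξ := by
  unfold lconv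
  rw [lintegral_lintegral_swap (by fun_prop)]
  rw [← lintegral_const_mul _ hG]
  refine lintegral_congr fun η => ?_
  rw [lintegral_mul_const _ (by fun_prop), lintegral_sub_right_eq_self F]

lemma lconv_assoc {F G H : Rn n → ℝ≥0∞} (hF : Measurable F) (hG : Measurable G)
    (hH : Measurable H) : lconv (lconv F G) H = lconv F (lconv G H) := by
  funext ξ
  simp only [lconv]
  have e1 : ∀ η, (∫⁻ δ, F (ξ - η - δ) * G δ) * H η = ∫⁻ δ, F (ξ - δ) * G (δ - η) * H η := by
    intro η
    rw [lintegral_mul_const _ (by fun_prop),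
      ← lintegral_sub_right_eq_self (fun δ => F (ξ - η - δ) * G δ) η]
    simp only [sub_sub_sub_cancel_right]
  rw [lintegral_congr e1, lintegral_lintegral_swap (by fun_prop)]
  refine lintegral_congr fun δ => ?_
  rw [← lintegral_const_mul _ (by fun_prop)]
  simp_rw [mul_assoc]

end Conv

-- Power weights with different exponents at high and low frequency

section PowerWeight

/-- The function `x ↦ x^a` for `x > 1`, `x ↦ x^b` for `x ≤ 1`. -/
def pw (a b x : ℝ) : ℝ := if 1 < x then x ^ a else x ^ b

lemma pw_of_gt {a b x : ℝ} (h : 1 < x) : pw a b x = x ^ a := if_pos h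

lemma pw_of_le {a b x : ℝ} (h : x ≤ 1) : pw a b x = x ^ b := if_neg (not_lt.2 h)

lemma pw_pos {a b x : ℝ} (h : 0 < x) : 0 < pw a b x := by
  unfold pw; split_ifs <;> positivity

lemma pw_nonneg {a b x : ℝ} (h : 0 ≤ x) : 0 ≤ pw a b x := by
  unfold pw; split_ifs <;> positivity

lemma pw_zero {x : ℝ} : pw 0 0 x = 1 := by
  unfold pw; split_ifs <;> simp

lemma pw_mul {a b a' b' x : ℝ} (h : 0 < x) : pw a b x * pw a' b' x = pw (a + a') (b + b') x := by
  unfold pw; split_ifs <;> rw [Real.rpow_add h]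

lemma pw_le_pw {a b a' b' x : ℝ} (h : 0 < x) (ha : a ≤ a') (hb : b' ≤ b) :
    pw a b x ≤ pw a' b' x := by
  unfold pw; split_ifs with h1
  · exact Real.rpow_le_rpow_of_exponent_le h1.le ha
  · exact Real.rpow_le_rpow_of_exponent_ge h (not_lt.1 h1) hb

lemma one_le_pw {a b x : ℝ} (h : 0 < x) (ha : 0 ≤ a) (hb : b ≤ 0) : 1 ≤ pw a b x := by
  rw [← pw_zero (x := x)]; exact pw_le_pw h ha hb

lemma pw_mono {a b x y : ℝ} (ha : 0 ≤ a) (hb : 0 ≤ b) (hx : 0 ≤ x) (hxy : x ≤ y) :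
    pw a b x ≤ pw a b y := by
  unfold pw; split_ifs with h1 h2 h2
  · exact Real.rpow_le_rpow hx hxy ha
  · linarith
  · exact (Real.rpow_le_one hx (not_lt.1 h1) hb).trans (Real.one_le_rpow h2.le ha)
  · exact Real.rpow_le_rpow hx hxy hb

/-- When x ≤ 1 < 2x the two exponents interact, which is why the constant contains both of them. -/
lemma pw_two_mul_le {a b x : ℝ} (ha : 0 ≤ a) (hb : 0 ≤ b) (hx : 0 ≤ x) :
    pw a b (2 * x) ≤ 2 ^ (a + b) * pw a b x := by
  have h2a : (1 : ℝ) ≤ 2 ^ a := Real.one_le_rpow (by norm_num) ha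
  have h2b : (1 : ℝ) ≤ 2 ^ b := Real.one_le_rpow (by norm_num) hb
  rw [Real.rpow_add (by norm_num)]
  unfold pw; split_ifs with h1 h2 h2
  · rw [Real.mul_rpow (by norm_num) hx]
    have : (0 : ℝ) ≤ x ^ a := by positivity
    nlinarith [mul_nonneg (mul_nonneg (by positivity : (0 : ℝ) ≤ 2 ^ a) this) (sub_nonneg.2 h2b)]
  · have e1 : (2 * x) ^ a ≤ 2 ^ a := Real.rpow_le_rpow (by positivity) (by linarith) ha
    have e2 : (1 : ℝ) ≤ 2 ^ b * x ^ b := by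
      rw [← Real.mul_rpow (by norm_num) hx]; exact Real.one_le_rpow h1.le hb
    calc (2 * x) ^ a ≤ 2 ^ a * 1 := by simpa using e1
      _ ≤ 2 ^ a * (2 ^ b * x ^ b) := by gcongr
      _ = _ := by ring
  · linarith
  · rw [Real.mul_rpow (by norm_num) hx]
    have : (0 : ℝ) ≤ x ^ b := by positivity
    nlinarith [mul_nonneg (mul_nonneg (by positivity : (0 : ℝ) ≤ 2 ^ b) this) (sub_nonneg.2 h2a)]

lemma pw_le_of_le_two_mul {a b x y : ℝ} (ha : 0 ≤ a) (hb : 0 ≤ b) (hy : 0 ≤ y) (hx : 0 ≤ x)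
    (h : y ≤ 2 * x) : pw a b y ≤ 2 ^ (a + b) * pw a b x :=
  (pw_mono ha hb hy h).trans (pw_two_mul_le ha hb hx)

lemma pw_le_add {a b x y z : ℝ} (ha : 0 ≤ a) (hb : 0 ≤ b) (hx : 0 ≤ x) (hy : 0 ≤ y) (hz : 0 ≤ z)
    (h : x ≤ y + z) : pw a b x ≤ 2 ^ (a + b) * (pw a b y + pw a b z) := by
  have h1 := pw_nonneg (a := a) (b := b) hy
  have h2 := pw_nonneg (a := a) (b := b) hz
  rcases le_total y z with hyz | hyz
  · refine (pw_le_of_le_two_mul ha hb hx hz (by linarith)).trans ?_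
    gcongr; linarith
  · refine (pw_le_of_le_two_mul ha hb hx hy (by linarith)).trans ?_
    gcongr; linarith

lemma pw_mul_self_le {a b x : ℝ} (h : 0 < x) : pw a b x * x ≤ pw (a + 1) b x := by
  unfold pw; split_ifs with h1
  · rw [Real.rpow_add h, Real.rpow_one]
  · have : 0 ≤ x ^ b := by positivity
    nlinarith [not_lt.1 h1]

/-- Comparison of a weight at `x ≤ y + z` with weights at `y` and at `z`, the loss `y^{-σ}` or
`z^{-σ}` being that of the larger variable. -/
lemma pw_high_le {s s₁ s₂ y z : ℝ} (hs : 0 ≤ s) (h1 : s ≤ s₁) (h2 : s ≤ s₂) (hy : 1 < y)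
    (hz : 1 < z) :
    y ^ s ≤ (y ^ (-(s₁ + s₂ - s)) + z ^ (-(s₁ + s₂ - s))) * (y ^ s₁ * z ^ s₂) := by
  have hy0 : 0 < y := by linarith
  have hz0 : 0 < z := by linarith
  rcases le_total y z with hyz | hyz
  · have : y ^ s ≤ y ^ (-(s₁ + s₂ - s)) * (y ^ s₁ * z ^ s₂) := by
      have e : y ^ s = y ^ (-(s₁ + s₂ - s)) * (y ^ s₁ * y ^ s₂) := by
        rw [← Real.rpow_add hy0, ← Real.rpow_add hy0]; congr 1; ring
      rw [e]; gcongr; linarith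
    refine this.trans ?_
    gcongr
    linarith [Real.rpow_pos_of_pos hz0 (-(s₁ + s₂ - s))]
  · have : y ^ s ≤ z ^ (-(s₁ + s₂ - s)) * (y ^ s₁ * z ^ s₂) := by
      have e : z ^ (-(s₁ + s₂ - s)) * (y ^ s₁ * z ^ s₂) = y ^ s * (y ^ (s₁ - s) * z ^ (-(s₁ - s))) := by
        have e1 : y ^ s₁ = y ^ s * y ^ (s₁ - s) := by rw [← Real.rpow_add hy0]; congr 1; ring
        have e2 : z ^ (-(s₁ + s₂ - s)) * z ^ s₂ = z ^ (-(s₁ - s)) := by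
          rw [← Real.rpow_add hz0]; congr 1; ring
        rw [e1, ← e2]; ring
      rw [e]
      refine le_mul_of_one_le_right (by positivity) ?_
      rw [Real.rpow_neg hz0.le, ← div_eq_mul_inv, ← Real.div_rpow hy0.le hz0.le]
      exact Real.one_le_rpow ((one_le_div hz0).2 hyz) (by linarith)
    refine this.trans ?_
    gcongr
    linarith [Real.rpow_pos_of_pos hy0 (-(s₁ + s₂ - s))]

/-- The larger variable pays y^{-σ} or z^{-σ} at high frequency, and a variable below 1 pays the
power -β. The losses involve one variable at a time and are square integrable when σ > n/2 > β. The
alternatives for the low exponents cover the case where all three carry β and the two cases where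
just one factor does; the last one is needed because the lemma is applied again with the factors
exchanged. -/
lemma pw_fst_le {s s₁ s₂ b b₁ b₂ β y z : ℝ} (hs : 0 ≤ s) (h1 : s ≤ s₁) (h2 : s ≤ s₂)
    (hβ : 0 ≤ β) (hb : (b = β ∧ b₁ = β ∧ b₂ = β) ∨ (b = 0 ∧ b₁ = β ∧ b₂ = 0) ∨
      (b = 0 ∧ b₁ = 0 ∧ b₂ = β)) (hy : 0 < y) (hz : 0 < z) :
    pw s b y ≤ (pw (-(s₁ + s₂ - s)) (-β) y + pw (-(s₁ + s₂ - s)) (-β) z) *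
      (pw s₁ b₁ y * pw s₂ b₂ z) := by
  have inv : ∀ {x : ℝ}, 0 < x → x ^ (-β) * x ^ β = 1 := fun hx => by
    rw [← Real.rpow_add hx]; simp
  have ge1 : ∀ {x : ℝ}, 0 < x → x ≤ 1 → 1 ≤ x ^ (-β) := fun hx h =>
    Real.one_le_rpow_of_pos_of_le_one_of_nonpos hx h (by linarith)
  have le1 : ∀ {x : ℝ}, 0 < x → x ≤ 1 → x ^ β ≤ 1 := fun hx h => Real.rpow_le_one hx.le h hβ
  have big : ∀ {x c : ℝ}, 1 < x → 0 ≤ c → 1 ≤ x ^ c := fun h hc => Real.one_le_rpow h.le hc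
  have hs1 : 0 ≤ s₁ := hs.trans h1
  have hs2 : 0 ≤ s₂ := hs.trans h2
  set σ := s₁ + s₂ - s with hσ
  by_cases hy1 : 1 < y <;> by_cases hz1 : 1 < z
  · simp only [pw_of_gt hy1, pw_of_gt hz1]
    exact pw_high_le hs h1 h2 hy1 hz1
  · have hz1' := not_lt.1 hz1
    simp only [pw_of_gt hy1, pw_of_le hz1']
    have e0 : y ^ s ≤ y ^ s₁ := Real.rpow_le_rpow_of_exponent_le hy1.le h1
    have e1 : 1 ≤ z ^ (-β) * z ^ b₂ := by
      rcases hb with ⟨-, -, h⟩ | ⟨-, -, h⟩ | ⟨-, -, h⟩ <;> rw [h]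
      · exact (inv hz).ge
      · simpa using ge1 hz hz1'
      · exact (inv hz).ge
    calc y ^ s ≤ 1 * y ^ s₁ := by simpa using e0
      _ ≤ (z ^ (-β) * z ^ b₂) * y ^ s₁ := by gcongr
      _ ≤ (z ^ (-β) * z ^ b₂) * y ^ s₁ + y ^ (-σ) * (y ^ s₁ * z ^ b₂) :=
          le_add_of_nonneg_right (by positivity)
      _ = _ := by ring
  · have hy1' := not_lt.1 hy1
    simp only [pw_of_gt hz1, pw_of_le hy1']
    have e0 : 1 ≤ z ^ s₂ := big hz1 hs2
    have e1 : y ^ b ≤ y ^ (-β) * y ^ b₁ := by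
      rcases hb with ⟨h', h, -⟩ | ⟨h', h, -⟩ | ⟨h', h, -⟩ <;> rw [h, h']
      · rw [inv hy]; exact le1 hy hy1'
      · rw [inv hy]; simp
      · simpa using ge1 hy hy1'
    calc y ^ b ≤ (y ^ (-β) * y ^ b₁) * 1 := by simpa using e1
      _ ≤ (y ^ (-β) * y ^ b₁) * z ^ s₂ := by gcongr
      _ ≤ (y ^ (-β) * y ^ b₁) * z ^ s₂ + z ^ (-σ) * (y ^ b₁ * z ^ s₂) :=
          le_add_of_nonneg_right (by positivity)
      _ = _ := by ring
  · have hy1' := not_lt.1 hy1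
    have hz1' := not_lt.1 hz1
    simp only [pw_of_le hy1', pw_of_le hz1']
    rcases hb with ⟨h', h, h''⟩ | ⟨h', h, h''⟩ | ⟨h', h, h''⟩ <;> rw [h, h', h'']
    · calc y ^ β = (z ^ (-β) * z ^ β) * y ^ β := by rw [inv hz, one_mul]
        _ ≤ (z ^ (-β) * z ^ β) * y ^ β + y ^ (-β) * (y ^ β * z ^ β) :=
          le_add_of_nonneg_right (by positivity)
        _ = _ := by ring
    · calc y ^ (0 : ℝ) = (y ^ (-β) * y ^ β) * z ^ (0 : ℝ) := by simp [inv hy]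
        _ ≤ (y ^ (-β) * y ^ β) * z ^ (0 : ℝ) + z ^ (-β) * (y ^ β * z ^ (0 : ℝ)) :=
          le_add_of_nonneg_right (by positivity)
        _ = _ := by ring
    · calc y ^ (0 : ℝ) = (z ^ (-β) * z ^ β) * y ^ (0 : ℝ) := by simp [inv hz]
        _ ≤ (z ^ (-β) * z ^ β) * y ^ (0 : ℝ) + y ^ (-β) * (y ^ (0 : ℝ) * z ^ β) :=
          le_add_of_nonneg_right (by positivity)
        _ = _ := by ring

/-- The kernel estimate behind the product estimates. -/
lemma pw_product_le {s s₁ s₂ b b₁ b₂ β x y z : ℝ} (hs : 0 ≤ s) (h1 : s ≤ s₁) (h2 : s ≤ s₂)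
    (hβ : 0 ≤ β) (hb : (b = β ∧ b₁ = β ∧ b₂ = β) ∨ (b = 0 ∧ b₁ = β ∧ b₂ = 0))
    (hx : 0 ≤ x) (hy : 0 < y) (hz : 0 < z) (h : x ≤ y + z) :
    pw s b x ≤ 2 ^ (s + b + 1) * ((pw (-(s₁ + s₂ - s)) (-β) y + pw (-(s₁ + s₂ - s)) (-β) z) *
      (pw s₁ b₁ y * pw s₂ b₂ z)) := by
  have hb0 : 0 ≤ b := by rcases hb with ⟨h, -⟩ | ⟨h, -⟩ <;> linarith
  have e1 := pw_fst_le (b := b) (b₁ := b₁) (b₂ := b₂) hs h1 h2 hβ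
    (by tauto) hy hz
  have e2 := pw_fst_le (b := b) (b₁ := b₂) (b₂ := b₁) hs h2 h1 hβ
    (by tauto) hz hy
  rw [add_comm s₂ s₁] at e2
  refine (pw_le_add hs hb0 hx hy.le hz.le h).trans ?_
  rw [Real.rpow_add_one (by norm_num), mul_assoc]
  gcongr
  linarith

end PowerWeight

-- Increments of the Gevrey weight, uniformly in ρ

section Radial

/-- The weight as a function of `|ξ|`. -/
def radial (ν a b ρ x : ℝ) : ℝ := pw a b x * Real.exp (ρ * max (x ^ ν) 1)

lemma weight_eq_radial (ν a b ρ : ℝ) (ξ : Rn n) : weight ν a b ρ ξ = radial ν a b ρ ‖ξ‖ := rfl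

lemma max_rpow_le_add {ν x y z : ℝ} (h0 : 0 ≤ ν) (h1 : ν ≤ 1) (hx : 0 ≤ x) (hy : 0 ≤ y)
    (hz : 0 ≤ z) (h : x ≤ y + z) : max (x ^ ν) 1 ≤ max (y ^ ν) 1 + max (z ^ ν) 1 := by
  refine max_le ?_ (by linarith [le_max_right (y ^ ν) 1, le_max_right (z ^ ν) 1])
  calc x ^ ν ≤ (y + z) ^ ν := Real.rpow_le_rpow hx h h0
    _ ≤ y ^ ν + z ^ ν := Real.rpow_add_le_add_rpow hy hz h0 h1
    _ ≤ _ := add_le_add (le_max_left _ _) (le_max_left _ _)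

lemma exp_max_rpow_le_mul {ν ρ x y z : ℝ} (hρ : 0 ≤ ρ) (h0 : 0 ≤ ν) (h1 : ν ≤ 1) (hx : 0 ≤ x)
    (hy : 0 ≤ y) (hz : 0 ≤ z) (h : x ≤ y + z) :
    Real.exp (ρ * max (x ^ ν) 1) ≤ Real.exp (ρ * max (y ^ ν) 1) * Real.exp (ρ * max (z ^ ν) 1) := by
  rw [← Real.exp_add, ← mul_add]
  exact Real.exp_le_exp.2 (mul_le_mul_of_nonneg_left (max_rpow_le_add h0 h1 hx hy hz h) hρ)

lemma exp_max_rpow_mono {ν ρ x y : ℝ} (hρ : 0 ≤ ρ) (h0 : 0 ≤ ν) (hx : 0 ≤ x) (h : x ≤ y) :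
    Real.exp (ρ * max (x ^ ν) 1) ≤ Real.exp (ρ * max (y ^ ν) 1) :=
  Real.exp_le_exp.2 (mul_le_mul_of_nonneg_left
    (max_le_max (Real.rpow_le_rpow hx h h0) le_rfl) hρ)

lemma one_le_exp_max_rpow {ν ρ x : ℝ} (hρ : 0 ≤ ρ) : 1 ≤ Real.exp (ρ * max (x ^ ν) 1) :=
  Real.one_le_exp (mul_nonneg hρ (zero_le_one.trans (le_max_right _ _)))

/-- Bound of the increment of the Gevrey weight, uniform in `ρ ≥ 0`. -/
lemma exp_sub_exp_le {ν ρ X Y Z : ℝ} (hρ : 0 ≤ ρ) (h0 : 0 < ν) (h1 : ν < 1) (hZ : 0 < Z)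
    (hZY : Z ≤ Y) (hYX : Y ≤ X) (hX : X ≤ Y + Z) :
    Y * (Real.exp (ρ * max (X ^ ν) 1) - Real.exp (ρ * max (Y ^ ν) 1)) ≤
      (1 - ν)⁻¹ * (Y ^ ν * (Z / max (Z ^ ν) 1)) *
        (Real.exp (ρ * max (Y ^ ν) 1) * Real.exp (ρ * max (Z ^ ν) 1)) := by
  have hY : 0 < Y := hZ.trans_le hZY
  have hX0 : 0 < X := hY.trans_le hYX
  set A := max (X ^ ν) 1 - max (Y ^ ν) 1 with hA
  set B := max (Z ^ ν) 1 with hB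
  have hB1 : 1 ≤ B := le_max_right _ _
  have hXY : Y ^ ν ≤ X ^ ν := Real.rpow_le_rpow hY.le hYX h0.le
  have hA0 : 0 ≤ A := sub_nonneg.2 (max_le_max hXY le_rfl)
  have hA1 : A ≤ X ^ ν - Y ^ ν := by
    rw [hA, sub_le_iff_le_add]
    refine max_le (by linarith [le_max_left (Y ^ ν) 1]) (by linarith [le_max_right (Y ^ ν) 1])
  have hA2 : X ^ ν - Y ^ ν ≤ ν * (Y ^ ν * (Z / Y)) := by
    have e1 : X ^ ν ≤ Y ^ ν * (1 + ν * (Z / Y)) := by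
      calc X ^ ν ≤ (Y + Z) ^ ν := Real.rpow_le_rpow hX0.le hX h0.le
        _ = Y ^ ν * (1 + Z / Y) ^ ν := by
          rw [← Real.mul_rpow hY.le (by positivity)]; congr 1; field_simp
        _ ≤ _ := by
          gcongr
          exact rpow_one_add_le_one_add_mul_self (by linarith [div_pos hZ hY]) h0.le h1.le
    nlinarith
  -- The gain of the factor ν over plain subadditivity comes from the concavity of x ↦ x^ν and from
  -- Z ≤ Y.
  have hA3 : A ≤ ν * B := by
    have : Y ^ ν * (Z / Y) ≤ Z ^ ν := by
      have e : Y ^ ν * (Z / Y) = Z * Y ^ (ν - 1) := by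
        rw [Real.rpow_sub_one hY.ne']; ring
      rw [e]
      calc Z * Y ^ (ν - 1) ≤ Z * Z ^ (ν - 1) := by
            gcongr 1
            exact Real.rpow_le_rpow_of_nonpos hZ hZY (by linarith)
        _ = Z ^ ν := by rw [Real.rpow_sub_one hZ.ne']; field_simp
    have h3 : ν * (Y ^ ν * (Z / Y)) ≤ ν * B := by
      gcongr; exact this.trans (le_max_left _ _)
    linarith
  have hA4 : Y * A ≤ Y ^ ν * Z := by
    have : Y * (ν * (Y ^ ν * (Z / Y))) = ν * (Y ^ ν * Z) := by field_simp
    have h4 : Y * A ≤ Y * (ν * (Y ^ ν * (Z / Y))) := by gcongr; linarith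
    have : 0 ≤ Y ^ ν * Z := by positivity
    nlinarith
  have hexp : Real.exp (ρ * max (X ^ ν) 1) = Real.exp (ρ * max (Y ^ ν) 1) * Real.exp (ρ * A) := by
    rw [← Real.exp_add, hA]; congr 1; ring
  have h5 : Real.exp (ρ * A) - 1 ≤ ρ * A * Real.exp (ρ * A) := by
    have := Real.add_one_le_exp (-(ρ * A))
    rw [Real.exp_neg] at this
    have hp := Real.exp_pos (ρ * A)
    have h6 : (-(ρ * A) + 1) * Real.exp (ρ * A) ≤ 1 := by
      calc _ ≤ (Real.exp (ρ * A))⁻¹ * Real.exp (ρ * A) := by gcongr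
        _ = 1 := inv_mul_cancel₀ hp.ne'
    linarith
  -- As A ≤ νB, a factor exp((1 - ν)ρB) is left over, and it absorbs ρB. This makes the bound
  -- uniform in ρ and is the reason for ν < 1 here.
  have h7 : ρ * B * Real.exp (ρ * A) ≤ (1 - ν)⁻¹ * Real.exp (ρ * B) := by
    have e1 : Real.exp (ρ * A) ≤ Real.exp (ν * (ρ * B)) := by
      apply Real.exp_le_exp.2
      calc ρ * A ≤ ρ * (ν * B) := by gcongr
        _ = _ := by ring
    have e2 : (1 - ν) * (ρ * B) ≤ Real.exp ((1 - ν) * (ρ * B)) := by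
      linarith [Real.add_one_le_exp ((1 - ν) * (ρ * B))]
    have e3 : Real.exp (ρ * B) = Real.exp ((1 - ν) * (ρ * B)) * Real.exp (ν * (ρ * B)) := by
      rw [← Real.exp_add]; congr 1; ring
    have hν : 0 < 1 - ν := by linarith
    rw [inv_mul_eq_div, le_div_iff₀ hν, e3]
    calc ρ * B * Real.exp (ρ * A) * (1 - ν) = ((1 - ν) * (ρ * B)) * Real.exp (ρ * A) := by ring
      _ ≤ _ := by gcongr
  have hB0 : 0 < B := by linarith
  rw [hexp]
  set e := Real.exp (ρ * max (Y ^ ν) 1)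
  have he : 0 < e := Real.exp_pos _
  calc Y * (e * Real.exp (ρ * A) - e) = e * (Y * (Real.exp (ρ * A) - 1)) := by ring
    _ ≤ e * (Y * (ρ * A * Real.exp (ρ * A))) := by gcongr
    _ = e * (Y * A / B) * (ρ * B * Real.exp (ρ * A)) := by field_simp
    _ ≤ e * (Y ^ ν * Z / B) * ((1 - ν)⁻¹ * Real.exp (ρ * B)) := by gcongr
    _ = _ := by ring

/-- With κ = α + β + 1 the weight at Y is at least (Y/X)^κ times the weight at X, also when 1 lies
between Y and X, since κ dominates α, β and α + β. As κ ≥ 1, Bernoulli's inequality bounds (Y/X)^κ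
below by 1 - κ(1 - Y/X). -/
lemma pw_sub_pw_le {α β X Y : ℝ} (hα : 0 ≤ α) (hβ : 0 ≤ β) (hY : 0 < Y) (hYX : Y ≤ X) :
    Y * (pw α β X - pw α β Y) ≤ (α + β + 1) * (X - Y) * pw α β X := by
  have hX : 0 < X := hY.trans_le hYX
  set κ := α + β + 1 with hκ
  have ht0 : 0 < Y / X := div_pos hY hX
  have ht1 : Y / X ≤ 1 := (div_le_one hX).2 hYX
  have key : pw α β X * (Y / X) ^ κ ≤ pw α β Y := by
    have h1 : ∀ c, 0 ≤ c → c ≤ κ → X ^ c * (Y / X) ^ κ ≤ Y ^ c := fun c _ hc => by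
      calc X ^ c * (Y / X) ^ κ ≤ X ^ c * (Y / X) ^ c := by
            gcongr 1
            exact Real.rpow_le_rpow_of_exponent_ge ht0 ht1 hc
        _ = Y ^ c := by
          rw [← Real.mul_rpow hX.le ht0.le]; congr 1; field_simp
    unfold pw; split_ifs with h2 h3 h3
    · exact h1 α hα (by linarith)
    · have e1 := h1 (α + β) (by linarith) (by linarith)
      rw [Real.rpow_add hX, Real.rpow_add hY] at e1
      have e2 : Y ^ α ≤ 1 := Real.rpow_le_one hY.le (not_lt.1 h3) hα
      have e3 : 1 ≤ X ^ β := Real.one_le_rpow h2.le hβ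
      calc X ^ α * (Y / X) ^ κ ≤ X ^ α * X ^ β * (Y / X) ^ κ := by
            gcongr; exact le_mul_of_one_le_right (by positivity) e3
        _ ≤ Y ^ α * Y ^ β := e1
        _ ≤ Y ^ β := mul_le_of_le_one_left (by positivity) e2
    · linarith
    · exact h1 β hβ (by linarith)
  have bern : 1 + κ * (Y / X - 1) ≤ (Y / X) ^ κ := by
    have := one_add_mul_self_le_rpow_one_add (s := Y / X - 1) (by linarith) (p := κ) (by linarith)
    simpa using this
  have hp : 0 < pw α β X := pw_pos hX
  have h4 : pw α β X - pw α β Y ≤ pw α β X * (κ * (1 - Y / X)) := by nlinarith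
  calc Y * (pw α β X - pw α β Y) ≤ Y * (pw α β X * (κ * (1 - Y / X))) := by gcongr
    _ = κ * (X - Y) * pw α β X * (Y / X) := by field_simp
    _ ≤ κ * (X - Y) * pw α β X := by
      refine mul_le_of_le_one_right ?_ ht1
      have : 0 ≤ κ := by positivity
      have : 0 ≤ X - Y := by linarith
      positivity

end Radial

-- The commutator estimate for the symmetrized transport term

section Commutator

lemma rpow_le_pw_mul_pw {ν Y X : ℝ} (h0 : 0 ≤ ν) (hY : 0 < Y) (hYX : Y ≤ X) :
    Y ^ ν ≤ pw (ν / 2) 0 X * pw (ν / 2) 0 Y := by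
  have hX : 0 < X := hY.trans_le hYX
  have h2 : 0 ≤ ν / 2 := by linarith
  have h1 : Y ^ (ν / 2) ≤ pw (ν / 2) 0 Y := by
    unfold pw; split_ifs with h
    · exact le_rfl
    · rw [Real.rpow_zero]; exact Real.rpow_le_one hY.le (not_lt.1 h) h2
  calc Y ^ ν = Y ^ (ν / 2) * Y ^ (ν / 2) := by rw [← Real.rpow_add hY]; congr 1; ring
    _ ≤ pw (ν / 2) 0 Y * pw (ν / 2) 0 Y :=
      mul_le_mul h1 h1 (by positivity) (pw_pos hY).le
    _ ≤ pw (ν / 2) 0 X * pw (ν / 2) 0 Y :=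
      mul_le_mul_of_nonneg_right (pw_mono h2 le_rfl hY.le hYX) (pw_pos hY).le

lemma sq_le_pw_mul_rpow {ν Z : ℝ} (hZ : 0 < Z) :
    Z * (Z / max (Z ^ ν) 1) ≤ pw (2 - ν) 0 Z := by
  have hm : 0 < max (Z ^ ν) 1 := lt_of_lt_of_le one_pos (le_max_right _ _)
  unfold pw; split_ifs with h
  · rw [Real.rpow_sub hZ, ← mul_div_assoc]
    have : Z * Z = Z ^ (2 : ℝ) := by rw [Real.rpow_two, sq]
    rw [this]
    gcongr
    exact le_max_left _ _
  · rw [Real.rpow_zero, ← mul_div_assoc, div_le_one hm]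
    have := not_lt.1 h
    nlinarith [le_max_right (Z ^ ν) 1]

lemma sq_le_pw_mul {ν X Y Z : ℝ} (h0 : 0 ≤ ν) (hZ : 0 < Z) (hZY : Z ≤ Y)
    (hYX : Y ≤ X) : Z ^ 2 ≤ pw (2 - ν) 0 Z * (pw (ν / 2) 0 X * pw (ν / 2) 0 Y) := by
  have hY : 0 < Y := hZ.trans_le hZY
  have hX : 0 < X := hY.trans_le hYX
  have h1 : Z ^ 2 ≤ pw (2 - ν) 0 Z * max (Z ^ ν) 1 := by
    have hm : 0 < max (Z ^ ν) 1 := lt_of_lt_of_le one_pos (le_max_right _ _)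
    calc Z ^ 2 = Z * (Z / max (Z ^ ν) 1) * max (Z ^ ν) 1 := by field_simp
      _ ≤ _ := by gcongr; exact sq_le_pw_mul_rpow hZ
  refine h1.trans (mul_le_mul_of_nonneg_left (max_le ?_ ?_) (pw_pos hZ).le)
  · exact (Real.rpow_le_rpow hZ.le hZY h0).trans (rpow_le_pw_mul_pw h0 hY hYX)
  · have := one_le_pw hX (by linarith : 0 ≤ ν / 2) le_rfl
    have := one_le_pw hY (by linarith : 0 ≤ ν / 2) le_rfl
    nlinarith

/-- For ν < 1 the increment of the exponential has to be used. For ν = 1 the subtracted exponential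
can be dropped: half a derivative on each of X and Y together with 2 - ν = 1 derivative on Z already
accounts for ZY. -/
lemma exists_exp_sub_exp_le {ν : ℝ} (h0 : 0 < ν) (h1 : ν ≤ 1) : ∃ C : ℝ, 0 < C ∧
    ∀ {ρ X Y Z : ℝ}, 0 ≤ ρ → 0 < Z → Z ≤ Y → Y ≤ X → X ≤ Y + Z →
      Z * Y * (Real.exp (ρ * max (X ^ ν) 1) - Real.exp (ρ * max (Y ^ ν) 1)) ≤
        C * pw (2 - ν) 0 Z * (pw (ν / 2) 0 X * pw (ν / 2) 0 Y) *
          (Real.exp (ρ * max (Y ^ ν) 1) * Real.exp (ρ * max (Z ^ ν) 1)) := by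
  rcases h1.lt_or_eq with h1' | rfl
  · refine ⟨(1 - ν)⁻¹, inv_pos.2 (by linarith), fun {ρ X Y Z} hρ hZ hZY hYX hX => ?_⟩
    have hY : 0 < Y := hZ.trans_le hZY
    have e := exp_sub_exp_le hρ h0 h1' hZ hZY hYX hX
    have hν : 0 < (1 - ν)⁻¹ := inv_pos.2 (by linarith)
    set E := Real.exp (ρ * max (Y ^ ν) 1) * Real.exp (ρ * max (Z ^ ν) 1) with hE
    have hE0 : 0 ≤ E := by positivity
    calc _ ≤ Z * ((1 - ν)⁻¹ * (Y ^ ν * (Z / max (Z ^ ν) 1)) * E) := by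
          rw [mul_assoc]; gcongr
      _ = (1 - ν)⁻¹ * ((Z * (Z / max (Z ^ ν) 1)) * Y ^ ν) * E := by ring
      _ ≤ (1 - ν)⁻¹ * (pw (2 - ν) 0 Z * (pw (ν / 2) 0 X * pw (ν / 2) 0 Y)) * E := by
          gcongr ?_ * ?_ * ?_
          exact mul_le_mul (sq_le_pw_mul_rpow hZ) (rpow_le_pw_mul_pw h0.le hY hYX)
            (by positivity) (pw_pos hZ).le
      _ = _ := by ring
  · refine ⟨1, one_pos, fun {ρ X Y Z} hρ hZ hZY hYX hX => ?_⟩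
    have hY : 0 < Y := hZ.trans_le hZY
    have hX0 : 0 < X := hY.trans_le hYX
    have e1 := exp_max_rpow_le_mul (ν := 1) hρ zero_le_one le_rfl hX0.le hY.le hZ.le hX
    have e2 : Z ≤ pw (2 - 1) 0 Z := by
      unfold pw; split_ifs with h
      · norm_num
      · simpa using h
    have e3 := rpow_le_pw_mul_pw (ν := 1) zero_le_one hY hYX
    rw [Real.rpow_one] at e3
    set E := Real.exp (ρ * max (Y ^ (1 : ℝ)) 1) * Real.exp (ρ * max (Z ^ (1 : ℝ)) 1) with hE
    calc _ ≤ Z * Y * E := by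
          gcongr
          linarith [Real.exp_pos (ρ * max (Y ^ (1 : ℝ)) 1)]
      _ ≤ pw (2 - 1) 0 Z * (pw (1 / 2) 0 X * pw (1 / 2) 0 Y) * E := by
          gcongr ?_ * E
          exact mul_le_mul e2 e3 hY.le (pw_pos hZ).le
      _ = _ := by ring

/-- The commutator estimate in the region where the two outer frequencies are comparable. -/
lemma exists_near_le {ν a low : ℝ} (h0 : 0 < ν) (h1 : ν ≤ 1) (ha : 0 ≤ a) (hlow : 0 ≤ low) :
    ∃ C : ℝ, 0 < C ∧ ∀ {ρ X Y Z : ℝ}, 0 ≤ ρ → 0 < Z → Z ≤ Y → Y ≤ X → X ≤ Y + Z →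
      Z * Y * (radial ν a low ρ X ^ 2 - radial ν a low ρ Y ^ 2) + radial ν a low ρ Y ^ 2 * Z ^ 2 ≤
        C * (radial ν (a + ν / 2) low ρ X * radial ν (a + ν / 2) low ρ Y *
          radial ν (2 - ν) 0 ρ Z) := by
  obtain ⟨C₁, hC₁, H⟩ := exists_exp_sub_exp_le h0 h1
  set K : ℝ := 2 ^ (a + low) with hK
  have hK0 : 0 < K := by positivity
  have hK1 : 1 ≤ K := Real.one_le_rpow (by norm_num) (by linarith)
  refine ⟨2 * K * C₁ + ((2 * a + 2 * low + 1) * K + 1), by positivity,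
    fun {ρ X Y Z} hρ hZ hZY hYX hX => ?_⟩
  have hY : 0 < Y := hZ.trans_le hZY
  have hX0 : 0 < X := hY.trans_le hYX
  have hν2 : 0 ≤ ν / 2 := by linarith
  have hH := H hρ hZ hZY hYX hX
  have hsq := sq_le_pw_mul h0.le hZ hZY hYX
  have heZ : 1 ≤ Real.exp (ρ * max (Z ^ ν) 1) := one_le_exp_max_rpow hρ
  have heXY := exp_max_rpow_mono (ν := ν) hρ h0.le hY.le hYX
  have hpXY : pw a low X ≤ K * pw a low Y :=
    pw_le_of_le_two_mul ha hlow hX0.le hY.le (by linarith)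
  have hpYX : pw a low Y ≤ pw a low X := pw_mono ha hlow hY.le hYX
  have hps : ∀ {x : ℝ}, 0 < x → pw (2 * a) (2 * low) x = pw a low x ^ 2 := fun hx => by
    rw [sq, pw_mul hx]; ring_nf
  have hd := pw_sub_pw_le (α := 2 * a) (β := 2 * low) (by linarith) (by linarith) hY hYX
  rw [hps hX0, hps hY] at hd
  have hA : ∀ {x : ℝ}, 0 < x → radial ν (a + ν / 2) low ρ x
      = pw a low x * pw (ν / 2) 0 x * Real.exp (ρ * max (x ^ ν) 1) := fun hx => by
    rw [radial, pw_mul hx, add_zero]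
  rw [hA hX0, hA hY]
  unfold radial
  set eX := Real.exp (ρ * max (X ^ ν) 1)
  set eY := Real.exp (ρ * max (Y ^ ν) 1)
  set eZ := Real.exp (ρ * max (Z ^ ν) 1)
  have heX0 : 0 < eX := Real.exp_pos _
  have heY0 : 0 < eY := Real.exp_pos _
  have hp := pw_pos (a := a) (b := low) hX0
  have hq := pw_pos (a := a) (b := low) hY
  have hg := pw_pos (a := 2 - ν) (b := 0) hZ
  have hhX := pw_pos (a := ν / 2) (b := 0) hX0
  have hhY := pw_pos (a := ν / 2) (b := 0) hY
  set p := pw a low X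
  set q := pw a low Y
  set g := pw (2 - ν) 0 Z
  set N := pw (ν / 2) 0 X * pw (ν / 2) 0 Y with hN
  have hN0 : 0 < N := by positivity
  have hpp : p ^ 2 ≤ K * (p * q) := by nlinarith
  -- The difference of the squared weights is split as p²(eX² - eY²) + (p² - q²)eY², that is, into
  -- an increment of the exponential and an increment of the power; the third term carries Z² and
  -- needs no cancellation.
  have T1 : Z * Y * (p ^ 2 * (eX ^ 2 - eY ^ 2)) ≤ 2 * K * C₁ * (p * q * (eX * eY) * N * (g * eZ)) := by
    have : eX ^ 2 - eY ^ 2 ≤ (eX - eY) * (2 * eX) := by nlinarith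
    have hee : 0 ≤ eX - eY := by linarith
    calc Z * Y * (p ^ 2 * (eX ^ 2 - eY ^ 2)) ≤ Z * Y * (p ^ 2 * ((eX - eY) * (2 * eX))) := by gcongr
      _ = (Z * Y * (eX - eY)) * (2 * eX) * p ^ 2 := by ring
      _ ≤ (C₁ * g * N * (eY * eZ)) * (2 * eX) * (K * (p * q)) := by gcongr
      _ = _ := by ring
  have hZ2 : Z ^ 2 * (p * q * (eY * eY)) ≤ p * q * (eX * eY) * N * (g * eZ) := by
    calc Z ^ 2 * (p * q * (eY * eY)) ≤ (g * N) * (p * q * (eX * eY)) := by gcongr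
      _ = (g * N) * (p * q * (eX * eY)) * 1 := by ring
      _ ≤ (g * N) * (p * q * (eX * eY)) * eZ := by gcongr
      _ = _ := by ring
  have T2 : Z * Y * ((p ^ 2 - q ^ 2) * eY ^ 2) ≤
      (2 * a + 2 * low + 1) * K * (p * q * (eX * eY) * N * (g * eZ)) := by
    calc Z * Y * ((p ^ 2 - q ^ 2) * eY ^ 2) = Z * (Y * (p ^ 2 - q ^ 2)) * eY ^ 2 := by ring
      _ ≤ Z * ((2 * a + 2 * low + 1) * Z * (K * (p * q))) * eY ^ 2 := by
        refine mul_le_mul_of_nonneg_right (mul_le_mul_of_nonneg_left (hd.trans ?_) hZ.le)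
          (sq_nonneg _)
        have hXZ : X - Y ≤ Z := by linarith
        gcongr
      _ = (2 * a + 2 * low + 1) * K * (Z ^ 2 * (p * q * (eY * eY))) := by ring
      _ ≤ _ := by gcongr
  have T3 : (q * eY) ^ 2 * Z ^ 2 ≤ p * q * (eX * eY) * N * (g * eZ) := by
    refine le_trans ?_ hZ2
    calc (q * eY) ^ 2 * Z ^ 2 = Z ^ 2 * (q * q * (eY * eY)) := by ring
      _ ≤ _ := by gcongr
  calc _ = Z * Y * (p ^ 2 * (eX ^ 2 - eY ^ 2)) + Z * Y * ((p ^ 2 - q ^ 2) * eY ^ 2)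
        + (q * eY) ^ 2 * Z ^ 2 := by ring
    _ ≤ 2 * K * C₁ * (p * q * (eX * eY) * N * (g * eZ)) +
        (2 * a + 2 * low + 1) * K * (p * q * (eX * eY) * N * (g * eZ)) +
        p * q * (eX * eY) * N * (g * eZ) := by gcongr
    _ = _ := by rw [hN]; ring

/-- Here X and Z are comparable and Y is the smallest variable. Above 1, of the 2a powers of Y the
amount a + ν/2 - 1 is moved to X and a - ν/2 to Z, which leaves a single power of Y; both amounts
are nonnegative because a ≥ 3/2. If X ≤ 1, the factor ZX is at most 2 and the weights at X and Y
suffice. -/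
lemma pw_sq_mul_le {ν a low X Y Z : ℝ} (h0 : 0 < ν) (h1 : ν ≤ 1) (ha : 3 / 2 ≤ a)
    (hlow : 0 ≤ low) (hY : 0 < Y) (hYX : Y ≤ X) (hYZ : Y < Z) (hXZ : X ≤ 2 * Z) (hZX : Z ≤ 2 * X) :
    pw a low Y ^ 2 * (Z * X) ≤ 2 * (pw (a + ν / 2) low X * pw (a + ν / 2) low Y * pw (2 - ν) 0 Z) +
      2 ^ low * (pw (a + ν / 2) low X * pw (a + 1 - ν / 2) low Z * pw 1 0 Y) := by
  have hX : 0 < X := hY.trans_le hYX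
  have hZ : 0 < Z := hY.trans hYZ
  have t1 : 0 < pw (a + ν / 2) low X * pw (a + ν / 2) low Y * pw (2 - ν) 0 Z :=
    mul_pos (mul_pos (pw_pos hX) (pw_pos hY)) (pw_pos hZ)
  have t2 : 0 < pw (a + ν / 2) low X * pw (a + 1 - ν / 2) low Z * pw 1 0 Y :=
    mul_pos (mul_pos (pw_pos hX) (pw_pos hZ)) (pw_pos hY)
  have h2l : (1 : ℝ) ≤ 2 ^ low := Real.one_le_rpow (by norm_num) hlow
  by_cases hX1 : X ≤ 1
  · have hY1 : Y ≤ 1 := hYX.trans hX1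
    refine le_add_of_le_of_nonneg ?_ (by positivity)
    have hg : 1 ≤ pw (2 - ν) 0 Z := one_le_pw hZ (by linarith) le_rfl
    rw [pw_of_le hY1, pw_of_le hX1, pw_of_le hY1]
    have e1 : Y ^ low ≤ X ^ low := Real.rpow_le_rpow hY.le hYX hlow
    have e2 : Z * X ≤ 2 := by nlinarith
    calc (Y ^ low) ^ 2 * (Z * X) ≤ (X ^ low * Y ^ low) * 2 := by
          rw [sq]; gcongr
      _ = 2 * (X ^ low * Y ^ low * 1) := by ring
      _ ≤ _ := by gcongr
  · have hX1 := not_le.1 hX1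
    refine le_add_of_nonneg_of_le (by positivity) ?_
    rw [pw_of_gt (a := a + ν / 2) hX1]
    by_cases hY1 : Y ≤ 1
    · rw [pw_of_le hY1, pw_of_le hY1, Real.rpow_zero, mul_one]
      have e0 : Y ^ low ≤ 1 := Real.rpow_le_one hY.le hY1 hlow
      have e1 : X ≤ X ^ (a + ν / 2) := by
        conv_lhs => rw [← Real.rpow_one X]
        exact Real.rpow_le_rpow_of_exponent_le hX1.le (by linarith)
      have e2 : Z ≤ 2 ^ low * pw (a + 1 - ν / 2) low Z := by
        by_cases hZ1 : 1 < Z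
        · rw [pw_of_gt hZ1]
          have : Z ≤ Z ^ (a + 1 - ν / 2) := by
            conv_lhs => rw [← Real.rpow_one Z]
            exact Real.rpow_le_rpow_of_exponent_le hZ1.le (by linarith)
          have : 0 < Z ^ (a + 1 - ν / 2) := by positivity
          nlinarith
        · have hZ1' := not_lt.1 hZ1
          rw [pw_of_le hZ1', ← Real.mul_rpow (by norm_num) hZ.le]
          exact hZ1'.trans (Real.one_le_rpow (by linarith) hlow)
      calc (Y ^ low) ^ 2 * (Z * X) ≤ 1 ^ 2 * ((2 ^ low * pw (a + 1 - ν / 2) low Z) *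
            X ^ (a + ν / 2)) := by
            have := pw_pos (a := a + 1 - ν / 2) (b := low) hZ
            gcongr
        _ = _ := by ring
    · have hY1 := not_le.1 hY1
      have hZ1 : 1 < Z := hY1.trans hYZ
      rw [pw_of_gt hY1, pw_of_gt hY1, pw_of_gt hZ1, Real.rpow_one]
      have e1 : Y ^ (a + ν / 2 - 1) ≤ X ^ (a + ν / 2 - 1) :=
        Real.rpow_le_rpow hY.le hYX (by linarith)
      have e2 : Y ^ (a - ν / 2) ≤ Z ^ (a - ν / 2) := Real.rpow_le_rpow hY.le hYZ.le (by linarith)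
      have e3 : (Y ^ a) ^ 2 = Y ^ (a + ν / 2 - 1) * Y ^ (a - ν / 2) * Y := by
        rw [sq, ← Real.rpow_add hY, ← Real.rpow_add hY]
        conv_rhs => rw [← Real.rpow_add_one hY.ne']
        congr 1; ring
      have e4 : X ^ (a + ν / 2) = X ^ (a + ν / 2 - 1) * X := by
        rw [← Real.rpow_add_one hX.ne']; congr 1; ring
      have e5 : Z ^ (a + 1 - ν / 2) = Z ^ (a - ν / 2) * Z := by
        rw [← Real.rpow_add_one hZ.ne']; congr 1; ring
      rw [e3, e4, e5]
      calc Y ^ (a + ν / 2 - 1) * Y ^ (a - ν / 2) * Y * (Z * X)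
          ≤ X ^ (a + ν / 2 - 1) * Z ^ (a - ν / 2) * Y * (Z * X) := by gcongr
        _ = 1 * (X ^ (a + ν / 2 - 1) * X * (Z ^ (a - ν / 2) * Z) * Y) := by ring
        _ ≤ _ := by gcongr

/-- The commutator estimate in the region where the inner frequency is large. -/
lemma exists_far_le {ν a low : ℝ} (h0 : 0 < ν) (h1 : ν ≤ 1) (ha : 3 / 2 ≤ a) (hlow : 0 ≤ low) :
    ∃ C : ℝ, 0 < C ∧ ∀ {ρ X Y Z : ℝ}, 0 ≤ ρ → 0 < Y → Y < Z → Y ≤ X → X ≤ Y + Z → Z ≤ X + Y →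
      radial ν a low ρ X ^ 2 * (Z * Y) + radial ν a low ρ Y ^ 2 * (Z * X) ≤
        C * (radial ν (a + ν / 2) low ρ X * radial ν (a + ν / 2) low ρ Y * radial ν (2 - ν) 0 ρ Z +
          radial ν (a + ν / 2) low ρ X * radial ν (a + 1 - ν / 2) low ρ Z * radial ν 1 0 ρ Y) := by
  set K : ℝ := 2 ^ (a - ν / 2 + low) with hK
  have hK0 : 0 < K := by positivity
  have hL0 : (0 : ℝ) < 2 ^ low := by positivity
  refine ⟨K + 2 + 2 ^ low, by positivity, fun {ρ X Y Z} hρ hY hYZ hYX hX hZ' => ?_⟩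
  have hX0 : 0 < X := hY.trans_le hYX
  have hZ : 0 < Z := hY.trans hYZ
  have hsq := pw_sq_mul_le h0 h1 ha hlow hY hYX hYZ (by linarith) (by linarith)
  have heZ : 1 ≤ Real.exp (ρ * max (Z ^ ν) 1) := one_le_exp_max_rpow hρ
  have heXY := exp_max_rpow_mono (ν := ν) hρ h0.le hY.le hYX
  have heX := exp_max_rpow_le_mul (ν := ν) hρ h0.le h1 hX0.le hY.le hZ.le hX
  unfold radial
  set eX := Real.exp (ρ * max (X ^ ν) 1)
  set eY := Real.exp (ρ * max (Y ^ ν) 1)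
  set eZ := Real.exp (ρ * max (Z ^ ν) 1)
  have heX0 : 0 < eX := Real.exp_pos _
  have heY0 : 0 < eY := Real.exp_pos _
  have heZ0 : 0 < eZ := Real.exp_pos _
  -- No cancellation is used in this region: the squared weight at X is shared as a + ν/2 on X and a
  -- - ν/2 on the comparable variable Z, which also takes the factor Z.
  have q1 : pw a low X ^ 2 * (Z * Y) ≤
      K * (pw (a + ν / 2) low X * pw (a + 1 - ν / 2) low Z * pw 1 0 Y) := by
    have e1 : pw a low X ^ 2 = pw (a + ν / 2) low X * pw (a - ν / 2) low X := by
      rw [sq, pw_mul hX0, pw_mul hX0]; ring_nf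
    have e2 : pw (a - ν / 2) low X ≤ K * pw (a - ν / 2) low Z :=
      pw_le_of_le_two_mul (by linarith) hlow hX0.le hZ.le (by linarith)
    have e3 : pw (a - ν / 2) low Z * Z ≤ pw (a + 1 - ν / 2) low Z := by
      refine (pw_mul_self_le hZ).trans (le_of_eq ?_); congr 1; ring
    have e4 : Y ≤ pw 1 0 Y := by
      unfold pw; split_ifs with h
      · simp
      · simpa using h
    have hp := pw_pos (a := a + ν / 2) (b := low) hX0
    have hp2 := pw_pos (a := a - ν / 2) (b := low) hZ
    have hp3 := pw_pos (a := a + 1 - ν / 2) (b := low) hZ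
    calc pw a low X ^ 2 * (Z * Y) ≤
          pw (a + ν / 2) low X * (K * pw (a - ν / 2) low Z) * (Z * Y) := by
          rw [e1]; gcongr
      _ = K * (pw (a + ν / 2) low X * (pw (a - ν / 2) low Z * Z) * Y) := by ring
      _ ≤ _ := by gcongr
  have hu : 0 < pw (a + ν / 2) low X * pw (a + ν / 2) low Y * pw (2 - ν) 0 Z :=
    mul_pos (mul_pos (pw_pos hX0) (pw_pos hY)) (pw_pos hZ)
  have hv : 0 < pw (a + ν / 2) low X * pw (a + 1 - ν / 2) low Z * pw 1 0 Y :=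
    mul_pos (mul_pos (pw_pos hX0) (pw_pos hZ)) (pw_pos hY)
  set u := pw (a + ν / 2) low X * pw (a + ν / 2) low Y * pw (2 - ν) 0 Z with hu'
  set v := pw (a + ν / 2) low X * pw (a + 1 - ν / 2) low Z * pw 1 0 Y with hv'
  have hE : eX ^ 2 ≤ eX * eY * eZ := by rw [sq, mul_assoc]; gcongr
  have hE' : eY ^ 2 ≤ eX * eY * eZ := by
    calc eY ^ 2 = eY * eY * 1 := by ring
      _ ≤ eX * eY * eZ := by gcongr
  calc _ = pw a low X ^ 2 * (Z * Y) * eX ^ 2 + pw a low Y ^ 2 * (Z * X) * eY ^ 2 := by ring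
    _ ≤ K * v * (eX * eY * eZ) + (2 * u + 2 ^ low * v) * (eX * eY * eZ) := by gcongr
    _ ≤ (K + 2 + 2 ^ low) * (u + v) * (eX * eY * eZ) := by
      rw [← add_mul]; gcongr; nlinarith [mul_pos hK0 hu, mul_pos hL0 hu]
    _ = _ := by rw [hu', hv']; ring

/-- The kernel of the symmetrized form `Re ⟨u, ∇v·∇u⟩`, estimated uniformly in `ρ ≥ 0`. -/
lemma exists_commutator_le {ν a low : ℝ} (h0 : 0 < ν) (h1 : ν ≤ 1) (ha : 3 / 2 ≤ a)
    (hlow : 0 ≤ low) : ∃ C : ℝ, 0 < C ∧ ∀ {ρ : ℝ} {ξ η : Rn n}, 0 ≤ ρ → ξ ≠ 0 → η ≠ 0 → ξ ≠ η →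
      |weight ν a low ρ ξ ^ 2 * inner ℝ (ξ - η) η - weight ν a low ρ η ^ 2 * inner ℝ (ξ - η) ξ| ≤
        C * (weight ν (a + ν / 2) low ρ ξ * weight ν (a + ν / 2) low ρ η *
            weight ν (2 - ν) 0 ρ (ξ - η) +
          weight ν (a + ν / 2) low ρ ξ * weight ν (a + 1 - ν / 2) low ρ (ξ - η) *
            weight ν 1 0 ρ η +
          weight ν (a + ν / 2) low ρ η * weight ν (a + 1 - ν / 2) low ρ (ξ - η) *
            weight ν 1 0 ρ ξ) := by
  obtain ⟨C₁, hC₁, H₁⟩ := exists_near_le h0 h1 (by linarith : 0 ≤ a) hlow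
  obtain ⟨C₂, hC₂, H₂⟩ := exists_far_le h0 h1 ha hlow
  have main : ∀ {ρ : ℝ} {ξ η : Rn n}, 0 ≤ ρ → ξ ≠ 0 → η ≠ 0 → ξ ≠ η → ‖η‖ ≤ ‖ξ‖ →
      |weight ν a low ρ ξ ^ 2 * inner ℝ (ξ - η) η - weight ν a low ρ η ^ 2 * inner ℝ (ξ - η) ξ| ≤
        (C₁ + C₂) * (weight ν (a + ν / 2) low ρ ξ * weight ν (a + ν / 2) low ρ η *
            weight ν (2 - ν) 0 ρ (ξ - η) +
          weight ν (a + ν / 2) low ρ ξ * weight ν (a + 1 - ν / 2) low ρ (ξ - η) *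
            weight ν 1 0 ρ η) := by
    intro ρ ξ η hρ hξ hη hne hle
    have hX0 : 0 < ‖ξ‖ := norm_pos_iff.2 hξ
    have hY0 : 0 < ‖η‖ := norm_pos_iff.2 hη
    have hZ0 : 0 < ‖ξ - η‖ := norm_pos_iff.2 (sub_ne_zero.2 hne)
    have hX : ‖ξ‖ ≤ ‖η‖ + ‖ξ - η‖ := by
      have := norm_add_le η (ξ - η); simpa using this
    have hZ : ‖ξ - η‖ ≤ ‖ξ‖ + ‖η‖ := norm_sub_le _ _
    simp only [weight_eq_radial]
    have hr : ∀ {a b x : ℝ}, 0 < x → 0 < radial ν a b ρ x := fun hx =>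
      mul_pos (pw_pos hx) (Real.exp_pos _)
    have t1 := mul_pos (mul_pos (hr (a := a + ν / 2) (b := low) hX0)
      (hr (a := a + ν / 2) (b := low) hY0)) (hr (a := 2 - ν) (b := 0) hZ0)
    have t2 := mul_pos (mul_pos (hr (a := a + ν / 2) (b := low) hX0)
      (hr (a := a + 1 - ν / 2) (b := low) hZ0)) (hr (a := 1) (b := 0) hY0)
    set u := radial ν (a + ν / 2) low ρ ‖ξ‖ * radial ν (a + ν / 2) low ρ ‖η‖ *
      radial ν (2 - ν) 0 ρ ‖ξ - η‖
    set v := radial ν (a + ν / 2) low ρ ‖ξ‖ * radial ν (a + 1 - ν / 2) low ρ ‖ξ - η‖ *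
      radial ν 1 0 ρ ‖η‖
    have i1 : |inner ℝ (ξ - η) η| ≤ ‖ξ - η‖ * ‖η‖ := abs_real_inner_le_norm _ _
    have i2 : |inner ℝ (ξ - η) ξ| ≤ ‖ξ - η‖ * ‖ξ‖ := abs_real_inner_le_norm _ _
    rcases le_or_gt ‖ξ - η‖ ‖η‖ with hZY | hZY
    · have h := H₁ hρ hZ0 hZY hle hX
      have hmono : radial ν a low ρ ‖η‖ ^ 2 ≤ radial ν a low ρ ‖ξ‖ ^ 2 := by
        refine pow_le_pow_left₀ (hr hY0).le ?_ 2
        exact mul_le_mul (pw_mono (by linarith) hlow hY0.le hle)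
          (exp_max_rpow_mono hρ h0.le hY0.le hle) (Real.exp_pos _).le (pw_pos hX0).le
      -- Writing ξ = η + (ξ - η) in the second inner product exhibits the difference of the weights,
      -- up to a term with |ξ - η|² that costs no derivative on η.
      have e : radial ν a low ρ ‖ξ‖ ^ 2 * inner ℝ (ξ - η) η -
          radial ν a low ρ ‖η‖ ^ 2 * inner ℝ (ξ - η) ξ =
          (radial ν a low ρ ‖ξ‖ ^ 2 - radial ν a low ρ ‖η‖ ^ 2) * inner ℝ (ξ - η) η -
            radial ν a low ρ ‖η‖ ^ 2 * ‖ξ - η‖ ^ 2 := by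
        rw [← real_inner_self_eq_norm_sq (ξ - η)]
        conv_rhs => rw [inner_sub_right (ξ - η) ξ η]
        ring
      rw [e]
      refine (abs_sub _ _).trans ?_
      rw [abs_mul, abs_of_nonneg (sub_nonneg.2 hmono), abs_of_nonneg (a := _ * ‖ξ - η‖ ^ 2)
        (by positivity)]
      have hd := sub_nonneg.2 hmono
      calc _ ≤ (radial ν a low ρ ‖ξ‖ ^ 2 - radial ν a low ρ ‖η‖ ^ 2) * (‖ξ - η‖ * ‖η‖) +
            radial ν a low ρ ‖η‖ ^ 2 * ‖ξ - η‖ ^ 2 := by gcongr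
        _ ≤ C₁ * u := by linarith
        _ ≤ _ := by nlinarith [mul_pos hC₂ t1, mul_pos hC₁ t2, mul_pos hC₂ t2]
    · have h := H₂ hρ hY0 hZY hle hX hZ
      refine (abs_sub _ _).trans ?_
      rw [abs_mul, abs_mul, abs_of_nonneg (sq_nonneg (radial ν a low ρ ‖ξ‖)),
        abs_of_nonneg (sq_nonneg (radial ν a low ρ ‖η‖))]
      calc _ ≤ radial ν a low ρ ‖ξ‖ ^ 2 * (‖ξ - η‖ * ‖η‖) +
            radial ν a low ρ ‖η‖ ^ 2 * (‖ξ - η‖ * ‖ξ‖) := by gcongr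
        _ ≤ C₂ * (u + v) := h
        _ ≤ _ := by nlinarith [mul_pos hC₁ t1, mul_pos hC₁ t2]
  refine ⟨C₁ + C₂, by positivity, fun {ρ ξ η} hρ hξ hη hne => ?_⟩
  have hw : ∀ (a b : ℝ) (ζ : Rn n), 0 ≤ weight ν a b ρ ζ := fun a b ζ =>
    mul_nonneg (pw_nonneg (norm_nonneg _)) (Real.exp_pos _).le
  -- The kernel is invariant under the exchange of ξ and η, so one may assume |η| ≤ |ξ|; the third
  -- term of the bound is the second one after the exchange.
  rcases le_total ‖η‖ ‖ξ‖ with hle | hle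
  · refine (main hρ hξ hη hne hle).trans ?_
    refine mul_le_mul_of_nonneg_left ?_ (by positivity)
    exact le_add_of_nonneg_right (mul_nonneg (mul_nonneg (hw _ _ _) (hw _ _ _)) (hw _ _ _))
  · have h := main hρ hη hξ hne.symm hle
    have hneg : ∀ (a b : ℝ), weight ν a b ρ (η - ξ) = weight ν a b ρ (ξ - η) := fun a b => by
      rw [weight_eq_radial, weight_eq_radial, norm_sub_rev]
    simp only [hneg] at h
    rw [← neg_sub ξ η, inner_neg_left, inner_neg_left] at h
    have e : weight ν a low ρ η ^ 2 * -inner ℝ (ξ - η) ξ - weight ν a low ρ ξ ^ 2 * -inner ℝ (ξ - η) η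
      = weight ν a low ρ ξ ^ 2 * inner ℝ (ξ - η) η - weight ν a low ρ η ^ 2 * inner ℝ (ξ - η) ξ := by
      ring
    rw [e] at h
    refine h.trans ?_
    refine mul_le_mul_of_nonneg_left ?_ (by positivity)
    have := mul_nonneg (mul_nonneg (hw (a + ν / 2) low ξ) (hw (a + 1 - ν / 2) low (ξ - η)))
      (hw 1 0 η)
    nlinarith

end Commutator

-- Weighted L² norms, embeddings and product estimates

section ENNRealWeight

/-- The weight as a function with values in `[0, ∞]`. -/
def ew (ν a b ρ : ℝ) (ξ : Rn n) : ℝ≥0∞ := ENNReal.ofReal (weight ν a b ρ ξ)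

/-- The weighted `L²` norm of a function with values in `[0, ∞]`. -/
def wl (ν a b ρ : ℝ) (F : Rn n → ℝ≥0∞) : ℝ≥0∞ := ltwo volume fun ξ => ew ν a b ρ ξ * F ξ

@[fun_prop]
lemma measurable_weight (ν a b ρ : ℝ) : Measurable (weight ν a b ρ : Rn n → ℝ) := by
  unfold weight
  refine Measurable.mul (Measurable.ite ?_ (by fun_prop) (by fun_prop)) (by fun_prop)
  exact measurableSet_lt measurable_const measurable_norm

@[fun_prop]
lemma measurable_ew (ν a b ρ : ℝ) : Measurable (ew ν a b ρ : Rn n → ℝ≥0∞) :=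
  (measurable_weight ν a b ρ).ennreal_ofReal

lemma weight_nonneg (ν a b ρ : ℝ) (ξ : Rn n) : 0 ≤ weight ν a b ρ ξ :=
  mul_nonneg (pw_nonneg (norm_nonneg _)) (Real.exp_pos _).le

lemma weight_pos (ν a b ρ : ℝ) {ξ : Rn n} (h : ξ ≠ 0) : 0 < weight ν a b ρ ξ :=
  mul_pos (pw_pos (norm_pos_iff.2 h)) (Real.exp_pos _)

lemma ew_ne_top (ν a b ρ : ℝ) (ξ : Rn n) : ew ν a b ρ ξ ≠ ∞ := ENNReal.ofReal_ne_top

lemma ew_ne_zero (ν a b ρ : ℝ) {ξ : Rn n} (h : ξ ≠ 0) : ew ν a b ρ ξ ≠ 0 := by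
  simpa [ew] using weight_pos ν a b ρ h

lemma ew_mul (ν a b ρ a' b' ρ' : ℝ) {ξ : Rn n} (h : ξ ≠ 0) :
    ew ν a b ρ ξ * ew ν a' b' ρ' ξ = ew ν (a + a') (b + b') (ρ + ρ') ξ := by
  rw [ew, ew, ew, ← ENNReal.ofReal_mul (weight_nonneg ..)]
  congr 1
  have : ‖ξ‖ > 0 := norm_pos_iff.2 h
  simp only [weight_eq_radial, radial]
  rw [← pw_mul this, add_mul, Real.exp_add]; ring

lemma ew_mono {ν a b ρ a' b' ρ' : ℝ} {ξ : Rn n} (h : ξ ≠ 0) (ha : a ≤ a') (hb : b' ≤ b)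
    (hρ : ρ ≤ ρ') : ew ν a b ρ ξ ≤ ew ν a' b' ρ' ξ := by
  have h0 : ‖ξ‖ > 0 := norm_pos_iff.2 h
  refine ENNReal.ofReal_le_ofReal (mul_le_mul (pw_le_pw h0 ha hb) ?_ (Real.exp_pos _).le
    (pw_pos h0).le)
  refine Real.exp_le_exp.2 (mul_le_mul_of_nonneg_right hρ ?_)
  exact zero_le_one.trans (le_max_right _ _)

lemma ew_mul_norm_le (ν a b ρ : ℝ) (ξ : Rn n) :
    ew ν a b ρ ξ * ‖ξ‖ₑ ≤ ew ν (a + 1) b ρ ξ := by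
  by_cases h : ξ = 0
  · simp [h]
  have h0 : 0 < ‖ξ‖ := norm_pos_iff.2 h
  rw [ew, ew, ← ofReal_norm, ← ENNReal.ofReal_mul (weight_nonneg ..)]
  refine ENNReal.ofReal_le_ofReal ?_
  simp only [weight_eq_radial, radial]
  calc _ = pw a b ‖ξ‖ * ‖ξ‖ * Real.exp (ρ * max (‖ξ‖ ^ ν) 1) := by ring
    _ ≤ _ := by gcongr; exact pw_mul_self_le h0

lemma ae_ne_zero (hn : 0 < n) : ∀ᵐ ξ : Rn n, ξ ≠ 0 := by
  have : Nonempty (Fin n) := ⟨⟨0, hn⟩⟩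
  exact Measure.ae_ne volume 0

lemma wl_mono_weight (hn : 0 < n) {ν a b ρ a' b' ρ' : ℝ} (ha : a ≤ a') (hb : b' ≤ b)
    (hρ : ρ ≤ ρ') (F : Rn n → ℝ≥0∞) : wl ν a b ρ F ≤ wl ν a' b' ρ' F := by
  refine ltwo_mono ?_
  filter_upwards [ae_ne_zero hn] with ξ hξ
  gcongr
  exact ew_mono hξ ha hb hρ

lemma wl_mono {ν a b ρ : ℝ} {F G : Rn n → ℝ≥0∞} (h : F ≤ᵐ[volume] G) :
    wl ν a b ρ F ≤ wl ν a b ρ G := by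
  refine ltwo_mono ?_
  filter_upwards [h] with ξ hξ
  gcongr

lemma wl_norm_mul_le (ν a b ρ : ℝ) (F : Rn n → ℝ≥0∞) :
    wl ν a b ρ (fun ξ => ‖ξ‖ₑ * F ξ) ≤ wl ν (a + 1) b ρ F := by
  refine ltwo_mono (ae_of_all _ fun ξ => ?_)
  dsimp only
  rw [← mul_assoc]
  gcongr
  exact ew_mul_norm_le ..

lemma wl_const_mul {ν a b ρ : ℝ} {c : ℝ≥0∞} (hc : c ≠ ∞) (F : Rn n → ℝ≥0∞) :
    wl ν a b ρ (fun ξ => c * F ξ) = c * wl ν a b ρ F := by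
  rw [wl, wl, ← ltwo_const_mul hc]
  congr 1; funext ξ; ring

lemma wl_add_le {ν a b ρ : ℝ} {F G : Rn n → ℝ≥0∞} (hF : AEMeasurable F) (hG : AEMeasurable G) :
    wl ν a b ρ (fun ξ => F ξ + G ξ) ≤ wl ν a b ρ F + wl ν a b ρ G := by
  simp only [wl, mul_add]
  exact ltwo_add_le (by fun_prop) (by fun_prop)

lemma wl_lintegral_le {α : Type*} [MeasurableSpace α] {m : Measure α} [SFinite m] {ν a b ρ : ℝ}
    {g : α → Rn n → ℝ≥0∞} (hg : Measurable (Function.uncurry g)) :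
    wl ν a b ρ (fun ξ => ∫⁻ s, g s ξ ∂m) ≤ ∫⁻ s, wl ν a b ρ (g s) ∂m := by
  have h := ltwo_lintegral_le (m := m) (m' := (volume : Measure (Rn n)))
    (g := fun s ξ => ew ν a b ρ ξ * g s ξ)
    (((measurable_ew ν a b ρ).comp measurable_snd).mul hg)
  refine le_trans (le_of_eq ?_) h
  unfold wl; congr 1; funext ξ
  rw [lintegral_const_mul' _ _ (ew_ne_top ν _ _ _ _)]

lemma measurable_wl {α : Type*} [MeasurableSpace α] {ν a b : ℝ} {ρ : α → ℝ} (hρ : Measurable ρ)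
    {g : α → Rn n → ℝ≥0∞} (hg : Measurable (Function.uncurry g)) :
    Measurable fun s => wl ν a b (ρ s) (g s) := by
  refine measurable_ltwo (g := fun s ξ => ew ν a b (ρ s) ξ * g s ξ) (Measurable.mul ?_ hg)
  refine Measurable.ennreal_ofReal ?_
  unfold weight
  refine Measurable.mul (Measurable.ite ?_ (by fun_prop) (by fun_prop)) (by fun_prop)
  exact measurableSet_lt measurable_const (by fun_prop)

/-- The square integrability of `|ξ|^{-β}` near `0` and of `|ξ|^{-σ}` near infinity. -/
lemma ltwo_pw_ne_top (hn : 0 < n) {σ β : ℝ} (hσ : n / 2 < σ) (hβ : β < n / 2) :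
    ltwo (volume : Measure (Rn n)) (fun ξ => ENNReal.ofReal (pw (-σ) (-β) ‖ξ‖)) ≠ ∞ := by
  have : Nonempty (Fin n) := ⟨⟨0, hn⟩⟩
  have key : Integrable (fun ξ : Rn n => pw (-(2 * σ)) (-(2 * β)) ‖ξ‖) := by
    rw [integrable_fun_norm_addHaar volume (f := pw (-(2 * σ)) (-(2 * β)))]
    rw [finrank_euclideanSpace, Fintype.card_fin, ← Ioc_union_Ioi_eq_Ioi (zero_le_one' ℝ)]
    have hcast : ∀ y : ℝ, 0 < y → y ^ (n - 1) = y ^ ((n : ℝ) - 1) := fun y hy => by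
      rw [← Real.rpow_natCast, Nat.cast_sub (by omega)]; simp
    refine IntegrableOn.union ?_ ?_
    · have h1 : IntegrableOn (fun y : ℝ => y ^ ((n : ℝ) - 1 - 2 * β)) (Ioc 0 1) :=
        (intervalIntegrable_iff_integrableOn_Ioc_of_le zero_le_one).1
          (intervalIntegral.intervalIntegrable_rpow' (by linarith))
      refine h1.congr_fun (fun y hy => ?_) measurableSet_Ioc
      simp only [smul_eq_mul]
      rw [hcast y hy.1, pw_of_le hy.2, ← Real.rpow_add hy.1]; congr 1
    · have h1 : IntegrableOn (fun y : ℝ => y ^ ((n : ℝ) - 1 - 2 * σ)) (Ioi 1) :=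
        integrableOn_Ioi_rpow_of_lt (by linarith) zero_lt_one
      refine h1.congr_fun (fun y hy => ?_) measurableSet_Ioi
      simp only [smul_eq_mul]
      have hy0 : 0 < y := zero_lt_one.trans hy
      rw [hcast y hy0, pw_of_gt hy, ← Real.rpow_add hy0]; congr 1
  have h2 := key.lintegral_lt_top
  rw [ltwo]
  refine ENNReal.rpow_ne_top_of_nonneg (by norm_num) (ne_of_lt ?_)
  refine lt_of_eq_of_lt (lintegral_congr_ae ?_) h2
  filter_upwards [ae_ne_zero hn] with ξ hξ
  have h0 : 0 < ‖ξ‖ := norm_pos_iff.2 hξ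
  rw [← ENNReal.ofReal_pow (pw_pos h0).le, sq, pw_mul h0]
  ring_nf

lemma measurable_pw {a b : ℝ} : Measurable (pw a b) := by
  unfold pw
  exact Measurable.ite (measurableSet_lt measurable_const measurable_id) (by fun_prop)
    (by fun_prop)

/-- The embedding of a weighted `L²` space into a weighted `L¹` space. -/
lemma exists_lintegral_ew_le (hn : 0 < n) {a b a' b' : ℝ} (ha : n / 2 < a - a')
    (hb : b - b' < n / 2) : ∃ C : ℝ≥0∞, C ≠ ∞ ∧ ∀ (ν ρ : ℝ) (F : Rn n → ℝ≥0∞), Measurable F →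
      ∫⁻ ξ, ew ν a' b' ρ ξ * F ξ ≤ C * wl ν a b ρ F := by
  refine ⟨_, ltwo_pw_ne_top hn ha hb, fun ν ρ F hF => ?_⟩
  have hm : Measurable fun ξ : Rn n => ENNReal.ofReal (pw (-(a - a')) (-(b - b')) ‖ξ‖) :=
    (measurable_pw.comp measurable_norm).ennreal_ofReal
  refine le_trans (le_of_eq (lintegral_congr_ae ?_))
    (lintegral_mul_le_ltwo hm.aemeasurable (by fun_prop : AEMeasurable fun ξ => ew ν a b ρ ξ * F ξ))
  filter_upwards [ae_ne_zero hn] with ξ hξ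
  have h0 : 0 < ‖ξ‖ := norm_pos_iff.2 hξ
  rw [← mul_assoc, ew, ew, ← ENNReal.ofReal_mul (pw_pos h0).le]
  congr 2
  simp only [weight_eq_radial, radial]
  rw [← mul_assoc, pw_mul h0]; ring_nf

lemma enorm_sub_add_triangle (ξ η : Rn n) : ‖ξ‖ ≤ ‖ξ - η‖ + ‖η‖ := by
  simpa using norm_add_le (ξ - η) η

lemma ae_sub_ne_zero (hn : 0 < n) (ξ : Rn n) : ∀ᵐ η : Rn n, ξ - η ≠ 0 ∧ η ≠ 0 := by
  have : Nonempty (Fin n) := ⟨⟨0, hn⟩⟩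
  filter_upwards [Measure.ae_ne volume ξ, ae_ne_zero hn] with η h1 h2
  exact ⟨sub_ne_zero.2 h1.symm, h2⟩

/-- The product estimate in weighted spaces, uniformly in `ρ ≥ 0`. -/
lemma exists_product_le (hn : 0 < n) {ν s s₁ s₂ b b₁ b₂ β : ℝ} (h0 : 0 ≤ ν) (h1 : ν ≤ 1)
    (hs : 0 ≤ s) (hs1 : s ≤ s₁) (hs2 : s ≤ s₂) (hσ : n / 2 < s₁ + s₂ - s) (hβ : 0 ≤ β)
    (hβ' : β < n / 2) (hb : (b = β ∧ b₁ = β ∧ b₂ = β) ∨ (b = 0 ∧ b₁ = β ∧ b₂ = 0)) :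
    ∃ C : ℝ≥0∞, C ≠ ∞ ∧ ∀ (ρ : ℝ) (F G : Rn n → ℝ≥0∞), 0 ≤ ρ → Measurable F → Measurable G →
      wl ν s b ρ (lconv F G) ≤ C * wl ν s₁ b₁ ρ F * wl ν s₂ b₂ ρ G := by
  -- Q is the loss in `pw_product_le`. It lies in L², so Q times a weighted L² factor lies in L¹ and
  -- Young's inequality applies to each of the two resulting convolutions.
  set Q : Rn n → ℝ≥0∞ := fun ξ => ENNReal.ofReal (pw (-(s₁ + s₂ - s)) (-β) ‖ξ‖) with hQ
  have hQm : Measurable Q := (measurable_pw.comp measurable_norm).ennreal_ofReal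
  have hQt : ltwo volume Q ≠ ∞ := ltwo_pw_ne_top hn hσ hβ'
  set K : ℝ≥0∞ := ENNReal.ofReal (2 ^ (s + b + 1)) with hK
  refine ⟨2 * K * ltwo volume Q, by finiteness, fun ρ F G hρ hF hG => ?_⟩
  set F₁ : Rn n → ℝ≥0∞ := fun ξ => ew ν s₁ b₁ ρ ξ * F ξ with hF₁
  set G₁ : Rn n → ℝ≥0∞ := fun ξ => ew ν s₂ b₂ ρ ξ * G ξ with hG₁
  have hF₁m : Measurable F₁ := by fun_prop
  have hG₁m : Measurable G₁ := by fun_prop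
  have point : ∀ ξ, ew ν s b ρ ξ * lconv F G ξ ≤
      K * (lconv (fun ζ => Q ζ * F₁ ζ) G₁ ξ + lconv F₁ (fun η => Q η * G₁ η) ξ) := by
    intro ξ
    unfold lconv
    rw [← lintegral_const_mul' _ _ (ew_ne_top ν _ _ _ _), ← lintegral_add_left (by fun_prop),
      ← lintegral_const_mul' _ _ ENNReal.ofReal_ne_top]
    refine lintegral_mono_ae ?_
    filter_upwards [ae_sub_ne_zero hn ξ] with η ⟨h2, h3⟩
    have hz : 0 < ‖ξ - η‖ := norm_pos_iff.2 h2
    have hy : 0 < ‖η‖ := norm_pos_iff.2 h3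
    have ker : ew ν s b ρ ξ ≤ K * ((Q (ξ - η) + Q η) * (ew ν s₁ b₁ ρ (ξ - η) * ew ν s₂ b₂ ρ η)) := by
      simp only [hK, hQ, ew]
      rw [← ENNReal.ofReal_add (pw_pos hz).le (pw_pos hy).le, ← ENNReal.ofReal_mul (weight_nonneg ..),
        ← ENNReal.ofReal_mul (add_pos (pw_pos hz) (pw_pos hy)).le,
        ← ENNReal.ofReal_mul (by positivity)]
      refine ENNReal.ofReal_le_ofReal ?_
      simp only [weight_eq_radial, radial]
      have e1 := pw_product_le hs hs1 hs2 hβ hb (norm_nonneg ξ) hz hy (enorm_sub_add_triangle ξ η)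
      have e2 := exp_max_rpow_le_mul (ν := ν) hρ h0 h1 (norm_nonneg ξ) hz.le hy.le
        (enorm_sub_add_triangle ξ η)
      refine (mul_le_mul e1 e2 (Real.exp_pos _).le ((pw_nonneg (norm_nonneg ξ)).trans e1)).trans
        (le_of_eq (by ring))
    calc ew ν s b ρ ξ * (F (ξ - η) * G η) ≤
          K * ((Q (ξ - η) + Q η) * (ew ν s₁ b₁ ρ (ξ - η) * ew ν s₂ b₂ ρ η)) *
            (F (ξ - η) * G η) := by gcongr
      _ = _ := by simp only [hF₁, hG₁]; ring
  have hQF : ∫⁻ ζ, Q ζ * F₁ ζ ≤ ltwo volume Q * ltwo volume F₁ :=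
    lintegral_mul_le_ltwo hQm.aemeasurable hF₁m.aemeasurable
  have hQG : ∫⁻ ζ, Q ζ * G₁ ζ ≤ ltwo volume Q * ltwo volume G₁ :=
    lintegral_mul_le_ltwo hQm.aemeasurable hG₁m.aemeasurable
  calc wl ν s b ρ (lconv F G) ≤ ltwo volume fun ξ =>
        K * (lconv (fun ζ => Q ζ * F₁ ζ) G₁ ξ + lconv F₁ (fun η => Q η * G₁ η) ξ) :=
        ltwo_mono (ae_of_all _ point)
    _ = K * ltwo volume fun ξ => lconv (fun ζ => Q ζ * F₁ ζ) G₁ ξ +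
          lconv F₁ (fun η => Q η * G₁ η) ξ := ltwo_const_mul ENNReal.ofReal_ne_top _
    _ ≤ K * (ltwo volume (lconv (fun ζ => Q ζ * F₁ ζ) G₁) +
          ltwo volume (lconv F₁ (fun η => Q η * G₁ η))) := by
        gcongr
        exact ltwo_add_le (measurable_lconv (by fun_prop) hG₁m).aemeasurable
          (measurable_lconv hF₁m (by fun_prop)).aemeasurable
    _ ≤ K * ((ltwo volume Q * ltwo volume F₁) * ltwo volume G₁ +
          ltwo volume F₁ * (ltwo volume Q * ltwo volume G₁)) := by
        gcongr
        · exact (ltwo_lconv_le' (by fun_prop) hG₁m).trans (by gcongr)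
        · exact (ltwo_lconv_le hF₁m (by fun_prop)).trans (by gcongr)
    _ = 2 * K * ltwo volume Q * ltwo volume F₁ * ltwo volume G₁ := by ring

/-- The weighted norm of a product, with the weight falling on one of the factors. -/
lemma wl_lconv_le {ν s b ρ : ℝ} (h0 : 0 ≤ ν) (h1 : ν ≤ 1) (hs : 0 ≤ s) (hb : 0 ≤ b) (hρ : 0 ≤ ρ)
    {F G : Rn n → ℝ≥0∞} (hF : Measurable F) (hG : Measurable G) :
    wl ν s b ρ (lconv F G) ≤ ENNReal.ofReal (2 ^ (s + b)) *
      (wl ν s b ρ F * (∫⁻ η, ew ν 0 0 ρ η * G η) + (∫⁻ η, ew ν 0 0 ρ η * F η) * wl ν s b ρ G) := by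
  have point : ∀ ξ, ew ν s b ρ ξ * lconv F G ξ ≤ ENNReal.ofReal (2 ^ (s + b)) *
      (lconv (fun ζ => ew ν s b ρ ζ * F ζ) (fun η => ew ν 0 0 ρ η * G η) ξ +
        lconv (fun ζ => ew ν 0 0 ρ ζ * F ζ) (fun η => ew ν s b ρ η * G η) ξ) := by
    intro ξ
    unfold lconv
    rw [← lintegral_const_mul' _ _ (ew_ne_top ν _ _ _ _), ← lintegral_add_left (by fun_prop),
      ← lintegral_const_mul' _ _ ENNReal.ofReal_ne_top]
    refine lintegral_mono fun η => ?_
    have ker : ew ν s b ρ ξ ≤ ENNReal.ofReal (2 ^ (s + b)) * (ew ν s b ρ (ξ - η) * ew ν 0 0 ρ η +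
        ew ν 0 0 ρ (ξ - η) * ew ν s b ρ η) := by
      simp only [ew]
      rw [← ENNReal.ofReal_mul (weight_nonneg ..), ← ENNReal.ofReal_mul (weight_nonneg ..),
        ← ENNReal.ofReal_add (mul_nonneg (weight_nonneg ..) (weight_nonneg ..))
          (mul_nonneg (weight_nonneg ..) (weight_nonneg ..)), ← ENNReal.ofReal_mul (by positivity)]
      refine ENNReal.ofReal_le_ofReal ?_
      simp only [weight_eq_radial, radial, pw_zero, one_mul]
      have e1 := pw_le_add hs hb (norm_nonneg ξ) (norm_nonneg (ξ - η)) (norm_nonneg η)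
        (enorm_sub_add_triangle ξ η)
      have e2 := exp_max_rpow_le_mul (ν := ν) hρ h0 h1 (norm_nonneg ξ) (norm_nonneg (ξ - η))
        (norm_nonneg η) (enorm_sub_add_triangle ξ η)
      exact (mul_le_mul e1 e2 (Real.exp_pos _).le ((pw_nonneg (norm_nonneg ξ)).trans e1)).trans
        (le_of_eq (by ring))
    calc ew ν s b ρ ξ * (F (ξ - η) * G η) ≤ ENNReal.ofReal (2 ^ (s + b)) *
          (ew ν s b ρ (ξ - η) * ew ν 0 0 ρ η + ew ν 0 0 ρ (ξ - η) * ew ν s b ρ η) *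
            (F (ξ - η) * G η) := by gcongr
      _ = _ := by ring
  refine (ltwo_mono (ae_of_all _ point)).trans ?_
  rw [ltwo_const_mul ENNReal.ofReal_ne_top]
  gcongr
  refine (ltwo_add_le (measurable_lconv (by fun_prop) (by fun_prop)).aemeasurable
    (measurable_lconv (by fun_prop) (by fun_prop)).aemeasurable).trans ?_
  gcongr
  · exact ltwo_lconv_le (by fun_prop) (by fun_prop)
  · exact ltwo_lconv_le' (by fun_prop) (by fun_prop)

end ENNRealWeight

-- Trilinear estimates for ⟨u, ∇v·∇u⟩

section Trilinear

/-- The kernel of the symmetrized form `Re ⟨u, ∇v·∇u⟩`. -/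
def commKernel (ν a low ρ : ℝ) (ξ η : Rn n) : ℝ :=
  weight ν a low ρ ξ ^ 2 * inner ℝ (ξ - η) η - weight ν a low ρ η ^ 2 * inner ℝ (ξ - η) ξ

/-- The commutator bound gives three convolution integrals, each with two factors in L² and one in
L¹. The L¹ factor is v with 2 - ν derivatives, controlled by the exponent ℓ + 2, or u with 1
derivative, controlled by ℓ + 1 + ν; in both cases the margin is ℓ + ν > n/2. -/
lemma exists_trilinear_le (hn : 0 < n) {ν low ℓ : ℝ} (h0 : 0 < ν) (h1 : ν ≤ 1) (hlow : 0 ≤ low)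
    (hlow' : low < n / 2) (hℓ : n / 2 - ν < ℓ) : ∃ C : ℝ≥0∞, C ≠ ∞ ∧
    ∀ (ρ : ℝ) (u v : Rn n → ℝ≥0∞), 0 ≤ ρ → Measurable u → Measurable v →
      ∫⁻ ξ, ∫⁻ η, ENNReal.ofReal |commKernel ν (ℓ + 1 + ν) low ρ ξ η| * (u ξ * v (ξ - η) * u η) ≤
        C * (wl ν (ℓ + 2) low ρ v * wl ν (ℓ + 1 + ν + ν / 2) low ρ u ^ 2 +
          wl ν (ℓ + 2 + ν / 2) low ρ v *
            (wl ν (ℓ + 1 + ν + ν / 2) low ρ u * wl ν (ℓ + 1 + ν) low ρ u)) := by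
  have hn1 : (1 : ℝ) ≤ n := by exact_mod_cast hn
  -- The requirement 3/2 ≤ ℓ + 1 + ν follows from ℓ + ν > n/2 ≥ 1/2.
  obtain ⟨C₀, hC₀, H⟩ := exists_commutator_le (n := n) h0 h1 (a := ℓ + 1 + ν) (low := low)
    (by linarith) hlow
  obtain ⟨C₁, hC₁, H₁⟩ := exists_lintegral_ew_le hn (a := ℓ + 2) (b := low) (a' := 2 - ν) (b' := 0)
    (by linarith) (by linarith)
  obtain ⟨C₂, hC₂, H₂⟩ := exists_lintegral_ew_le hn (a := ℓ + 1 + ν) (b := low) (a' := 1) (b' := 0)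
    (by linarith) (by linarith)
  refine ⟨ENNReal.ofReal C₀ * (C₁ + 2 * C₂), by finiteness, fun ρ u v hρ hu hv => ?_⟩
  set A : Rn n → ℝ≥0∞ := fun ξ => ew ν (ℓ + 1 + ν + ν / 2) low ρ ξ * u ξ with hA
  set B : Rn n → ℝ≥0∞ := fun ξ => ew ν (ℓ + 2 + ν / 2) low ρ ξ * v ξ with hB
  set G : Rn n → ℝ≥0∞ := fun ξ => ew ν (2 - ν) 0 ρ ξ * v ξ with hG
  set P : Rn n → ℝ≥0∞ := fun ξ => ew ν 1 0 ρ ξ * u ξ with hP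
  have hAm : Measurable A := by fun_prop
  have hBm : Measurable B := by fun_prop
  have hGm : Measurable G := by fun_prop
  have hPm : Measurable P := by fun_prop
  have point : ∀ᵐ ξ : Rn n, ∫⁻ η, ENNReal.ofReal |commKernel ν (ℓ + 1 + ν) low ρ ξ η| *
      (u ξ * v (ξ - η) * u η) ≤
      ENNReal.ofReal C₀ * (A ξ * lconv G A ξ + A ξ * lconv B P ξ + P ξ * lconv B A ξ) := by
    filter_upwards [ae_ne_zero hn] with ξ hξ
    unfold lconv
    have mm : ∀ F G : Rn n → ℝ≥0∞, Measurable F → Measurable G →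
        Measurable fun η => F (ξ - η) * G η := fun F G hF hG => by fun_prop
    rw [← lintegral_const_mul _ (mm G A hGm hAm), ← lintegral_const_mul _ (mm B P hBm hPm),
      ← lintegral_const_mul _ (mm B A hBm hAm),
      ← lintegral_add_left ((mm G A hGm hAm).const_mul _),
      ← lintegral_add_right _ ((mm B A hBm hAm).const_mul _),
      ← lintegral_const_mul' _ _ ENNReal.ofReal_ne_top]
    refine lintegral_mono_ae ?_
    filter_upwards [ae_sub_ne_zero hn ξ] with η ⟨h2, h3⟩
    have k := H hρ hξ h3 (sub_ne_zero.1 h2)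
    have e : ℓ + 1 + ν + 1 - ν / 2 = ℓ + 2 + ν / 2 := by ring
    rw [e] at k
    have ker : ENNReal.ofReal |commKernel ν (ℓ + 1 + ν) low ρ ξ η| ≤ ENNReal.ofReal C₀ *
        (ew ν (ℓ + 1 + ν + ν / 2) low ρ ξ * ew ν (ℓ + 1 + ν + ν / 2) low ρ η *
            ew ν (2 - ν) 0 ρ (ξ - η) +
          ew ν (ℓ + 1 + ν + ν / 2) low ρ ξ * ew ν (ℓ + 2 + ν / 2) low ρ (ξ - η) * ew ν 1 0 ρ η +
          ew ν (ℓ + 1 + ν + ν / 2) low ρ η * ew ν (ℓ + 2 + ν / 2) low ρ (ξ - η) *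
            ew ν 1 0 ρ ξ) := by
      have w0 : ∀ (a b : ℝ) (ζ : Rn n), 0 ≤ weight ν a b ρ ζ := fun a b ζ => weight_nonneg ..
      have w3 : ∀ (a b a' b' a'' b'' : ℝ) (ζ ζ' ζ'' : Rn n), ew ν a b ρ ζ * ew ν a' b' ρ ζ' *
          ew ν a'' b'' ρ ζ'' = ENNReal.ofReal (weight ν a b ρ ζ * weight ν a' b' ρ ζ' *
            weight ν a'' b'' ρ ζ'') := fun a b a' b' a'' b'' ζ ζ' ζ'' => by
        rw [ew, ew, ew, ENNReal.ofReal_mul (mul_nonneg (w0 _ _ _) (w0 _ _ _)),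
          ENNReal.ofReal_mul (w0 _ _ _)]
      have p3 : ∀ (a b a' b' a'' b'' : ℝ) (ζ ζ' ζ'' : Rn n), 0 ≤ weight ν a b ρ ζ *
          weight ν a' b' ρ ζ' * weight ν a'' b'' ρ ζ'' := fun a b a' b' a'' b'' ζ ζ' ζ'' =>
        mul_nonneg (mul_nonneg (w0 _ _ _) (w0 _ _ _)) (w0 _ _ _)
      rw [w3, w3, w3, ← ENNReal.ofReal_add (p3 ..) (p3 ..),
        ← ENNReal.ofReal_add (add_nonneg (p3 ..) (p3 ..)) (p3 ..), ← ENNReal.ofReal_mul hC₀.le]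
      exact ENNReal.ofReal_le_ofReal k
    refine (mul_le_mul_left ker _).trans (le_of_eq ?_)
    simp only [hA, hB, hG, hP]
    ring
  have t1 : ∫⁻ ξ, A ξ * lconv G A ξ ≤ ltwo volume A * ((C₁ * wl ν (ℓ + 2) low ρ v) *
      ltwo volume A) := by
    refine (lintegral_mul_le_ltwo hAm.aemeasurable (measurable_lconv hGm hAm).aemeasurable).trans ?_
    gcongr
    refine (ltwo_lconv_le' hGm hAm).trans ?_
    gcongr
    exact H₁ ν ρ v hv
  have t2 : ∫⁻ ξ, A ξ * lconv B P ξ ≤ ltwo volume A * (ltwo volume B *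
      (C₂ * wl ν (ℓ + 1 + ν) low ρ u)) := by
    refine (lintegral_mul_le_ltwo hAm.aemeasurable (measurable_lconv hBm hPm).aemeasurable).trans ?_
    gcongr
    refine (ltwo_lconv_le hBm hPm).trans ?_
    gcongr
    exact H₂ ν ρ u hu
  have t3 : ∫⁻ ξ, P ξ * lconv B A ξ ≤ (C₂ * wl ν (ℓ + 1 + ν) low ρ u) *
      (ltwo volume B * ltwo volume A) := by
    calc ∫⁻ ξ, P ξ * lconv B A ξ ≤ ∫⁻ ξ, P ξ * (ltwo volume B * ltwo volume A) := by
          gcongr with ξ; exact lconv_le_ltwo hBm hAm ξ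
      _ = (∫⁻ ξ, P ξ) * (ltwo volume B * ltwo volume A) := lintegral_mul_const _ hPm
      _ ≤ _ := by gcongr; exact H₂ ν ρ u hu
  refine (lintegral_mono_ae point).trans ?_
  have m2 : Measurable fun ξ => A ξ * lconv B P ξ := hAm.mul (measurable_lconv hBm hPm)
  have m3 : Measurable fun ξ => P ξ * lconv B A ξ := hPm.mul (measurable_lconv hBm hAm)
  rw [lintegral_const_mul' _ _ ENNReal.ofReal_ne_top, lintegral_add_right _ m3,
    lintegral_add_right _ m2]
  refine (mul_le_mul' le_rfl (add_le_add (add_le_add t1 t2) t3)).trans ?_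
  rw [mul_assoc (ENNReal.ofReal C₀)]
  refine mul_le_mul' le_rfl ?_
  change _ ≤ (C₁ + 2 * C₂) * (wl ν (ℓ + 2) low ρ v * ltwo volume A ^ 2 +
    ltwo volume B * (ltwo volume A * wl ν (ℓ + 1 + ν) low ρ u))
  set x := wl ν (ℓ + 2) low ρ v * ltwo volume A ^ 2
  set y := ltwo volume B * (ltwo volume A * wl ν (ℓ + 1 + ν) low ρ u)
  calc _ = C₁ * x + 2 * C₂ * y := by simp only [x, y]; ring
    _ ≤ C₁ * x + 2 * C₂ * y + (C₁ * y + 2 * C₂ * x) := le_self_add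
    _ = _ := by ring

/-- Without symmetrization u is needed with the exponent ℓ + 2 + ν/2, which the energy estimate
cannot close but which the a priori bounds on the phases supply. The estimate serves only to justify
absolute convergence. The squared weight is distributed as ℓ + 1 + 3ν/2 on u and ℓ + 1 + ν/2 on the
product. -/
lemma exists_abs_trilinear_le (hn : 0 < n) {ν low ℓ : ℝ} (h0 : 0 < ν) (h1 : ν ≤ 1)
    (hlow : 0 ≤ low) (hlow' : low < n / 2) (hℓ : n / 2 - ν < ℓ) : ∃ C : ℝ≥0∞, C ≠ ∞ ∧
    ∀ (ρ : ℝ) (u v : Rn n → ℝ≥0∞), 0 ≤ ρ → Measurable u → Measurable v →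
      ∫⁻ ξ, ew ν (ℓ + 1 + ν) low ρ ξ ^ 2 * (u ξ *
          lconv (fun ζ => ‖ζ‖ₑ * v ζ) (fun η => ‖η‖ₑ * u η) ξ) ≤
        C * (wl ν (ℓ + 1 + ν + ν / 2) low ρ u *
          (wl ν (ℓ + 2 + ν / 2) low ρ v * wl ν (ℓ + 1 + ν) low ρ u +
            wl ν (ℓ + 2) low ρ v * wl ν (ℓ + 2 + ν / 2) low ρ u)) := by
  have hn1 : (1 : ℝ) ≤ n := by exact_mod_cast hn
  obtain ⟨C₁, hC₁, H₁⟩ := exists_lintegral_ew_le hn (a := ℓ + 2) (b := low) (a' := 1) (b' := 0)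
    (by linarith) (by linarith)
  obtain ⟨C₂, hC₂, H₂⟩ := exists_lintegral_ew_le hn (a := ℓ + 1 + ν) (b := low) (a' := 1) (b' := 0)
    (by linarith) (by linarith)
  set K := ENNReal.ofReal (2 ^ (ℓ + 1 + ν / 2 + low))
  refine ⟨K * (C₁ + C₂), by finiteness, fun ρ u v hρ hu hv => ?_⟩
  set F : Rn n → ℝ≥0∞ := fun ζ => ‖ζ‖ₑ * v ζ with hF
  set G : Rn n → ℝ≥0∞ := fun ζ => ‖ζ‖ₑ * u ζ with hG
  have hFm : Measurable F := by fun_prop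
  have hGm : Measurable G := by fun_prop
  have e1 : ∫⁻ ξ, ew ν (ℓ + 1 + ν) low ρ ξ ^ 2 * (u ξ * lconv F G ξ) =
      ∫⁻ ξ, (ew ν (ℓ + 1 + ν + ν / 2) low ρ ξ * u ξ) *
        (ew ν (ℓ + 1 + ν / 2) low ρ ξ * lconv F G ξ) := by
    refine lintegral_congr_ae ?_
    filter_upwards [ae_ne_zero hn] with ξ hξ
    have : ew ν (ℓ + 1 + ν) low ρ ξ ^ 2 = ew ν (ℓ + 1 + ν + ν / 2) low ρ ξ *
        ew ν (ℓ + 1 + ν / 2) low ρ ξ := by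
      rw [sq, ew_mul _ _ _ _ _ _ _ hξ, ew_mul _ _ _ _ _ _ _ hξ]; congr 1; ring
    rw [this]; ring
  rw [e1]
  refine (lintegral_mul_le_ltwo (by fun_prop)
    ((measurable_ew ..).mul (measurable_lconv hFm hGm)).aemeasurable).trans ?_
  have hI : ∀ w : Rn n → ℝ≥0∞, ∫⁻ η, ew ν 0 0 ρ η * (‖η‖ₑ * w η) ≤ ∫⁻ η, ew ν 1 0 ρ η * w η :=
    fun w => by
      refine lintegral_mono fun η => ?_
      rw [← mul_assoc]
      gcongr
      simpa using ew_mul_norm_le ν 0 0 ρ η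
  have hW : ∀ w : Rn n → ℝ≥0∞, wl ν (ℓ + 1 + ν / 2) low ρ (fun ζ => ‖ζ‖ₑ * w ζ) ≤
      wl ν (ℓ + 2 + ν / 2) low ρ w := fun w => by
    refine (wl_norm_mul_le ..).trans (le_of_eq ?_); congr 1; ring
  have e2 := wl_lconv_le (s := ℓ + 1 + ν / 2) (b := low) h0.le h1 (by linarith) hlow hρ hFm hGm
  change wl ν (ℓ + 1 + ν + ν / 2) low ρ u * wl ν (ℓ + 1 + ν / 2) low ρ (lconv F G) ≤ _
  refine (mul_le_mul_right (e2.trans (mul_le_mul_right (add_le_add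
    (mul_le_mul' (hW v) ((hI u).trans (H₂ ν ρ u hu)))
    (mul_le_mul' ((hI v).trans (H₁ ν ρ v hv)) (hW u))) _)) _).trans ?_
  set x := wl ν (ℓ + 2 + ν / 2) low ρ v * wl ν (ℓ + 1 + ν) low ρ u
  set y := wl ν (ℓ + 2) low ρ v * wl ν (ℓ + 2 + ν / 2) low ρ u
  set z := wl ν (ℓ + 1 + ν + ν / 2) low ρ u
  calc _ = K * z * (C₂ * x + C₁ * y) := by simp only [x, y, K]; ring
    _ ≤ K * z * (C₂ * x + C₁ * y + (C₁ * x + C₂ * y)) :=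
        mul_le_mul' le_rfl le_self_add
    _ = _ := by ring

end Trilinear

-- The Fourier transform: uniqueness, inversion and Plancherel

section Fourier

lemma unitFactor_pos (n : ℕ) : 0 < unitFactor n := by unfold unitFactor; positivity

lemma unitFactor_le_one (n : ℕ) : unitFactor n ≤ 1 := by
  refine Real.rpow_le_one_of_one_le_of_nonpos (by linarith [Real.pi_gt_three]) ?_
  have : (0 : ℝ) ≤ n := n.cast_nonneg
  linarith

lemma unitFactor_sq_mul (n : ℕ) : unitFactor n * unitFactor n * (2 * Real.pi) ^ n = 1 := by
  have h : (0 : ℝ) < 2 * Real.pi := by positivity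
  rw [unitFactor, ← Real.rpow_natCast, ← Real.rpow_add h, ← Real.rpow_add h]
  ring_nf
  simp

/-- The scaling `x ↦ x / 2π`. -/
def scaleEquiv (n : ℕ) : Rn n ≃L[ℝ] Rn n :=
  ContinuousLinearEquiv.smulLeft (Units.mk0 (2 * Real.pi)⁻¹ (by positivity))

lemma scaleEquiv_apply (x : Rn n) : scaleEquiv n x = (2 * Real.pi)⁻¹ • x := rfl

lemma exists_schwartz_eq_schwartzHat (g : 𝓢(Rn n, ℂ)) :
    ∃ g' : 𝓢(Rn n, ℂ), ∀ x, g' x = schwartzHat g x := by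
  refine ⟨(unitFactor n : ℂ) • SchwartzMap.compCLMOfContinuousLinearEquiv ℂ (scaleEquiv n) (𝓕 g),
    fun x => ?_⟩
  simp [schwartzHat, scaleEquiv_apply, SchwartzMap.fourier_coe]

lemma exists_schwartzHat_eq (g : 𝓢(Rn n, ℂ)) :
    ∃ g' : 𝓢(Rn n, ℂ), ∀ x, schwartzHat g' x = g x := by
  refine ⟨𝓕⁻ ((unitFactor n : ℂ)⁻¹ •
    SchwartzMap.compCLMOfContinuousLinearEquiv ℂ (scaleEquiv n).symm g), fun x => ?_⟩
  have h : (unitFactor n : ℂ) ≠ 0 := by exact_mod_cast (unitFactor_pos n).ne'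
  rw [schwartzHat, ← SchwartzMap.fourier_coe, FourierTransform.fourier_fourierInv_eq]
  simp only [_root_.smul_apply, smul_eq_mul, SchwartzMap.compCLMOfContinuousLinearEquiv_apply,
    Function.comp_apply]
  rw [← scaleEquiv_apply, ContinuousLinearEquiv.symm_apply_apply, mul_inv_cancel_left₀ h]

lemma exists_schwartz_eq_of_contDiff {g : Rn n → ℝ} (hg : ContDiff ℝ ((⊤ : ℕ∞) : WithTop ℕ∞) g)
    (hs : HasCompactSupport g) : ∃ g' : 𝓢(Rn n, ℂ), ∀ x, g' x = (g x : ℂ) := by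
  have h1 : HasCompactSupport fun x => (g x : ℂ) := hs.comp_left (g := ((↑) : ℝ → ℂ)) (by simp)
  have h2 : ContDiff ℝ ((⊤ : ℕ∞) : WithTop ℕ∞) fun x => (g x : ℂ) :=
    Complex.ofRealCLM.contDiff.comp hg
  exact ⟨h1.toSchwartzMap h2, fun x => rfl⟩

lemma IsFourier.ae_eq_right {u v v' : Rn n → ℂ} (h : IsFourier u v) (h' : IsFourier u v') :
    v =ᵐ[volume] v' := by
  refine ae_eq_of_integral_contDiff_smul_eq h.locallyIntegrable_right h'.locallyIntegrable_right
    fun g hg hs => ?_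
  obtain ⟨g', hg'⟩ := exists_schwartz_eq_of_contDiff hg hs
  have := (h.integral_eq g').symm.trans (h'.integral_eq g')
  simpa [hg', mul_comm] using this

lemma IsFourier.ae_eq_left {u u' v : Rn n → ℂ} (h : IsFourier u v) (h' : IsFourier u' v) :
    u =ᵐ[volume] u' := by
  refine ae_eq_of_integral_contDiff_smul_eq h.locallyIntegrable_left h'.locallyIntegrable_left
    fun g hg hs => ?_
  obtain ⟨g', hg'⟩ := exists_schwartz_eq_of_contDiff hg hs
  obtain ⟨g'', hg''⟩ := exists_schwartzHat_eq g'
  have := (h.integral_eq g'').trans (h'.integral_eq g'').symm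
  simpa [hg', hg'', mul_comm] using this

lemma IsFourier.congr_right {u v v' : Rn n → ℂ} (h : IsFourier u v) (hv : v =ᵐ[volume] v') :
    IsFourier u v' where
  locallyIntegrable_left := h.locallyIntegrable_left
  locallyIntegrable_right := (locallyIntegrable_congr hv).1 h.locallyIntegrable_right
  integrable_left := h.integrable_left
  integrable_right g := (h.integrable_right g).congr (by filter_upwards [hv] with x hx; rw [hx])
  integral_eq g := (h.integral_eq g).trans
    (integral_congr_ae (by filter_upwards [hv] with x hx; rw [hx]))

lemma IsFourier.sub {u v u' v' : Rn n → ℂ} (h : IsFourier u v) (h' : IsFourier u' v') :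
    IsFourier (fun x => u x - u' x) (fun ξ => v ξ - v' ξ) where
  locallyIntegrable_left := h.locallyIntegrable_left.sub h'.locallyIntegrable_left
  locallyIntegrable_right := h.locallyIntegrable_right.sub h'.locallyIntegrable_right
  integrable_left g := by simpa only [sub_mul] using! (h.integrable_left g).sub (h'.integrable_left g)
  integrable_right g := by
    simpa only [sub_mul] using! (h.integrable_right g).sub (h'.integrable_right g)
  integral_eq g := by
    simp only [sub_mul]
    rw [integral_sub (h.integrable_left g) (h'.integrable_left g),
      integral_sub (h.integrable_right g) (h'.integrable_right g), h.integral_eq, h'.integral_eq]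

lemma IsFourier.const_mul {u v : Rn n → ℂ} (h : IsFourier u v) (c : ℂ) :
    IsFourier (fun x => c * u x) (fun ξ => c * v ξ) where
  locallyIntegrable_left := h.locallyIntegrable_left.smul c
  locallyIntegrable_right := h.locallyIntegrable_right.smul c
  integrable_left g := by simpa only [mul_assoc] using (h.integrable_left g).const_mul c
  integrable_right g := by simpa only [mul_assoc] using (h.integrable_right g).const_mul c
  integral_eq g := by
    simp only [mul_assoc]
    rw [integral_const_mul, integral_const_mul, h.integral_eq]

lemma IsFourier.isFourier_hat {u v : Rn n → ℂ} (h : IsFourier u v) : IsFourier u (hat u) := by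
  have hex : ∃ v, IsFourier u v := ⟨v, h⟩
  rw [hat, dif_pos hex]
  exact hex.choose_spec

lemma IsFourier.hat_ae_eq {u v : Rn n → ℂ} (h : IsFourier u v) : hat u =ᵐ[volume] v :=
  h.isFourier_hat.ae_eq_right h

/-- This frees the estimates from the representative chosen in `hat`: any Fourier transform of u, in
particular a measurable one, may be used. -/
lemma IsFourier.wnorm_eq {u v : Rn n → ℂ} (h : IsFourier u v) (ν a b ρ : ℝ) :
    wnorm ν a b ρ u = wl ν a b ρ (fun ξ => ‖v ξ‖ₑ) := by
  rw [wnorm, if_pos ⟨v, h⟩, eLpNorm_two_eq, wl]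
  refine ltwo_congr ?_
  filter_upwards [h.hat_ae_eq] with ξ hξ
  rw [enorm_mul, hξ, ew, ← ofReal_norm, Complex.norm_real, Real.norm_of_nonneg (weight_nonneg ..)]

lemma isFourier_hat_of_wnorm_lt_top {ν a b ρ : ℝ} {u : Rn n → ℂ} (h : wnorm ν a b ρ u < ∞) :
    IsFourier u (hat u) := by
  by_cases hex : ∃ v, IsFourier u v
  · exact hex.choose_spec.isFourier_hat
  · rw [wnorm, if_neg hex] at h
    exact absurd h (lt_irrefl _)

/-- The inverse Fourier transform `x ↦ (2π)^{-n/2} ∫ e^{i x·ξ} v(ξ) dξ` of an integrable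
function. -/
def invF (v : Rn n → ℂ) (x : Rn n) : ℂ :=
  (unitFactor n : ℂ) * ∫ ξ, Complex.exp (Complex.I * ((inner ℝ x ξ : ℝ) : ℂ)) * v ξ

lemma invF_eq_fourierInv (v : Rn n → ℂ) (x : Rn n) :
    invF v x = (unitFactor n : ℂ) * 𝓕⁻ v ((2 * Real.pi)⁻¹ • x) := by
  rw [invF, Real.fourierInv_eq']
  congr 2; funext ξ
  rw [smul_eq_mul, real_inner_smul_right, real_inner_comm ξ x]
  have : 2 * Real.pi * ((2 * Real.pi)⁻¹ * inner ℝ x ξ) = inner ℝ x ξ := by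
    have : 2 * Real.pi ≠ 0 := by positivity
    field_simp
  rw [real_inner_comm, this, mul_comm Complex.I]

lemma integrable_exp_mul {v : Rn n → ℂ} (hv : Integrable v) (x : Rn n) :
    Integrable fun ξ => Complex.exp (Complex.I * ((inner ℝ x ξ : ℝ) : ℂ)) * v ξ := by
  refine hv.bdd_mul (c := 1) (by fun_prop) (ae_of_all _ fun ξ => ?_)
  rw [mul_comm, Complex.norm_exp_ofReal_mul_I]

lemma enorm_invF_le (v : Rn n → ℂ) (x : Rn n) : ‖invF v x‖ₑ ≤ ∫⁻ ξ, ‖v ξ‖ₑ := by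
  rw [invF, enorm_mul]
  calc _ ≤ 1 * ∫⁻ ξ, ‖Complex.exp (Complex.I * ((inner ℝ x ξ : ℝ) : ℂ)) * v ξ‖ₑ := by
        gcongr
        · rw [← ofReal_norm, Complex.norm_real, Real.norm_of_nonneg (unitFactor_pos n).le]
          simpa using unitFactor_le_one n
        · exact enorm_integral_le_lintegral_enorm _
    _ = _ := by
      rw [one_mul]
      refine lintegral_congr fun ξ => ?_
      rw [enorm_mul, mul_comm Complex.I, ← ofReal_norm, Complex.norm_exp_ofReal_mul_I]; simp

lemma continuous_invF {v : Rn n → ℂ} (hv : Integrable v) : Continuous (invF v) := by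
  refine continuous_const.mul (continuous_of_dominated (bound := fun ξ => ‖v ξ‖)
    (fun x => (integrable_exp_mul hv x).aestronglyMeasurable) (fun x => ae_of_all _ fun ξ => ?_)
    hv.norm (ae_of_all _ fun ξ => by fun_prop))
  rw [norm_mul, mul_comm Complex.I, Complex.norm_exp_ofReal_mul_I, one_mul]

lemma integral_comp_scale (f : Rn n → ℂ) :
    ∫ x, f ((2 * Real.pi)⁻¹ • x) = (((2 * Real.pi) ^ n : ℝ) : ℂ) * ∫ x, f x := by
  have h : (0 : ℝ) < 2 * Real.pi := by positivity
  rw [Measure.integral_comp_inv_smul, finrank_euclideanSpace, Fintype.card_fin,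
    abs_of_pos (by positivity), Complex.real_smul]

/-- After the scaling by 2π, whose Jacobian is cancelled by the two normalization factors, this is
the multiplication formula combined with Fourier inversion for the test function. -/
lemma isFourier_invF {v : Rn n → ℂ} (hv : Integrable v) : IsFourier (invF v) v where
  locallyIntegrable_left := (continuous_invF hv).locallyIntegrable
  locallyIntegrable_right := hv.locallyIntegrable
  integrable_left g := by
    obtain ⟨g', hg'⟩ := exists_schwartz_eq_schwartzHat g
    simp_rw [← hg']
    refine g'.integrable.bdd_mul (c := ∫ ξ, ‖v ξ‖) (continuous_invF hv).aestronglyMeasurable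
      (ae_of_all _ fun x => ?_)
    have := enorm_invF_le v x
    rw [← ofReal_integral_norm_eq_lintegral_enorm hv, ← ofReal_norm] at this
    exact (ENNReal.ofReal_le_ofReal_iff (integral_nonneg fun _ => norm_nonneg _)).1 this
  integrable_right g := by
    exact hv.mul_bdd (c := ‖g.toBoundedContinuousFunction‖) g.continuous.aestronglyMeasurable
      (ae_of_all _ fun x => g.toBoundedContinuousFunction.norm_coe_le_norm x)
  integral_eq g := by
    have e1 : ∀ x, invF v x * schwartzHat g x = (fun y => (unitFactor n : ℂ) * (unitFactor n : ℂ) *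
        (𝓕⁻ v y * 𝓕 (g : Rn n → ℂ) y)) ((2 * Real.pi)⁻¹ • x) := fun x => by
      rw [invF_eq_fourierInv, schwartzHat]; ring
    rw [integral_congr_ae (ae_of_all _ e1), integral_comp_scale (fun y => (unitFactor n : ℂ) *
      (unitFactor n : ℂ) * (𝓕⁻ v y * 𝓕 (g : Rn n → ℂ) y)), integral_const_mul, ← mul_assoc]
    have e2 : (((2 * Real.pi) ^ n : ℝ) : ℂ) * ((unitFactor n : ℂ) * (unitFactor n : ℂ)) = 1 := by
      rw [mul_comm]; exact_mod_cast unitFactor_sq_mul n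
    rw [e2, one_mul]
    have hflip := VectorFourier.integral_fourierIntegral_smul_eq_flip (μ := volume) (ν := volume)
      (L := -innerₗ (Rn n)) (f := v) (g := 𝓕 (g : Rn n → ℂ)) Real.continuous_fourierChar
      (show Continuous fun p : Rn n × Rn n => -(inner ℝ p.1 p.2 : ℝ) by fun_prop) hv (𝓕 g).integrable
    have e3 : ∀ x, VectorFourier.fourierIntegral Real.fourierChar volume (-innerₗ (Rn n)).flip
        (𝓕 (g : Rn n → ℂ)) x = g x := fun x => by
      have : (-innerₗ (Rn n)).flip = -innerₗ (Rn n) := by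
        ext a b; simp [real_inner_comm]
      rw [this]
      change 𝓕⁻ (𝓕 (g : Rn n → ℂ)) x = g x
      rw [← SchwartzMap.fourier_coe, ← SchwartzMap.fourierInv_coe,
        FourierTransform.fourierInv_fourier_eq]
    simp only [e3] at hflip
    exact hflip

/-- A continuous function whose Fourier transform is integrable is given by the inversion
formula. -/
lemma IsFourier.eq_invF {u v : Rn n → ℂ} (h : IsFourier u v) (hu : Continuous u)
    (hv : Integrable v) : u = invF v :=
  (hu.ae_eq_iff_eq volume (continuous_invF hv)).1 (h.ae_eq_left (isFourier_invF hv))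

lemma ae_eq_of_invF_eq {v v' : Rn n → ℂ} (hv : Integrable v) (hv' : Integrable v')
    (h : invF v = invF v') : v =ᵐ[volume] v' :=
  (isFourier_invF hv).ae_eq_right (h ▸ isFourier_invF hv')

lemma lintegral_comp_scale {f : Rn n → ℝ≥0∞} (hf : AEMeasurable f) :
    ∫⁻ x, f ((2 * Real.pi)⁻¹ • x) = ENNReal.ofReal ((2 * Real.pi) ^ n) * ∫⁻ x, f x := by
  have h : (0 : ℝ) < 2 * Real.pi := by positivity
  have hm := Measure.map_addHaar_smul (volume : Measure (Rn n)) (r := (2 * Real.pi)⁻¹)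
    (by positivity)
  have h2 : AEMeasurable f (Measure.map (fun x : Rn n => (2 * Real.pi)⁻¹ • x) volume) := by
    rw [hm]; exact hf.smul_measure _
  rw [← lintegral_map' h2 (by fun_prop), hm, lintegral_smul_measure, finrank_euclideanSpace,
    Fintype.card_fin, smul_eq_mul]
  congr 2
  rw [inv_pow, inv_inv, abs_of_pos (by positivity)]

/-- Every square integrable function is the Fourier transform of a square integrable function. -/
lemma exists_isFourier_of_memLp {v : Rn n → ℂ} (hv : MemLp v 2 volume) :
    ∃ u : Rn n → ℂ, IsFourier u v ∧ MemLp u 2 volume ∧ eLpNorm u 2 volume = eLpNorm v 2 volume := by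
  set V : Lp ℂ 2 (volume : Measure (Rn n)) := hv.toLp v with hV
  set W : Lp ℂ 2 (volume : Measure (Rn n)) := 𝓕⁻ V with hW
  have hVv : V =ᵐ[volume] v := hv.coeFn_toLp
  have hFW : 𝓕 W = V := by rw [hW]; exact FourierTransform.fourier_fourierInv_eq V
  have hWm : AEStronglyMeasurable (W : Rn n → ℂ) volume := Lp.aestronglyMeasurable W
  have hqm : Measure.QuasiMeasurePreserving (fun x : Rn n => (2 * Real.pi)⁻¹ • x) volume volume :=
    Measure.quasiMeasurePreserving_smul volume (by positivity)
  have hnorm : eLpNorm (fun x => (unitFactor n : ℂ) * W ((2 * Real.pi)⁻¹ • x)) 2 volume =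
      eLpNorm v 2 volume := by
    have e1 : eLpNorm v 2 volume = eLpNorm W 2 volume := by
      rw [← eLpNorm_congr_ae hVv, ← hFW]
      have := Lp.norm_fourier_eq W
      rw [Lp.norm_def, Lp.norm_def,
        ENNReal.toReal_eq_toReal_iff' (Lp.eLpNorm_ne_top _) (Lp.eLpNorm_ne_top _)] at this
      exact this
    rw [e1, eLpNorm_two_eq, eLpNorm_two_eq, ltwo, ltwo]
    congr 1
    simp_rw [enorm_mul, mul_pow]
    have huf : ‖(unitFactor n : ℂ)‖ₑ = ENNReal.ofReal (unitFactor n) := by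
      rw [← ofReal_norm, Complex.norm_real, Real.norm_of_nonneg (unitFactor_pos n).le]
    rw [lintegral_const_mul' _ _ (by finiteness), lintegral_comp_scale (f := fun y => ‖W y‖ₑ ^ 2)
      (hWm.enorm.pow_const 2), ← mul_assoc, huf, ← ENNReal.ofReal_pow (unitFactor_pos n).le,
      ← ENNReal.ofReal_mul (by positivity), sq, unitFactor_sq_mul]
    simp
  have hu : MemLp (fun x => (unitFactor n : ℂ) * W ((2 * Real.pi)⁻¹ • x)) 2 volume :=
    ⟨(hWm.comp_quasiMeasurePreserving hqm).const_mul _, hnorm ▸ hv.eLpNorm_lt_top⟩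
  refine ⟨_, ⟨hu.locallyIntegrable (by norm_num), hv.locallyIntegrable (by norm_num),
    fun g => ?_, fun g => ?_, fun g => ?_⟩, hu, hnorm⟩
  · obtain ⟨g', hg'⟩ := exists_schwartz_eq_schwartzHat g
    simp_rw [← hg']
    exact hu.integrable_mul (g'.memLp 2 volume)
  · exact hv.integrable_mul (g.memLp 2 volume)
  · have e1 : ∀ x, (unitFactor n : ℂ) * W ((2 * Real.pi)⁻¹ • x) * schwartzHat g x =
        (fun y => (unitFactor n : ℂ) * (unitFactor n : ℂ) *
          (W y * 𝓕 (g : Rn n → ℂ) y)) ((2 * Real.pi)⁻¹ • x) := fun x => by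
      rw [schwartzHat]; ring
    rw [integral_congr_ae (ae_of_all _ e1), integral_comp_scale (fun y => (unitFactor n : ℂ) *
      (unitFactor n : ℂ) * (W y * 𝓕 (g : Rn n → ℂ) y)), integral_const_mul, ← mul_assoc]
    have e2 : (((2 * Real.pi) ^ n : ℝ) : ℂ) * ((unitFactor n : ℂ) * (unitFactor n : ℂ)) = 1 := by
      rw [mul_comm]; exact_mod_cast unitFactor_sq_mul n
    rw [e2, one_mul]
    have h3 := congrArg (fun T => T g) (Lp.fourier_toTemperedDistribution_eq W)
    simp only [TemperedDistribution.fourier_apply] at h3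
    rw [Lp.toTemperedDistribution_apply, Lp.toTemperedDistribution_apply, hFW] at h3
    simp only [smul_eq_mul, SchwartzMap.fourier_coe] at h3
    calc _ = ∫ x, 𝓕 (g : Rn n → ℂ) x * W x := by simp_rw [mul_comm]
      _ = ∫ x, g x * V x := h3
      _ = _ := integral_congr_ae (by filter_upwards [hVv] with x hx; rw [hx, mul_comm])

end Fourier

-- Products and convolutions of Fourier transforms

section Products

lemma mulHat_congr {a a' b b' : Rn n → ℂ} (ha : a =ᵐ[volume] a') (hb : b =ᵐ[volume] b') :
    mulHat a b = mulHat a' b' := by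
  funext ξ
  rw [mulHat, mulHat]
  congr 1
  refine integral_congr_ae ?_
  filter_upwards [(quasiMeasurePreserving_sub_left volume ξ).ae_eq ha, hb] with η h1 h2
  simp only [Function.comp_apply] at h1
  rw [h1, h2]

lemma enorm_unitFactor_le : ‖(unitFactor n : ℂ)‖ₑ ≤ 1 := by
  rw [← ofReal_norm, Complex.norm_real, Real.norm_of_nonneg (unitFactor_pos n).le]
  simpa using unitFactor_le_one n

lemma enorm_mulHat_le (a b : Rn n → ℂ) (ξ : Rn n) :
    ‖mulHat a b ξ‖ₑ ≤ lconv (fun ζ => ‖a ζ‖ₑ) (fun η => ‖b η‖ₑ) ξ := by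
  rw [mulHat, enorm_mul]
  calc _ ≤ 1 * ∫⁻ η, ‖a (ξ - η) * b η‖ₑ := by
        gcongr
        · exact enorm_unitFactor_le
        · exact enorm_integral_le_lintegral_enorm _
    _ = _ := by simp only [one_mul, enorm_mul, lconv]

open scoped Convolution in
lemma mulHat_eq_convolution (a b : Rn n → ℂ) :
    mulHat a b = fun ξ => (unitFactor n : ℂ) *
      (b ⋆[ContinuousLinearMap.mul ℝ ℂ, volume] a) ξ := by
  funext ξ
  simp [mulHat, convolution, mul_comm]

lemma integrable_mulHat {a b : Rn n → ℂ} (ha : Integrable a) (hb : Integrable b) :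
    Integrable (mulHat a b) := by
  rw [mulHat_eq_convolution]
  exact (hb.integrable_convolution (ContinuousLinearMap.mul ℝ ℂ) ha).const_mul _

open scoped Convolution in
lemma invF_mulHat {a b : Rn n → ℂ} (ha : Integrable a) (hb : Integrable b) (x : Rn n) :
    invF (mulHat a b) x = invF a x * invF b x := by
  have h := integral_convolution (ContinuousLinearMap.mul ℝ ℂ) (μ := volume) (ν := volume)
    (integrable_exp_mul hb x) (integrable_exp_mul ha x)
  simp only [ContinuousLinearMap.mul_apply'] at h
  rw [invF, invF, invF, mulHat_eq_convolution]
  have e : ∀ ξ, Complex.exp (Complex.I * ((inner ℝ x ξ : ℝ) : ℂ)) * ((unitFactor n : ℂ) *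
      (b ⋆[ContinuousLinearMap.mul ℝ ℂ, volume] a) ξ) = (unitFactor n : ℂ) *
      ((fun ξ => Complex.exp (Complex.I * ((inner ℝ x ξ : ℝ) : ℂ)) * b ξ)
        ⋆[ContinuousLinearMap.mul ℝ ℂ, volume]
        (fun ξ => Complex.exp (Complex.I * ((inner ℝ x ξ : ℝ) : ℂ)) * a ξ)) ξ := fun ξ => by
    simp only [convolution, ContinuousLinearMap.mul_apply']
    rw [mul_left_comm, ← integral_const_mul]
    congr 2; funext t
    have : Complex.exp (Complex.I * ((inner ℝ x ξ : ℝ) : ℂ)) =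
        Complex.exp (Complex.I * ((inner ℝ x t : ℝ) : ℂ)) *
          Complex.exp (Complex.I * ((inner ℝ x (ξ - t) : ℝ) : ℂ)) := by
      rw [← Complex.exp_add, inner_sub_right]; congr 1; push_cast; ring
    rw [this]; ring
  rw [integral_congr_ae (ae_of_all _ e), integral_const_mul, h]
  ring

lemma invF_sum {ι : Type*} (s : Finset ι) {f : ι → Rn n → ℂ} (hf : ∀ i ∈ s, Integrable (f i))
    (x : Rn n) : invF (fun ξ => ∑ i ∈ s, f i ξ) x = ∑ i ∈ s, invF (f i) x := by
  simp only [invF, Finset.mul_sum]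
  rw [← Finset.mul_sum, ← integral_finsetSum]
  exact fun i hi => integrable_exp_mul (hf i hi) x

lemma invF_add {f g : Rn n → ℂ} (hf : Integrable f) (hg : Integrable g) (x : Rn n) :
    invF (fun ξ => f ξ + g ξ) x = invF f x + invF g x := by
  simp only [invF, mul_add]
  rw [integral_add (integrable_exp_mul hf x) (integrable_exp_mul hg x), mul_add]

lemma invF_sub {f g : Rn n → ℂ} (hf : Integrable f) (hg : Integrable g) (x : Rn n) :
    invF (fun ξ => f ξ - g ξ) x = invF f x - invF g x := by
  simp only [invF, mul_sub]
  rw [integral_sub (integrable_exp_mul hf x) (integrable_exp_mul hg x), mul_sub]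

lemma invF_const_mul (c : ℂ) (f : Rn n → ℂ) (x : Rn n) :
    invF (fun ξ => c * f ξ) x = c * invF f x := by
  simp only [invF, mul_left_comm _ c, integral_const_mul]

end Products

-- Derivatives and the differential terms of the system

section Derivatives

/-- The unit vector in the direction of the `j`-th axis. -/
def unitVec (j : Fin n) : Rn n := EuclideanSpace.basisFun (Fin n) ℝ j

lemma inner_unitVec (j : Fin n) (ξ : Rn n) : inner ℝ (unitVec j) ξ = ξ j := by
  simp [unitVec, EuclideanSpace.inner_single_left]

lemma norm_coord_le (j : Fin n) (ξ : Rn n) : |ξ j| ≤ ‖ξ‖ := by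
  rw [← inner_unitVec]
  refine (abs_real_inner_le_norm _ _).trans ?_
  rw [unitVec, OrthonormalBasis.norm_eq_one, one_mul]

lemma enorm_derivHat_le (j : Fin n) (v : Rn n → ℂ) (ξ : Rn n) :
    ‖derivHat j v ξ‖ₑ ≤ ‖ξ‖ₑ * ‖v ξ‖ₑ := by
  rw [derivHat, enorm_mul, enorm_mul]
  gcongr
  rw [← ofReal_norm, ← ofReal_norm, Complex.norm_I, ENNReal.ofReal_one, one_mul,
    Complex.norm_real, ← ofReal_norm]
  exact ENNReal.ofReal_le_ofReal (norm_coord_le j ξ)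

/-- Integrability of a function together with its first two moments. -/
structure IntegrableMoments (v : Rn n → ℂ) : Prop where
  zero : Integrable v
  one : Integrable fun ξ => (‖ξ‖ : ℂ) * v ξ
  two : Integrable fun ξ => (‖ξ‖ ^ 2 : ℂ) * v ξ

lemma IntegrableMoments.derivHat {v : Rn n → ℂ} (h : IntegrableMoments v) (j : Fin n) :
    Integrable (derivHat j v) := by
  refine h.one.mono ?_ (ae_of_all _ fun ξ => ?_)
  · unfold Gevrey.derivHat
    exact AEStronglyMeasurable.mul (by fun_prop) h.zero.aestronglyMeasurable
  · have := enorm_derivHat_le j v ξ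
    rw [norm_mul, Complex.norm_real, norm_norm, ← ENNReal.ofReal_le_ofReal_iff (by positivity),
      ENNReal.ofReal_mul (norm_nonneg _), ofReal_norm, ofReal_norm, ofReal_norm]
    exact this

lemma IntegrableMoments.norm_derivHat {v : Rn n → ℂ} (h : IntegrableMoments v) (j : Fin n) :
    Integrable fun ξ => (‖ξ‖ : ℂ) * Gevrey.derivHat j v ξ := by
  refine h.two.mono ?_ (ae_of_all _ fun ξ => ?_)
  · exact AEStronglyMeasurable.mul (by fun_prop) (h.derivHat j).aestronglyMeasurable
  · have := norm_coord_le j ξ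
    simp only [Gevrey.derivHat, norm_mul, Complex.norm_real, norm_pow, Complex.norm_I,
      one_mul, Real.norm_eq_abs, abs_norm]
    rw [← mul_assoc, sq]
    gcongr

lemma IntegrableMoments.laplaceHat {v : Rn n → ℂ} (h : IntegrableMoments v) :
    Integrable (laplaceHat v) := by
  refine h.two.neg.congr (ae_of_all _ fun ξ => ?_)
  simp [Gevrey.laplaceHat]

/-- Differentiation under the integral sign, dominated by |ξ||v|. Derivatives along the axes are
enough, since differentiability is part of the notion of solution and only the values of the
derivatives have to be identified. -/
lemma hasDerivAt_invF_line {v : Rn n → ℂ} (h0 : Integrable v)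
    (h1 : Integrable fun ξ => (‖ξ‖ : ℂ) * v ξ) (x : Rn n) (j : Fin n) :
    HasDerivAt (fun s : ℝ => invF v (x + s • unitVec j)) (invF (derivHat j v) x) 0 := by
  have hder : ∀ (ξ : Rn n) (s : ℝ), HasDerivAt (fun s : ℝ =>
      Complex.exp (Complex.I * ((inner ℝ (x + s • unitVec j) ξ : ℝ) : ℂ)) * v ξ)
      (Complex.exp (Complex.I * ((inner ℝ (x + s • unitVec j) ξ : ℝ) : ℂ)) * derivHat j v ξ) s := by
    intro ξ s
    have hin : ∀ s : ℝ, (inner ℝ (x + s • unitVec j) ξ : ℝ) = inner ℝ x ξ + s * ξ j := fun s => by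
      rw [inner_add_left, real_inner_smul_left, inner_unitVec]
    simp only [hin]
    have h2 : HasDerivAt (fun s : ℝ => Complex.I * ((inner ℝ x ξ + s * ξ j : ℝ) : ℂ))
        (Complex.I * ((ξ j : ℝ) : ℂ)) s := by
      refine HasDerivAt.const_mul _ (HasDerivAt.ofReal_comp ?_)
      simpa using ((hasDerivAt_id s).mul_const (ξ j)).const_add (inner ℝ x ξ)
    refine (h2.cexp.mul_const (v ξ)).congr_deriv ?_
    rw [derivHat]; ring
  have hmeas : AEStronglyMeasurable (derivHat j v) volume := by
    unfold derivHat
    exact AEStronglyMeasurable.mul (by fun_prop) h0.aestronglyMeasurable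
  have key := (hasDerivAt_integral_of_dominated_loc_of_deriv_le (μ := volume)
    (F := fun (s : ℝ) ξ => Complex.exp (Complex.I * ((inner ℝ (x + s • unitVec j) ξ : ℝ) : ℂ)) * v ξ)
    (F' := fun (s : ℝ) ξ =>
      Complex.exp (Complex.I * ((inner ℝ (x + s • unitVec j) ξ : ℝ) : ℂ)) * derivHat j v ξ)
    (bound := fun ξ => ‖(‖ξ‖ : ℂ) * v ξ‖) (x₀ := (0 : ℝ)) (s := univ) Filter.univ_mem
    (Eventually.of_forall fun s => (integrable_exp_mul h0 _).aestronglyMeasurable)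
    (integrable_exp_mul h0 _)
    (AEStronglyMeasurable.mul (by fun_prop) hmeas)
    (ae_of_all _ fun ξ s _ => ?_) h1.norm (ae_of_all _ fun ξ s _ => hder ξ s)).2
  · have := key.const_mul (unitFactor n : ℂ)
    simpa only [invF, zero_smul, add_zero] using this
  · have h3 := enorm_derivHat_le j v ξ
    rw [norm_mul, mul_comm Complex.I, Complex.norm_exp_ofReal_mul_I, one_mul, norm_mul,
      Complex.norm_real, norm_norm, ← ENNReal.ofReal_le_ofReal_iff (by positivity),
      ENNReal.ofReal_mul (norm_nonneg _), ofReal_norm, ofReal_norm, ofReal_norm]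
    exact h3

lemma fderiv_unitVec {u : Rn n → ℂ} {v : Rn n → ℂ} (hu : u = invF v) (hd : Differentiable ℝ u)
    (h0 : Integrable v) (h1 : Integrable fun ξ => (‖ξ‖ : ℂ) * v ξ) (x : Rn n) (j : Fin n) :
    fderiv ℝ u x (unitVec j) = invF (derivHat j v) x := by
  have h2 : HasDerivAt (fun s : ℝ => u (x + s • unitVec j)) (fderiv ℝ u x (unitVec j)) 0 := by
    have h3 : HasDerivAt (fun s : ℝ => x + s • unitVec j) (unitVec j) 0 := by
      simpa using ((hasDerivAt_id (0 : ℝ)).smul_const (unitVec j)).const_add x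
    have h4 : HasFDerivAt u (fderiv ℝ u x) (x + (0 : ℝ) • unitVec j) := by
      simpa using (hd x).hasFDerivAt
    exact h4.comp_hasDerivAt 0 h3
  have h5 := hasDerivAt_invF_line h0 h1 x j
  rw [hu] at h2 ⊢
  exact h2.unique h5

lemma laplacian_eq_sum {E : Type*} [NormedAddCommGroup E] [NormedSpace ℝ E] {u : Rn n → E}
    (hu : ContDiff ℝ 2 u) (x : Rn n) :
    Δ u x = ∑ j, fderiv ℝ (fun y => fderiv ℝ u y (unitVec j)) x (unitVec j) := by
  rw [InnerProductSpace.laplacian_eq_iteratedFDeriv_orthonormalBasis u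
    (EuclideanSpace.basisFun (Fin n) ℝ)]
  refine Finset.sum_congr rfl fun j _ => ?_
  rw [iteratedFDeriv_two_apply]
  have hd : DifferentiableAt ℝ (fderiv ℝ u) x :=
    (hu.fderiv_right (m := 1) (by norm_num)).differentiable (by norm_num) x
  rw [fderiv_clm_apply hd (differentiableAt_const _)]
  simp [unitVec]

lemma laplacian_eq_invF {u : Rn n → ℂ} {v : Rn n → ℂ} (hu : u = invF v) (hd : ContDiff ℝ 2 u)
    (hv : IntegrableMoments v) (x : Rn n) : Δ u x = invF (laplaceHat v) x := by
  rw [laplacian_eq_sum hd]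
  have h1 : Differentiable ℝ u := hd.differentiable (by norm_num)
  have h2 : ∀ j, (fun y => fderiv ℝ u y (unitVec j)) = invF (derivHat j v) := fun j =>
    funext fun y => fderiv_unitVec hu h1 hv.zero hv.one y j
  have h3 : ∀ j, Differentiable ℝ fun y => fderiv ℝ u y (unitVec j) := fun j =>
    ((hd.fderiv_right (m := 1) (by norm_num)).differentiable (by norm_num)).clm_apply
      (differentiable_const _)
  have h4 : ∀ j, Integrable (derivHat j (derivHat j v)) := fun j => by
    refine hv.two.mono ?_ (ae_of_all _ fun ξ => ?_)
    · unfold derivHat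
      exact AEStronglyMeasurable.mul (by fun_prop)
        (AEStronglyMeasurable.mul (by fun_prop) hv.zero.aestronglyMeasurable)
    · have := norm_coord_le j ξ
      simp only [derivHat, norm_mul, Complex.norm_real, norm_pow, Complex.norm_I,
        one_mul, Real.norm_eq_abs, abs_norm]
      rw [← mul_assoc, sq]
      gcongr
  rw [Finset.sum_congr rfl fun j _ => fderiv_unitVec (h2 j) (h3 j) (hv.derivHat j)
    (hv.norm_derivHat j) x j, ← invF_sum _ fun j _ => h4 j]
  congr 1; funext ξ
  simp only [derivHat, laplaceHat]
  have : ((‖ξ‖ ^ 2 : ℝ) : ℂ) = ∑ j, ((ξ j : ℝ) : ℂ) * ((ξ j : ℝ) : ℂ) := by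
    rw [EuclideanSpace.real_norm_sq_eq]; push_cast; simp [sq]
  rw [this, ← Finset.sum_neg_distrib, Finset.sum_mul]
  refine Finset.sum_congr rfl fun j _ => ?_
  linear_combination (((ξ j : ℝ) : ℂ) * ((ξ j : ℝ) : ℂ) * v ξ) * Complex.I_mul_I

lemma fderiv_gradient_eq_sum {E : Type*} [NormedAddCommGroup E] [NormedSpace ℝ E] (L : Rn n →L[ℝ] E)
    (φ : Rn n → ℝ) (x : Rn n) :
    L (∇ φ x) = ∑ j, (fderiv ℝ φ x (unitVec j)) • L (unitVec j) := by
  conv_lhs => rw [← (EuclideanSpace.basisFun (Fin n) ℝ).sum_repr' (∇ φ x)]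
  rw [map_sum]
  refine Finset.sum_congr rfl fun j _ => ?_
  rw [map_smul, real_inner_comm, inner_gradient_left]; rfl

lemma fderiv_ofReal_comp {φ : Rn n → ℝ} (hφ : Differentiable ℝ φ) (x e : Rn n) :
    fderiv ℝ (fun y => (φ y : ℂ)) x e = ((fderiv ℝ φ x e : ℝ) : ℂ) := by
  have := (Complex.ofRealCLM.hasFDerivAt.comp x (hφ x).hasFDerivAt).fderiv
  rw [show (fun y => (φ y : ℂ)) = Complex.ofRealCLM ∘ φ from rfl, this]
  simp

lemma contDiff_ofReal_comp {φ : Rn n → ℝ} (hφ : ContDiff ℝ 2 φ) :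
    ContDiff ℝ 2 fun y => (φ y : ℂ) := Complex.ofRealCLM.contDiff.comp hφ

lemma laplacian_ofReal_comp {φ : Rn n → ℝ} (hφ : ContDiff ℝ 2 φ) (x : Rn n) :
    Δ (fun y => (φ y : ℂ)) x = ((Δ φ x : ℝ) : ℂ) := by
  have hd : Differentiable ℝ φ := hφ.differentiable (by norm_num)
  rw [laplacian_eq_sum hφ, laplacian_eq_sum (contDiff_ofReal_comp hφ), Complex.ofReal_sum]
  refine Finset.sum_congr rfl fun j _ => ?_
  simp only [fderiv_ofReal_comp hd]
  exact fderiv_ofReal_comp (((hφ.fderiv_right (m := 1) (by norm_num)).differentiable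
    (by norm_num)).clm_apply (differentiable_const _)) x _

lemma integrable_gradDotHat {p a : Rn n → ℂ} (hp : IntegrableMoments p)
    (ha : IntegrableMoments a) : Integrable (gradDotHat p a) :=
  integrable_finsetSum _ fun j _ => integrable_mulHat (hp.derivHat j) (ha.derivHat j)

lemma invF_gradDotHat {p a : Rn n → ℂ} (hp : IntegrableMoments p)
    (ha : IntegrableMoments a) (x : Rn n) :
    invF (gradDotHat p a) x = ∑ j, invF (derivHat j p) x * invF (derivHat j a) x := by
  unfold gradDotHat
  rw [invF_sum _ fun j _ => integrable_mulHat (hp.derivHat j) (ha.derivHat j)]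
  exact Finset.sum_congr rfl fun j _ => invF_mulHat (hp.derivHat j) (ha.derivHat j) x

lemma integrable_transportHat {p a : Rn n → ℂ} (hp : IntegrableMoments p)
    (ha : IntegrableMoments a) : Integrable (transportHat p a) :=
  ((integrable_gradDotHat hp ha).const_mul 2).add (integrable_mulHat hp.laplaceHat ha.zero)

/-- The transport term `2∇φ·∇w + (Δφ)w` through Fourier transforms. -/
lemma transport_eq_invF {φ : Rn n → ℝ} {w p a : Rn n → ℂ} (hφ : (fun x => (φ x : ℂ)) = invF p)
    (hw : w = invF a) (hφd : ContDiff ℝ 2 φ) (hwd : ContDiff ℝ 2 w) (hp : IntegrableMoments p)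
    (ha : IntegrableMoments a) (x : Rn n) :
    2 * fderiv ℝ w x (∇ φ x) + ((Δ φ x : ℝ) : ℂ) * w x = invF (transportHat p a) x := by
  have hd : Differentiable ℝ φ := hφd.differentiable (by norm_num)
  have hwd1 : Differentiable ℝ w := hwd.differentiable (by norm_num)
  have e1 : invF (transportHat p a) x = 2 * invF (gradDotHat p a) x +
      invF (mulHat (laplaceHat p) a) x := by
    unfold transportHat
    rw [invF_add ((integrable_gradDotHat hp ha).const_mul 2) (integrable_mulHat hp.laplaceHat ha.zero),
      invF_const_mul]
  rw [e1, invF_gradDotHat hp ha, invF_mulHat hp.laplaceHat ha.zero, ← laplacian_ofReal_comp hφd,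
    laplacian_eq_invF hφ (contDiff_ofReal_comp hφd) hp, ← hw, fderiv_gradient_eq_sum]
  congr 2
  refine Finset.sum_congr rfl fun j _ => ?_
  rw [fderiv_unitVec hw hwd1 ha.zero ha.one, Complex.real_smul, ← fderiv_ofReal_comp hd,
    fderiv_unitVec hφ ((contDiff_ofReal_comp hφd).differentiable (by norm_num)) hp.zero hp.one]

lemma norm_gradient_sq_sub {φ φ' : Rn n → ℝ} (hφ : Differentiable ℝ φ) (hφ' : Differentiable ℝ φ')
    (x : Rn n) : ‖∇ φ' x‖ ^ 2 - ‖∇ φ x‖ ^ 2 = ∑ j,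
      fderiv ℝ (fun y => φ' y + φ y) x (unitVec j) * fderiv ℝ (fun y => φ' y - φ y) x (unitVec j) := by
  have h : ∀ ψ : Rn n → ℝ, ‖∇ ψ x‖ ^ 2 = ∑ j, fderiv ℝ ψ x (unitVec j) ^ 2 := fun ψ => by
    rw [← real_inner_self_eq_norm_sq, inner_gradient_left, fderiv_gradient_eq_sum]
    simp [sq]
  rw [h, h, ← Finset.sum_sub_distrib]
  refine Finset.sum_congr rfl fun j _ => ?_
  rw [fderiv_fun_add (hφ' x) (hφ x), fderiv_fun_sub (hφ' x) (hφ x)]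
  simp only [add_apply, _root_.sub_apply]
  ring

/-- The quadratic term `|∇φ'|² - |∇φ|²` through Fourier transforms. -/
lemma norm_gradient_sq_sub_eq_invF {φ φ' : Rn n → ℝ} {p p' : Rn n → ℂ}
    (hφ : (fun x => (φ x : ℂ)) = invF p) (hφ' : (fun x => (φ' x : ℂ)) = invF p')
    (hd : Differentiable ℝ φ) (hd' : Differentiable ℝ φ')
    (hp : IntegrableMoments fun ξ => p' ξ + p ξ) (hm : IntegrableMoments fun ξ => p' ξ - p ξ)
    (hp0 : Integrable p) (hp0' : Integrable p') (x : Rn n) :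
    ((‖∇ φ' x‖ ^ 2 - ‖∇ φ x‖ ^ 2 : ℝ) : ℂ) =
      invF (gradDotHat (fun ξ => p' ξ + p ξ) (fun ξ => p' ξ - p ξ)) x := by
  rw [norm_gradient_sq_sub hd hd', invF_gradDotHat hp hm, Complex.ofReal_sum]
  refine Finset.sum_congr rfl fun j _ => ?_
  have h1 : (fun x => ((φ' x + φ x : ℝ) : ℂ)) = invF fun ξ => p' ξ + p ξ := by
    funext y
    rw [invF_add hp0' hp0, Complex.ofReal_add, ← hφ, ← hφ']
  have h2 : (fun x => ((φ' x - φ x : ℝ) : ℂ)) = invF fun ξ => p' ξ - p ξ := by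
    funext y
    rw [invF_sub hp0' hp0, Complex.ofReal_sub, ← hφ, ← hφ']
  have o : Differentiable ℝ (Complex.ofReal : ℝ → ℂ) := Complex.ofRealCLM.differentiable
  rw [Complex.ofReal_mul, ← fderiv_ofReal_comp (hd'.fun_add hd),
    ← fderiv_ofReal_comp (hd'.fun_sub hd),
    ← fderiv_unitVec h1 (o.comp (hd'.fun_add hd)) hp.zero hp.one,
    ← fderiv_unitVec h2 (o.comp (hd'.fun_sub hd)) hm.zero hm.one]

end Derivatives

-- Jointly measurable representatives of curves in L²

section JointMeasurability

open scoped Convolution in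
/-- A continuous curve in `L²` has a jointly measurable representative. -/
lemma exists_measurable_uncurry {F : ℝ → Rn n → ℂ} {T : ℝ} (hF : ∀ t ∈ Ici T, MemLp (F t) 2 volume)
    (hc : ∀ s ∈ Ici T, Tendsto (fun t => eLpNorm (fun ξ => F t ξ - F s ξ) 2 volume)
      (𝓝[Ici T] s) (𝓝 0)) :
    ∃ G : ℝ → Rn n → ℂ, Measurable (Function.uncurry G) ∧ ∀ t ∈ Ici T, F t =ᵐ[volume] G t := by
  -- The curve, extended by its value at T to earlier times, is mollified in ξ. The mollified
  -- functions are continuous in t and in ξ separately, hence jointly measurable, and they converge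
  -- almost everywhere in ξ by Lebesgue differentiation.
  let B : ℕ → ContDiffBump (0 : Rn n) := fun N =>
    ⟨1 / ((N : ℝ) + 1), 2 / ((N : ℝ) + 1), by positivity, by gcongr; norm_num⟩
  let θ : ℕ → Rn n → ℝ := fun N => (B N).normed volume
  let g : ℕ → ℝ → Rn n → ℂ := fun N t =>
    θ N ⋆[ContinuousLinearMap.lsmul ℝ ℝ, volume] F (max t T)
  have hmax : ∀ t : ℝ, max t T ∈ Ici T := fun t => mem_Ici.2 (le_max_right t T)
  have hloc : ∀ t, LocallyIntegrable (F (max t T)) volume := fun t =>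
    (hF _ (hmax t)).locallyIntegrable (by norm_num)
  have hθc : ∀ N, Continuous (θ N) := fun N => (B N).continuous_normed
  have hθs : ∀ N, HasCompactSupport (θ N) := fun N => (B N).hasCompactSupport_normed
  have hgξ : ∀ N t, Continuous (g N t) := fun N t =>
    (hθs N).continuous_convolution_left _ (hθc N) (hloc t)
  have hθL : ∀ N, MemLp (θ N) 2 volume := fun N => (hθc N).memLp_of_hasCompactSupport (hθs N)
  have hgt : ∀ N ξ, Continuous fun t => g N t ξ := by
    intro N ξ
    rw [continuous_iff_continuousAt]
    intro s
    have hint : ∀ t, Integrable fun η => θ N η • F (max t T) (ξ - η) := fun t => by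
      have := ((hθs N).convolutionExists_left (ContinuousLinearMap.lsmul ℝ ℝ) (hθc N) (hloc t)) ξ
      exact this
    have hb : ∀ t, ‖g N t ξ - g N s ξ‖ₑ ≤ ltwo volume (fun η => ‖θ N η‖ₑ) *
        eLpNorm (fun η => F (max t T) η - F (max s T) η) 2 volume := fun t => by
      have e : g N t ξ - g N s ξ = ∫ η, θ N η • (F (max t T) (ξ - η) - F (max s T) (ξ - η)) := by
        simp only [smul_sub]
        rw [integral_sub (hint t) (hint s)]; rfl
      rw [e]
      refine (enorm_integral_le_lintegral_enorm _).trans ?_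
      simp only [enorm_smul]
      have hm := ((hF _ (hmax t)).1.sub (hF _ (hmax s)).1)
      have hm2 : AEMeasurable (fun η => ‖F (max t T) (ξ - η) - F (max s T) (ξ - η)‖ₑ) volume :=
        (hm.comp_quasiMeasurePreserving (quasiMeasurePreserving_sub_left volume ξ)).enorm
      refine (lintegral_mul_le_ltwo (hθc N).aestronglyMeasurable.enorm hm2).trans ?_
      rw [eLpNorm_two_eq,
        ltwo_comp_sub_left (fun η => ‖F (max t T) η - F (max s T) η‖ₑ) ξ]
    rw [ContinuousAt, tendsto_iff_edist_tendsto_0]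
    have ht : Tendsto (fun t : ℝ => max t T) (𝓝 s) (𝓝[Ici T] (max s T)) :=
      tendsto_nhdsWithin_iff.2 ⟨(continuous_id.max continuous_const).tendsto s,
        Eventually.of_forall hmax⟩
    have h0 := (hc _ (hmax s)).comp ht
    have h1 : ltwo volume (fun η => ‖θ N η‖ₑ) ≠ ∞ := by
      rw [← eLpNorm_two_eq]; exact (hθL N).2.ne
    have h2 := ENNReal.Tendsto.const_mul h0 (Or.inr h1)
    rw [mul_zero] at h2
    refine tendsto_of_tendsto_of_tendsto_of_le_of_le tendsto_const_nhds h2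
      (fun _ => zero_le) fun t => ?_
    rw [edist_eq_enorm_sub]; exact hb t
  have hmeas : ∀ N, StronglyMeasurable (Function.uncurry (g N)) := fun N =>
    stronglyMeasurable_uncurry_of_continuous_of_stronglyMeasurable (hgt N)
      fun t => (hgξ N t).stronglyMeasurable
  refine ⟨fun t ξ => limUnder atTop fun N => g N t ξ,
    (StronglyMeasurable.limUnder (l := atTop) (f := fun N => Function.uncurry (g N))
      hmeas).measurable, fun t ht => ?_⟩
  have hl : LocallyIntegrable (F t) volume := (hF t ht).locallyIntegrable (by norm_num)
  have h0 : Tendsto (fun N => (B N).rOut) atTop (𝓝 0) := by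
    have := (tendsto_one_div_add_atTop_nhds_zero_nat (𝕜 := ℝ)).const_mul 2
    simpa [B, div_eq_mul_inv] using this
  filter_upwards [ContDiffBump.ae_convolution_tendsto_right_of_locallyIntegrable (φ := B) (K := 2)
    h0 (Eventually.of_forall fun N => by simp only [B]; rw [mul_one_div]) hl] with ξ hξ
  have : max t T = t := max_eq_left ht
  simp only [g, this]
  exact hξ.limUnder_eq.symm

end JointMeasurability

-- Integration by parts for absolutely continuous functions

section ProductRule

/-- Integration by parts on the half-plane `s < s'`. -/
lemma integral_mul_integral_eq {m : Measure ℝ} [SFinite m] [NullSingletonClass m] {f g : ℝ → ℂ}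
    (hf : Integrable f m) (hg : Integrable g m) :
    (∫ s, f s ∂m) * ∫ s, g s ∂m =
      (∫ s, f s * ∫ s' in Ioi s, g s' ∂m ∂m) + ∫ s, g s * ∫ s' in Ioi s, f s' ∂m ∂m := by
  have hP : Integrable (fun z : ℝ × ℝ => f z.1 * g z.2) (m.prod m) := hf.mul_prod hg
  have hS : MeasurableSet {z : ℝ × ℝ | z.1 < z.2} := measurableSet_lt measurable_fst measurable_snd
  have h1 : (∫ s, f s ∂m) * ∫ s, g s ∂m = ∫ z, f z.1 * g z.2 ∂(m.prod m) :=
    (integral_prod_mul f g).symm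
  rw [h1, ← integral_add_compl hS hP, ← integral_indicator hS, ← integral_indicator hS.compl,
    integral_prod _ (hP.indicator hS), integral_prod_symm _ (hP.indicator hS.compl)]
  congr 1
  · refine integral_congr_ae (ae_of_all _ fun s => ?_)
    simp only
    rw [← integral_const_mul, ← integral_indicator measurableSet_Ioi]
    rfl
  · refine integral_congr_ae (ae_of_all _ fun s => ?_)
    simp only
    -- The complementary half-plane contains the diagonal, which is negligible because the measure
    -- has no atoms.
    rw [← integral_Ici_eq_integral_Ioi, ← integral_const_mul, ← integral_indicator measurableSet_Ici]
    refine integral_congr_ae (ae_of_all _ fun s' => ?_)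
    simp only [indicator, mem_compl_iff, mem_ofPred_eq, not_lt, mem_Ici, mul_comm]

/-- Product rule for absolutely continuous functions. -/
lemma mul_eq_add_setIntegral {a b : ℝ} {F G f g : ℝ → ℂ}
    (hf : IntegrableOn f (Ioc a b)) (hg : IntegrableOn g (Ioc a b))
    (hF : ∀ t ∈ Icc a b, F t = F a + ∫ s in Ioc a t, f s)
    (hG : ∀ t ∈ Icc a b, G t = G a + ∫ s in Ioc a t, g s) :
    IntegrableOn (fun s => f s * G s + F s * g s) (Ioc a b) ∧
      ∀ t ∈ Icc a b, F t * G t = F a * G a + ∫ s in Ioc a t, (f s * G s + F s * g s) := by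
  have key : ∀ {F f : ℝ → ℂ}, IntegrableOn f (Ioc a b) →
      (∀ t ∈ Icc a b, F t = F a + ∫ s in Ioc a t, f s) → ∀ {g : ℝ → ℂ}, IntegrableOn g (Ioc a b) →
      IntegrableOn (fun s => F s * g s) (Ioc a b) := by
    intro F f hf hF g hg
    have hc : ContinuousOn F (Icc a b) := by
      have := intervalIntegral.continuousOn_primitive (f := f) (μ := volume) (a := a) (b := b)
        ((integrableOn_Icc_iff_integrableOn_Ioc).2 hf)
      exact (continuousOn_const.add this).congr fun t ht => hF t ht
    obtain ⟨M, hM⟩ := isCompact_Icc.exists_bound_of_continuousOn hc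
    refine Integrable.bdd_mul (c := M) hg
      ((hc.mono Ioc_subset_Icc_self).aestronglyMeasurable measurableSet_Ioc) ?_
    exact (ae_restrict_iff' measurableSet_Ioc).2 (ae_of_all _ fun s hs => hM s (Ioc_subset_Icc_self hs))
  have i1 := key hg hG hf
  have i2 := key hf hF hg
  have i1' : IntegrableOn (fun s => f s * G s) (Ioc a b) := by simpa only [mul_comm] using i1
  refine ⟨i1'.add i2, fun t ht => ?_⟩
  have hsub : Ioc a t ⊆ Ioc a b := Ioc_subset_Ioc_right ht.2
  have hft := hf.mono_set hsub
  have hgt := hg.mono_set hsub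
  have tail : ∀ {F f : ℝ → ℂ}, IntegrableOn f (Ioc a b) →
      (∀ t ∈ Icc a b, F t = F a + ∫ s in Ioc a t, f s) → ∀ s ∈ Ioc a t,
      ∫ s' in Ioi s, f s' ∂(volume.restrict (Ioc a t)) = F t - F s := by
    intro F f hf hF s hs
    rw [Measure.restrict_restrict measurableSet_Ioi, hF t ht, hF s ⟨hs.1.le, hs.2.trans ht.2⟩,
      show Ioi s ∩ Ioc a t = Ioc s t by
        ext x; simp only [mem_inter_iff, mem_Ioi, mem_Ioc]
        exact ⟨fun h => ⟨h.1, h.2.2⟩, fun h => ⟨h.1, hs.1.trans h.1, h.2⟩⟩]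
    have : Ioc a t = Ioc a s ∪ Ioc s t := (Ioc_union_Ioc_eq_Ioc hs.1.le hs.2).symm
    rw [this, setIntegral_union (Set.disjoint_left.2 fun x h1 h2 => absurd h1.2 (not_le.2 h2.1))
      measurableSet_Ioc (hf.mono_set (Ioc_subset_Ioc_right (hs.2.trans ht.2)))
      (hf.mono_set (Ioc_subset_Ioc hs.1.le ht.2))]
    ring
  have h1 := integral_mul_integral_eq hft hgt
  have e1 : ∫ s in Ioc a t, f s * ∫ s' in Ioi s, g s' ∂(volume.restrict (Ioc a t)) =
      ∫ s in Ioc a t, (f s * G t - f s * G s) :=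
    setIntegral_congr_fun measurableSet_Ioc fun s hs => by
      rw [tail hg hG s hs, mul_sub]
  have e2 : ∫ s in Ioc a t, g s * ∫ s' in Ioi s, f s' ∂(volume.restrict (Ioc a t)) =
      ∫ s in Ioc a t, (F t * g s - F s * g s) :=
    setIntegral_congr_fun measurableSet_Ioc fun s hs => by
      rw [tail hf hF s hs]; ring
  rw [e1, e2, integral_sub (hft.mul_const _) (i1'.mono_set hsub),
    integral_sub (hgt.const_mul _) (i2.mono_set hsub), integral_mul_const, integral_const_mul] at h1
  rw [integral_add (i1'.mono_set hsub) (i2.mono_set hsub)]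
  have hFt := hF t ht
  have hGt := hG t ht
  set X := ∫ s in Ioc a t, f s
  set Y := ∫ s in Ioc a t, g s
  have hX : X = F t - F a := by rw [hFt]; ring
  have hY : Y = G t - G a := by rw [hGt]; ring
  rw [hX, hY] at h1
  linear_combination -h1

end ProductRule

-- Absorption of powers by the exponential weight

section ExponentGain

lemma exists_rpow_le_exp {ν ρ : ℝ} (hν : 0 < ν) (hρ : 0 < ρ) (A : ℝ) :
    ∃ C : ℝ, 0 < C ∧ ∀ x : ℝ, 1 < x → x ^ A ≤ C * Real.exp (ρ * x ^ ν) := by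
  obtain ⟨N, hN⟩ := exists_nat_ge (A / ν)
  refine ⟨N.factorial / ρ ^ N, by positivity, fun x hx => ?_⟩
  have hx0 : 0 < x := by linarith
  have h1 : x ^ A ≤ (x ^ ν) ^ N := by
    rw [← Real.rpow_natCast, ← Real.rpow_mul hx0.le]
    exact Real.rpow_le_rpow_of_exponent_le hx.le (by rw [div_le_iff₀ hν] at hN; linarith)
  have h2 := Real.pow_div_factorial_le_exp (ρ * x ^ ν) (by positivity) N
  rw [div_le_iff₀ (by positivity), mul_pow] at h2
  rw [div_mul_eq_mul_div, le_div_iff₀ (by positivity)]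
  nlinarith [pow_pos hρ N]

/-- For ρ > 0 the exponential beats every power of |ξ|. Thus at each finite time regularity is free,
with a constant depending on ρ that only enters qualitative statements on convergence. -/
lemma exists_ew_le {ν ρ : ℝ} (hν : 0 < ν) (hρ : 0 < ρ) (a a' b : ℝ) :
    ∃ C : ℝ≥0∞, C ≠ ∞ ∧ ∀ ξ : Rn n, ew ν a' b 0 ξ ≤ C * ew ν a b ρ ξ := by
  obtain ⟨C, hC, h⟩ := exists_rpow_le_exp hν hρ (a' - a)
  refine ⟨ENNReal.ofReal (max C 1), ENNReal.ofReal_ne_top, fun ξ => ?_⟩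
  rw [ew, ew, ← ENNReal.ofReal_mul (by positivity)]
  refine ENNReal.ofReal_le_ofReal ?_
  rw [weight, weight, zero_mul, Real.exp_zero, mul_one]
  by_cases h1 : 1 < ‖ξ‖
  · have hx : 0 < ‖ξ‖ := by linarith
    simp only [h1, if_true]
    have h2 := h _ h1
    have h3 : Real.exp (ρ * ‖ξ‖ ^ ν) ≤ Real.exp (ρ * max (‖ξ‖ ^ ν) 1) :=
      Real.exp_le_exp.2 (by gcongr; exact le_max_left _ _)
    have h4 : ‖ξ‖ ^ a' = ‖ξ‖ ^ a * ‖ξ‖ ^ (a' - a) := by rw [← Real.rpow_add hx]; congr 1; ring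
    rw [h4]
    calc _ ≤ ‖ξ‖ ^ a * (C * Real.exp (ρ * ‖ξ‖ ^ ν)) := by gcongr
      _ ≤ ‖ξ‖ ^ a * (max C 1 * Real.exp (ρ * max (‖ξ‖ ^ ν) 1)) := by
        gcongr; exact le_max_left _ _
      _ = _ := by ring
  · simp only [h1, if_false]
    have h3 : 1 ≤ Real.exp (ρ * max (‖ξ‖ ^ ν) 1) := Real.one_le_exp (by positivity)
    have h4 : (1 : ℝ) ≤ max C 1 := le_max_right _ _
    have h5 : 0 ≤ ‖ξ‖ ^ b := by positivity
    calc ‖ξ‖ ^ b = 1 * (‖ξ‖ ^ b * 1) := by ring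
      _ ≤ _ := by gcongr

/-- The first two moments are controlled by a Gevrey norm. -/
lemma exists_moments_le (hn : 0 < n) {ν ρ₀ b : ℝ} (hν : 0 < ν) (hρ₀ : 0 < ρ₀) (hb : b < n / 2)
    (a : ℝ) : ∃ C : ℝ≥0∞, C ≠ ∞ ∧ ∀ (ρ : ℝ) (F : Rn n → ℝ≥0∞), ρ₀ ≤ ρ → Measurable F →
      ∫⁻ ξ, ew ν 2 0 0 ξ * F ξ ≤ C * wl ν a b ρ F := by
  obtain ⟨C₁, hC₁, h1⟩ := exists_lintegral_ew_le (n := n) hn (a := 3 + n / 2) (b := b) (a' := 2)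
    (b' := 0) (by linarith) (by linarith)
  obtain ⟨C₂, hC₂, h2⟩ := exists_ew_le (n := n) hν hρ₀ a (3 + n / 2) b
  refine ⟨C₁ * C₂, ENNReal.mul_ne_top hC₁ hC₂, fun ρ F hρ hF => (h1 ν 0 F hF).trans ?_⟩
  rw [mul_assoc]
  gcongr
  rw [← wl_const_mul hC₂]
  refine ltwo_mono ?_
  filter_upwards [ae_ne_zero hn] with ξ hξ
  calc _ ≤ C₂ * ew ν a b ρ₀ ξ * F ξ := by gcongr; exact h2 ξ
    _ ≤ C₂ * ew ν a b ρ ξ * F ξ := by gcongr; exact ew_mono hξ le_rfl le_rfl hρ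
    _ = _ := by ring

lemma one_le_ew_two (ν : ℝ) (ξ : Rn n) : 1 ≤ ew ν 2 0 0 ξ := by
  rw [ew, weight, zero_mul, Real.exp_zero, mul_one, ENNReal.one_le_ofReal]
  split_ifs with h
  · exact Real.one_le_rpow h.le (by norm_num)
  · simp

lemma enorm_le_ew_two (ν : ℝ) (ξ : Rn n) : ‖ξ‖ₑ ≤ ew ν 2 0 0 ξ := by
  rw [ew, weight, zero_mul, Real.exp_zero, mul_one, ← ofReal_norm]
  refine ENNReal.ofReal_le_ofReal ?_
  split_ifs with h
  · rw [Real.rpow_two]; nlinarith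
  · simpa using not_lt.1 h

lemma enorm_sq_le_ew_two (ν : ℝ) (ξ : Rn n) : ‖ξ‖ₑ ^ 2 ≤ ew ν 2 0 0 ξ := by
  rw [ew, weight, zero_mul, Real.exp_zero, mul_one, ← ofReal_norm, ← ENNReal.ofReal_pow (norm_nonneg _)]
  refine ENNReal.ofReal_le_ofReal ?_
  split_ifs with h
  · rw [Real.rpow_two]
  · simpa using not_lt.1 h

lemma integrableMoments_of_lintegral {ν : ℝ} {v : Rn n → ℂ} (hv : Measurable v)
    (h : ∫⁻ ξ, ew ν 2 0 0 ξ * ‖v ξ‖ₑ ≠ ∞) : IntegrableMoments v where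
  zero := ⟨hv.aestronglyMeasurable, lt_of_le_of_lt (lintegral_mono fun ξ => by
    calc ‖v ξ‖ₑ = 1 * ‖v ξ‖ₑ := (one_mul _).symm
      _ ≤ ew ν 2 0 0 ξ * ‖v ξ‖ₑ := by gcongr; exact one_le_ew_two ν ξ) h.lt_top⟩
  one := ⟨by fun_prop, lt_of_le_of_lt (lintegral_mono fun ξ => by
    rw [enorm_mul, ← ofReal_norm, Complex.norm_real, norm_norm, ofReal_norm]
    gcongr; exact enorm_le_ew_two ν ξ) h.lt_top⟩
  two := ⟨by fun_prop, lt_of_le_of_lt (lintegral_mono fun ξ => by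
    rw [enorm_mul, ← ofReal_norm, norm_pow, Complex.norm_real, norm_norm,
      ENNReal.ofReal_pow (norm_nonneg _), ofReal_norm]
    gcongr; exact enorm_sq_le_ew_two ν ξ) h.lt_top⟩

end ExponentGain

-- Measurability and pointwise bounds of the bilinear terms

section Bilinear

lemma measurable_uncurry_mulHat {a b : ℝ → Rn n → ℂ} (ha : Measurable (Function.uncurry a))
    (hb : Measurable (Function.uncurry b)) :
    Measurable (Function.uncurry fun t => mulHat (a t) (b t)) := by
  have h : StronglyMeasurable (Function.uncurry fun (z : ℝ × Rn n) η =>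
      a z.1 (z.2 - η) * b z.1 η) := by
    refine Measurable.stronglyMeasurable ?_
    exact (ha.comp (by fun_prop : Measurable fun q : (ℝ × Rn n) × Rn n => (q.1.1, q.1.2 - q.2))).mul
      (hb.comp (by fun_prop : Measurable fun q : (ℝ × Rn n) × Rn n => (q.1.1, q.2)))
  exact (h.integral_prod_right.const_mul _).measurable

lemma measurable_uncurry_derivHat {a : ℝ → Rn n → ℂ} (ha : Measurable (Function.uncurry a))
    (j : Fin n) : Measurable (Function.uncurry fun t => derivHat j (a t)) := by
  have h : Measurable fun z : ℝ × Rn n => Complex.I * ((z.2 j : ℝ) : ℂ) := by fun_prop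
  exact h.mul ha

lemma measurable_uncurry_laplaceHat {a : ℝ → Rn n → ℂ} (ha : Measurable (Function.uncurry a)) :
    Measurable (Function.uncurry fun t => laplaceHat (a t)) := by
  have h : Measurable fun z : ℝ × Rn n => -((‖z.2‖ ^ 2 : ℝ) : ℂ) := by fun_prop
  exact h.mul ha

lemma measurable_uncurry_gradDotHat {a b : ℝ → Rn n → ℂ} (ha : Measurable (Function.uncurry a))
    (hb : Measurable (Function.uncurry b)) :
    Measurable (Function.uncurry fun t => gradDotHat (a t) (b t)) :=
  Finset.measurable_fun_sum Finset.univ fun j _ => measurable_uncurry_mulHat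
    (measurable_uncurry_derivHat ha j) (measurable_uncurry_derivHat hb j)

lemma measurable_uncurry_transportHat {a b : ℝ → Rn n → ℂ} (ha : Measurable (Function.uncurry a))
    (hb : Measurable (Function.uncurry b)) :
    Measurable (Function.uncurry fun t => transportHat (a t) (b t)) := by
  have h1 := measurable_uncurry_gradDotHat ha hb
  have h2 := measurable_uncurry_mulHat (measurable_uncurry_laplaceHat ha) hb
  have h3 := (h1.const_mul 2).add h2
  exact h3

lemma enorm_gradDotHat_le (a b : Rn n → ℂ) (ξ : Rn n) : ‖gradDotHat a b ξ‖ₑ ≤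
    n * lconv (fun ζ => ‖ζ‖ₑ * ‖a ζ‖ₑ) (fun η => ‖η‖ₑ * ‖b η‖ₑ) ξ := by
  refine (enorm_sum_le _ _).trans ?_
  calc _ ≤ ∑ _j : Fin n, lconv (fun ζ => ‖ζ‖ₑ * ‖a ζ‖ₑ) (fun η => ‖η‖ₑ * ‖b η‖ₑ) ξ :=
        Finset.sum_le_sum fun j _ => (enorm_mulHat_le _ _ ξ).trans
          (lconv_mono (ae_of_all _ (enorm_derivHat_le j a)) (ae_of_all _ (enorm_derivHat_le j b)) ξ)
    _ = _ := by simp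

lemma enorm_laplaceHat (a : Rn n → ℂ) (ξ : Rn n) : ‖laplaceHat a ξ‖ₑ = ‖ξ‖ₑ ^ 2 * ‖a ξ‖ₑ := by
  rw [laplaceHat, enorm_mul, enorm_neg, ← ofReal_norm, Complex.norm_real, norm_pow, norm_norm,
    ENNReal.ofReal_pow (norm_nonneg _), ofReal_norm]

lemma enorm_transportHat_le (a b : Rn n → ℂ) (ξ : Rn n) : ‖transportHat a b ξ‖ₑ ≤
    2 * (n * lconv (fun ζ => ‖ζ‖ₑ * ‖a ζ‖ₑ) (fun η => ‖η‖ₑ * ‖b η‖ₑ) ξ) +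
      lconv (fun ζ => ‖ζ‖ₑ ^ 2 * ‖a ζ‖ₑ) (fun η => ‖b η‖ₑ) ξ := by
  refine (enorm_add_le _ _).trans ?_
  gcongr
  · rw [enorm_mul]
    gcongr
    · rw [← ofReal_norm]; simp
    · exact enorm_gradDotHat_le a b ξ
  · refine (enorm_mulHat_le _ _ ξ).trans (le_of_eq ?_)
    simp only [enorm_laplaceHat]

end Bilinear

-- From pointwise evolution equations to the Fourier side

section Evolution

/-- An evolution equation for functions with integrable Fourier transforms, in integrated form and
on the Fourier side. -/
lemma ae_sub_eq_setIntegral {y Y G : ℝ → Rn n → ℂ} {s t : ℝ} (hst : s ≤ t)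
    (hYs : Integrable (Y s)) (hYt : Integrable (Y t)) (hys : y s = invF (Y s))
    (hyt : y t = invF (Y t)) (hG : Measurable (Function.uncurry G))
    (hGi : ∫⁻ τ in Ioc s t, ∫⁻ ξ, ‖G τ ξ‖ₑ ≠ ∞)
    (hder : ∀ τ ∈ Icc s t, ∀ x, HasDerivWithinAt (fun σ => y σ x) (invF (G τ) x) (Ici s) τ) :
    ∀ᵐ ξ, Y t ξ - Y s ξ = ∫ τ in Ioc s t, G τ ξ := by
  set m : Measure ℝ := volume.restrict (Ioc s t)
  have hprod : Integrable (Function.uncurry G) (m.prod volume) := by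
    refine ⟨hG.aestronglyMeasurable, ?_⟩
    rw [HasFiniteIntegral, lintegral_prod _ hG.enorm.aemeasurable]
    exact hGi.lt_top
  have hR : Integrable (fun ξ => ∫ τ in Ioc s t, G τ ξ) := hprod.integral_prod_right
  have hE : ∀ x, Integrable (fun z : ℝ × Rn n =>
      Complex.exp (Complex.I * ((inner ℝ x z.2 : ℝ) : ℂ)) * G z.1 z.2) (m.prod volume) := fun x => by
    refine Integrable.bdd_mul (c := 1) hprod (by fun_prop) (ae_of_all _ fun z => ?_)
    rw [mul_comm Complex.I, Complex.norm_exp_ofReal_mul_I]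
  -- By injectivity of the inverse transform on L¹ it suffices to compare the functions of x, where
  -- the fundamental theorem of calculus applies for each x.
  refine ae_eq_of_invF_eq (hYt.sub hYs) hR ?_
  funext x
  have hint : IntegrableOn (fun τ => invF (G τ) x) (Ioc s t) :=
    (hE x).integral_prod_left.const_mul _
  have h1 : ∫ τ in s..t, invF (G τ) x = y t x - y s x := by
    refine intervalIntegral.integral_eq_sub_of_hasDeriv_right_of_le (f := fun τ => y τ x) hst (fun τ hτ => ?_)
      (fun τ hτ => ?_) ((intervalIntegrable_iff_integrableOn_Ioc_of_le hst).2 hint)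
    · exact ((hder τ hτ x).continuousWithinAt).mono Icc_subset_Ici_self
    · exact (hder τ (Ioo_subset_Icc_self hτ) x).mono fun z hz => hτ.1.le.trans (le_of_lt hz)
  have h2 : invF (fun ξ => Y t ξ - Y s ξ) x = invF (Y t) x - invF (Y s) x := invF_sub hYt hYs x
  have h3 : invF (fun ξ => ∫ τ in Ioc s t, G τ ξ) x = ∫ τ in Ioc s t, invF (G τ) x := by
    simp only [invF, integral_const_mul]
    congr 1
    rw [integral_integral_swap (hE x)]
    exact integral_congr_ae (ae_of_all _ fun ξ => (integral_const_mul _ _).symm)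
  calc invF (fun ξ => Y t ξ - Y s ξ) x = y t x - y s x := by rw [h2, hys, hyt]
    _ = _ := by rw [h3, ← h1, intervalIntegral.integral_of_le hst]

end Evolution

-- Interpolation between a strong bound and a weak convergence

section Interpolation

lemma ew_le_of_norm_le {N : ℝ} (hN : 1 ≤ N) (ν a a' b ρ : ℝ) {ξ : Rn n} (h : ‖ξ‖ ≤ N) :
    ew ν a b ρ ξ ≤ ENNReal.ofReal (N ^ max (a - a') 0) * ew ν a' b ρ ξ := by
  rw [ew, ew, ← ENNReal.ofReal_mul (by positivity), weight, weight, ← mul_assoc]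
  refine ENNReal.ofReal_le_ofReal ?_
  gcongr
  have h0 : (1 : ℝ) ≤ N ^ max (a - a') 0 := Real.one_le_rpow hN (le_max_right _ _)
  split_ifs with h1
  · have hx : 0 < ‖ξ‖ := by linarith
    calc ‖ξ‖ ^ a = ‖ξ‖ ^ (a - a') * ‖ξ‖ ^ a' := by rw [← Real.rpow_add hx]; congr 1; ring
      _ ≤ N ^ max (a - a') 0 * ‖ξ‖ ^ a' := by
        gcongr
        exact (Real.rpow_le_rpow_of_exponent_le h1.le (le_max_left _ _)).trans
          (Real.rpow_le_rpow hx.le h (le_max_right _ _))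
  · exact le_mul_of_one_le_left (by positivity) h0

lemma ew_le_of_lt_norm {N : ℝ} (hN : 1 ≤ N) (ν b ρ : ℝ) {a a' : ℝ} (ha : a' ≤ a) {ξ : Rn n}
    (h : N < ‖ξ‖) : ew ν a' b ρ ξ ≤ ENNReal.ofReal (N ^ (-(a - a'))) * ew ν a b ρ ξ := by
  rw [ew, ew, ← ENNReal.ofReal_mul (by positivity), weight, weight, ← mul_assoc]
  refine ENNReal.ofReal_le_ofReal ?_
  have h1 : 1 < ‖ξ‖ := by linarith
  have hx : 0 < ‖ξ‖ := by linarith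
  gcongr
  simp only [h1, if_true]
  calc ‖ξ‖ ^ a' = ‖ξ‖ ^ (-(a - a')) * ‖ξ‖ ^ a := by rw [← Real.rpow_add hx]; congr 1; ring
    _ ≤ N ^ (-(a - a')) * ‖ξ‖ ^ a := by
      gcongr 1
      exact Real.rpow_le_rpow_of_nonpos (by linarith) h.le (by linarith)

lemma tendsto_ofReal_rpow_neg {δ : ℝ} (hδ : 0 < δ) (M : ℝ≥0∞) (hM : M ≠ ∞) :
    Tendsto (fun N : ℝ => ENNReal.ofReal (N ^ (-δ)) * M) atTop (𝓝 0) := by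
  have h := ENNReal.Tendsto.mul_const (ENNReal.tendsto_ofReal (tendsto_rpow_neg_atTop hδ))
    (Or.inr hM)
  simpa using h

/-- Boundedness for the exponent `a` and convergence for some exponent imply convergence for every
exponent less than `a`. -/
lemma tendsto_wl_of_bounded {ι : Type*} {l : Filter ι} {ν a a' a'' b ρ : ℝ}
    {D : ι → Rn n → ℝ≥0∞} {M : ℝ≥0∞} (hM : M ≠ ∞) (hD : ∀ i, Measurable (D i))
    (hb : ∀ᶠ i in l, wl ν a b ρ (D i) ≤ M)
    (h0 : Tendsto (fun i => wl ν a' b ρ (D i)) l (𝓝 0)) (ha : a'' < a) :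
    Tendsto (fun i => wl ν a'' b ρ (D i)) l (𝓝 0) := by
  -- Frequencies beyond N gain the factor N^{-(a - a'')} from the strong norm; below N any two
  -- exponents are comparable up to a power of N.
  have key : ∀ N : ℝ, 1 ≤ N → ∀ F : Rn n → ℝ≥0∞, Measurable F → wl ν a'' b ρ F ≤
      ENNReal.ofReal (N ^ (-(a - a''))) * wl ν a b ρ F +
        ENNReal.ofReal (N ^ max (a'' - a') 0) * wl ν a' b ρ F := by
    intro N hN F hF
    rw [wl, wl, wl, ← ltwo_const_mul ENNReal.ofReal_ne_top, ← ltwo_const_mul ENNReal.ofReal_ne_top]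
    have hm : ∀ a, Measurable fun ξ : Rn n => ew ν a b ρ ξ * F ξ := fun a =>
      (measurable_ew _ _ _ _).mul hF
    refine (ltwo_mono (ae_of_all _ fun ξ => ?_)).trans
      (ltwo_add_le ((hm a).const_mul _).aemeasurable ((hm a').const_mul _).aemeasurable)
    by_cases h : ‖ξ‖ ≤ N
    · refine le_trans ?_ le_add_self
      simp only [← mul_assoc]
      gcongr
      exact ew_le_of_norm_le hN _ _ _ _ _ h
    · refine le_trans ?_ le_self_add
      simp only [← mul_assoc]
      gcongr
      exact ew_le_of_lt_norm hN _ _ _ ha.le (not_le.1 h)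
  rw [ENNReal.tendsto_nhds_zero] at h0 ⊢
  intro ε hε
  have hε2 : 0 < ε / 2 := ENNReal.half_pos hε.ne'
  obtain ⟨N, hN1, hN2⟩ := (((ENNReal.tendsto_nhds_zero.1
    (tendsto_ofReal_rpow_neg (sub_pos.2 ha) M hM)) _ hε2).and (eventually_ge_atTop 1)).exists
  set K := ENNReal.ofReal (N ^ max (a'' - a') 0)
  have h1 : 0 < ε / 2 / K :=
    ENNReal.div_pos hε2.ne' ENNReal.ofReal_ne_top
  filter_upwards [hb, h0 _ h1] with i hi1 hi2
  calc _ ≤ _ := key N hN2 (D i) (hD i)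
    _ ≤ ε / 2 + ε / 2 := by
      gcongr
      · exact le_trans (by gcongr) hN1
      · exact (mul_le_mul_right hi2 K).trans ENNReal.mul_div_le
    _ = ε := ENNReal.add_halves ε

lemma tendsto_ltwo_tail {G : Rn n → ℝ≥0∞} (hG : Measurable G) (h : ltwo volume G ≠ ∞) :
    Tendsto (fun N : ℝ => ltwo volume (indicator {ξ : Rn n | N < ‖ξ‖} G)) atTop (𝓝 0) := by
  have h1 : Tendsto (fun N : ℝ => ∫⁻ ξ, (indicator {ξ : Rn n | N < ‖ξ‖} G ξ) ^ 2) atTop (𝓝 0) := by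
    have := tendsto_lintegral_filter_of_dominated_convergence (l := (atTop : Filter ℝ))
      (μ := (volume : Measure (Rn n)))
      (F := fun N ξ => (indicator {ξ : Rn n | N < ‖ξ‖} G ξ) ^ 2) (f := fun _ => 0)
      (fun ξ => G ξ ^ 2)
      (Eventually.of_forall fun N =>
        (hG.indicator (measurableSet_lt measurable_const measurable_norm)).pow_const 2)
      (Eventually.of_forall fun N => ae_of_all _ fun ξ => by
        gcongr; exact indicator_le_self _ _ _)
      (by rw [← ltwo_sq]; exact ENNReal.pow_ne_top h)
      (ae_of_all _ fun ξ => by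
        refine tendsto_const_nhds.congr' ?_
        filter_upwards [eventually_ge_atTop ‖ξ‖] with N hN
        simp [indicator, not_lt.2 hN])
    simpa using this
  have h2 := (ENNReal.continuous_rpow_const (y := (1 / 2 : ℝ))).tendsto 0 |>.comp h1
  simpa [ltwo, Function.comp_def] using h2

/-- Boundedness for the exponent `a` and convergence for some exponent imply weak convergence for
the exponent `a`. -/
lemma tendsto_lintegral_of_bounded {ι : Type*} {l : Filter ι} {ν a a' b ρ : ℝ}
    {D : ι → Rn n → ℝ≥0∞} {M : ℝ≥0∞} (hM : M ≠ ∞) (hD : ∀ i, Measurable (D i))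
    (hb : ∀ᶠ i in l, wl ν a b ρ (D i) ≤ M)
    (h0 : Tendsto (fun i => wl ν a' b ρ (D i)) l (𝓝 0)) {G : Rn n → ℝ≥0∞} (hG : Measurable G)
    (hG2 : ltwo volume G ≠ ∞) :
    Tendsto (fun i => ∫⁻ ξ, G ξ * (ew ν a b ρ ξ * D i ξ)) l (𝓝 0) := by
  -- At the top exponent high frequencies gain nothing from the weight; their smallness comes from
  -- the L² tail of the fixed function G.
  have key : ∀ N : ℝ, 1 ≤ N → ∀ F : Rn n → ℝ≥0∞, Measurable F →
      ∫⁻ ξ, G ξ * (ew ν a b ρ ξ * F ξ) ≤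
      ltwo volume (indicator {ξ : Rn n | N < ‖ξ‖} G) * wl ν a b ρ F +
        ENNReal.ofReal (N ^ max (a - a') 0) * ltwo volume G * wl ν a' b ρ F := by
    intro N hN F hF
    have hi : Measurable (indicator {ξ : Rn n | N < ‖ξ‖} G) :=
      hG.indicator (measurableSet_lt measurable_const measurable_norm)
    have hm : ∀ a, Measurable fun ξ : Rn n => ew ν a b ρ ξ * F ξ := fun a =>
      (measurable_ew _ _ _ _).mul hF
    calc _ ≤ ∫⁻ ξ, (indicator {ξ : Rn n | N < ‖ξ‖} G ξ * (ew ν a b ρ ξ * F ξ) +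
          ENNReal.ofReal (N ^ max (a - a') 0) * (G ξ * (ew ν a' b ρ ξ * F ξ))) := by
          refine lintegral_mono fun ξ => ?_
          by_cases h : ‖ξ‖ ≤ N
          · refine le_trans ?_ le_add_self
            calc _ ≤ G ξ * (ENNReal.ofReal (N ^ max (a - a') 0) * ew ν a' b ρ ξ * F ξ) := by
                  gcongr; exact ew_le_of_norm_le hN _ _ _ _ _ h
              _ = _ := by ring
          · refine le_trans ?_ le_self_add
            rw [indicator_of_mem (show ξ ∈ {ξ : Rn n | N < ‖ξ‖} from not_le.1 h)]
      _ = (∫⁻ ξ, indicator {ξ : Rn n | N < ‖ξ‖} G ξ * (ew ν a b ρ ξ * F ξ)) +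
          ENNReal.ofReal (N ^ max (a - a') 0) * ∫⁻ ξ, (G ξ * (ew ν a' b ρ ξ * F ξ)) := by
          have h1 : Measurable fun ξ => indicator {ξ : Rn n | N < ‖ξ‖} G ξ * (ew ν a b ρ ξ * F ξ) :=
            hi.mul (hm a)
          have h2 : Measurable fun ξ => G ξ * (ew ν a' b ρ ξ * F ξ) := hG.mul (hm a')
          rw [lintegral_add_left h1, lintegral_const_mul _ h2]
      _ ≤ _ := by
          rw [mul_assoc]
          gcongr
          · exact lintegral_mul_le_ltwo hi.aemeasurable (hm a).aemeasurable
          · exact lintegral_mul_le_ltwo hG.aemeasurable (hm a').aemeasurable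
  rw [ENNReal.tendsto_nhds_zero] at h0 ⊢
  intro ε hε
  have hε2 : 0 < ε / 2 := ENNReal.half_pos hε.ne'
  have ht : Tendsto (fun N : ℝ => ltwo volume (indicator {ξ : Rn n | N < ‖ξ‖} G) * M) atTop
      (𝓝 0) := by
    simpa using ENNReal.Tendsto.mul_const (tendsto_ltwo_tail hG hG2) (Or.inr hM)
  obtain ⟨N, hN1, hN2⟩ := (((ENNReal.tendsto_nhds_zero.1 ht) _ hε2).and
    (eventually_ge_atTop 1)).exists
  set K := ENNReal.ofReal (N ^ max (a - a') 0) * ltwo volume G with hK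
  have h1 : 0 < ε / 2 / K :=
    ENNReal.div_pos hε2.ne' (ENNReal.mul_ne_top ENNReal.ofReal_ne_top hG2)
  filter_upwards [hb, h0 _ h1] with i hi1 hi2
  calc _ ≤ _ := key N hN2 (D i) (hD i)
    _ ≤ ε / 2 + ε / 2 := by
      gcongr
      · exact le_trans (by gcongr) hN1
      · exact (mul_le_mul_right hi2 K).trans ENNReal.mul_div_le
    _ = ε := ENNReal.add_halves ε

end Interpolation

-- Existence of limits of curves, strong and weak

section Limits

lemma enorm_weight_mul (ν a b ρ : ℝ) (ξ : Rn n) (z : ℂ) :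
    ‖(weight ν a b ρ ξ : ℂ) * z‖ₑ = ew ν a b ρ ξ * ‖z‖ₑ := by
  rw [enorm_mul, ew, ← ofReal_norm, Complex.norm_real, Real.norm_of_nonneg (weight_nonneg _ _ _ _ _)]

lemma ae_ne_top_of_wl (hn : 0 < n) {ν a b ρ : ℝ} {F : Rn n → ℝ≥0∞} (hF : Measurable F)
    (h : wl ν a b ρ F ≠ ∞) : ∀ᵐ ξ, F ξ ≠ ∞ := by
  have h1 : ∫⁻ ξ, (ew ν a b ρ ξ * F ξ) ^ 2 ≠ ∞ := by
    rw [← ltwo_sq]; exact ENNReal.pow_ne_top h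
  filter_upwards [ae_lt_top (((measurable_ew ν a b ρ).mul hF).pow_const 2) h1, ae_ne_zero hn]
    with ξ h2 h3 h4
  change (ew ν a b ρ ξ * F ξ) ^ 2 < ∞ at h2
  rw [h4, ENNReal.mul_top (ew_ne_zero _ _ _ _ h3)] at h2
  simp at h2

/-- Weak convergence on the Fourier side, from boundedness and convergence in a weaker norm. -/
lemma tendsto_integral_weight {ν a a' b ρ : ℝ} {U : ℝ → Rn n → ℂ} {V : Rn n → ℂ} {M : ℝ≥0∞}
    {T : ℝ} (hU : ∀ t, Measurable (U t)) (hV : Measurable V) (hM : M ≠ ∞)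
    (hUM : ∀ t ∈ Ici T, wl ν a b ρ (fun ξ => ‖U t ξ‖ₑ) ≤ M)
    (hVM : wl ν a b ρ (fun ξ => ‖V ξ‖ₑ) ≤ M)
    (h0 : Tendsto (fun t => wl ν a' b ρ fun ξ => ‖U t ξ - V ξ‖ₑ) atTop (𝓝 0))
    {G : Rn n → ℂ} (hG : MemLp G 2 volume) :
    Tendsto (fun t => ∫ ξ, conj (G ξ) * ((weight ν a b ρ ξ : ℂ) * U t ξ)) atTop
      (𝓝 (∫ ξ, conj (G ξ) * ((weight ν a b ρ ξ : ℂ) * V ξ))) := by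
  have hmw : Measurable fun ξ : Rn n => (weight ν a b ρ ξ : ℂ) :=
    Complex.measurable_ofReal.comp (measurable_weight _ _ _ _)
  have hmem : ∀ {v : Rn n → ℂ}, Measurable v → wl ν a b ρ (fun ξ => ‖v ξ‖ₑ) ≤ M →
      Integrable fun ξ => conj (G ξ) * ((weight ν a b ρ ξ : ℂ) * v ξ) := by
    intro v hv hvM
    have h1 : MemLp (fun ξ => (weight ν a b ρ ξ : ℂ) * v ξ) 2 volume := by
      refine ⟨(hmw.mul hv).aestronglyMeasurable, ?_⟩
      rw [eLpNorm_two_eq]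
      simp only [enorm_weight_mul]
      exact lt_of_le_of_lt hvM hM.lt_top
    exact hG.star.integrable_mul h1
  obtain ⟨g, hg, hgG⟩ := hG.1.aemeasurable
  have hg2 : ltwo volume (fun ξ => ‖g ξ‖ₑ) ≠ ∞ := by
    rw [← eLpNorm_two_eq, ← eLpNorm_congr_ae hgG]; exact hG.2.ne
  have hb : ∀ᶠ t in atTop, wl ν a b ρ (fun ξ => ‖U t ξ - V ξ‖ₑ) ≤ M + M := by
    filter_upwards [eventually_ge_atTop T] with t ht
    refine (wl_mono (ae_of_all _ fun ξ => enorm_sub_le)).trans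
      ((wl_add_le (hU t).enorm.aemeasurable hV.enorm.aemeasurable).trans ?_)
    gcongr
    exact hUM t ht
  have key := tendsto_lintegral_of_bounded (ENNReal.add_ne_top.2 ⟨hM, hM⟩)
    (fun t => ((hU t).sub hV).enorm) hb h0 hg.enorm hg2
  rw [tendsto_iff_edist_tendsto_0]
  refine tendsto_of_tendsto_of_tendsto_of_le_of_le' tendsto_const_nhds key
    (Eventually.of_forall fun _ => zero_le) ?_
  filter_upwards [eventually_ge_atTop T] with t ht
  rw [edist_eq_enorm_sub, ← integral_sub (hmem (hU t) (hUM t ht)) (hmem hV hVM)]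
  refine (enorm_integral_le_lintegral_enorm _).trans (le_of_eq (lintegral_congr_ae ?_))
  filter_upwards [hgG] with ξ hξ
  rw [← mul_sub, ← mul_sub, enorm_mul, enorm_weight_mul, hξ, RCLike.enorm_conj]
  rfl

lemma tendsto_lintegral_Ioi_zero {f : ℝ → ℝ≥0∞} (hf : Measurable f) {T : ℝ}
    (h : ∫⁻ τ in Ioi T, f τ ≠ ∞) : Tendsto (fun t => ∫⁻ τ in Ioi t, f τ) atTop (𝓝 0) := by
  have := tendsto_lintegral_filter_of_dominated_convergence (l := (atTop : Filter ℝ))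
    (μ := volume.restrict (Ioi T)) (F := fun t => indicator (Ioi t) f) (f := fun _ => 0) f
    (Eventually.of_forall fun t => hf.indicator measurableSet_Ioi)
    (Eventually.of_forall fun t => ae_of_all _ fun τ => indicator_le_self _ _ _) h
    (ae_of_all _ fun τ => by
      refine tendsto_const_nhds.congr' ?_
      filter_upwards [eventually_ge_atTop τ] with t ht
      simp [indicator, not_lt.2 ht])
  rw [lintegral_zero] at this
  refine this.congr' ?_
  filter_upwards [eventually_ge_atTop T] with t ht
  rw [lintegral_indicator measurableSet_Ioi, Measure.restrict_restrict measurableSet_Ioi,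
    inter_eq_left.2 (Ioi_subset_Ioi ht)]

/-- A curve with integrable velocity in a weak norm, bounded in a strong norm, has a limit. -/
lemma exists_limit (hn : 0 < n) {ν a a' b ρ T : ℝ} {U R : ℝ → Rn n → ℂ} {M : ℝ≥0∞}
    (hU : ∀ t, Measurable (U t)) (hR : Measurable (Function.uncurry R))
    (hUM : ∀ t ∈ Ici T, wl ν a b ρ (fun ξ => ‖U t ξ‖ₑ) ≤ M)
    (hode : ∀ t ∈ Ici T, ∀ᵐ ξ, U t ξ - U T ξ = ∫ τ in Ioc T t, R τ ξ)
    (hRD : ∫⁻ τ in Ioi T, wl ν a' b ρ (fun ξ => ‖R τ ξ‖ₑ) ≠ ∞) :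
    ∃ V : Rn n → ℂ, Measurable V ∧ wl ν a b ρ (fun ξ => ‖V ξ‖ₑ) ≤ M ∧
      (∀ t ∈ Ici T, wl ν a' b ρ (fun ξ => ‖U t ξ - V ξ‖ₑ) ≤
        ∫⁻ τ in Ioi t, wl ν a' b ρ (fun ξ => ‖R τ ξ‖ₑ)) ∧
      Tendsto (fun t => wl ν a' b ρ fun ξ => ‖U t ξ - V ξ‖ₑ) atTop (𝓝 0) := by
  have hRe : Measurable (Function.uncurry fun τ ξ => ‖R τ ξ‖ₑ) := hR.enorm
  have hsw : Measurable fun ξ => ∫⁻ τ in Ioi T, ‖R τ ξ‖ₑ :=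
    Measurable.lintegral_prod_left' (f := fun z : ℝ × Rn n => ‖R z.1 z.2‖ₑ) hRe
  have hfin : ∀ᵐ ξ, ∫⁻ τ in Ioi T, ‖R τ ξ‖ₑ ≠ ∞ :=
    ae_ne_top_of_wl hn hsw (ne_top_of_le_ne_top hRD (wl_lintegral_le hRe))
  -- The limit is defined by integrating the velocity to infinity; the integral converges for almost
  -- every ξ because its weighted L² norm is finite by Minkowski's inequality.
  let V : Rn n → ℂ := fun ξ => U T ξ + ∫ τ in Ioi T, R τ ξ
  have hV : Measurable V := (hU T).add
    ((hR.stronglyMeasurable.integral_prod_left (μ := volume.restrict (Ioi T))).measurable)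
  have hdiff : ∀ t ∈ Ici T, ∀ᵐ ξ, U t ξ - V ξ = -∫ τ in Ioi t, R τ ξ := by
    intro t ht
    filter_upwards [hode t ht, hfin] with ξ h1 h2
    have hi : IntegrableOn (fun τ => R τ ξ) (Ioi T) :=
      ⟨(hR.comp (by fun_prop : Measurable fun τ : ℝ => (τ, ξ))).aestronglyMeasurable, h2.lt_top⟩
    have h3 : ∫ τ in Ioi T, R τ ξ = (∫ τ in Ioc T t, R τ ξ) + ∫ τ in Ioi t, R τ ξ := by
      rw [← setIntegral_union (Ioc_disjoint_Ioi le_rfl)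
        measurableSet_Ioi (hi.mono_set Ioc_subset_Ioi_self) (hi.mono_set (Ioi_subset_Ioi ht)),
        Ioc_union_Ioi_eq_Ioi ht]
    simp only [V]
    rw [h3, ← h1]; ring
  have hdle : ∀ t ∈ Ici T, wl ν a' b ρ (fun ξ => ‖U t ξ - V ξ‖ₑ) ≤
        ∫⁻ τ in Ioi t, wl ν a' b ρ (fun ξ => ‖R τ ξ‖ₑ) := by
    intro t ht
    refine le_trans (wl_mono ?_) (wl_lintegral_le hRe)
    filter_upwards [hdiff t ht] with ξ h
    rw [h, enorm_neg]
    exact enorm_integral_le_lintegral_enorm _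
  refine ⟨V, hV, ?_, hdle, ?_⟩
  -- The strong bound is transferred to V by Fatou's lemma along the times T + N, at which the
  -- convergence is pointwise almost everywhere.
  · have hlim : ∀ᵐ ξ, Tendsto (fun N : ℕ => U (T + N) ξ) atTop (𝓝 (V ξ)) := by
      have hN : ∀ᵐ ξ, ∀ N : ℕ, U (T + N) ξ - V ξ = -∫ τ in Ioi (T + N), R τ ξ :=
        ae_all_iff.2 fun N => hdiff _ (by simp)
      filter_upwards [hN, hfin] with ξ h1 h2
      have h3 := (tendsto_lintegral_Ioi_zero (hRe.comp
        (by fun_prop : Measurable fun τ : ℝ => (τ, ξ))) h2).comp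
        (tendsto_atTop_add_const_left atTop T tendsto_natCast_atTop_atTop)
      rw [tendsto_iff_edist_tendsto_0]
      refine tendsto_of_tendsto_of_tendsto_of_le_of_le tendsto_const_nhds h3
        (fun _ => zero_le) fun N => ?_
      rw [edist_eq_enorm_sub, h1 N, enorm_neg]
      exact enorm_integral_le_lintegral_enorm _
    have hm : ∀ N : ℕ, Measurable fun ξ => (ew ν a b ρ ξ * ‖U (T + N) ξ‖ₑ) ^ 2 := fun N =>
      ((measurable_ew _ _ _ _).mul (hU _).enorm).pow_const 2
    have h4 : ∫⁻ ξ, (ew ν a b ρ ξ * ‖V ξ‖ₑ) ^ 2 ≤ M ^ 2 := by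
      calc _ = ∫⁻ ξ, liminf (fun N : ℕ => (ew ν a b ρ ξ * ‖U (T + N) ξ‖ₑ) ^ 2) atTop := by
            refine lintegral_congr_ae ?_
            filter_upwards [hlim] with ξ h
            refine (Tendsto.liminf_eq ?_).symm
            exact ((ENNReal.continuous_pow 2).tendsto _).comp (ENNReal.Tendsto.const_mul
              ((continuous_enorm.tendsto _).comp h) (Or.inr (ew_ne_top _ _ _ _ _)))
        _ ≤ liminf (fun N : ℕ => ∫⁻ ξ, (ew ν a b ρ ξ * ‖U (T + N) ξ‖ₑ) ^ 2) atTop :=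
            lintegral_liminf_le hm
        _ ≤ M ^ 2 := by
            refine liminf_le_of_le (by isBoundedDefault) fun c hc => ?_
            obtain ⟨N, hN⟩ := hc.exists
            refine hN.trans ?_
            rw [← ltwo_sq]
            gcongr
            exact hUM (T + N) (by simp)
    rw [← ltwo_sq] at h4
    exact (ENNReal.pow_le_pow_left_iff two_ne_zero).1 h4
  · refine tendsto_of_tendsto_of_tendsto_of_le_of_le' tendsto_const_nhds
      (tendsto_lintegral_Ioi_zero (measurable_wl measurable_const hRe) hRD)
      (Eventually.of_forall fun _ => zero_le) ?_
    filter_upwards [eventually_ge_atTop T] with t ht using hdle t ht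

end Limits

-- Symmetrization of the transport form

section Symmetrization

lemma enorm_inner_le (x y : Rn n) : ‖((inner ℝ x y : ℝ) : ℂ)‖ₑ ≤ ‖x‖ₑ * ‖y‖ₑ := by
  rw [← ofReal_norm, Complex.norm_real, ← ofReal_norm, ← ofReal_norm,
    ← ENNReal.ofReal_mul (norm_nonneg _)]
  exact ENNReal.ofReal_le_ofReal (norm_inner_le_norm x y)

lemma gradDotHat_eq_integral {v u : Rn n → ℂ} (hv : Measurable v) (hu : Measurable u) {ξ : Rn n}
    (h : lconv (fun ζ => ‖ζ‖ₑ * ‖v ζ‖ₑ) (fun η => ‖η‖ₑ * ‖u η‖ₑ) ξ ≠ ∞) :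
    gradDotHat v u ξ = -(unitFactor n : ℂ) *
      ∫ η, ((inner ℝ (ξ - η) η : ℝ) : ℂ) * (v (ξ - η) * u η) := by
  have hi : ∀ j, Integrable fun η => derivHat j v (ξ - η) * derivHat j u η := fun j => by
    refine ⟨?_, lt_of_le_of_lt (lintegral_mono fun η => ?_) h.lt_top⟩
    · unfold derivHat
      have := hv.comp (measurable_id.const_sub ξ)
      exact Measurable.aestronglyMeasurable (by fun_prop)
    · rw [enorm_mul]
      gcongr
      · exact enorm_derivHat_le j v _
      · exact enorm_derivHat_le j u _
  simp only [gradDotHat, mulHat]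
  rw [← Finset.mul_sum, ← integral_finsetSum _ fun j _ => hi j, neg_mul, ← mul_neg, ← integral_neg]
  congr 2
  funext η
  rw [PiLp.inner_apply, Complex.ofReal_sum, Finset.sum_mul, ← Finset.sum_neg_distrib]
  refine Finset.sum_congr rfl fun j _ => ?_
  simp only [derivHat, RCLike.inner_apply, conj_trivial, Complex.ofReal_mul, PiLp.sub_apply]
  linear_combination (((ξ j - η j : ℝ) : ℂ) * v (ξ - η) * (((η j : ℝ) : ℂ) * u η)) *
    Complex.I_mul_I

/-- Symmetrization of the quadratic form `⟨u, W² ∇v·∇u⟩` for a real function with Fourier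
transform `v`. -/
lemma ofReal_integral_gradDotHat_le {ν a b ρ : ℝ} {v u : Rn n → ℂ} (hv : Measurable v)
    (hu : Measurable u) (hreal : ∀ᵐ ζ, v (-ζ) = conj (v ζ))
    (h : ∫⁻ ξ, ew ν a b ρ ξ ^ 2 * (‖u ξ‖ₑ *
      lconv (fun ζ => ‖ζ‖ₑ * ‖v ζ‖ₑ) (fun η => ‖η‖ₑ * ‖u η‖ₑ) ξ) ≠ ∞) :
    ENNReal.ofReal (2 * ∫ ξ, weight ν a b ρ ξ ^ 2 * (conj (u ξ) * gradDotHat v u ξ).re) ≤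
      ∫⁻ ξ, ∫⁻ η, ENNReal.ofReal |commKernel ν a b ρ ξ η| * (‖u ξ‖ₑ * ‖v (ξ - η)‖ₑ * ‖u η‖ₑ) := by
  let m : Rn n → ℝ := fun ξ => weight ν a b ρ ξ ^ 2
  have hm : Measurable m := (measurable_weight _ _ _ _).pow_const 2
  let Φ : Rn n × Rn n → ℂ := fun z => (m z.1 : ℂ) * (conj (u z.1) *
    (((inner ℝ (z.1 - z.2) z.2 : ℝ) : ℂ) * (v (z.1 - z.2) * u z.2)))
  have hΦm : Measurable Φ := by
    have h1 : Measurable fun z : Rn n × Rn n => v (z.1 - z.2) :=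
      hv.comp (measurable_fst.sub measurable_snd)
    have h2 : Measurable fun z : Rn n × Rn n => conj (u z.1) :=
      Complex.continuous_conj.measurable.comp (hu.comp measurable_fst)
    have h3 : Measurable fun z : Rn n × Rn n => (m z.1 : ℂ) :=
      Complex.measurable_ofReal.comp (hm.comp measurable_fst)
    have h4 : Measurable fun z : Rn n × Rn n => ((inner ℝ (z.1 - z.2) z.2 : ℝ) : ℂ) := by fun_prop
    exact h3.mul (h2.mul (h4.mul (h1.mul (hu.comp measurable_snd))))
  have hme : ∀ ξ, ‖(m ξ : ℂ)‖ₑ = ew ν a b ρ ξ ^ 2 := fun ξ => by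
    rw [← ofReal_norm, Complex.norm_real, Real.norm_of_nonneg (sq_nonneg _), ew,
      ENNReal.ofReal_pow (weight_nonneg _ _ _ _ _)]
  have hinner : ∀ ξ, ∫⁻ η, ‖Φ (ξ, η)‖ₑ ≤ ew ν a b ρ ξ ^ 2 * (‖u ξ‖ₑ *
      lconv (fun ζ => ‖ζ‖ₑ * ‖v ζ‖ₑ) (fun η => ‖η‖ₑ * ‖u η‖ₑ) ξ) := fun ξ => by
    have e : ∀ η, ‖Φ (ξ, η)‖ₑ ≤ ew ν a b ρ ξ ^ 2 * (‖u ξ‖ₑ *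
        (‖ξ - η‖ₑ * ‖v (ξ - η)‖ₑ * (‖η‖ₑ * ‖u η‖ₑ))) := fun η => by
      simp only [Φ, enorm_mul, hme, RCLike.enorm_conj]
      calc _ ≤ ew ν a b ρ ξ ^ 2 * (‖u ξ‖ₑ *
            (‖ξ - η‖ₑ * ‖η‖ₑ * (‖v (ξ - η)‖ₑ * ‖u η‖ₑ))) := by gcongr; exact enorm_inner_le _ _
        _ = _ := by ring
    have hmm : Measurable fun η => ‖ξ - η‖ₑ * ‖v (ξ - η)‖ₑ * (‖η‖ₑ * ‖u η‖ₑ) := by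
      have := hv.comp (measurable_id.const_sub ξ)
      have h2 : Measurable fun η => ‖v (ξ - η)‖ₑ := this.enorm
      fun_prop
    refine (lintegral_mono e).trans (le_of_eq ?_)
    rw [lintegral_const_mul _ (hmm.const_mul _), lintegral_const_mul _ hmm]
    rfl
  have hΦ : Integrable Φ (volume.prod volume) := by
    refine ⟨hΦm.aestronglyMeasurable, ?_⟩
    rw [HasFiniteIntegral, lintegral_prod _ hΦm.enorm.aemeasurable]
    exact lt_of_le_of_lt (lintegral_mono hinner) h.lt_top
  -- The hypothesis gives a finite convolution only where the weight and u do not vanish; elsewhere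
  -- both sides of the identity below are zero.
  have hfin : ∀ᵐ ξ, m ξ ≠ 0 → u ξ ≠ 0 →
      lconv (fun ζ => ‖ζ‖ₑ * ‖v ζ‖ₑ) (fun η => ‖η‖ₑ * ‖u η‖ₑ) ξ ≠ ∞ := by
    have hmeas : Measurable fun ξ => ew ν a b ρ ξ ^ 2 * (‖u ξ‖ₑ *
        lconv (fun ζ => ‖ζ‖ₑ * ‖v ζ‖ₑ) (fun η => ‖η‖ₑ * ‖u η‖ₑ) ξ) :=
      ((measurable_ew _ _ _ _).pow_const 2).mul (hu.enorm.mul (measurable_lconv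
        (measurable_enorm.mul hv.enorm) (measurable_enorm.mul hu.enorm)))
    filter_upwards [ae_lt_top hmeas h] with ξ h1 h2 h3 h4
    rw [h4, ENNReal.mul_top (by simpa using h3), ENNReal.mul_top] at h1
    · simp at h1
    · rw [← hme]; simpa using h2
  have e1 : (∫ ξ, m ξ * (conj (u ξ) * gradDotHat v u ξ).re) =
      -unitFactor n * (∫ ξ, ∫ η, Φ (ξ, η)).re := by
    have h1 : ∀ᵐ ξ, ((m ξ * (conj (u ξ) * gradDotHat v u ξ).re : ℝ)) =
        -unitFactor n * (∫ η, Φ (ξ, η)).re := by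
      filter_upwards [hfin] with ξ hξ
      simp only [Φ]
      rw [integral_const_mul, integral_const_mul]
      by_cases hm0 : m ξ = 0
      · simp [hm0]
      by_cases hu0 : u ξ = 0
      · simp [hu0]
      rw [gradDotHat_eq_integral hv hu (hξ hm0 hu0), ← Complex.re_ofReal_mul,
        ← Complex.re_ofReal_mul]
      congr 1
      push_cast; ring
    rw [integral_congr_ae h1, integral_const_mul]
    congr 1
    exact integral_re hΦ.integral_prod_left
  -- Exchange the variables and conjugate: as v(-ζ) is the conjugate of v(ζ), the same real part is
  -- obtained with the weight at η and the inner product with -ξ. Adding the two forms produces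
  -- `commKernel`.
  have e2 : (∫ ξ, ∫ η, Φ (ξ, η)).re =
      (∫ ξ, ∫ η, -((m η : ℂ) * (conj (u ξ) *
        (((inner ℝ (ξ - η) ξ : ℝ) : ℂ) * (v (ξ - η) * u η))))).re := by
    rw [integral_integral_swap hΦ, ← Complex.conj_re, ← integral_conj]
    congr 2
    funext ξ
    rw [← integral_conj]
    refine integral_congr_ae ?_
    filter_upwards [(quasiMeasurePreserving_sub_left volume ξ).ae hreal] with η hη
    simp only [Φ, map_mul, Complex.conj_ofReal, Complex.conj_conj]
    rw [show η - ξ = -(ξ - η) by abel, hη, Complex.conj_conj, inner_neg_left]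
    push_cast; ring
  let Ψ : Rn n × Rn n → ℂ := fun z => -((m z.2 : ℂ) * (conj (u z.1) *
        (((inner ℝ (z.1 - z.2) z.1 : ℝ) : ℂ) * (v (z.1 - z.2) * u z.2))))
  have hΨ : Integrable Ψ (volume.prod volume) := by
    have hs := hΦ.swap.norm
    refine (integrable_norm_iff ?_).1 (hs.congr ?_)
    · have h1 : Measurable fun z : Rn n × Rn n => v (z.1 - z.2) :=
        hv.comp (measurable_fst.sub measurable_snd)
      have h2 : Measurable fun z : Rn n × Rn n => conj (u z.1) :=
        Complex.continuous_conj.measurable.comp (hu.comp measurable_fst)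
      have h3 : Measurable fun z : Rn n × Rn n => (m z.2 : ℂ) :=
        Complex.measurable_ofReal.comp (hm.comp measurable_snd)
      have h4 : Measurable fun z : Rn n × Rn n => ((inner ℝ (z.1 - z.2) z.1 : ℝ) : ℂ) := by fun_prop
      exact (h3.mul (h2.mul (h4.mul (h1.mul (hu.comp measurable_snd))))).neg.aestronglyMeasurable
    · have hq : Measure.QuasiMeasurePreserving (fun z : Rn n × Rn n => z.1 - z.2)
          (volume.prod volume) volume :=
        quasiMeasurePreserving_sub volume volume
      filter_upwards [hq.ae hreal] with z hz
      simp only [Function.comp_apply, Prod.swap, Φ, Ψ, norm_neg, norm_mul, RCLike.norm_conj]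
      rw [show z.2 - z.1 = -(z.1 - z.2) by abel, hz, inner_neg_left, RCLike.norm_conj,
        Complex.ofReal_neg, norm_neg]
      ring
  have e3 : 2 * (∫ ξ, ∫ η, Φ (ξ, η)).re = (∫ z, (Φ z + Ψ z) ∂(volume.prod volume)).re := by
    rw [integral_add hΦ hΨ, Complex.add_re, integral_prod _ hΦ, integral_prod _ hΨ, two_mul]
    nth_rw 2 [e2]
  have e4 : ∀ z, Φ z + Ψ z = (commKernel ν a b ρ z.1 z.2 : ℂ) *
      (conj (u z.1) * v (z.1 - z.2) * u z.2) := fun z => by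
    simp only [Φ, Ψ, m, commKernel]; push_cast; ring
  have e5 : 2 * ∫ ξ, weight ν a b ρ ξ ^ 2 * (conj (u ξ) * gradDotHat v u ξ).re =
      -unitFactor n * (∫ z, (Φ z + Ψ z) ∂(volume.prod volume)).re := by
    rw [← e3]; change 2 * (∫ ξ, m ξ * _) = _; rw [e1]; ring
  rw [e5]
  have h6 : -unitFactor n * (∫ z, (Φ z + Ψ z) ∂(volume.prod volume)).re ≤
      ‖∫ z, (Φ z + Ψ z) ∂(volume.prod volume)‖ := by
    have := Complex.abs_re_le_norm (∫ z, (Φ z + Ψ z) ∂(volume.prod volume))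
    have h7 := unitFactor_le_one n
    have h8 := unitFactor_pos n
    have h9 := neg_abs_le (∫ z, (Φ z + Ψ z) ∂(volume.prod volume)).re
    have h10 := abs_nonneg (∫ z, (Φ z + Ψ z) ∂(volume.prod volume)).re
    nlinarith
  refine (ENNReal.ofReal_le_ofReal h6).trans ?_
  rw [ofReal_norm]
  refine (enorm_integral_le_lintegral_enorm _).trans (le_of_eq ?_)
  have hae : AEMeasurable (fun z => ‖Φ z + Ψ z‖ₑ) (volume.prod volume) :=
    (hΦ.add hΨ).aestronglyMeasurable.enorm
  rw [lintegral_prod _ hae]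
  simp only [e4, enorm_mul, RCLike.enorm_conj]
  refine lintegral_congr fun ξ => lintegral_congr fun η => ?_
  rw [← ofReal_norm, Complex.norm_real, Real.norm_eq_abs]

end Symmetrization

-- The energy identity with a decreasing Gevrey radius

section Energy

/-- The factor |ξ|^ν ∨ 1 arises from differentiating the weight in ρ. It equals 1 at low frequency,
so that the dissipation is exactly the square of the norm with ν/2 more derivatives. -/
lemma weight_add_half_sq {ν : ℝ} (hν : 0 ≤ ν) (a b ρ : ℝ) (ξ : Rn n) :
    max (‖ξ‖ ^ ν) 1 * weight ν a b ρ ξ ^ 2 = weight ν (a + ν / 2) b ρ ξ ^ 2 := by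
  rw [weight, weight, mul_pow, mul_pow, ← mul_assoc]
  congr 1
  split_ifs with h
  · have hx : 0 < ‖ξ‖ := by linarith
    rw [max_eq_left (Real.one_le_rpow h.le hν), ← Real.rpow_natCast, ← Real.rpow_natCast,
      ← Real.rpow_mul hx.le, ← Real.rpow_mul hx.le, ← Real.rpow_add hx]
    congr 1; push_cast; ring
  · rw [max_eq_right (Real.rpow_le_one (norm_nonneg _) (not_lt.1 h) hν), one_mul]

lemma hasDerivAt_weight {ν a b : ℝ} {r ρ : ℝ → ℝ} (hρ : ∀ τ, HasDerivAt ρ (-r τ) τ) (ξ : Rn n)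
    (τ : ℝ) : HasDerivAt (fun τ => weight ν a b (ρ τ) ξ)
      (-(r τ * max (‖ξ‖ ^ ν) 1) * weight ν a b (ρ τ) ξ) τ := by
  have h := (((hρ τ).mul_const (max (‖ξ‖ ^ ν) 1)).exp).const_mul
    (if 1 < ‖ξ‖ then ‖ξ‖ ^ a else ‖ξ‖ ^ b)
  refine h.congr_deriv ?_
  rw [weight]; ring

/-- The derivative of `|W U|²` along an absolutely continuous curve `U`, in integrated form. -/
lemma norm_weight_mul_sq_eq {ν a b : ℝ} (hν : 0 ≤ ν) {r ρ : ℝ → ℝ} (hr : Continuous r)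
    (hρ : ∀ τ, HasDerivAt ρ (-r τ) τ) (ξ : Rn n) {s t : ℝ} (hst : s ≤ t) {U f : ℝ → ℂ}
    (hf : IntegrableOn f (Ioc s t)) (hU : ∀ τ ∈ Icc s t, U τ = U s + ∫ σ in Ioc s τ, f σ) :
    weight ν a b (ρ t) ξ ^ 2 * ‖U t‖ ^ 2 = weight ν a b (ρ s) ξ ^ 2 * ‖U s‖ ^ 2 +
      ∫ τ in Ioc s t, (2 * (weight ν a b (ρ τ) ξ ^ 2 * (conj (U τ) * f τ).re) -
        2 * (r τ * (weight ν (a + ν / 2) b (ρ τ) ξ ^ 2 * ‖U τ‖ ^ 2))) := by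
  set K := max (‖ξ‖ ^ ν) 1
  let W : ℝ → ℂ := fun τ => (weight ν a b (ρ τ) ξ : ℂ)
  let W' : ℝ → ℂ := fun τ => ((-(r τ * K) * weight ν a b (ρ τ) ξ : ℝ) : ℂ)
  have hWd : ∀ τ, HasDerivAt W (W' τ) τ := fun τ => (hasDerivAt_weight hρ ξ τ).ofReal_comp
  have hWc : Continuous W := continuous_iff_continuousAt.2 fun τ => (hWd τ).continuousAt
  have hwc : Continuous fun τ => weight ν a b (ρ τ) ξ :=
    continuous_iff_continuousAt.2 fun τ => (hasDerivAt_weight hρ ξ τ).continuousAt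
  have hW'c : Continuous W' := by fun_prop
  have hW' : ∀ t, IntegrableOn W' (Ioc s t) := fun t =>
    (hW'c.integrableOn_Icc).mono_set Ioc_subset_Icc_self
  have hW : ∀ τ ∈ Icc s t, W τ = W s + ∫ σ in Ioc s τ, W' σ := fun τ hτ => by
    have := intervalIntegral.integral_eq_sub_of_hasDerivAt (fun x _ => hWd x)
      (hW'c.intervalIntegrable s τ)
    rw [intervalIntegral.integral_of_le hτ.1] at this
    rw [this]; ring
  -- The product rule is used twice, for the weight times U and then for this product times its
  -- conjugate, because U is only absolutely continuous in time.
  obtain ⟨hy', hy⟩ := mul_eq_add_setIntegral (hW' t) hf hW hU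
  have hcy' : IntegrableOn (fun τ => conj (W' τ * U τ + W τ * f τ)) (Ioc s t) := by
    have h1 := hy'.re.ofReal (𝕜 := ℂ)
    have h2 := hy'.im.ofReal (𝕜 := ℂ)
    refine (h1.sub (h2.mul_const Complex.I)).congr (ae_of_all _ fun τ => ?_)
    apply Complex.ext <;> simp; ring
  have hcy : ∀ τ ∈ Icc s t, conj (W τ * U τ) = conj (W s * U s) +
      ∫ σ in Ioc s τ, conj (W' σ * U σ + W σ * f σ) := fun τ hτ => by
    rw [hy τ hτ, map_add, integral_conj]
  obtain ⟨hz', hz⟩ := mul_eq_add_setIntegral hy' hcy' hy hcy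
  have h1 := hz t ⟨hst, le_rfl⟩
  have e : ∀ τ, ((W τ * U τ) * conj (W τ * U τ)).re = weight ν a b (ρ τ) ξ ^ 2 * ‖U τ‖ ^ 2 :=
    fun τ => by
      rw [Complex.mul_conj, Complex.ofReal_re, Complex.normSq_eq_norm_sq, norm_mul, mul_pow]
      simp only [W, Complex.norm_real, Real.norm_eq_abs, sq_abs]
  have h2 := congrArg Complex.re h1
  rw [Complex.add_re, e, e] at h2
  rw [h2]
  congr 1
  rw [← RCLike.re_eq_complex_re, ← integral_re hz']
  refine integral_congr_ae (ae_of_all _ fun τ => ?_)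
  simp only [W, W', RCLike.re_eq_complex_re]
  have hn2 : ‖U τ‖ ^ 2 = (U τ).re * (U τ).re + (U τ).im * (U τ).im := by
    rw [← Complex.normSq_eq_norm_sq, Complex.normSq_apply]
  rw [← weight_add_half_sq hν, hn2]
  simp only [map_add, map_mul, Complex.conj_ofReal, Complex.add_re, Complex.mul_re, Complex.mul_im,
    Complex.add_im, Complex.ofReal_re, Complex.ofReal_im, Complex.conj_re, Complex.conj_im]
  ring

lemma toReal_wl_sq {ν a b ρ : ℝ} {u : Rn n → ℂ} (hu : Measurable u) :
    ∫ ξ, weight ν a b ρ ξ ^ 2 * ‖u ξ‖ ^ 2 = (wl ν a b ρ (fun ξ => ‖u ξ‖ₑ) ^ 2).toReal := by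
  have hm : Measurable fun ξ => weight ν a b ρ ξ ^ 2 * ‖u ξ‖ ^ 2 :=
    ((measurable_weight _ _ _ _).pow_const 2).mul (hu.norm.pow_const 2)
  rw [wl, ltwo_sq, integral_eq_lintegral_of_nonneg_ae (ae_of_all _ fun ξ => by positivity)
    hm.aestronglyMeasurable]
  congr 1
  refine lintegral_congr fun ξ => ?_
  rw [ENNReal.ofReal_mul (by positivity), ENNReal.ofReal_pow (weight_nonneg _ _ _ _ _),
    ENNReal.ofReal_pow (norm_nonneg _), ofReal_norm, mul_pow, ew]

lemma measurable_uncurry_weight {ν a b : ℝ} {ρ : ℝ → ℝ} (hρ : Measurable ρ) :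
    Measurable fun z : ℝ × Rn n => weight ν a b (ρ z.1) z.2 := by
  unfold weight
  refine Measurable.mul (Measurable.ite ?_ (by fun_prop) (by fun_prop)) (by fun_prop)
  exact measurableSet_lt measurable_const measurable_snd.norm

/-- The energy inequality for a curve on the Fourier side with velocity `R`. -/
lemma wl_sq_add_le {ν a b : ℝ} (hν : 0 ≤ ν) {r ρ : ℝ → ℝ} (hr : Continuous r)
    (hr0 : ∀ τ, 0 ≤ r τ) (hρ : ∀ τ, HasDerivAt ρ (-r τ) τ) {s t : ℝ} (hst : s ≤ t)
    {u R : ℝ → Rn n → ℂ} (hu : Measurable (Function.uncurry u))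
    (hR : Measurable (Function.uncurry R))
    (hode : ∀ τ ∈ Icc s t, ∀ᵐ ξ, u τ ξ - u s ξ = ∫ σ in Ioc s τ, R σ ξ)
    (hRi : ∫⁻ τ in Ioc s t, ∫⁻ ξ, ‖R τ ξ‖ₑ ≠ ∞)
    (hA : ∫⁻ τ in Ioc s t, ∫⁻ ξ, ew ν a b (ρ τ) ξ ^ 2 * (‖u τ ξ‖ₑ * ‖R τ ξ‖ₑ) ≠ ∞)
    (hJ : ∫⁻ τ in Ioc s t, ENNReal.ofReal (r τ) *
      wl ν (a + ν / 2) b (ρ τ) (fun ξ => ‖u τ ξ‖ₑ) ^ 2 ≠ ∞)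
    (hs : wl ν a b (ρ s) (fun ξ => ‖u s ξ‖ₑ) ≠ ∞) (ht : wl ν a b (ρ t) (fun ξ => ‖u t ξ‖ₑ) ≠ ∞)
    {Q : ℝ → ℝ≥0∞}
    (hQ : ∀ᵐ τ ∂volume.restrict (Ioc s t), ENNReal.ofReal (2 * ∫ ξ, weight ν a b (ρ τ) ξ ^ 2 *
      (conj (u τ ξ) * R τ ξ).re) ≤ Q τ) :
    wl ν a b (ρ t) (fun ξ => ‖u t ξ‖ₑ) ^ 2 + 2 * ∫⁻ τ in Ioc s t, ENNReal.ofReal (r τ) *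
      wl ν (a + ν / 2) b (ρ τ) (fun ξ => ‖u τ ξ‖ₑ) ^ 2 ≤
    wl ν a b (ρ s) (fun ξ => ‖u s ξ‖ₑ) ^ 2 + ∫⁻ τ in Ioc s t, Q τ := by
  set m : Measure ℝ := volume.restrict (Ioc s t) with hm
  have hρc : Continuous ρ := continuous_iff_continuousAt.2 fun τ => (hρ τ).continuousAt
  have hwm : ∀ a, Measurable fun z : ℝ × Rn n => weight ν a b (ρ z.1) z.2 ^ 2 := fun a =>
    (measurable_uncurry_weight hρc.measurable).pow_const 2
  have huξ : ∀ τ, Measurable (u τ) := fun τ => hu.of_uncurry_left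
  let Ψ₁ : ℝ → Rn n → ℝ := fun τ ξ => weight ν a b (ρ τ) ξ ^ 2 * (conj (u τ ξ) * R τ ξ).re
  let Ψ₂ : ℝ → Rn n → ℝ := fun τ ξ => r τ * (weight ν (a + ν / 2) b (ρ τ) ξ ^ 2 * ‖u τ ξ‖ ^ 2)
  have hΨ₁m : Measurable (Function.uncurry Ψ₁) :=
    (hwm a).mul (Complex.measurable_re.comp ((Complex.continuous_conj.measurable.comp hu).mul hR))
  have hΨ₂m : Measurable (Function.uncurry Ψ₂) :=
    (hr.measurable.comp measurable_fst).mul ((hwm _).mul (hu.norm.pow_const 2))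
  have hΨ₁ : Integrable (Function.uncurry Ψ₁) (m.prod volume) := by
    refine ⟨hΨ₁m.aestronglyMeasurable, ?_⟩
    rw [HasFiniteIntegral, lintegral_prod _ hΨ₁m.enorm.aemeasurable]
    refine lt_of_le_of_lt (lintegral_mono fun τ => lintegral_mono fun ξ => ?_) hA.lt_top
    simp only [Function.uncurry, Ψ₁, enorm_mul, enorm_pow]
    gcongr
    · rw [ew, ← ofReal_norm, Real.norm_of_nonneg (weight_nonneg _ _ _ _ _)]
    · rw [← RCLike.enorm_conj (u τ ξ), ← enorm_mul, ← ofReal_norm, ← ofReal_norm]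
      exact ENNReal.ofReal_le_ofReal (Complex.abs_re_le_norm _)
  have hΨ₂e : ∀ τ, ∫⁻ ξ, ‖Ψ₂ τ ξ‖ₑ = ENNReal.ofReal (r τ) *
      wl ν (a + ν / 2) b (ρ τ) (fun ξ => ‖u τ ξ‖ₑ) ^ 2 := fun τ => by
    have hmm : Measurable fun ξ => (ew ν (a + ν / 2) b (ρ τ) ξ * ‖u τ ξ‖ₑ) ^ 2 :=
      ((measurable_ew _ _ _ _).mul (huξ τ).enorm).pow_const 2
    rw [wl, ltwo_sq, ← lintegral_const_mul _ hmm]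
    refine lintegral_congr fun ξ => ?_
    simp only [Ψ₂, enorm_mul, enorm_pow, mul_pow]
    rw [ew, ← ofReal_norm, Real.norm_of_nonneg (hr0 τ), ← ofReal_norm,
      Real.norm_of_nonneg (weight_nonneg _ _ _ _ _), enorm_norm]
  have hΨ₂ : Integrable (Function.uncurry Ψ₂) (m.prod volume) := by
    refine ⟨hΨ₂m.aestronglyMeasurable, ?_⟩
    rw [HasFiniteIntegral, lintegral_prod _ hΨ₂m.enorm.aemeasurable]
    simp only [Function.uncurry, hΨ₂e]
    exact hJ.lt_top
  -- The evolution equation holds for each time outside a null set that depends on the time. For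
  -- almost every ξ the function v is absolutely continuous in τ, and by Tonelli it agrees with u at
  -- almost every τ.
  let v : ℝ → Rn n → ℂ := fun τ ξ => u s ξ + ∫ σ in Ioc s τ, R σ ξ
  have hv : Measurable (Function.uncurry v) := by
    have h1 : StronglyMeasurable (Function.uncurry fun (z : ℝ × Rn n) (σ : ℝ) =>
        indicator {q : (ℝ × Rn n) × ℝ | s < q.2 ∧ q.2 ≤ q.1.1} (fun q => R q.2 q.1.2) (z, σ)) := by
      refine Measurable.stronglyMeasurable (Measurable.indicator ?_ ?_)
      · exact hR.comp (by fun_prop : Measurable fun q : (ℝ × Rn n) × ℝ => (q.2, q.1.2))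
      · exact (measurableSet_lt measurable_const measurable_snd).inter
          (measurableSet_le measurable_snd (measurable_fst.comp measurable_fst))
    have h2 := h1.integral_prod_right (ν := (volume : Measure ℝ))
    have h3 : Measurable fun z : ℝ × Rn n => ∫ σ in Ioc s z.1, R σ z.2 := by
      simp only [← integral_indicator measurableSet_Ioc]
      exact h2.measurable
    exact ((huξ s).comp measurable_snd).add h3
  have hvu : ∀ᵐ ξ, ∀ᵐ τ ∂m, u τ ξ = v τ ξ := by
    refine (Measure.ae_ae_comm (p := fun τ ξ => u τ ξ = v τ ξ) (measurableSet_eq_fun hu hv)).1 ?_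
    refine (ae_restrict_iff' measurableSet_Ioc).2 (ae_of_all _ fun τ hτ => ?_)
    filter_upwards [hode τ (Ioc_subset_Icc_self hτ)] with ξ h
    simp only [v, ← h]; ring
  have hRξ : ∀ᵐ ξ, IntegrableOn (fun τ => R τ ξ) (Ioc s t) := by
    have h1 : Integrable (Function.uncurry R) (m.prod volume) := by
      refine ⟨hR.aestronglyMeasurable, ?_⟩
      rw [HasFiniteIntegral, lintegral_prod _ hR.enorm.aemeasurable]
      exact hRi.lt_top
    exact h1.prod_left_ae
  have hpt : ∀ᵐ ξ, weight ν a b (ρ t) ξ ^ 2 * ‖u t ξ‖ ^ 2 - weight ν a b (ρ s) ξ ^ 2 * ‖u s ξ‖ ^ 2 =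
      ∫ τ, (2 * Ψ₁ τ ξ - 2 * Ψ₂ τ ξ) ∂m := by
    filter_upwards [hvu, hRξ, hode t ⟨hst, le_rfl⟩] with ξ h1 h2 h3
    have hvs : v s ξ = u s ξ := by simp [v]
    have hvt : v t ξ = u t ξ := by simp only [v, ← h3]; ring
    have h4 := norm_weight_mul_sq_eq (a := a) (b := b) hν hr hρ ξ hst h2 (U := fun τ => v τ ξ)
      (fun τ _ => by rw [hvs])
    simp only [hvs, hvt] at h4
    rw [h4, add_sub_cancel_left]
    refine integral_congr_ae ?_
    filter_upwards [h1] with τ h5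
    simp only [Ψ₁, Ψ₂, h5]
  have hE : ∀ τ, wl ν a b (ρ τ) (fun ξ => ‖u τ ξ‖ₑ) ≠ ∞ →
      Integrable fun ξ => weight ν a b (ρ τ) ξ ^ 2 * ‖u τ ξ‖ ^ 2 := fun τ h => by
    have hmm : Measurable fun ξ => weight ν a b (ρ τ) ξ ^ 2 * ‖u τ ξ‖ ^ 2 :=
      ((measurable_weight _ _ _ _).pow_const 2).mul ((huξ τ).norm.pow_const 2)
    refine ⟨hmm.aestronglyMeasurable, ?_⟩
    have h2 := ENNReal.pow_ne_top (n := 2) h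
    rw [wl, ltwo_sq] at h2
    refine lt_of_le_of_lt (le_of_eq (lintegral_congr fun ξ => ?_)) h2.lt_top
    rw [enorm_mul, enorm_pow, enorm_pow, mul_pow, enorm_norm, ew, ← ofReal_norm,
      Real.norm_of_nonneg (weight_nonneg _ _ _ _ _)]
  have hΨ : Integrable (Function.uncurry fun ξ τ => 2 * Ψ₁ τ ξ - 2 * Ψ₂ τ ξ)
      ((volume : Measure (Rn n)).prod m) := ((hΨ₁.const_mul 2).sub (hΨ₂.const_mul 2)).swap
  have hreal := integral_congr_ae hpt
  rw [integral_sub (hE t ht) (hE s hs), toReal_wl_sq (huξ t), toReal_wl_sq (huξ s),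
    integral_integral_swap hΨ] at hreal
  have hsec : ∀ᵐ τ ∂m, ∫ ξ, (2 * Ψ₁ τ ξ - 2 * Ψ₂ τ ξ) = 2 * (∫ ξ, Ψ₁ τ ξ) - 2 * ∫ ξ, Ψ₂ τ ξ := by
    filter_upwards [hΨ₁.prod_right_ae, hΨ₂.prod_right_ae] with τ h1 h2
    have h1' : Integrable (Ψ₁ τ) := h1
    have h2' : Integrable (Ψ₂ τ) := h2
    rw [integral_sub (h1'.const_mul 2) (h2'.const_mul 2), integral_const_mul, integral_const_mul]
  have hi₁ : Integrable (fun τ => ∫ ξ, Ψ₁ τ ξ) m := hΨ₁.integral_prod_left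
  have hi₂ : Integrable (fun τ => ∫ ξ, Ψ₂ τ ξ) m := hΨ₂.integral_prod_left
  rw [integral_congr_ae hsec, integral_sub (hi₁.const_mul 2) (hi₂.const_mul 2),
    integral_const_mul 2 fun τ => ∫ ξ, Ψ₂ τ ξ] at hreal
  have hJe : ∫ τ, (∫ ξ, Ψ₂ τ ξ) ∂m = (∫⁻ τ, ENNReal.ofReal (r τ) *
      wl ν (a + ν / 2) b (ρ τ) (fun ξ => ‖u τ ξ‖ₑ) ^ 2 ∂m).toReal := by
    have hp : ∀ τ ξ, 0 ≤ Ψ₂ τ ξ := fun τ ξ => mul_nonneg (hr0 τ) (by positivity)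
    rw [integral_integral hΨ₂, integral_eq_lintegral_of_nonneg_ae
      (f := fun z : ℝ × Rn n => Ψ₂ z.1 z.2)
      (ae_of_all _ fun z => hp z.1 z.2) hΨ₂m.aestronglyMeasurable]
    congr 1
    simp only [← hΨ₂e]
    have h1 := lintegral_prod (μ := m) (ν := volume) _ hΨ₂m.enorm.aemeasurable
    refine Eq.trans (lintegral_congr fun z => ?_) h1
    rw [← ofReal_norm, Function.uncurry, Real.norm_of_nonneg (hp z.1 z.2)]
  rw [hJe] at hreal
  set J := ∫⁻ τ, ENNReal.ofReal (r τ) * wl ν (a + ν / 2) b (ρ τ) (fun ξ => ‖u τ ξ‖ₑ) ^ 2 ∂m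
  have hEt := ENNReal.pow_ne_top (n := 2) ht
  have hEs := ENNReal.pow_ne_top (n := 2) hs
  set Et := wl ν a b (ρ t) (fun ξ => ‖u t ξ‖ₑ) ^ 2
  set Es := wl ν a b (ρ s) (fun ξ => ‖u s ξ‖ₑ) ^ 2
  -- Only the positive part of the power contributes, so a one-sided bound by Q is enough.
  have hI : ENNReal.ofReal (∫ τ, (2 * ∫ ξ, Ψ₁ τ ξ) ∂m) ≤ ∫⁻ τ, Q τ ∂m := by
    refine le_trans ?_ (lintegral_mono_ae hQ)
    rw [integral_eq_lintegral_pos_part_sub_lintegral_neg_part (hi₁.const_mul 2)]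
    refine (ENNReal.ofReal_le_ofReal (sub_le_self _ ENNReal.toReal_nonneg)).trans ?_
    exact ENNReal.ofReal_toReal_le
  calc Et + 2 * J = ENNReal.ofReal (Et.toReal + 2 * J.toReal) := by
        rw [ENNReal.ofReal_add (by positivity) (by positivity), ENNReal.ofReal_mul (by norm_num),
          ENNReal.ofReal_toReal hEt, ENNReal.ofReal_toReal hJ]
        simp
    _ = ENNReal.ofReal (Es.toReal + ∫ τ, (2 * ∫ ξ, Ψ₁ τ ξ) ∂m) := by congr 1; linarith
    _ ≤ ENNReal.ofReal Es.toReal + ENNReal.ofReal (∫ τ, (2 * ∫ ξ, Ψ₁ τ ξ) ∂m) := ENNReal.ofReal_add_le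
    _ ≤ _ := by
        rw [ENNReal.ofReal_toReal hEs]
        gcongr

end Energy

-- The a priori estimate for the difference of two phases

section EnergyEstimate

/-- The velocity `(2t²)⁻¹ ∇v·∇u` of the difference of two phases, on the Fourier side. -/
def phaseVelocity (v u : ℝ → Rn n → ℂ) (τ : ℝ) (ξ : Rn n) : ℂ :=
  (((2 * τ ^ 2)⁻¹ : ℝ) : ℂ) * gradDotHat (v τ) (u τ) ξ

lemma measurable_phaseVelocity {v u : ℝ → Rn n → ℂ} (hv : Measurable (Function.uncurry v))
    (hu : Measurable (Function.uncurry u)) : Measurable (Function.uncurry (phaseVelocity v u)) := by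
  have h1 := measurable_uncurry_gradDotHat hv hu
  have h2 : Measurable fun z : ℝ × Rn n => (((2 * z.1 ^ 2)⁻¹ : ℝ) : ℂ) := by fun_prop
  exact h2.mul h1

/-- The factor `(2t²)⁻¹`. -/
def invTwoSq (τ : ℝ) : ℝ≥0∞ := ENNReal.ofReal (2 * τ ^ 2)⁻¹

lemma measurable_invTwoSq : Measurable invTwoSq := by unfold invTwoSq; fun_prop

lemma enorm_ofReal_inv (τ : ℝ) : ‖(((2 * τ ^ 2)⁻¹ : ℝ) : ℂ)‖ₑ = invTwoSq τ := by
  rw [← ofReal_norm, Complex.norm_real, Real.norm_of_nonneg (by positivity), invTwoSq]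

/-- A curve of Fourier transforms controlled by `B H`, as in the definition of `Z`. -/
structure Controlled (ν a b : ℝ) (r ρ : ℝ → ℝ) (T : ℝ) (H : ℝ → ℝ≥0∞) (B : ℝ≥0∞)
    (v : ℝ → Rn n → ℂ) : Prop where
  measurable : Measurable (Function.uncurry v)
  sup_le : ∀ t ∈ Ici T, wl ν a b (ρ t) (fun ξ => ‖v t ξ‖ₑ) ≤ B * H t
  int_le : ∫⁻ t in Ici T, ENNReal.ofReal (r t) *
    ((H t)⁻¹ * wl ν (a + ν / 2) b (ρ t) (fun ξ => ‖v t ξ‖ₑ)) ^ 2 ≤ B ^ 2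

lemma Controlled.mono {ν a b : ℝ} {r ρ : ℝ → ℝ} {T T' : ℝ} {H : ℝ → ℝ≥0∞} {B : ℝ≥0∞}
    {v : ℝ → Rn n → ℂ} (h : Controlled ν a b r ρ T H B v) (hT : T ≤ T') :
    Controlled ν a b r ρ T' H B v where
  measurable := h.measurable
  sup_le t ht := h.sup_le t (hT.trans ht)
  int_le := (lintegral_mono_set (Ici_subset_Ici.2 hT)).trans h.int_le

/-- The Cauchy-Schwarz inequality with the weight `r`. -/
lemma lintegral_mul_mul_le {m : Measure ℝ} {r f g : ℝ → ℝ≥0∞} (hr : Measurable r) (hf : Measurable f)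
    (hg : Measurable g) : ∫⁻ t, r t * (f t * g t) ∂m ≤
      (∫⁻ t, r t * f t ^ 2 ∂m) ^ (1 / 2 : ℝ) * (∫⁻ t, r t * g t ^ 2 ∂m) ^ (1 / 2 : ℝ) := by
  have hs : ∀ x : ℝ≥0∞, x ^ (1 / 2 : ℝ) * x ^ (1 / 2 : ℝ) = x := fun x => by
    rw [← ENNReal.rpow_add_of_nonneg _ _ (by norm_num) (by norm_num)]; norm_num
  have e : ∀ f : ℝ → ℝ≥0∞, (∫⁻ t, r t * f t ^ 2 ∂m) ^ (1 / 2 : ℝ) =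
      ltwo m fun t => r t ^ (1 / 2 : ℝ) * f t := fun f => by
    rw [ltwo]
    congr 2; funext t
    rw [sq, sq, mul_mul_mul_comm, hs]
  rw [e, e]
  refine le_trans (le_of_eq (lintegral_congr fun t => ?_)) (lintegral_mul_le_ltwo
    ((hr.pow_const _).mul hf).aemeasurable ((hr.pow_const _).mul hg).aemeasurable)
  rw [mul_mul_mul_comm, hs]

lemma rpow_half_mul_le (x y : ℝ≥0∞) : x ^ (1 / 2 : ℝ) * y ≤ x + y ^ 2 := by
  have hs : x ^ (1 / 2 : ℝ) * x ^ (1 / 2 : ℝ) = x := by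
    rw [← ENNReal.rpow_add_of_nonneg _ _ (by norm_num) (by norm_num)]; norm_num
  rcases le_total (x ^ (1 / 2 : ℝ)) y with h | h
  · calc _ ≤ y * y := by gcongr
      _ ≤ _ := by rw [sq]; exact le_add_self
  · calc _ ≤ x ^ (1 / 2 : ℝ) * x ^ (1 / 2 : ℝ) := by gcongr
      _ ≤ _ := by rw [hs]; exact le_self_add

lemma mul_le_sq_add_sq (x y : ℝ≥0∞) : x * y ≤ x ^ 2 + y ^ 2 := by
  rcases le_total x y with h | h
  · exact (mul_le_mul_left h y).trans (by rw [← sq]; exact le_add_self)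
  · exact (mul_le_mul_right h x).trans (by rw [← sq]; exact le_self_add)

/-- The a priori estimate for the difference of two phases. -/
lemma exists_wl_sq_le (hn : 0 < n) {ν low ℓ : ℝ} (h0 : 0 < ν) (h1 : ν ≤ 1) (hlow : 0 ≤ low)
    (hlow' : low < n / 2) (hℓ : n / 2 - ν < ℓ) : ∃ c : ℝ, 0 < c ∧
    ∀ (r ρ : ℝ → ℝ) (T : ℝ) (H : ℝ → ℝ≥0∞) (A B B' : ℝ≥0∞) (v u : ℝ → Rn n → ℂ),
      Continuous r → (∀ τ, 0 < r τ) → (∀ τ, HasDerivAt ρ (-r τ) τ) → (∀ τ, 0 ≤ ρ τ) →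
      Measurable H → (∀ τ, H τ ≠ 0) → (∀ τ, H τ ≠ ∞) → Monotone H → B ≠ ∞ → B' ≠ ∞ → A ≠ ∞ →
      (∀ τ ∈ Ici T, invTwoSq τ * H τ ≤ ENNReal.ofReal (r τ) * A) →
      Controlled ν (ℓ + 2) low r ρ T H B v → Controlled ν (ℓ + 2) low r ρ T H B' u →
      (∀ τ ∈ Ici T, ∀ᵐ ζ, v τ (-ζ) = conj (v τ ζ)) →
      (∀ t ∈ Ici T, ∫⁻ τ in Ioc T t, ∫⁻ ξ, ‖phaseVelocity v u τ ξ‖ₑ ≠ ∞) →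
      (∀ t ∈ Ici T, ∀ᵐ ξ, u t ξ - u T ξ = ∫ τ in Ioc T t, phaseVelocity v u τ ξ) →
      B * A ≤ ENNReal.ofReal c →
      ∀ t ∈ Ici T, wl ν (ℓ + 1 + ν) low (ρ t) (fun ξ => ‖u t ξ‖ₑ) ^ 2 ≤
        2 * wl ν (ℓ + 1 + ν) low (ρ T) (fun ξ => ‖u T ξ‖ₑ) ^ 2 := by
  obtain ⟨C, hC, htri⟩ := exists_trilinear_le hn h0 h1 hlow hlow' hℓ
  obtain ⟨C', hC', habs⟩ := exists_abs_trilinear_le hn h0 h1 hlow hlow' hℓ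
  -- With this c the smallness of BA gives C·B·A ≤ 1/2, C being the constant of the trilinear
  -- estimate; C' serves only for absolute convergence.
  refine ⟨1 / (2 * (C.toReal + 1)), by positivity, ?_⟩
  intro r ρ T H A B B' v u hr hr0 hρ hρ0 hHm hH0 hHt hHmono hB hB' hA hHA hcv hcu hreal hRi hode hBA
    t₁ ht₁
  have hCBA : C * (B * A) ≤ 1 / 2 := by
    calc C * (B * A) ≤ ENNReal.ofReal C.toReal * ENNReal.ofReal (1 / (2 * (C.toReal + 1))) := by
          rw [ENNReal.ofReal_toReal hC]; gcongr
      _ = ENNReal.ofReal (C.toReal * (1 / (2 * (C.toReal + 1)))) :=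
          (ENNReal.ofReal_mul ENNReal.toReal_nonneg).symm
      _ ≤ ENNReal.ofReal (1 / 2) := by
          refine ENNReal.ofReal_le_ofReal ?_
          have : 0 ≤ C.toReal := ENNReal.toReal_nonneg
          rw [mul_one_div, div_le_div_iff₀ (by positivity) (by norm_num)]
          linarith
      _ = 1 / 2 := by rw [ENNReal.ofReal_div_of_pos (by norm_num)]; simp
  have hρc : Continuous ρ := continuous_iff_continuousAt.2 fun τ => (hρ τ).continuousAt
  set Y : ℝ → ℝ≥0∞ := fun τ => wl ν (ℓ + 1 + ν) low (ρ τ) (fun ξ => ‖u τ ξ‖ₑ) with hY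
  set X : ℝ → ℝ≥0∞ := fun τ => wl ν (ℓ + 1 + ν + ν / 2) low (ρ τ) (fun ξ => ‖u τ ξ‖ₑ) with hX
  set Xu : ℝ → ℝ≥0∞ := fun τ => wl ν (ℓ + 2 + ν / 2) low (ρ τ) (fun ξ => ‖u τ ξ‖ₑ) with hXu
  set Xv : ℝ → ℝ≥0∞ := fun τ => wl ν (ℓ + 2 + ν / 2) low (ρ τ) (fun ξ => ‖v τ ξ‖ₑ) with hXv
  set V : ℝ → ℝ≥0∞ := fun τ => wl ν (ℓ + 2) low (ρ τ) (fun ξ => ‖v τ ξ‖ₑ) with hV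
  have hum := hcu.measurable
  have hvm := hcv.measurable
  have hXm : Measurable X := measurable_wl hρc.measurable hum.enorm
  have hYm : Measurable Y := measurable_wl hρc.measurable hum.enorm
  have hXum : Measurable Xu := measurable_wl hρc.measurable hum.enorm
  have hXvm : Measurable Xv := measurable_wl hρc.measurable hvm.enorm
  have hYle : ∀ τ ∈ Ici T, Y τ ≤ B' * H τ := fun τ hτ =>
    (wl_mono_weight hn (by linarith) le_rfl le_rfl _).trans (hcu.sup_le τ hτ)
  have hXle : ∀ τ, X τ ≤ Xu τ := fun τ => wl_mono_weight hn (by linarith) le_rfl le_rfl _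
  have hrm : Measurable fun τ => ENNReal.ofReal (r τ) := hr.measurable.ennreal_ofReal
  have hXv' : ∀ τ, Xv τ = H τ * ((H τ)⁻¹ * Xv τ) := fun τ => by
    rw [← mul_assoc, ENNReal.mul_inv_cancel (hH0 τ) (hHt τ), one_mul]
  have hXu' : ∀ τ, Xu τ = H τ * ((H τ)⁻¹ * Xu τ) := fun τ => by
    rw [← mul_assoc, ENNReal.mul_inv_cancel (hH0 τ) (hHt τ), one_mul]
  set qv : ℝ → ℝ≥0∞ := fun τ => (H τ)⁻¹ * Xv τ with hqv
  set qu : ℝ → ℝ≥0∞ := fun τ => (H τ)⁻¹ * Xu τ with hqu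
  have hqvm : Measurable qv := hHm.inv.mul hXvm
  have hqum : Measurable qu := hHm.inv.mul hXum
  have hsub : ∀ t, Ioc T t ⊆ Ici T := fun t τ hτ => hτ.1.le
  have hqv2 : ∀ t, ∫⁻ τ in Ioc T t, ENNReal.ofReal (r τ) * qv τ ^ 2 ≤ B ^ 2 := fun t =>
    (lintegral_mono_set (hsub t)).trans hcv.int_le
  have hqu2 : ∀ t, ∫⁻ τ in Ioc T t, ENNReal.ofReal (r τ) * qu τ ^ 2 ≤ B' ^ 2 := fun t =>
    (lintegral_mono_set (hsub t)).trans hcu.int_le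
  have hfin : ∀ t, ∀ᵐ τ ∂volume.restrict (Ioc T t), Xu τ ≠ ∞ ∧ Xv τ ≠ ∞ := by
    intro t
    have key : ∀ {q : ℝ → ℝ≥0∞} {B : ℝ≥0∞}, Measurable q → B ≠ ∞ →
        ∫⁻ τ in Ioc T t, ENNReal.ofReal (r τ) * q τ ^ 2 ≤ B ^ 2 →
        ∀ᵐ τ ∂volume.restrict (Ioc T t), q τ ≠ ∞ := by
      intro q B hq hB h
      filter_upwards [ae_lt_top (hrm.mul (hq.pow_const 2))
        (ne_top_of_le_ne_top (ENNReal.pow_ne_top hB) h)] with τ h1 h2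
      have h3 : ENNReal.ofReal (r τ) * q τ ^ 2 < ∞ := h1
      rw [h2] at h3
      simp [ENNReal.mul_top, hr0 τ] at h3
    filter_upwards [key hqvm hB (hqv2 t), key hqum hB' (hqu2 t)] with τ h1 h2
    rw [hXv', hXu']
    exact ⟨ENNReal.mul_ne_top (hHt τ) h2, ENNReal.mul_ne_top (hHt τ) h1⟩
  have hJfin : ∀ t ∈ Ici T, ∫⁻ τ in Ioc T t, ENNReal.ofReal (r τ) * X τ ^ 2 ≠ ∞ := by
    intro t ht
    refine ne_top_of_le_ne_top (b := H t ^ 2 * B' ^ 2) (ENNReal.mul_ne_top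
      (ENNReal.pow_ne_top (hHt t)) (ENNReal.pow_ne_top hB')) ?_
    refine le_trans ?_ (mul_le_mul_right (hqu2 t) (H t ^ 2))
    rw [← lintegral_const_mul _ (by fun_prop)]
    refine setLIntegral_mono' measurableSet_Ioc fun τ hτ => ?_
    calc _ ≤ ENNReal.ofReal (r τ) * (H t * qu τ) ^ 2 := by
          gcongr
          exact (hXle τ).trans ((hXu' τ).le.trans (by gcongr; exact hHmono hτ.2))
      _ = _ := by ring
  -- The term with Y is bounded through the supremum S on the compact interval, which is finite by
  -- the a priori control of u; finiteness is what later allows S²/2 to be subtracted.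
  set S : ℝ≥0∞ := ⨆ τ ∈ Icc T t₁, Y τ with hS
  have hYS : ∀ τ ∈ Icc T t₁, Y τ ≤ S := fun τ hτ => le_iSup₂ (f := fun τ (_ : τ ∈ Icc T t₁) => Y τ) τ hτ
  have hStop : S ≠ ∞ := by
    refine ne_top_of_le_ne_top (ENNReal.mul_ne_top hB' (hHt t₁)) (iSup₂_le fun τ hτ => ?_)
    exact (hYle τ hτ.1).trans (by gcongr; exact hHmono hτ.2)
  have hYtop : ∀ τ ∈ Ici T, Y τ ≠ ∞ := fun τ hτ =>
    ne_top_of_le_ne_top (ENNReal.mul_ne_top hB' (hHt τ)) (hYle τ hτ)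
  have habs' : ∀ τ, ∫⁻ ξ, ew ν (ℓ + 1 + ν) low (ρ τ) ξ ^ 2 * (‖u τ ξ‖ₑ *
      lconv (fun ζ => ‖ζ‖ₑ * ‖v τ ζ‖ₑ) (fun η => ‖η‖ₑ * ‖u τ η‖ₑ) ξ) ≤
      C' * (X τ * (Xv τ * Y τ + V τ * Xu τ)) := fun τ =>
    habs (ρ τ) _ _ (hρ0 τ) (hum.of_uncurry_left (x := τ)).enorm (hvm.of_uncurry_left (x := τ)).enorm
  have hmain : ∀ t ∈ Icc T t₁, Y t ^ 2 ≤ Y T ^ 2 + S ^ 2 / 2 := by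
    intro t ht
    -- A qualitative bound, from the estimate without symmetrization and the full a priori control
    -- of u; its size plays no role.
    have hAfin : ∫⁻ τ in Ioc T t, ∫⁻ ξ, ew ν (ℓ + 1 + ν) low (ρ τ) ξ ^ 2 *
        (‖u τ ξ‖ₑ * ‖phaseVelocity v u τ ξ‖ₑ) ≠ ∞ := by
      have hb : ∀ τ ∈ Ioc T t, ∫⁻ ξ, ew ν (ℓ + 1 + ν) low (ρ τ) ξ ^ 2 *
          (‖u τ ξ‖ₑ * ‖phaseVelocity v u τ ξ‖ₑ) ≤ (n * C' * A * H t ^ 2) *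
            (B' * (ENNReal.ofReal (r τ) * qu τ ^ 2 + ENNReal.ofReal (r τ) * qv τ ^ 2) +
              B * (ENNReal.ofReal (r τ) * qu τ ^ 2)) := by
        intro τ hτ
        have hum' : Measurable (u τ) := hum.of_uncurry_left
        have hvm' : Measurable (v τ) := hvm.of_uncurry_left
        have hmm : Measurable fun ξ => ew ν (ℓ + 1 + ν) low (ρ τ) ξ ^ 2 * (‖u τ ξ‖ₑ *
            lconv (fun ζ => ‖ζ‖ₑ * ‖v τ ζ‖ₑ) (fun η => ‖η‖ₑ * ‖u τ η‖ₑ) ξ) :=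
          ((measurable_ew _ _ _ _).pow_const 2).mul (hum'.enorm.mul (measurable_lconv
            (measurable_enorm.mul hvm'.enorm) (measurable_enorm.mul hum'.enorm)))
        calc _ ≤ ∫⁻ ξ, (invTwoSq τ * n) * (ew ν (ℓ + 1 + ν) low (ρ τ) ξ ^ 2 * (‖u τ ξ‖ₑ *
              lconv (fun ζ => ‖ζ‖ₑ * ‖v τ ζ‖ₑ) (fun η => ‖η‖ₑ * ‖u τ η‖ₑ) ξ)) := by
              refine lintegral_mono fun ξ => ?_
              rw [phaseVelocity, enorm_mul, enorm_ofReal_inv]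
              calc _ ≤ ew ν (ℓ + 1 + ν) low (ρ τ) ξ ^ 2 * (‖u τ ξ‖ₑ * (invTwoSq τ * (n *
                    lconv (fun ζ => ‖ζ‖ₑ * ‖v τ ζ‖ₑ) (fun η => ‖η‖ₑ * ‖u τ η‖ₑ) ξ))) := by
                    gcongr; exact enorm_gradDotHat_le _ _ _
                _ = _ := by ring
          _ ≤ (invTwoSq τ * n) * (C' * (X τ * (Xv τ * Y τ + V τ * Xu τ))) := by
              rw [lintegral_const_mul _ hmm]
              gcongr
              exact habs' τ
          _ ≤ (invTwoSq τ * n) * (C' * ((H τ * qu τ) * ((H τ * qv τ) * (B' * H τ) +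
                (B * H τ) * (H τ * qu τ)))) := by
              gcongr
              · exact (hXle τ).trans (hXu' τ).le
              · exact (hXv' τ).le
              · exact hYle τ hτ.1.le
              · exact hcv.sup_le τ hτ.1.le
              · exact (hXu' τ).le
          _ = (invTwoSq τ * H τ) * (n * C' * H τ ^ 2 *
                (B' * (qu τ * qv τ) + B * qu τ ^ 2)) := by ring
          _ ≤ (ENNReal.ofReal (r τ) * A) * (n * C' * H t ^ 2 *
                (B' * (qu τ ^ 2 + qv τ ^ 2) + B * qu τ ^ 2)) := by
              refine mul_le_mul' (hHA τ hτ.1.le) ?_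
              gcongr
              · exact hHmono hτ.2
              · exact mul_le_sq_add_sq _ _
          _ = _ := by ring
      refine ne_top_of_le_ne_top ?_ (setLIntegral_mono' measurableSet_Ioc hb)
      rw [lintegral_const_mul _ (by fun_prop), lintegral_add_left (by fun_prop),
        lintegral_const_mul _ (by fun_prop), lintegral_const_mul _ (by fun_prop),
        lintegral_add_left (by fun_prop)]
      have f1 := ne_top_of_le_ne_top (ENNReal.pow_ne_top hB') (hqu2 t)
      have f2 := ne_top_of_le_ne_top (ENNReal.pow_ne_top hB) (hqv2 t)
      have f3 := hHt t
      finiteness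
    -- At almost every time the norms with ν/2 more derivatives are finite, so the symmetrization is
    -- legitimate and the trilinear estimate can be inserted.
    have hQ : ∀ᵐ τ ∂volume.restrict (Ioc T t), ENNReal.ofReal (2 * ∫ ξ,
        weight ν (ℓ + 1 + ν) low (ρ τ) ξ ^ 2 * (conj (u τ ξ) * phaseVelocity v u τ ξ).re) ≤
        invTwoSq τ * (C * (V τ * X τ ^ 2 + Xv τ * (X τ * Y τ))) := by
      filter_upwards [hfin t, ae_restrict_mem measurableSet_Ioc] with τ h2 hτ
      have hτ' : τ ∈ Ici T := hτ.1.le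
      have hVtop : V τ ≠ ∞ := ne_top_of_le_ne_top (ENNReal.mul_ne_top hB (hHt τ)) (hcv.sup_le τ hτ')
      have hXtop : X τ ≠ ∞ := ne_top_of_le_ne_top h2.1 (hXle τ)
      have hne := ne_top_of_le_ne_top (ENNReal.mul_ne_top hC' (ENNReal.mul_ne_top hXtop
        (ENNReal.add_ne_top.2 ⟨ENNReal.mul_ne_top h2.2 (hYtop τ hτ'),
          ENNReal.mul_ne_top hVtop h2.1⟩))) (habs' τ)
      have hsym := (ofReal_integral_gradDotHat_le (hvm.of_uncurry_left (x := τ))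
        (hum.of_uncurry_left (x := τ)) (hreal τ hτ') hne).trans
        (htri (ρ τ) _ _ (hρ0 τ) (hum.of_uncurry_left (x := τ)).enorm
          (hvm.of_uncurry_left (x := τ)).enorm)
      refine le_trans (le_of_eq ?_) (mul_le_mul_right hsym (invTwoSq τ))
      rw [invTwoSq, ← ENNReal.ofReal_mul (by positivity)]
      congr 1
      rw [mul_left_comm]
      congr 1
      rw [← integral_const_mul]
      refine integral_congr_ae (ae_of_all _ fun ξ => ?_)
      simp only [phaseVelocity]
      rw [mul_left_comm (conj (u τ ξ)), Complex.re_ofReal_mul]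
      ring
    have henergy := wl_sq_add_le (a := ℓ + 1 + ν) (b := low) h0.le hr (fun τ => (hr0 τ).le) hρ ht.1
      hum (measurable_phaseVelocity hvm hum) (fun τ hτ => hode τ hτ.1) (hRi t ht.1) hAfin
      (hJfin t ht.1) (hYtop T self_mem_Ici) (hYtop t ht.1) hQ
    set J := ∫⁻ τ in Ioc T t, ENNReal.ofReal (r τ) * X τ ^ 2 with hJ
    have hQint : ∫⁻ τ in Ioc T t, invTwoSq τ * (C * (V τ * X τ ^ 2 + Xv τ * (X τ * Y τ))) ≤
        J + S ^ 2 / 2 := by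
      calc _ ≤ ∫⁻ τ in Ioc T t, (C * A) * (B * (ENNReal.ofReal (r τ) * X τ ^ 2) +
            S * (ENNReal.ofReal (r τ) * (qv τ * X τ))) := by
            refine setLIntegral_mono' measurableSet_Ioc fun τ hτ => ?_
            calc _ ≤ invTwoSq τ * (C * ((B * H τ) * X τ ^ 2 + (H τ * qv τ) * (X τ * S))) := by
                  gcongr
                  · exact hcv.sup_le τ hτ.1.le
                  · exact (hXv' τ).le
                  · exact hYS τ ⟨hτ.1.le, hτ.2.trans ht.2⟩
              _ = (invTwoSq τ * H τ) * (C * (B * X τ ^ 2 + S * (qv τ * X τ))) := by ring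
              _ ≤ (ENNReal.ofReal (r τ) * A) * (C * (B * X τ ^ 2 + S * (qv τ * X τ))) := by
                  exact mul_le_mul' (hHA τ hτ.1.le) le_rfl
              _ = _ := by ring
        _ = (C * A) * (B * J + S * ∫⁻ τ in Ioc T t, ENNReal.ofReal (r τ) * (qv τ * X τ)) := by
            rw [lintegral_const_mul _ (by fun_prop), lintegral_add_left (by fun_prop),
              lintegral_const_mul _ (by fun_prop), lintegral_const_mul _ (by fun_prop)]
        _ ≤ (C * A) * (B * J + S * (B * J ^ (1 / 2 : ℝ))) := by
            gcongr
            refine (lintegral_mul_mul_le hrm hqvm hXm).trans ?_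
            gcongr
            refine (ENNReal.rpow_le_rpow (hqv2 t) (by norm_num)).trans (le_of_eq ?_)
            rw [← ENNReal.rpow_natCast, ← ENNReal.rpow_mul]; norm_num
        _ = (C * (B * A)) * (J + J ^ (1 / 2 : ℝ) * S) := by ring
        _ ≤ (1 / 2) * (J + (J + S ^ 2)) := by
            gcongr
            exact rpow_half_mul_le J S
        _ = J + S ^ 2 / 2 := by
            rw [← add_assoc, mul_add, ← two_mul, ← mul_assoc, one_div,
              ENNReal.inv_mul_cancel (by norm_num) (by norm_num), one_mul, ENNReal.div_eq_inv_mul]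
    -- The dissipation on the left is 2J and the trilinear term costs only J + S²/2, so it is
    -- absorbed with one J to spare.
    have h3 : Y t ^ 2 + 2 * J ≤ Y T ^ 2 + (J + S ^ 2 / 2) := henergy.trans (by gcongr)
    have h4 : Y t ^ 2 + J ≤ Y T ^ 2 + S ^ 2 / 2 := by
      refine (ENNReal.add_le_add_iff_right (hJfin t ht.1)).1 ?_
      calc _ = Y t ^ 2 + 2 * J := by rw [two_mul, add_assoc]
        _ ≤ _ := h3
        _ = _ := by ring
    exact le_self_add.trans h4
  have hS2 : S ^ 2 ≤ Y T ^ 2 + S ^ 2 / 2 := by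
    set D := Y T ^ 2 + S ^ 2 / 2
    have h5 : S ≤ D ^ (1 / 2 : ℝ) := iSup₂_le fun τ hτ => by
      have := ENNReal.rpow_le_rpow (hmain τ hτ) (z := 1 / 2) (by norm_num)
      rwa [← ENNReal.rpow_natCast, ← ENNReal.rpow_mul, Nat.cast_ofNat,
        show (2 : ℝ) * (1 / 2) = 1 by norm_num, ENNReal.rpow_one] at this
    calc S ^ 2 ≤ (D ^ (1 / 2 : ℝ)) ^ 2 := by gcongr
      _ = D := by rw [← ENNReal.rpow_natCast, ← ENNReal.rpow_mul]; norm_num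
  have hS3 : S ^ 2 / 2 ≤ Y T ^ 2 := by
    refine (ENNReal.add_le_add_iff_right (a := S ^ 2 / 2)
      (ENNReal.div_ne_top (ENNReal.pow_ne_top hStop) (by norm_num))).1 ?_
    rwa [ENNReal.add_halves]
  calc Y t₁ ^ 2 ≤ Y T ^ 2 + S ^ 2 / 2 := hmain t₁ ⟨ht₁, le_rfl⟩
    _ ≤ Y T ^ 2 + Y T ^ 2 := by gcongr
    _ = _ := (two_mul _).symm

end EnergyEstimate

-- Bilinear estimates for the velocities

section BilinearEstimates

lemma wl_gradDotHat_le {ν a b ρ : ℝ} (v u : Rn n → ℂ) :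
    wl ν a b ρ (fun ξ => ‖gradDotHat v u ξ‖ₑ) ≤
      n * wl ν a b ρ (lconv (fun ζ => ‖ζ‖ₑ * ‖v ζ‖ₑ) (fun η => ‖η‖ₑ * ‖u η‖ₑ)) := by
  rw [← wl_const_mul (ENNReal.natCast_ne_top n)]
  exact wl_mono (ae_of_all _ fun ξ => enorm_gradDotHat_le v u ξ)

/-- The bilinear estimate for `∇v·∇u` with a loss of one derivative on `u`. -/
lemma exists_wl_gradDotHat_le (hn : 0 < n) {ν low ℓ : ℝ} (h0 : 0 < ν) (h1 : ν ≤ 1) (hlow : 0 ≤ low)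
    (hlow' : low < n / 2) (hℓ : n / 2 - ν < ℓ) : ∃ C : ℝ≥0∞, C ≠ ∞ ∧
    ∀ (ρ : ℝ) (v u : Rn n → ℂ), 0 ≤ ρ → Measurable v → Measurable u →
      wl ν (ℓ + ν) low ρ (fun ξ => ‖gradDotHat v u ξ‖ₑ) ≤
        C * wl ν (ℓ + 2) low ρ (fun ξ => ‖v ξ‖ₑ) * wl ν (ℓ + 1 + ν) low ρ (fun ξ => ‖u ξ‖ₑ) := by
  have hn' : (0 : ℝ) ≤ n / 2 := by positivity
  -- The margin s₁ + s₂ - s is ℓ + 1, which exceeds n/2 since ν ≤ 1; the same inequality gives s ≤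
  -- s₁.
  obtain ⟨C, hC, h⟩ := exists_product_le (n := n) hn (s := ℓ + ν) (s₁ := ℓ + 1) (s₂ := ℓ + ν) (b := low)
    (b₁ := low) (b₂ := low) (β := low) h0.le h1 (by linarith) (by linarith) (by linarith)
    (by linarith) hlow hlow' (Or.inl ⟨rfl, rfl, rfl⟩)
  refine ⟨n * C, by finiteness, fun ρ v u hρ hv hu => (wl_gradDotHat_le v u).trans ?_⟩
  rw [mul_assoc, mul_assoc]
  gcongr
  refine (h ρ _ _ hρ (measurable_enorm.mul hv.enorm) (measurable_enorm.mul hu.enorm)).trans ?_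
  rw [mul_assoc]
  gcongr
  · exact (wl_norm_mul_le _ _ _ _ _).trans (le_of_eq (by ring_nf))
  · exact (wl_norm_mul_le _ _ _ _ _).trans (le_of_eq (by ring_nf))

/-- The bilinear estimate for the transport term in `L²`. -/
lemma exists_wl_transportHat_le (hn : 0 < n) {ν low k ℓ : ℝ} (h0 : 0 < ν) (h1 : ν ≤ 1)
    (hlow : 0 ≤ low) (hlow' : low < n / 2) (hℓ : n / 2 - ν < ℓ) (hk : 1 - ν / 2 ≤ k) :
    ∃ C : ℝ≥0∞, C ≠ ∞ ∧ ∀ (ρ : ℝ) (p a : Rn n → ℂ), 0 ≤ ρ → Measurable p → Measurable a →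
      wl ν 0 0 ρ (fun ξ => ‖transportHat p a ξ‖ₑ) ≤
        C * wl ν (ℓ + 2 + ν / 2) low ρ (fun ξ => ‖p ξ‖ₑ) *
          wl ν (k + ν / 2) 0 ρ (fun ξ => ‖a ξ‖ₑ) := by
  have hn' : (1 : ℝ) / 2 ≤ n / 2 := by
    have : (1 : ℝ) ≤ n := by exact_mod_cast hn
    linarith
  -- The condition k ≥ 1 - ν/2 is exactly s ≤ s₂: the gradient of w is controlled in L² by the norm
  -- with ν/2 extra derivatives.
  obtain ⟨C₁, hC₁, H₁⟩ := exists_product_le (n := n) hn (s := 0) (s₁ := ℓ + 1 + ν / 2)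
    (s₂ := k - 1 + ν / 2) (b := 0) (b₁ := low) (b₂ := 0) (β := low) h0.le h1 le_rfl (by linarith)
    (by linarith) (by linarith) hlow hlow' (Or.inr ⟨rfl, rfl, rfl⟩)
  obtain ⟨C₂, hC₂, H₂⟩ := exists_product_le (n := n) hn (s := 0) (s₁ := ℓ + ν / 2)
    (s₂ := k + ν / 2) (b := 0) (b₁ := low) (b₂ := 0) (β := low) h0.le h1 le_rfl (by linarith)
    (by linarith) (by linarith) hlow hlow' (Or.inr ⟨rfl, rfl, rfl⟩)
  refine ⟨2 * (n * C₁) + C₂, by finiteness, fun ρ p a hρ hp ha => ?_⟩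
  have m1 : Measurable fun ζ => ‖ζ‖ₑ * ‖p ζ‖ₑ := measurable_enorm.mul hp.enorm
  have m2 : Measurable fun ζ => ‖ζ‖ₑ * ‖a ζ‖ₑ := measurable_enorm.mul ha.enorm
  have m3 : Measurable fun ζ => ‖ζ‖ₑ ^ 2 * ‖p ζ‖ₑ := (measurable_enorm.pow_const 2).mul hp.enorm
  refine (wl_mono (ae_of_all _ (enorm_transportHat_le p a))).trans ?_
  refine (wl_add_le (((measurable_lconv m1 m2).const_mul _).const_mul _).aemeasurable
    (measurable_lconv m3 ha.enorm).aemeasurable).trans ?_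
  rw [wl_const_mul (by norm_num), wl_const_mul (ENNReal.natCast_ne_top n), add_mul, add_mul]
  refine add_le_add ?_ ?_
  · rw [show 2 * (n * C₁) * wl ν (ℓ + 2 + ν / 2) low ρ (fun ξ => ‖p ξ‖ₑ) *
      wl ν (k + ν / 2) 0 ρ (fun ξ => ‖a ξ‖ₑ) = 2 * (n * (C₁ * wl ν (ℓ + 2 + ν / 2) low ρ
        (fun ξ => ‖p ξ‖ₑ) * wl ν (k + ν / 2) 0 ρ (fun ξ => ‖a ξ‖ₑ))) by ring]
    refine mul_le_mul_right (mul_le_mul_right ((H₁ ρ _ _ hρ m1 m2).trans ?_) _) _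
    gcongr
    · exact (wl_norm_mul_le _ _ _ _ _).trans (le_of_eq (by ring_nf))
    · exact (wl_norm_mul_le _ _ _ _ _).trans (le_of_eq (by ring_nf))
  · refine (H₂ ρ _ _ hρ m3 ha.enorm).trans ?_
    gcongr
    have e : (fun ζ : Rn n => ‖ζ‖ₑ ^ 2 * ‖p ζ‖ₑ) = fun ζ => ‖ζ‖ₑ * (‖ζ‖ₑ * ‖p ζ‖ₑ) := by
      funext ζ; ring
    rw [e]
    refine (wl_norm_mul_le _ _ _ _ _).trans ((wl_norm_mul_le _ _ _ _ _).trans (le_of_eq ?_))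
    ring_nf

end BilinearEstimates

-- Measurable Fourier transforms of curves in 𝒳_ρ

section Extraction

/-- The weighted curve is continuous in L², hence has a jointly measurable version; dividing by the
weight, which vanishes at most at the origin, gives one for the transforms themselves. -/
lemma exists_measurable_fourier (hn : 0 < n) {ν a b T : ℝ} {ρ ρ' : ℝ → ℝ} (hρ' : Measurable ρ')
    (hρ : ∀ t ∈ Ici T, ρ t = ρ' t) {u : ℝ → Rn n → ℂ}
    (hu : ∀ t ∈ Ici T, wnorm ν a b (ρ t) (u t) < ∞) (hc : ContinuousInTime ν a b ρ T u) :
    ∃ g : ℝ → Rn n → ℂ, Measurable (Function.uncurry g) ∧ ∀ t ∈ Ici T, IsFourier (u t) (g t) := by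
  have hF : ∀ t ∈ Ici T, IsFourier (u t) (hat (u t)) := fun t ht =>
    isFourier_hat_of_wnorm_lt_top (hu t ht)
  obtain ⟨G, hG, hGF⟩ := exists_measurable_uncurry (T := T)
    (F := fun t ξ => (weight ν a b (ρ t) ξ : ℂ) * hat (u t) ξ) (fun t ht => by
      refine ⟨(Complex.measurable_ofReal.comp (measurable_weight _ _ _ _)).aestronglyMeasurable.mul
        (hF t ht).locallyIntegrable_right.aestronglyMeasurable, ?_⟩
      have h1 := hu t ht
      rw [(hF t ht).wnorm_eq, wl] at h1
      rw [eLpNorm_two_eq]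
      simpa only [enorm_weight_mul] using h1) hc
  have hw : Measurable fun z : ℝ × Rn n => ((weight ν a b (ρ' z.1) z.2 : ℂ))⁻¹ :=
    (Complex.measurable_ofReal.comp (measurable_uncurry_weight hρ')).inv
  refine ⟨fun t ξ => ((weight ν a b (ρ' t) ξ : ℂ))⁻¹ * G t ξ, hw.mul hG, fun t ht =>
    (hF t ht).congr_right ?_⟩
  filter_upwards [hGF t ht, ae_ne_zero hn] with ξ h1 h2
  have h3 : (weight ν a b (ρ' t) ξ : ℂ) ≠ 0 := by
    exact_mod_cast (weight_pos ν a b (ρ' t) h2).ne'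
  rw [← h1, hρ t ht, ← mul_assoc, inv_mul_cancel₀ h3, one_mul]

/-- The data of a curve in `𝒳_ρ`, on the Fourier side. -/
lemma exists_controlled (hn : 0 < n) {ν a b T : ℝ} {r ρ h r' ρ' h' : ℝ → ℝ} (hρ' : Measurable ρ')
    (hh' : Measurable h') (hρ : ∀ t ∈ Ici T, ρ t = ρ' t) (hr : ∀ t ∈ Ici T, r t = r' t)
    (hh : ∀ t ∈ Ici T, h t = h' t) (hpos : ∀ t ∈ Ici T, 0 < h t) {u : ℝ → Rn n → ℂ}
    (hu : MemX ν a b r ρ T fun t x => ((h t)⁻¹ : ℂ) * u t x) :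
    max (supPart ν a b ρ T h u) (intPart ν a b r ρ T h u) ≠ ∞ ∧
      ∃ p : ℝ → Rn n → ℂ, (∀ t ∈ Ici T, IsFourier (u t) (p t)) ∧
        ∀ B, max (supPart ν a b ρ T h u) (intPart ν a b r ρ T h u) ≤ B →
          Controlled ν a b r' ρ' T (fun t => ENNReal.ofReal (h' t)) B p := by
  have hsup : ∀ t ∈ Ici T, wnorm ν a b (ρ t) (fun x => ((h t)⁻¹ : ℂ) * u t x) < ∞ := fun t ht => by
    refine lt_of_le_of_lt ?_ hu.sup_lt_top
    have := le_iSup₂ (f := fun t (_ : t ∈ Ici T) => (ENNReal.ofReal 1)⁻¹ *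
      wnorm ν a b (ρ t) (fun x => ((h t)⁻¹ : ℂ) * u t x)) t ht
    simpa [supPart] using this
  obtain ⟨g, hg, hgF⟩ := exists_measurable_fourier hn hρ' hρ hsup hu.continuousInTime
  have hhm : Measurable fun z : ℝ × Rn n => (h' z.1 : ℂ) :=
    Complex.measurable_ofReal.comp (hh'.comp measurable_fst)
  -- The continuity in time is that of u/h, so g is a transform of the rescaled curve and the factor
  -- h is put back.
  let p : ℝ → Rn n → ℂ := fun t ξ => (h' t : ℂ) * g t ξ
  have hp : Measurable (Function.uncurry p) := hhm.mul hg
  have hpF : ∀ t ∈ Ici T, IsFourier (u t) (p t) := fun t ht => by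
    have h1 := (hgF t ht).const_mul (h' t : ℂ)
    have h2 : (h' t : ℂ) ≠ 0 := by rw [← hh t ht]; exact_mod_cast (hpos t ht).ne'
    simpa only [hh t ht, mul_inv_cancel_left₀ h2] using h1
  have hscale : ∀ t ∈ Ici T, ∀ a, wnorm ν a b (ρ t) (fun x => ((h t)⁻¹ : ℂ) * u t x) =
      (ENNReal.ofReal (h t))⁻¹ * wnorm ν a b (ρ t) (u t) := fun t ht a => by
    have hp0 := hpos t ht
    rw [((hpF t ht).const_mul _).wnorm_eq, (hpF t ht).wnorm_eq, ← wl_const_mul (by simpa using hp0)]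
    congr 1; funext ξ
    rw [enorm_mul, ← Complex.ofReal_inv, ← ofReal_norm, Complex.norm_real,
      Real.norm_of_nonneg (by positivity), ENNReal.ofReal_inv_of_pos hp0]
  refine ⟨?_, p, hpF, fun B hB => ⟨hp, fun t ht => ?_, ?_⟩⟩
  · refine (max_lt ?_ ?_).ne
    · have h1 := hu.sup_lt_top
      refine lt_of_le_of_lt (iSup₂_mono fun t ht => ?_) h1
      simp [hscale t ht]
    · have h1 := hu.int_lt_top
      refine lt_of_le_of_lt (le_of_eq ?_) h1
      rw [intPart, intPart]
      congr 1
      refine setLIntegral_congr_fun measurableSet_Ici fun t ht => ?_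
      simp [hscale t ht]
  · have h1 : (ENNReal.ofReal (h t))⁻¹ * wnorm ν a b (ρ t) (u t) ≤ B :=
      (le_iSup₂ (f := fun t (_ : t ∈ Ici T) => (ENNReal.ofReal (h t))⁻¹ *
        wnorm ν a b (ρ t) (u t)) t ht).trans ((le_max_left _ _).trans hB)
    rw [(hpF t ht).wnorm_eq, hρ t ht, hh t ht] at h1
    have h2 : 0 < h' t := by rw [← hh t ht]; exact hpos t ht
    have h3 : ENNReal.ofReal (h' t) ≠ 0 := by simpa using h2
    calc _ = ENNReal.ofReal (h' t) * ((ENNReal.ofReal (h' t))⁻¹ *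
          wl ν a b (ρ' t) fun ξ => ‖p t ξ‖ₑ) := by
          rw [← mul_assoc, ENNReal.mul_inv_cancel h3 ENNReal.ofReal_ne_top, one_mul]
      _ ≤ ENNReal.ofReal (h' t) * B := by gcongr
      _ = _ := mul_comm _ _
  · have h1 : intPart ν a b r ρ T h u ≤ B := (le_max_right _ _).trans hB
    rw [intPart] at h1
    have h2 : (∫⁻ t in Ici T, ENNReal.ofReal (r t) *
        ((ENNReal.ofReal (h t))⁻¹ * wnorm ν (a + ν / 2) b (ρ t) (u t)) ^ 2) ≤ B ^ 2 := by
      have := ENNReal.rpow_le_rpow h1 (z := 2) (by norm_num)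
      rw [← ENNReal.rpow_mul] at this
      norm_num at this
      exact this
    refine le_trans (le_of_eq (setLIntegral_congr_fun measurableSet_Ici fun t ht => ?_)) h2
    rw [(hpF t ht).wnorm_eq, hρ t ht, hh t ht, hr t ht]

end Extraction

-- Reality on the Fourier side

section Reality

lemma invF_conjHat (v : Rn n → ℂ) (x : Rn n) : invF (conjHat v) x = conj (invF v x) := by
  simp only [invF, map_mul, Complex.conj_ofReal, ← integral_conj, conjHat]
  congr 1
  rw [← integral_neg_eq_self]
  congr 1; funext ξ
  rw [inner_neg_right, neg_neg, ← Complex.exp_conj, map_mul, Complex.conj_I, Complex.conj_ofReal]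
  push_cast; ring_nf

lemma integrable_conjHat {v : Rn n → ℂ} (hv : Integrable v) : Integrable (conjHat v) := by
  have h := hv.comp_neg
  exact (LinearIsometryEquiv.integrable_comp_iff (Complex.conjLIE)).2 h

lemma ae_neg_eq_conj {v : Rn n → ℂ} (hv : Integrable v)
    (h : ∀ x, conj (invF v x) = invF v x) : ∀ᵐ ζ, v (-ζ) = conj (v ζ) := by
  have h1 : conjHat v =ᵐ[volume] v := ae_eq_of_invF_eq (integrable_conjHat hv) hv
    (funext fun x => by rw [invF_conjHat, h])
  filter_upwards [h1] with ζ hζ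
  rw [← hζ, conjHat, Complex.conj_conj]

end Reality

-- The equations for the phase difference and for the amplitude

section Equations

lemma invTwoSq_le_one {τ : ℝ} (h : 1 ≤ τ) : invTwoSq τ ≤ 1 := by
  rw [invTwoSq, ENNReal.ofReal_le_one]
  exact inv_le_one_of_one_le₀ (by nlinarith)

lemma lintegral_gradDotHat_le {v u : Rn n → ℂ} (hv : Measurable v) (hu : Measurable u) (ν : ℝ) :
    ∫⁻ ξ, ‖gradDotHat v u ξ‖ₑ ≤ n * ((∫⁻ ξ, ew ν 2 0 0 ξ * ‖v ξ‖ₑ) *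
      ∫⁻ ξ, ew ν 2 0 0 ξ * ‖u ξ‖ₑ) := by
  have m1 : Measurable fun ζ => ‖ζ‖ₑ * ‖v ζ‖ₑ := measurable_enorm.mul hv.enorm
  have m2 : Measurable fun ζ => ‖ζ‖ₑ * ‖u ζ‖ₑ := measurable_enorm.mul hu.enorm
  refine (lintegral_mono fun ξ => enorm_gradDotHat_le v u ξ).trans ?_
  rw [lintegral_const_mul _ (measurable_lconv m1 m2), lintegral_lconv m1 m2]
  gcongr
  · exact enorm_le_ew_two ν _
  · exact enorm_le_ew_two ν _

lemma lintegral_transportHat_le {v u : Rn n → ℂ} (hv : Measurable v) (hu : Measurable u) (ν : ℝ) :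
    ∫⁻ ξ, ‖transportHat v u ξ‖ₑ ≤ (2 * n + 1) * ((∫⁻ ξ, ew ν 2 0 0 ξ * ‖v ξ‖ₑ) *
      ∫⁻ ξ, ew ν 2 0 0 ξ * ‖u ξ‖ₑ) := by
  have m1 : Measurable fun ζ => ‖ζ‖ₑ * ‖v ζ‖ₑ := measurable_enorm.mul hv.enorm
  have m2 : Measurable fun ζ => ‖ζ‖ₑ * ‖u ζ‖ₑ := measurable_enorm.mul hu.enorm
  have m3 : Measurable fun ζ => ‖ζ‖ₑ ^ 2 * ‖v ζ‖ₑ := (measurable_enorm.pow_const 2).mul hv.enorm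
  refine (lintegral_mono fun ξ => enorm_transportHat_le v u ξ).trans ?_
  rw [lintegral_add_left (((measurable_lconv m1 m2).const_mul _).const_mul _),
    lintegral_const_mul _ ((measurable_lconv m1 m2).const_mul _),
    lintegral_const_mul _ (measurable_lconv m1 m2), lintegral_lconv m1 m2,
    lintegral_lconv m3 hu.enorm, add_mul, one_mul, mul_assoc]
  gcongr
  · exact enorm_le_ew_two ν _
  · exact enorm_le_ew_two ν _
  · exact enorm_sq_le_ew_two ν _
  · calc _ = 1 * ‖u _‖ₑ := (one_mul _).symm
      _ ≤ _ := by gcongr; exact one_le_ew_two ν _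

lemma lintegral_laplaceHat_le (v : Rn n → ℂ) (ν : ℝ) :
    ∫⁻ ξ, ‖laplaceHat v ξ‖ₑ ≤ ∫⁻ ξ, ew ν 2 0 0 ξ * ‖v ξ‖ₑ := by
  refine lintegral_mono fun ξ => ?_
  rw [enorm_laplaceHat]
  gcongr
  exact enorm_sq_le_ew_two ν _

lemma Controlled.exists_moments_le (hn : 0 < n) {ν a b : ℝ} (hν : 0 < ν) (hb : b < n / 2)
    {r ρ : ℝ → ℝ} {T : ℝ} {H : ℝ → ℝ≥0∞} {B : ℝ≥0∞} {v : ℝ → Rn n → ℂ}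
    (h : Controlled ν a b r ρ T H B v) (hB : B ≠ ∞) (hH : ∀ t, H t ≠ ∞) (hHm : Monotone H)
    (hρ : Antitone ρ) {t : ℝ} (hρt : 0 < ρ t) :
    ∃ M : ℝ≥0∞, M ≠ ∞ ∧ ∀ τ ∈ Icc T t, ∫⁻ ξ, ew ν 2 0 0 ξ * ‖v τ ξ‖ₑ ≤ M := by
  obtain ⟨C, hC, h1⟩ := Gevrey.exists_moments_le (n := n) hn hν hρt hb a
  refine ⟨C * (B * H t), ENNReal.mul_ne_top hC (ENNReal.mul_ne_top hB (hH t)), fun τ hτ => ?_⟩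
  refine (h1 (ρ τ) _ (hρ hτ.2) (h.measurable.of_uncurry_left (x := τ)).enorm).trans ?_
  gcongr
  exact (h.sup_le τ hτ.1).trans (by gcongr; exact hHm hτ.2)

lemma Controlled.integrableMoments (hn : 0 < n) {ν a b : ℝ} (hν : 0 < ν) (hb : b < n / 2)
    {r ρ : ℝ → ℝ} {T : ℝ} {H : ℝ → ℝ≥0∞} {B : ℝ≥0∞} {v : ℝ → Rn n → ℂ}
    (h : Controlled ν a b r ρ T H B v) (hB : B ≠ ∞) (hH : ∀ t, H t ≠ ∞) (hHm : Monotone H)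
    (hρ : Antitone ρ) {t : ℝ} (hρt : 0 < ρ t) (ht : t ∈ Ici T) : IntegrableMoments (v t) := by
  obtain ⟨M, hM, h1⟩ := h.exists_moments_le hn hν hb hB hH hHm hρ hρt
  exact integrableMoments_of_lintegral (h.measurable.of_uncurry_left (x := t))
    (ne_top_of_le_ne_top hM (h1 t ⟨ht, le_rfl⟩))

/-- The gauge factors have modulus one, and g₀(w, w) involves w only through |w|². This removes the
source term from the equation of the phase difference. -/
lemma gZero_eq_of_gaugeEquiv {T κ μ : ℝ} {w w' : ℝ → Rn n → ℂ} {φ φ' : ℝ → Rn n → ℝ}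
    (h : GaugeEquiv T w φ w' φ') {t : ℝ} (ht : t ∈ Ici T) (x : Rn n) :
    gZero κ μ (w' t) (w' t) x = gZero κ μ (w t) (w t) x := by
  have e : (fun y => w' t y * conj (w' t y)) = fun y => w t y * conj (w t y) := by
    funext y
    have h1 := congrArg (fun z : ℂ => ‖z‖) (h t ht y)
    simp only [norm_mul] at h1
    have h2 : ∀ s : ℝ, ‖Complex.exp (-Complex.I * (s : ℂ))‖ = 1 := fun s => by
      rw [show -Complex.I * (s : ℂ) = ((-s : ℝ) : ℂ) * Complex.I by push_cast; ring,
        Complex.norm_exp_ofReal_mul_I]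
    rw [h2, h2, one_mul, one_mul] at h1
    rw [Complex.mul_conj, Complex.mul_conj, Complex.normSq_eq_norm_sq, Complex.normSq_eq_norm_sq, h1]
  rw [gZero, gZero, e]

/-- The equation for the difference of two gauge equivalent phases, on the Fourier side. -/
lemma phase_evolution (hn : 0 < n) {ν ℓ low γ μ κ T : ℝ} (hν : 0 < ν) (hlow : low < n / 2)
    (hT : 1 ≤ T) {r ρ : ℝ → ℝ} {H : ℝ → ℝ≥0∞} {B : ℝ≥0∞} (hB : B ≠ ∞) (hH : ∀ t, H t ≠ ∞)
    (hHm : Monotone H) (hρ : Antitone ρ) (hρ0 : ∀ t, 0 < ρ t)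
    {w w' : ℝ → Rn n → ℂ} {φ φ' : ℝ → Rn n → ℝ} {p p' : ℝ → Rn n → ℂ}
    (hs : IsSolution γ μ κ T w φ) (hs' : IsSolution γ μ κ T w' φ') (hg : GaugeEquiv T w φ w' φ')
    (hp : Controlled ν (ℓ + 2) low r ρ T H B p) (hp' : Controlled ν (ℓ + 2) low r ρ T H B p')
    (hF : ∀ t ∈ Ici T, IsFourier (fun x => (φ t x : ℂ)) (p t))
    (hF' : ∀ t ∈ Ici T, IsFourier (fun x => (φ' t x : ℂ)) (p' t)) {s t : ℝ} (hsT : T ≤ s)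
    (hst : s ≤ t) :
    (∫⁻ τ in Ioc s t, ∫⁻ ξ, ‖phaseVelocity (fun τ ξ => p' τ ξ + p τ ξ)
      (fun τ ξ => p' τ ξ - p τ ξ) τ ξ‖ₑ ≠ ∞) ∧
    ∀ᵐ ξ, (p' t ξ - p t ξ) - (p' s ξ - p s ξ) = ∫ τ in Ioc s t,
      phaseVelocity (fun τ ξ => p' τ ξ + p τ ξ) (fun τ ξ => p' τ ξ - p τ ξ) τ ξ := by
  -- On the compact time interval ρ is at least ρ(t) > 0, so two moments of the transforms are
  -- bounded uniformly there.
  obtain ⟨M, hM, hMp⟩ := hp.exists_moments_le hn hν hlow hB hH hHm hρ (hρ0 t)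
  obtain ⟨M', hM', hMp'⟩ := hp'.exists_moments_le hn hν hlow hB hH hHm hρ (hρ0 t)
  have hpm : ∀ τ, Measurable (p τ) := fun τ => hp.measurable.of_uncurry_left
  have hpm' : ∀ τ, Measurable (p' τ) := fun τ => hp'.measurable.of_uncurry_left
  have hvm : Measurable (Function.uncurry fun τ ξ => p' τ ξ + p τ ξ) :=
    hp'.measurable.add hp.measurable
  have hum : Measurable (Function.uncurry fun τ ξ => p' τ ξ - p τ ξ) :=
    hp'.measurable.sub hp.measurable
  have hsum : ∀ {q : Rn n → ℂ} {τ : ℝ}, τ ∈ Icc T t → (∀ ξ, ‖q ξ‖ₑ ≤ ‖p' τ ξ‖ₑ + ‖p τ ξ‖ₑ) →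
      ∫⁻ ξ, ew ν 2 0 0 ξ * ‖q ξ‖ₑ ≤ M' + M := by
    intro q τ hτ h
    calc _ ≤ ∫⁻ ξ, (ew ν 2 0 0 ξ * ‖p' τ ξ‖ₑ + ew ν 2 0 0 ξ * ‖p τ ξ‖ₑ) := by
          refine lintegral_mono fun ξ => ?_
          simp only
          rw [← mul_add]; gcongr; exact h ξ
      _ = _ := lintegral_add_left ((measurable_ew _ _ _ _).mul (hpm' τ).enorm) _
      _ ≤ _ := add_le_add (hMp' τ hτ) (hMp τ hτ)
  have hMv : ∀ τ ∈ Icc T t, ∫⁻ ξ, ew ν 2 0 0 ξ * ‖p' τ ξ + p τ ξ‖ₑ ≤ M' + M := fun τ hτ =>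
    hsum hτ fun ξ => enorm_add_le _ _
  have hMu : ∀ τ ∈ Icc T t, ∫⁻ ξ, ew ν 2 0 0 ξ * ‖p' τ ξ - p τ ξ‖ₑ ≤ M' + M := fun τ hτ =>
    hsum hτ fun ξ => enorm_sub_le
  have hMM : M' + M ≠ ∞ := ENNReal.add_ne_top.2 ⟨hM', hM⟩
  have hmv : ∀ τ ∈ Icc T t, IntegrableMoments fun ξ => p' τ ξ + p τ ξ := fun τ hτ =>
    integrableMoments_of_lintegral ((hpm' τ).add (hpm τ)) (ne_top_of_le_ne_top hMM (hMv τ hτ))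
  have hmu : ∀ τ ∈ Icc T t, IntegrableMoments fun ξ => p' τ ξ - p τ ξ := fun τ hτ =>
    integrableMoments_of_lintegral ((hpm' τ).sub (hpm τ)) (ne_top_of_le_ne_top hMM (hMu τ hτ))
  have hmp : ∀ τ ∈ Icc T t, Integrable (p τ) := fun τ hτ =>
    (integrableMoments_of_lintegral (hpm τ) (ne_top_of_le_ne_top hM (hMp τ hτ))).zero
  have hmp' : ∀ τ ∈ Icc T t, Integrable (p' τ) := fun τ hτ =>
    (integrableMoments_of_lintegral (hpm' τ) (ne_top_of_le_ne_top hM' (hMp' τ hτ))).zero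
  have hfin : ∫⁻ τ in Ioc s t, ∫⁻ ξ, ‖phaseVelocity (fun τ ξ => p' τ ξ + p τ ξ)
      (fun τ ξ => p' τ ξ - p τ ξ) τ ξ‖ₑ ≠ ∞ := by
    refine ne_top_of_le_ne_top (b := ∫⁻ _ in Ioc s t, n * ((M' + M) * (M' + M))) ?_
      (setLIntegral_mono' measurableSet_Ioc fun τ hτ => ?_)
    · rw [setLIntegral_const]; simp only [Real.volume_Ioc]; finiteness
    · have hτ' : τ ∈ Icc T t := ⟨hsT.trans hτ.1.le, hτ.2⟩
      calc _ ≤ ∫⁻ ξ, ‖gradDotHat (fun ξ => p' τ ξ + p τ ξ) (fun ξ => p' τ ξ - p τ ξ) ξ‖ₑ := by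
            refine lintegral_mono fun ξ => ?_
            rw [phaseVelocity, enorm_mul, enorm_ofReal_inv]
            exact mul_le_of_le_one_left zero_le (invTwoSq_le_one (hT.trans hτ'.1))
        _ ≤ _ := (lintegral_gradDotHat_le ((hpm' τ).add (hpm τ)) ((hpm' τ).sub (hpm τ)) ν).trans (by
            gcongr
            · exact hMv τ hτ'
            · exact hMu τ hτ')
  refine ⟨hfin, ?_⟩
  have hcφ : ∀ τ ∈ Ici T, Continuous fun x => (φ τ x : ℂ) := fun τ hτ =>
    Complex.continuous_ofReal.comp (hs.contDiff_φ τ hτ).continuous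
  have hcφ' : ∀ τ ∈ Ici T, Continuous fun x => (φ' τ x : ℂ) := fun τ hτ =>
    Complex.continuous_ofReal.comp (hs'.contDiff_φ τ hτ).continuous
  have e : ∀ τ ∈ Icc T t, (fun x => (φ τ x : ℂ)) = invF (p τ) := fun τ hτ =>
    (hF τ hτ.1).eq_invF (hcφ τ hτ.1) (hmp τ hτ)
  have e' : ∀ τ ∈ Icc T t, (fun x => (φ' τ x : ℂ)) = invF (p' τ) := fun τ hτ =>
    (hF' τ hτ.1).eq_invF (hcφ' τ hτ.1) (hmp' τ hτ)
  have ey : ∀ τ ∈ Icc T t, (fun x => ((φ' τ x - φ τ x : ℝ) : ℂ)) =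
      invF fun ξ => p' τ ξ - p τ ξ := fun τ hτ => by
    funext x
    rw [invF_sub (hmp' τ hτ) (hmp τ hτ), ← e τ hτ, ← e' τ hτ, Complex.ofReal_sub]
  refine ae_sub_eq_setIntegral (y := fun τ x => ((φ' τ x - φ τ x : ℝ) : ℂ))
    (Y := fun τ ξ => p' τ ξ - p τ ξ) hst (hmu s ⟨hsT, hst⟩).zero (hmu t ⟨hsT.trans hst, le_rfl⟩).zero
    (ey s ⟨hsT, hst⟩) (ey t ⟨hsT.trans hst, le_rfl⟩) (measurable_phaseVelocity hvm hum) hfin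
    fun τ hτ x => ?_
  have hτ' : τ ∈ Icc T t := ⟨hsT.trans hτ.1, hτ.2⟩
  have hd := ((hs'.eq_φ τ hτ'.1 x).sub (hs.eq_φ τ hτ'.1 x)).ofReal_comp
  refine (hd.mono (Ici_subset_Ici.2 hsT)).congr_deriv ?_
  have e1 : invF (phaseVelocity (fun τ ξ => p' τ ξ + p τ ξ) (fun τ ξ => p' τ ξ - p τ ξ) τ) x =
      (((2 * τ ^ 2)⁻¹ : ℝ) : ℂ) * invF (gradDotHat (fun ξ => p' τ ξ + p τ ξ)
        (fun ξ => p' τ ξ - p τ ξ)) x := invF_const_mul _ _ x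
  rw [e1, ← norm_gradient_sq_sub_eq_invF (e τ hτ') (e' τ hτ')
    ((hs.contDiff_φ τ hτ'.1).differentiable (by norm_num))
    ((hs'.contDiff_φ τ hτ'.1).differentiable (by norm_num)) (hmv τ hτ') (hmu τ hτ') (hmp τ hτ')
    (hmp' τ hτ'), gZero_eq_of_gaugeEquiv hg hτ'.1]
  push_cast; ring

/-- The velocity of the amplitude on the Fourier side. -/
def amplitudeVelocity (p a : ℝ → Rn n → ℂ) (τ : ℝ) (ξ : Rn n) : ℂ :=
  (((2 * τ ^ 2)⁻¹ : ℝ) : ℂ) * (Complex.I * laplaceHat (a τ) ξ + transportHat (p τ) (a τ) ξ)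

lemma measurable_amplitudeVelocity {p a : ℝ → Rn n → ℂ} (hp : Measurable (Function.uncurry p))
    (ha : Measurable (Function.uncurry a)) :
    Measurable (Function.uncurry (amplitudeVelocity p a)) := by
  have h1 := measurable_uncurry_laplaceHat ha
  have h2 := measurable_uncurry_transportHat hp ha
  have h3 : Measurable fun z : ℝ × Rn n => (((2 * z.1 ^ 2)⁻¹ : ℝ) : ℂ) := by fun_prop
  have h4 := h3.mul ((h1.const_mul Complex.I).add h2)
  exact h4

/-- The equation for the amplitude, on the Fourier side. -/
lemma amplitude_evolution (hn : 0 < n) {ν ℓ k low γ μ κ T : ℝ} (hν : 0 < ν) (hlow : low < n / 2)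
    (hT : 1 ≤ T) {r ρ : ℝ → ℝ} {H : ℝ → ℝ≥0∞} {B B' : ℝ≥0∞} (hB : B ≠ ∞) (hB' : B' ≠ ∞)
    (hH : ∀ t, H t ≠ ∞) (hHm : Monotone H) (hρ : Antitone ρ) (hρ0 : ∀ t, 0 < ρ t)
    {w : ℝ → Rn n → ℂ} {φ : ℝ → Rn n → ℝ} {p a : ℝ → Rn n → ℂ} (hs : IsSolution γ μ κ T w φ)
    (hp : Controlled ν (ℓ + 2) low r ρ T H B p) (ha : Controlled ν k 0 r ρ T (fun _ => 1) B' a)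
    (hF : ∀ t ∈ Ici T, IsFourier (fun x => (φ t x : ℂ)) (p t))
    (hFw : ∀ t ∈ Ici T, IsFourier (w t) (a t)) {t : ℝ} (hst : T ≤ t) :
    ∀ᵐ ξ, a t ξ - a T ξ = ∫ τ in Ioc T t, amplitudeVelocity p a τ ξ := by
  have hn' : (0 : ℝ) < n / 2 := by positivity
  obtain ⟨M, hM, hMp⟩ := hp.exists_moments_le hn hν hlow hB hH hHm hρ (hρ0 t)
  obtain ⟨M', hM', hMa⟩ := ha.exists_moments_le hn hν hn' hB' (fun _ => by norm_num)
    monotone_const hρ (hρ0 t)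
  have hpm : ∀ τ, Measurable (p τ) := fun τ => hp.measurable.of_uncurry_left
  have ham : ∀ τ, Measurable (a τ) := fun τ => ha.measurable.of_uncurry_left
  have hmp : ∀ τ ∈ Icc T t, IntegrableMoments (p τ) := fun τ hτ =>
    integrableMoments_of_lintegral (hpm τ) (ne_top_of_le_ne_top hM (hMp τ hτ))
  have hma : ∀ τ ∈ Icc T t, IntegrableMoments (a τ) := fun τ hτ =>
    integrableMoments_of_lintegral (ham τ) (ne_top_of_le_ne_top hM' (hMa τ hτ))
  have hfin : ∫⁻ τ in Ioc T t, ∫⁻ ξ, ‖amplitudeVelocity p a τ ξ‖ₑ ≠ ∞ := by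
    refine ne_top_of_le_ne_top (b := ∫⁻ _ in Ioc T t, (M' + (2 * n + 1) * (M * M'))) ?_
      (setLIntegral_mono' measurableSet_Ioc fun τ hτ => ?_)
    · rw [setLIntegral_const]; simp only [Real.volume_Ioc]; finiteness
    · have hτ' : τ ∈ Icc T t := Ioc_subset_Icc_self hτ
      have hlm : Measurable fun ξ => ‖laplaceHat (a τ) ξ‖ₑ := by
        simp only [enorm_laplaceHat]; exact (measurable_enorm.pow_const 2).mul (ham τ).enorm
      calc _ ≤ ∫⁻ ξ, (‖laplaceHat (a τ) ξ‖ₑ + ‖transportHat (p τ) (a τ) ξ‖ₑ) := by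
            refine lintegral_mono fun ξ => ?_
            rw [amplitudeVelocity, enorm_mul, enorm_ofReal_inv]
            refine (mul_le_of_le_one_left zero_le (invTwoSq_le_one (hT.trans hτ'.1))).trans ?_
            refine (enorm_add_le _ _).trans (le_of_eq ?_)
            rw [enorm_mul, ← ofReal_norm Complex.I, Complex.norm_I]; simp
        _ = _ := lintegral_add_left hlm _
        _ ≤ _ := add_le_add ((lintegral_laplaceHat_le _ ν).trans (hMa τ hτ'))
            ((lintegral_transportHat_le (hpm τ) (ham τ) ν).trans (by
              gcongr
              · exact hMp τ hτ'
              · exact hMa τ hτ'))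
  have eφ : ∀ τ ∈ Icc T t, (fun x => (φ τ x : ℂ)) = invF (p τ) := fun τ hτ =>
    (hF τ hτ.1).eq_invF (Complex.continuous_ofReal.comp (hs.contDiff_φ τ hτ.1).continuous)
      (hmp τ hτ).zero
  have ew : ∀ τ ∈ Icc T t, w τ = invF (a τ) := fun τ hτ =>
    (hFw τ hτ.1).eq_invF (hs.contDiff_w τ hτ.1).continuous (hma τ hτ).zero
  refine ae_sub_eq_setIntegral (y := w) (Y := a) hst (hma T ⟨le_rfl, hst⟩).zero
    (hma t ⟨hst, le_rfl⟩).zero (ew T ⟨le_rfl, hst⟩) (ew t ⟨hst, le_rfl⟩)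
    (measurable_amplitudeVelocity hp.measurable ha.measurable) hfin fun τ hτ x => ?_
  refine (hs.eq_w τ hτ.1 x).congr_deriv ?_
  have e1 : invF (amplitudeVelocity p a τ) x = (((2 * τ ^ 2)⁻¹ : ℝ) : ℂ) *
      (Complex.I * invF (laplaceHat (a τ)) x + invF (transportHat (p τ) (a τ)) x) := by
    rw [← invF_const_mul Complex.I, ← invF_add ((hma τ hτ).laplaceHat.const_mul _)
      (integrable_transportHat (hmp τ hτ) (hma τ hτ)), ← invF_const_mul]
    rfl
  rw [e1, ← laplacian_eq_invF (ew τ hτ) (hs.contDiff_w τ hτ.1) (hma τ hτ),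
    ← transport_eq_invF (eφ τ hτ) (ew τ hτ) (hs.contDiff_φ τ hτ.1) (hs.contDiff_w τ hτ.1) (hmp τ hτ)
      (hma τ hτ)]
  ring

end Equations

-- Convergence of the phase difference

section PhaseLimit

/-- The functions of time that enter the estimates, on `[T, ∞)`. -/
structure TimeWeights (r ρ : ℝ → ℝ) (ρinf T : ℝ) (H H₁ : ℝ → ℝ≥0∞) : Prop where
  one_le : 1 ≤ T
  continuous_r : Continuous r
  r_pos : ∀ τ, 0 < r τ
  hasDerivAt_ρ : ∀ τ, HasDerivAt ρ (-r τ) τ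
  ρinf_nonneg : 0 ≤ ρinf
  ρinf_lt : ∀ τ, ρinf < ρ τ
  measurable_H : Measurable H
  H_ne_zero : ∀ τ, H τ ≠ 0
  H_ne_top : ∀ τ, H τ ≠ ∞
  monotone_H : Monotone H
  H₁_ne_top : ∀ τ, H₁ τ ≠ ∞
  antitone_H₁ : Antitone H₁
  tendsto_H₁ : Tendsto H₁ atTop (𝓝 0)
  mul_le : ∀ τ ∈ Ici T, invTwoSq τ * H τ ≤ ENNReal.ofReal (r τ) * H₁ τ
  lintegral_r : ∫⁻ τ in Ioi T, ENNReal.ofReal (r τ) ≠ ∞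

namespace TimeWeights

variable {r ρ : ℝ → ℝ} {ρinf T : ℝ} {H H₁ : ℝ → ℝ≥0∞}

lemma ρ_pos (h : TimeWeights r ρ ρinf T H H₁) (τ : ℝ) : 0 < ρ τ :=
  h.ρinf_nonneg.trans_lt (h.ρinf_lt τ)

lemma continuous_ρ (h : TimeWeights r ρ ρinf T H H₁) : Continuous ρ :=
  continuous_iff_continuousAt.2 fun τ => (h.hasDerivAt_ρ τ).continuousAt

lemma antitone_ρ (h : TimeWeights r ρ ρinf T H H₁) : Antitone ρ :=
  antitone_of_deriv_nonpos (fun τ => (h.hasDerivAt_ρ τ).differentiableAt) fun τ => by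
    rw [(h.hasDerivAt_ρ τ).deriv]; linarith [h.r_pos τ]

end TimeWeights

/-- The factor 3 is generous: (x + y)² ≤ 4x² + 4y² gives 8B² for the integral part, below (3B)², and
the supremum part needs only 2B. -/
lemma Controlled.of_enorm_le {ν a b : ℝ} {r ρ : ℝ → ℝ} (hr : Measurable r) (hρ : Measurable ρ)
    {T : ℝ} {H : ℝ → ℝ≥0∞} (hH : Measurable H) {B : ℝ≥0∞} {p p' q : ℝ → Rn n → ℂ}
    (hp : Controlled ν a b r ρ T H B p) (hp' : Controlled ν a b r ρ T H B p')
    (hq : Measurable (Function.uncurry q)) (h : ∀ t ξ, ‖q t ξ‖ₑ ≤ ‖p' t ξ‖ₑ + ‖p t ξ‖ₑ) :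
    Controlled ν a b r ρ T H (3 * B) q := by
  have hm : ∀ t, Measurable (p t) := fun t => hp.measurable.of_uncurry_left
  have hm' : ∀ t, Measurable (p' t) := fun t => hp'.measurable.of_uncurry_left
  have hle : ∀ a t, wl ν a b (ρ t) (fun ξ => ‖q t ξ‖ₑ) ≤
      wl ν a b (ρ t) (fun ξ => ‖p' t ξ‖ₑ) + wl ν a b (ρ t) (fun ξ => ‖p t ξ‖ₑ) := fun a t =>
    (wl_mono (ae_of_all _ (h t))).trans
      (wl_add_le (hm' t).enorm.aemeasurable (hm t).enorm.aemeasurable)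
  refine ⟨hq, fun t ht => ?_, ?_⟩
  · calc _ ≤ B * H t + B * H t := (hle a t).trans (add_le_add (hp'.sup_le t ht) (hp.sup_le t ht))
      _ = 2 * (B * H t) := (two_mul _).symm
      _ ≤ 3 * (B * H t) := by gcongr; norm_num
      _ = _ := by ring
  · have hsq : ∀ x y : ℝ≥0∞, (x + y) ^ 2 ≤ 4 * x ^ 2 + 4 * y ^ 2 := fun x y => by
      rcases le_total x y with hxy | hxy
      · calc (x + y) ^ 2 ≤ (y + y) ^ 2 := by gcongr
          _ = 4 * y ^ 2 := by ring
          _ ≤ _ := le_add_self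
      · calc (x + y) ^ 2 ≤ (x + x) ^ 2 := by gcongr
          _ = 4 * x ^ 2 := by ring
          _ ≤ _ := le_self_add
    have hmf : ∀ {p : ℝ → Rn n → ℂ}, Measurable (Function.uncurry p) → Measurable fun t =>
        ENNReal.ofReal (r t) * ((H t)⁻¹ * wl ν (a + ν / 2) b (ρ t) (fun ξ => ‖p t ξ‖ₑ)) ^ 2 := by
      intro p hp
      have h1 : Measurable fun t => wl ν (a + ν / 2) b (ρ t) (fun ξ => ‖p t ξ‖ₑ) :=
        measurable_wl hρ hp.enorm
      fun_prop
    calc _ ≤ ∫⁻ t in Ici T, (4 * (ENNReal.ofReal (r t) *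
          ((H t)⁻¹ * wl ν (a + ν / 2) b (ρ t) (fun ξ => ‖p' t ξ‖ₑ)) ^ 2) +
          4 * (ENNReal.ofReal (r t) *
          ((H t)⁻¹ * wl ν (a + ν / 2) b (ρ t) (fun ξ => ‖p t ξ‖ₑ)) ^ 2)) := by
          refine lintegral_mono fun t => ?_
          simp only
          calc _ ≤ ENNReal.ofReal (r t) * ((H t)⁻¹ * wl ν (a + ν / 2) b (ρ t) (fun ξ => ‖p' t ξ‖ₑ) +
                (H t)⁻¹ * wl ν (a + ν / 2) b (ρ t) (fun ξ => ‖p t ξ‖ₑ)) ^ 2 := by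
                rw [← mul_add]; gcongr; exact hle _ t
            _ ≤ ENNReal.ofReal (r t) * (4 * ((H t)⁻¹ *
                  wl ν (a + ν / 2) b (ρ t) (fun ξ => ‖p' t ξ‖ₑ)) ^ 2 +
                4 * ((H t)⁻¹ * wl ν (a + ν / 2) b (ρ t) (fun ξ => ‖p t ξ‖ₑ)) ^ 2) := by
                gcongr; exact hsq _ _
            _ = _ := by ring
      _ ≤ 4 * B ^ 2 + 4 * B ^ 2 := by
          rw [lintegral_add_left ((hmf hp'.measurable).const_mul 4),
            lintegral_const_mul _ (hmf hp'.measurable), lintegral_const_mul _ (hmf hp.measurable)]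
          gcongr
          · exact hp'.int_le
          · exact hp.int_le
      _ = 8 * B ^ 2 := by ring
      _ ≤ 9 * B ^ 2 := by gcongr; norm_num
      _ = _ := by ring

lemma le_two_mul_of_sq_le {x y : ℝ≥0∞} (h : x ^ 2 ≤ 2 * y ^ 2) : x ≤ 2 * y := by
  refine (ENNReal.pow_le_pow_left_iff two_ne_zero).1 (h.trans ?_)
  calc 2 * y ^ 2 ≤ 4 * y ^ 2 := by gcongr; norm_num
    _ = _ := by ring

/-- Existence of the limit of the difference of two gauge equivalent phases, and the rate of
convergence, on the Fourier side. -/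
lemma exists_phase_limit (hn : 0 < n) {ν low ℓ : ℝ} (h0 : 0 < ν) (h1 : ν ≤ 1) (hlow : 0 ≤ low)
    (hlow' : low < n / 2) (hℓ : n / 2 - ν < ℓ) : ∃ c : ℝ, 0 < c ∧ ∃ C : ℝ≥0∞, C ≠ ∞ ∧
    ∀ (γ μ κ : ℝ) (r ρ : ℝ → ℝ) (ρinf T : ℝ) (H H₁ : ℝ → ℝ≥0∞) (b : ℝ≥0∞)
      (w w' : ℝ → Rn n → ℂ) (φ φ' : ℝ → Rn n → ℝ) (p p' : ℝ → Rn n → ℂ),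
      TimeWeights r ρ ρinf T H H₁ → b ≠ ∞ → IsSolution γ μ κ T w φ → IsSolution γ μ κ T w' φ' →
      GaugeEquiv T w φ w' φ' → Controlled ν (ℓ + 2) low r ρ T H b p →
      Controlled ν (ℓ + 2) low r ρ T H b p' →
      (∀ t ∈ Ici T, IsFourier (fun x => (φ t x : ℂ)) (p t)) →
      (∀ t ∈ Ici T, IsFourier (fun x => (φ' t x : ℂ)) (p' t)) →
      ∃ V : Rn n → ℂ, Measurable V ∧ (∃ M : ℝ≥0∞, M ≠ ∞ ∧
        wl ν (ℓ + 1 + ν) low ρinf (fun ξ => ‖V ξ‖ₑ) ≤ M ∧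
        ∀ t ∈ Ici T, wl ν (ℓ + 1 + ν) low ρinf (fun ξ => ‖p' t ξ - p t ξ‖ₑ) ≤ M) ∧
        Tendsto (fun t => wl ν (ℓ + ν) low ρinf fun ξ => ‖p' t ξ - p t ξ - V ξ‖ₑ) atTop (𝓝 0) ∧
        ∀ T₁ ∈ Ici T, b * H₁ T₁ ≤ ENNReal.ofReal c → ∀ t ∈ Ici T₁,
          wl ν (ℓ + ν) low ρinf (fun ξ => ‖p' t ξ - p t ξ - V ξ‖ₑ) ≤
            C * b * (∫⁻ τ in Ioi T, ENNReal.ofReal (r τ)) *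
              wl ν (ℓ + 1 + ν) low (ρ T₁) (fun ξ => ‖p' T₁ ξ - p T₁ ξ‖ₑ) * H₁ t := by
  obtain ⟨c, hc, henergy⟩ := exists_wl_sq_le hn h0 h1 hlow hlow' hℓ
  obtain ⟨C, hC, hbil⟩ := exists_wl_gradDotHat_le hn h0 h1 hlow hlow' hℓ
  -- The sum and the difference of the phases are controlled with 3b, whence c/3; in 6 the factor 3
  -- is that of v and the factor 2 comes from the energy bound for u.
  refine ⟨c / 3, by positivity, 6 * C, by finiteness, ?_⟩
  intro γ μ κ r ρ ρinf T H H₁ b w w' φ φ' p p' htw hb hs hs' hg hp hp' hF hF'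
  set v : ℝ → Rn n → ℂ := fun τ ξ => p' τ ξ + p τ ξ with hv
  set u : ℝ → Rn n → ℂ := fun τ ξ => p' τ ξ - p τ ξ with hu
  have hrm := htw.continuous_r.measurable
  have hρm := htw.continuous_ρ.measurable
  have hcv : Controlled ν (ℓ + 2) low r ρ T H (3 * b) v := Controlled.of_enorm_le hrm hρm
    htw.measurable_H hp hp' (hp'.measurable.add hp.measurable) fun t ξ => enorm_add_le _ _
  have hcu : Controlled ν (ℓ + 2) low r ρ T H (3 * b) u := Controlled.of_enorm_le hrm hρm
    htw.measurable_H hp hp' (hp'.measurable.sub hp.measurable) fun t ξ => enorm_sub_le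
  have hvm := hcv.measurable
  have hum := hcu.measurable
  have h3b : 3 * b ≠ ∞ := by finiteness
  set Y : ℝ → ℝ≥0∞ := fun t => wl ν (ℓ + 1 + ν) low (ρ t) (fun ξ => ‖u t ξ‖ₑ) with hY
  have hreal : ∀ τ ∈ Ici T, ∀ᵐ ζ, v τ (-ζ) = conj (v τ ζ) := fun τ hτ => by
    have i1 := (hp.integrableMoments hn h0 hlow' hb htw.H_ne_top htw.monotone_H htw.antitone_ρ
      (htw.ρ_pos τ) hτ).zero
    have i2 := (hp'.integrableMoments hn h0 hlow' hb htw.H_ne_top htw.monotone_H htw.antitone_ρ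
      (htw.ρ_pos τ) hτ).zero
    refine ae_neg_eq_conj (i2.add i1) fun x => ?_
    change conj (invF (fun ξ => p' τ ξ + p τ ξ) x) = invF (fun ξ => p' τ ξ + p τ ξ) x
    rw [invF_add i2 i1,
      ← (hF τ hτ).eq_invF (Complex.continuous_ofReal.comp (hs.contDiff_φ τ hτ).continuous) i1,
      ← (hF' τ hτ).eq_invF (Complex.continuous_ofReal.comp (hs'.contDiff_φ τ hτ).continuous) i2,
      map_add, Complex.conj_ofReal, Complex.conj_ofReal]
  have hevo : ∀ s t, T ≤ s → s ≤ t → (∫⁻ τ in Ioc s t, ∫⁻ ξ, ‖phaseVelocity v u τ ξ‖ₑ ≠ ∞) ∧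
      ∀ᵐ ξ, u t ξ - u s ξ = ∫ τ in Ioc s t, phaseVelocity v u τ ξ := fun s t hs1 hst =>
    phase_evolution hn h0 hlow' htw.one_le hb htw.H_ne_top htw.monotone_H htw.antitone_ρ htw.ρ_pos
      hs hs' hg hp hp' hF hF' hs1 hst
  have hbound : ∀ T₁ ∈ Ici T, 3 * b * H₁ T₁ ≤ ENNReal.ofReal c → ∀ t ∈ Ici T₁, Y t ≤ 2 * Y T₁ := by
    intro T₁ hT₁ hc1 t ht
    refine le_two_mul_of_sq_le (henergy r ρ T₁ H (H₁ T₁) (3 * b) (3 * b) v u htw.continuous_r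
      htw.r_pos htw.hasDerivAt_ρ (fun τ => (htw.ρ_pos τ).le) htw.measurable_H htw.H_ne_zero
      htw.H_ne_top htw.monotone_H h3b h3b (htw.H₁_ne_top T₁) (fun τ hτ => ?_) (hcv.mono hT₁)
      (hcu.mono hT₁) (fun τ hτ => hreal τ (mem_Ici.2 (le_trans hT₁ hτ)))
      (fun t ht => (hevo T₁ t hT₁ ht).1) (fun t ht => (hevo T₁ t hT₁ ht).2) hc1 t ht)
    refine (htw.mul_le τ (mem_Ici.2 (le_trans hT₁ hτ))).trans ?_
    gcongr
    exact htw.antitone_H₁ hτ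
  -- The velocity is estimated with one derivative less than u. Its size is r H₁ times constants, H₁
  -- is at most its value at S, and r is integrable.
  have hvel : ∀ S ∈ Ici T, ∀ M : ℝ≥0∞, (∀ τ ∈ Ici S, Y τ ≤ M) →
      ∫⁻ τ in Ioi S, wl ν (ℓ + ν) low ρinf (fun ξ => ‖phaseVelocity v u τ ξ‖ₑ) ≤
        C * (3 * b) * M * H₁ S * ∫⁻ τ in Ioi T, ENNReal.ofReal (r τ) := by
    intro S hS M hM
    calc _ ≤ ∫⁻ τ in Ioi S, C * (3 * b) * M * H₁ S * ENNReal.ofReal (r τ) := by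
          refine setLIntegral_mono' measurableSet_Ioi fun τ hτ => ?_
          have hτS : τ ∈ Ici S := mem_Ici.2 (le_of_lt hτ)
          have hτT : τ ∈ Ici T := mem_Ici.2 (le_trans hS hτS)
          have e : (fun ξ => ‖phaseVelocity v u τ ξ‖ₑ) =
              fun ξ => invTwoSq τ * ‖gradDotHat (v τ) (u τ) ξ‖ₑ := by
            funext ξ; rw [phaseVelocity, enorm_mul, enorm_ofReal_inv]
          rw [e, wl_const_mul (c := invTwoSq τ) ENNReal.ofReal_ne_top]
          calc _ ≤ invTwoSq τ * (C * ((3 * b) * H τ) * M) := by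
                gcongr
                refine (wl_mono_weight hn le_rfl le_rfl (htw.ρinf_lt τ).le _).trans
                  ((hbil (ρ τ) (v τ) (u τ) (htw.ρ_pos τ).le hvm.of_uncurry_left
                    hum.of_uncurry_left).trans ?_)
                gcongr
                · exact hcv.sup_le τ hτT
                · exact hM τ hτS
            _ = (invTwoSq τ * H τ) * (C * (3 * b) * M) := by ring
            _ ≤ (ENNReal.ofReal (r τ) * H₁ S) * (C * (3 * b) * M) := by
                refine mul_le_mul_left ((htw.mul_le τ hτT).trans ?_) _
                gcongr
                exact htw.antitone_H₁ hτS
            _ = _ := by ring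
      _ = C * (3 * b) * M * H₁ S * ∫⁻ τ in Ioi S, ENNReal.ofReal (r τ) :=
          lintegral_const_mul _ hrm.ennreal_ofReal
      _ ≤ _ := by
          gcongr
          exact hS
  -- The limit exists without any smallness: H₁ tends to zero, so the energy bound holds from some
  -- T₂ on, and before T₂ the a priori control of u is enough.
  obtain ⟨T₂, hT₂c, hT₂⟩ : ∃ T₂, 3 * b * H₁ T₂ ≤ ENNReal.ofReal c ∧ T ≤ T₂ := by
    have h2 := ENNReal.Tendsto.const_mul (a := 3 * b) htw.tendsto_H₁ (Or.inr h3b)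
    rw [mul_zero] at h2
    exact (((ENNReal.tendsto_nhds_zero.1 h2) _ (ENNReal.ofReal_pos.2 hc)).and
      (eventually_ge_atTop T)).exists
  have hYle : ∀ τ ∈ Ici T, Y τ ≤ 3 * b * H τ := fun τ hτ =>
    (wl_mono_weight hn (by linarith) le_rfl le_rfl _).trans (hcu.sup_le τ hτ)
  set M : ℝ≥0∞ := max (3 * b * H T₂) (2 * Y T₂) with hMdef
  have hM : M ≠ ∞ := by
    have f1 := htw.H_ne_top T₂
    have f2 : Y T₂ ≠ ∞ := ne_top_of_le_ne_top (by finiteness) (hYle T₂ hT₂)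
    exact (max_lt (by finiteness) (by finiteness)).ne
  have hYM : ∀ τ ∈ Ici T, Y τ ≤ M := fun τ hτ => by
    rcases le_total τ T₂ with h2 | h2
    · refine (hYle τ hτ).trans (le_trans ?_ (le_max_left _ _))
      gcongr
      exact htw.monotone_H h2
    · exact (hbound T₂ hT₂ hT₂c τ h2).trans (le_max_right _ _)
  have huM : ∀ t ∈ Ici T, wl ν (ℓ + 1 + ν) low ρinf (fun ξ => ‖u t ξ‖ₑ) ≤ M := fun t ht =>
    (wl_mono_weight hn le_rfl le_rfl (htw.ρinf_lt t).le _).trans (hYM t ht)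
  have hRm := measurable_phaseVelocity hvm hum
  obtain ⟨V, hV, hVM, hVle, hVt⟩ := exists_limit hn (U := u) (R := phaseVelocity v u)
    (fun t => hum.of_uncurry_left) hRm huM (fun t ht => (hevo T t le_rfl ht).2)
    (ne_top_of_le_ne_top (by
      have f1 := htw.H₁_ne_top T
      have f2 := htw.lintegral_r
      finiteness) (hvel T self_mem_Ici M hYM))
  refine ⟨V, hV, ⟨M, hM, hVM, huM⟩, hVt, fun T₁ hT₁ hc1 t ht => ?_⟩
  have hc2 : 3 * b * H₁ T₁ ≤ ENNReal.ofReal c := by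
    calc 3 * b * H₁ T₁ = 3 * (b * H₁ T₁) := by ring
      _ ≤ 3 * ENNReal.ofReal (c / 3) := by gcongr
      _ = ENNReal.ofReal c := by
        rw [show (3 : ℝ≥0∞) = ENNReal.ofReal 3 by simp, ← ENNReal.ofReal_mul (by norm_num)]
        congr 1; ring
  have htT : t ∈ Ici T := mem_Ici.2 (le_trans hT₁ ht)
  refine (hVle t htT).trans ((hvel t htT (2 * Y T₁) fun τ hτ =>
    hbound T₁ hT₁ hc2 τ (mem_Ici.2 (le_trans ht hτ))).trans (le_of_eq ?_))
  ring

end PhaseLimit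

-- From limits on the Fourier side to limits of functions

section Limits

lemma one_le_ew_zero (ν : ℝ) {ρ : ℝ} (hρ : 0 ≤ ρ) (ξ : Rn n) : 1 ≤ ew ν 0 0 ρ ξ := by
  rw [ew, weight_eq_radial, radial, pw_zero, one_mul]
  exact ENNReal.one_le_ofReal.2 (one_le_exp_max_rpow hρ)

/-- The embedding of the Fourier transforms into `L¹`. -/
lemma exists_lintegral_le_wl (hn : 0 < n) {a b : ℝ} (ha : n / 2 < a) (hb : b < n / 2) :
    ∃ C : ℝ≥0∞, C ≠ ∞ ∧ ∀ (ν ρ : ℝ) (F : Rn n → ℝ≥0∞), 0 ≤ ρ → Measurable F →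
      ∫⁻ ξ, F ξ ≤ C * wl ν a b ρ F := by
  obtain ⟨C, hC, h⟩ := exists_lintegral_ew_le (n := n) hn (a := a) (b := b) (a' := 0) (b' := 0)
    (by linarith) (by linarith)
  refine ⟨C, hC, fun ν ρ F hρ hF => le_trans (lintegral_mono fun ξ => ?_) (h ν ρ F hF)⟩
  exact le_mul_of_one_le_left zero_le (one_le_ew_zero ν hρ ξ)

lemma integrable_of_lintegral_enorm {v : Rn n → ℂ} (hv : Measurable v)
    (h : ∫⁻ ξ, ‖v ξ‖ₑ ≠ ∞) : Integrable v :=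
  ⟨hv.aestronglyMeasurable, h.lt_top⟩

/-- A curve of Fourier transforms that is bounded for the exponent `a` and converges for some
exponent. -/
structure ConvergesTo (ν a b ρ T : ℝ) (U : ℝ → Rn n → ℂ) (V : Rn n → ℂ) : Prop where
  measurable : ∀ t, Measurable (U t)
  measurable_limit : Measurable V
  bounded : ∃ M : ℝ≥0∞, M ≠ ∞ ∧ wl ν a b ρ (fun ξ => ‖V ξ‖ₑ) ≤ M ∧
    ∀ t ∈ Ici T, wl ν a b ρ (fun ξ => ‖U t ξ‖ₑ) ≤ M
  tendsto : ∃ a', Tendsto (fun t => wl ν a' b ρ fun ξ => ‖U t ξ - V ξ‖ₑ) atTop (𝓝 0)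

namespace ConvergesTo

variable {ν a b ρ T : ℝ} {U : ℝ → Rn n → ℂ} {V : Rn n → ℂ}

lemma tendsto_wl (h : ConvergesTo ν a b ρ T U V) {a' : ℝ} (ha : a' < a) :
    Tendsto (fun t => wl ν a' b ρ fun ξ => ‖U t ξ - V ξ‖ₑ) atTop (𝓝 0) := by
  obtain ⟨M, hM, hV, hU⟩ := h.bounded
  obtain ⟨a₀, h0⟩ := h.tendsto
  refine tendsto_wl_of_bounded (M := M + M) (by finiteness)
    (fun t => ((h.measurable t).sub h.measurable_limit).enorm) ?_ h0 ha
  filter_upwards [eventually_ge_atTop T] with t ht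
  exact (wl_mono (ae_of_all _ fun ξ => enorm_sub_le)).trans
    ((wl_add_le (h.measurable t).enorm.aemeasurable h.measurable_limit.enorm.aemeasurable).trans
      (add_le_add (hU t ht) hV))

lemma tendsto_wnorm (h : ConvergesTo ν a b ρ T U V) {u : ℝ → Rn n → ℂ} {v : Rn n → ℂ}
    (hu : ∀ t ∈ Ici T, IsFourier (u t) (U t)) (hv : IsFourier v V) {a' : ℝ} (ha : a' < a) :
    Tendsto (fun t => wnorm ν a' b ρ fun x => u t x - v x) atTop (𝓝 0) := by
  refine (h.tendsto_wl ha).congr' ?_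
  filter_upwards [eventually_ge_atTop T] with t ht
  exact (((hu t ht).sub hv).wnorm_eq _ _ _ _).symm

lemma wnorm_lt_top (h : ConvergesTo ν a b ρ T U V) {v : Rn n → ℂ} (hv : IsFourier v V) :
    wnorm ν a b ρ v < ∞ := by
  obtain ⟨M, hM, hV, -⟩ := h.bounded
  rw [hv.wnorm_eq]
  exact hV.trans_lt hM.lt_top

lemma weakTendsto (h : ConvergesTo ν a b ρ T U V) {u : ℝ → Rn n → ℂ} {v : Rn n → ℂ}
    (hu : ∀ t ∈ Ici T, IsFourier (u t) (U t)) (hv : IsFourier v V) : WeakTendsto ν a b ρ u v := by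
  intro G hG
  obtain ⟨M, hM, hV, hU⟩ := h.bounded
  obtain ⟨a₀, h0⟩ := h.tendsto
  have key := tendsto_integral_weight h.measurable h.measurable_limit hM hU hV h0 hG
  rw [integral_congr_ae (g := fun ξ => conj (G ξ) * ((weight ν a b ρ ξ : ℂ) * V ξ))
    (by filter_upwards [hv.hat_ae_eq] with ξ hξ; rw [hξ])]
  refine key.congr' ?_
  filter_upwards [eventually_ge_atTop T] with t ht
  exact integral_congr_ae (by filter_upwards [(hu t ht).hat_ae_eq] with ξ hξ; rw [hξ])

lemma isAmplitudeLimit {k : ℝ} (h : ConvergesTo ν k 0 ρ T U V) {u : ℝ → Rn n → ℂ} {v : Rn n → ℂ}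
    (hu : ∀ t ∈ Ici T, IsFourier (u t) (U t)) (hv : IsFourier v V) :
    IsAmplitudeLimit ν ρ k u v :=
  ⟨h.wnorm_lt_top hv, fun _ hk => h.tendsto_wnorm hu hv hk, h.weakTendsto hu hv⟩

lemma isPhaseLimit {low ℓ : ℝ} (h : ConvergesTo ν (ℓ + 2) low ρ T U V) {φ : ℝ → Rn n → ℝ}
    {ω : Rn n → ℝ} (hu : ∀ t ∈ Ici T, IsFourier (fun x => (φ t x : ℂ)) (U t))
    (hv : IsFourier (fun x => (ω x : ℂ)) V) : IsPhaseLimit ν low ρ ℓ φ ω := by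
  refine ⟨h.wnorm_lt_top hv, fun ℓ' hℓ => ?_, h.weakTendsto hu hv⟩
  simp only [normY, Complex.ofReal_sub]
  exact h.tendsto_wnorm hu hv (by linarith)

lemma tendsto_lintegral (h : ConvergesTo ν a b ρ T U V) (hn : 0 < n) (hρ : 0 ≤ ρ)
    (ha : n / 2 < a) (hb : b < n / 2) :
    Tendsto (fun t => ∫⁻ ξ, ‖U t ξ - V ξ‖ₑ) atTop (𝓝 0) := by
  -- An exponent strictly between n/2 and a: convergence holds only below a, and the embedding into
  -- L¹ only above n/2.
  obtain ⟨C, hC, hle⟩ := exists_lintegral_le_wl hn (a := (a + n / 2) / 2) (by linarith) hb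
  have h1 := ENNReal.Tendsto.const_mul (a := C) (h.tendsto_wl (a' := (a + n / 2) / 2) (by linarith))
    (Or.inr hC)
  rw [mul_zero] at h1
  exact tendsto_of_tendsto_of_tendsto_of_le_of_le tendsto_const_nhds h1 (fun _ => zero_le)
    fun t => hle ν ρ _ hρ ((h.measurable t).sub h.measurable_limit).enorm

/-- A limit of Fourier transforms of real functions. -/
lemma exists_real_limit (h : ConvergesTo ν a b ρ T U V) (hn : 0 < n) (hρ : 0 ≤ ρ)
    (ha : n / 2 < a) (hb : b < n / 2) {φ : ℝ → Rn n → ℝ}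
    (hu : ∀ t ∈ Ici T, IsFourier (fun x => (φ t x : ℂ)) (U t))
    (hc : ∀ t ∈ Ici T, Continuous (φ t)) :
    ∃ ω : Rn n → ℝ, Continuous ω ∧ IsFourier (fun x => (ω x : ℂ)) V ∧
      ∀ t ∈ Ici T, ∀ x, ‖(φ t x : ℂ) - ω x‖ₑ ≤ ∫⁻ ξ, ‖U t ξ - V ξ‖ₑ := by
  obtain ⟨M, hM, hV, hU⟩ := h.bounded
  obtain ⟨C, hC, hle⟩ := exists_lintegral_le_wl hn ha hb
  have hi : ∀ {v : Rn n → ℂ}, Measurable v → wl ν a b ρ (fun ξ => ‖v ξ‖ₑ) ≤ M → Integrable v :=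
    fun hv hvM => integrable_of_lintegral_enorm hv (ne_top_of_le_ne_top (b := C * M) (by finiteness)
      ((hle ν ρ _ hρ hv.enorm).trans (by gcongr)))
  have hVi : Integrable V := hi h.measurable_limit hV
  have hUi : ∀ t ∈ Ici T, Integrable (U t) := fun t ht => hi (h.measurable t) (hU t ht)
  have hφ : ∀ t ∈ Ici T, (fun x => (φ t x : ℂ)) = invF (U t) := fun t ht =>
    (hu t ht).eq_invF (Complex.continuous_ofReal.comp (hc t ht)) (hUi t ht)
  have hd : ∀ t ∈ Ici T, ∀ x, ‖(φ t x : ℂ) - invF V x‖ₑ ≤ ∫⁻ ξ, ‖U t ξ - V ξ‖ₑ := fun t ht x => by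
    rw [show (φ t x : ℂ) = invF (U t) x from congrFun (hφ t ht) x, ← invF_sub (hUi t ht) hVi]
    exact enorm_invF_le _ _
  have hlim : ∀ x, Tendsto (fun t => (φ t x : ℂ)) atTop (𝓝 (invF V x)) := fun x => by
    rw [tendsto_iff_edist_tendsto_0]
    refine tendsto_of_tendsto_of_tendsto_of_le_of_le' tendsto_const_nhds
      (h.tendsto_lintegral hn hρ ha hb) (Eventually.of_forall fun _ => zero_le) ?_
    filter_upwards [eventually_ge_atTop T] with t ht
    rw [edist_eq_enorm_sub]
    exact hd t ht x
  -- The inverse transform of V is a pointwise limit of real numbers.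
  have hre : ∀ x, ((invF V x).re : ℂ) = invF V x := fun x => by
    have h1 := (Complex.continuous_im.tendsto _).comp (hlim x)
    have h2 : (invF V x).im = 0 := tendsto_nhds_unique h1 (by simp [Function.comp_def])
    exact Complex.ext (by simp) (by simp [h2])
  refine ⟨fun x => (invF V x).re, Complex.continuous_re.comp (continuous_invF hVi), ?_,
    fun t ht x => ?_⟩
  · simp only [hre]
    exact isFourier_invF hVi
  · rw [hre]
    exact hd t ht x

end ConvergesTo

end Limits

-- Extension of the functions of time to the real line

section Weights

/-- The functions of time, extended to the real line. -/
lemma exists_timeWeights {γ t₀ ρ₀ T : ℝ} {r h₀ h₁ : ℝ → ℝ} (hr : IsRate γ r)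
    (hh : IsEstimating γ r h₀ h₁) (ht₀ : 1 ≤ t₀) (hT : t₀ ≤ T)
    (hρ : ∀ t, t₀ ≤ t → 0 ≤ rho r t₀ ρ₀ t) :
    ∃ r' ρ' h₀' h₁' : ℝ → ℝ, TimeWeights r' ρ' (rhoInf r t₀ ρ₀) T (fun t => ENNReal.ofReal (h₀' t))
        (fun t => ENNReal.ofReal (h₁' t)) ∧ Measurable h₀' ∧
      (∀ t ∈ Ici (1 : ℝ), r t = r' t) ∧ (∀ t ∈ Ici T, rho r t₀ ρ₀ t = ρ' t) ∧
      (∀ t ∈ Ici (1 : ℝ), h₀ t = h₀' t) ∧ (∀ t ∈ Ici (1 : ℝ), h₁ t = h₁' t) := by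
  have hm1 : ∀ t : ℝ, max t 1 ∈ Ici (1 : ℝ) := fun t => mem_Ici.2 (le_max_right _ _)
  have hme : ∀ t ∈ Ici (1 : ℝ), max t 1 = t := fun t ht => max_eq_left ht
  -- Times before 1 are frozen at 1. The extension keeps positivity, monotonicity and continuity, so
  -- that ρ becomes differentiable on the whole line with derivative -r'.
  set r' : ℝ → ℝ := fun t => r (max t 1) with hr'
  have hrc : Continuous r' := hr.contDiffOn.continuousOn.comp_continuous
    (continuous_id.max continuous_const) hm1
  have hrr : ∀ t ∈ Ici (1 : ℝ), r t = r' t := fun t ht => by simp only [hr', hme t ht]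
  have hpos : ∀ t, 0 < r' t := fun t => hr.pos _ (hm1 t)
  set ρ' : ℝ → ℝ := fun t => ρ₀ - ∫ s in t₀..t, r' s with hρ'
  have hT1 : 1 ≤ T := ht₀.trans hT
  have hder : ∀ τ, HasDerivAt ρ' (-r' τ) τ := fun τ => by
    simpa using (hrc.integral_hasStrictDerivAt t₀ τ).hasDerivAt.const_sub ρ₀
  have hint : IntegrableOn r (Ioi t₀) := hr.integrableOn.mono_set fun s hs =>
    mem_Ici.2 (ht₀.trans (le_of_lt hs))
  have hivl : ∀ t, t₀ ≤ t → ∫ s in t₀..t, r s = ∫ s in t₀..t, r' s := fun t ht => by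
    refine intervalIntegral.integral_congr fun s hs => hrr s ?_
    rw [uIcc_of_le ht] at hs
    exact mem_Ici.2 (ht₀.trans hs.1)
  have hρe : ∀ t, t₀ ≤ t → rho r t₀ ρ₀ t = ρ' t := fun t ht => by
    rw [rho, hivl t ht, abs_of_nonneg (intervalIntegral.integral_nonneg ht fun s _ => (hpos s).le)]
  have hanti : StrictAnti ρ' := strictAnti_of_deriv_neg fun τ => by
    rw [(hder τ).deriv]; linarith [hpos τ]
  have hlim : Tendsto ρ' atTop (𝓝 (rhoInf r t₀ ρ₀)) := by
    refine Tendsto.congr' (f₁ := fun t => ρ₀ - ∫ s in t₀..t, r s) ?_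
      ((intervalIntegral_tendsto_integral_Ioi t₀ hint tendsto_id).const_sub ρ₀)
    filter_upwards [eventually_ge_atTop t₀] with t ht
    simp only [hρ', hivl t ht]
  have hinf : 0 ≤ rhoInf r t₀ ρ₀ := ge_of_tendsto hlim (by
    filter_upwards [eventually_ge_atTop t₀] with t ht
    rw [← hρe t ht]; exact hρ t ht)
  refine ⟨r', ρ', fun t => h₀ (max t 1), fun t => h₁ (max t 1), ?_, ?_, hrr,
    fun t ht => hρe t (hT.trans ht), fun t ht => by simp only [hme t ht],
    fun t ht => by simp only [hme t ht]⟩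
  · have hmono : Monotone fun t => h₀ (max t 1) := fun s t hst =>
      hh.monotoneOn (hm1 s) (hm1 t) (max_le_max_right _ hst)
    refine ⟨hT1, hrc, hpos, hder, hinf, fun τ => ?_, hmono.measurable.ennreal_ofReal,
      fun τ => ?_, fun τ => ENNReal.ofReal_ne_top, fun s t hst => ENNReal.ofReal_le_ofReal (hmono hst),
      fun τ => ENNReal.ofReal_ne_top, fun s t hst => ENNReal.ofReal_le_ofReal
        (hh.antitoneOn (hm1 s) (hm1 t) (max_le_max_right _ hst)), ?_, fun τ hτ => ?_, ?_⟩
    -- The strict inequality passes through the time τ + 1. It makes ρ(τ) > 0 even when ρ(∞) = 0.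
    · exact lt_of_le_of_lt (hanti.antitone.le_of_tendsto hlim (τ + 1)) (hanti (lt_add_one τ))
    · simpa using hh.pos_zero _ (hm1 τ)
    · have h1 := (ENNReal.continuous_ofReal.tendsto 0).comp hh.tendsto_zero
      rw [ENNReal.ofReal_zero] at h1
      refine h1.congr' ?_
      filter_upwards [eventually_ge_atTop 1] with t ht
      simp only [Function.comp, hme t ht]
    · have hτ1 : τ ∈ Ici (1 : ℝ) := mem_Ici.2 (hT1.trans hτ)
      have hτ0 : 0 < τ := lt_of_lt_of_le one_pos hτ1
      simp only [hme τ hτ1, ← hrr τ hτ1, invTwoSq]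
      rw [← ENNReal.ofReal_mul (by positivity), ← ENNReal.ofReal_mul (hr.pos τ hτ1).le]
      refine ENNReal.ofReal_le_ofReal ?_
      have h1 := hh.le_one τ hτ1
      rw [Real.rpow_neg hτ0.le, Real.rpow_two] at h1
      have hp := hr.pos τ hτ1
      have hp0 := hh.pos_zero τ hτ1
      have h2 : (τ ^ 2)⁻¹ * h₀ τ ≤ r τ * h₁ τ := by
        calc (τ ^ 2)⁻¹ * h₀ τ = r τ * ((τ ^ 2)⁻¹ * (r τ)⁻¹ * h₀ τ) := by field_simp
          _ ≤ _ := mul_le_mul_of_nonneg_left h1 hp.le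
      refine le_trans ?_ h2
      gcongr
      nlinarith [sq_nonneg τ]
    · have h1 : IntegrableOn r' (Ioi T) := (hr.integrableOn.mono_set fun s hs =>
        mem_Ici.2 (hT1.trans (le_of_lt hs))).congr_fun
          (fun s hs => hrr s (mem_Ici.2 (hT1.trans (le_of_lt hs)))) measurableSet_Ioi
      exact h1.lintegral_lt_top.ne
  · exact Monotone.measurable fun s t hst =>
      hh.monotoneOn (hm1 s) (hm1 t) (max_le_max_right _ hst)

end Weights

-- Convergence of the amplitudes

section AmplitudeLimit

lemma lintegral_invTwoSq_ne_top {T : ℝ} (hT : 1 ≤ T) : ∫⁻ τ in Ioi T, invTwoSq τ ≠ ∞ := by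
  have h1 : IntegrableOn (fun τ : ℝ => τ ^ (-2 : ℝ)) (Ioi T) :=
    integrableOn_Ioi_rpow_of_lt (by norm_num) (by linarith)
  refine ne_top_of_le_ne_top h1.lintegral_lt_top.ne
    (setLIntegral_mono' measurableSet_Ioi fun τ hτ => ENNReal.ofReal_le_ofReal ?_)
  have h2 : 0 < τ := by linarith [mem_Ioi.1 hτ]
  rw [Real.rpow_neg h2.le, Real.rpow_two]
  gcongr
  nlinarith [sq_nonneg τ]

/-- The limit of the amplitude, on the Fourier side. -/
lemma exists_amplitude_limit (hn : 0 < n) {ν low k ℓ γ μ κ T : ℝ} (h0 : 0 < ν) (h1 : ν ≤ 1)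
    (hlow : 0 ≤ low) (hlow' : low < n / 2) (hℓ : n / 2 - ν < ℓ) (hk : 1 - ν / 2 ≤ k)
    {r ρ : ℝ → ℝ} {ρinf : ℝ} {H H₁ : ℝ → ℝ≥0∞} {B B' : ℝ≥0∞} (hB : B ≠ ∞) (hB' : B' ≠ ∞)
    {w : ℝ → Rn n → ℂ} {φ : ℝ → Rn n → ℝ} {p a : ℝ → Rn n → ℂ}
    (htw : TimeWeights r ρ ρinf T H H₁) (hs : IsSolution γ μ κ T w φ)
    (hp : Controlled ν (ℓ + 2) low r ρ T H B p) (ha : Controlled ν k 0 r ρ T (fun _ => 1) B' a)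
    (hF : ∀ t ∈ Ici T, IsFourier (fun x => (φ t x : ℂ)) (p t))
    (hFw : ∀ t ∈ Ici T, IsFourier (w t) (a t)) : ∃ V, ConvergesTo ν k 0 ρinf T a V := by
  obtain ⟨C, hC, htr⟩ := exists_wl_transportHat_le hn h0 h1 hlow hlow' hℓ hk
  have hpm : ∀ τ, Measurable (p τ) := fun τ => hp.measurable.of_uncurry_left
  have ham : ∀ τ, Measurable (a τ) := fun τ => ha.measurable.of_uncurry_left
  have haM : ∀ t ∈ Ici T, wl ν k 0 ρinf (fun ξ => ‖a t ξ‖ₑ) ≤ B' := fun t ht =>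
    (wl_mono_weight hn le_rfl le_rfl (htw.ρinf_lt t).le _).trans (by simpa using ha.sup_le t ht)
  have hrm := htw.continuous_r.measurable
  have hρm := htw.continuous_ρ.measurable
  set q : ℝ → ℝ≥0∞ := fun τ => wl ν (ℓ + 2 + ν / 2) low (ρ τ) fun ξ => ‖p τ ξ‖ₑ with hq
  set y : ℝ → ℝ≥0∞ := fun τ => wl ν (k + ν / 2) 0 (ρ τ) fun ξ => ‖a τ ξ‖ₑ with hy
  have hqm : Measurable q := measurable_wl hρm hp.measurable.enorm
  have hym : Measurable y := measurable_wl hρm ha.measurable.enorm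
  -- The exponent -2 accommodates both terms: the Laplacian maps exponent 0 ≤ k into it, and the
  -- transport term is even in L².
  have hlap : ∀ τ ∈ Ici T, wl ν (-2) 0 ρinf (fun ξ => ‖laplaceHat (a τ) ξ‖ₑ) ≤ B' := fun τ hτ => by
    calc _ = wl ν (-2) 0 ρinf (fun ξ => ‖ξ‖ₑ * (‖ξ‖ₑ * ‖a τ ξ‖ₑ)) := by
          congr 1; funext ξ; rw [enorm_laplaceHat, sq, mul_assoc]
      _ ≤ wl ν (-2 + 1 + 1) 0 ρinf (fun ξ => ‖a τ ξ‖ₑ) :=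
          (wl_norm_mul_le _ _ _ _ _).trans (wl_norm_mul_le _ _ _ _ _)
      _ ≤ _ := (wl_mono_weight hn (by linarith) le_rfl le_rfl _).trans (haM τ hτ)
  -- Trading H for r H₁ leaves r times the product of two norms with ν/2 extra derivatives, each
  -- square integrable against r, so that Cauchy-Schwarz gives integrability in time.
  have htrans : ∀ τ ∈ Ici T, invTwoSq τ * wl ν (-2) 0 ρinf (fun ξ => ‖transportHat (p τ) (a τ) ξ‖ₑ) ≤
      C * H₁ T * (ENNReal.ofReal (r τ) * (((H τ)⁻¹ * q τ) * ((1 : ℝ≥0∞)⁻¹ * y τ))) := fun τ hτ => by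
    calc _ ≤ invTwoSq τ * (C * q τ * y τ) := by
          gcongr
          exact (wl_mono_weight hn (by norm_num) le_rfl (htw.ρinf_lt τ).le _).trans
            (htr (ρ τ) _ _ (htw.ρ_pos τ).le (hpm τ) (ham τ))
      _ = (invTwoSq τ * H τ) * (C * ((H τ)⁻¹ * q τ) * y τ) := by
          rw [show (invTwoSq τ * H τ) * (C * ((H τ)⁻¹ * q τ) * y τ) =
            (H τ * (H τ)⁻¹) * (invTwoSq τ * (C * q τ * y τ)) by ring,
            ENNReal.mul_inv_cancel (htw.H_ne_zero τ) (htw.H_ne_top τ), one_mul]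
      _ ≤ (ENNReal.ofReal (r τ) * H₁ T) * (C * ((H τ)⁻¹ * q τ) * y τ) := by
          refine mul_le_mul_left ((htw.mul_le τ hτ).trans ?_) _
          gcongr
          exact htw.antitone_H₁ hτ
      _ = _ := by rw [inv_one, one_mul]; ring
  have hHm := htw.measurable_H
  have hfin : ∫⁻ τ in Ioi T, ENNReal.ofReal (r τ) *
      (((H τ)⁻¹ * q τ) * ((1 : ℝ≥0∞)⁻¹ * y τ)) ≠ ∞ := by
    refine ne_top_of_le_ne_top ?_ (lintegral_mul_mul_le hrm.ennreal_ofReal (hHm.inv.mul hqm)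
      (hym.const_mul _))
    refine ENNReal.mul_ne_top (ENNReal.rpow_ne_top_of_nonneg (by norm_num) ?_)
      (ENNReal.rpow_ne_top_of_nonneg (by norm_num) ?_)
    · exact ne_top_of_le_ne_top (by finiteness)
        ((lintegral_mono_set Ioi_subset_Ici_self).trans hp.int_le)
    · exact ne_top_of_le_ne_top (by finiteness)
        ((lintegral_mono_set Ioi_subset_Ici_self).trans ha.int_le)
  have hRD : ∫⁻ τ in Ioi T, wl ν (-2) 0 ρinf (fun ξ => ‖amplitudeVelocity p a τ ξ‖ₑ) ≠ ∞ := by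
    have hm1 : ∀ τ, Measurable (laplaceHat (a τ)) := fun τ =>
      (measurable_uncurry_laplaceHat ha.measurable).of_uncurry_left
    have hm2 : ∀ τ, Measurable (transportHat (p τ) (a τ)) := fun τ =>
      (measurable_uncurry_transportHat hp.measurable ha.measurable).of_uncurry_left
    refine ne_top_of_le_ne_top (b := (∫⁻ τ in Ioi T, invTwoSq τ * B') + ∫⁻ τ in Ioi T,
      C * H₁ T * (ENNReal.ofReal (r τ) * (((H τ)⁻¹ * q τ) * ((1 : ℝ≥0∞)⁻¹ * y τ)))) ?_ ?_
    · have f1 := lintegral_invTwoSq_ne_top htw.one_le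
      have f2 := htw.H₁_ne_top T
      rw [lintegral_mul_const _ measurable_invTwoSq, lintegral_const_mul' _ _ (by finiteness)]
      finiteness
    · rw [← lintegral_add_left (measurable_invTwoSq.mul_const _)]
      refine setLIntegral_mono' measurableSet_Ioi fun τ hτ => ?_
      have hτ' : τ ∈ Ici T := mem_Ici.2 (le_of_lt hτ)
      refine le_trans ?_ (add_le_add (mul_le_mul_right (hlap τ hτ') (invTwoSq τ)) (htrans τ hτ'))
      rw [← mul_add]
      calc _ ≤ wl ν (-2) 0 ρinf (fun ξ => invTwoSq τ *
            (‖laplaceHat (a τ) ξ‖ₑ + ‖transportHat (p τ) (a τ) ξ‖ₑ)) := by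
            refine wl_mono (ae_of_all _ fun ξ => ?_)
            dsimp only
            rw [amplitudeVelocity, enorm_mul, enorm_ofReal_inv]
            gcongr
            refine (enorm_add_le _ _).trans (le_of_eq ?_)
            rw [enorm_mul, ← ofReal_norm Complex.I, Complex.norm_I]; simp
        _ = invTwoSq τ * wl ν (-2) 0 ρinf
            (fun ξ => ‖laplaceHat (a τ) ξ‖ₑ + ‖transportHat (p τ) (a τ) ξ‖ₑ) :=
            wl_const_mul (c := invTwoSq τ) ENNReal.ofReal_ne_top _
        _ ≤ _ := by
            gcongr
            exact wl_add_le (hm1 τ).enorm.aemeasurable (hm2 τ).enorm.aemeasurable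
  obtain ⟨V, hV, hVM, -, hVt⟩ := exists_limit hn (U := a) (R := amplitudeVelocity p a) ham
    (measurable_amplitudeVelocity hp.measurable ha.measurable) haM
    (fun t ht => amplitude_evolution hn h0 hlow' htw.one_le hB hB' htw.H_ne_top htw.monotone_H
      htw.antitone_ρ htw.ρ_pos hs hp ha hF hFw ht) hRD
  exact ⟨V, ham, hV, ⟨B', hB', hVM, haM⟩, -2, hVt⟩

end AmplitudeLimit

-- The gauge relation at infinity

section GaugeLimit

lemma ltwo_le_wl {ν k ρ : ℝ} (hn : 0 < n) (hk : 0 ≤ k) (hρ : 0 ≤ ρ) (F : Rn n → ℝ≥0∞) :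
    ltwo volume F ≤ wl ν k 0 ρ F :=
  le_trans (ltwo_mono (ae_of_all _ fun ξ => le_mul_of_one_le_left zero_le (one_le_ew_zero ν hρ ξ)))
    (wl_mono_weight hn hk le_rfl le_rfl F)

lemma memLp_of_wl {ν k ρ : ℝ} (hn : 0 < n) (hk : 0 ≤ k) (hρ : 0 ≤ ρ) {v : Rn n → ℂ}
    (hv : Measurable v) (h : wl ν k 0 ρ (fun ξ => ‖v ξ‖ₑ) ≠ ∞) : MemLp v 2 volume := by
  refine ⟨hv.aestronglyMeasurable, ?_⟩
  rw [eLpNorm_two_eq]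
  exact (ltwo_le_wl hn hk hρ _).trans_lt h.lt_top

/-- Plancherel's theorem for functions with square integrable Fourier transform. -/
lemma IsFourier.eLpNorm_eq {u v : Rn n → ℂ} (h : IsFourier u v) (hv : MemLp v 2 volume) :
    eLpNorm u 2 volume = eLpNorm v 2 volume := by
  obtain ⟨u', hu', -, he⟩ := exists_isFourier_of_memLp hv
  rw [← he, eLpNorm_congr_ae (h.ae_eq_left hu')]

/-- Convergence in measure of the functions of a convergent curve of Fourier transforms, in `L²`. -/
lemma ConvergesTo.tendsto_eLpNorm {ν k ρ T : ℝ} {U : ℝ → Rn n → ℂ} {V : Rn n → ℂ}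
    (h : ConvergesTo ν k 0 ρ T U V) (hn : 0 < n) (hk : 0 < k) (hρ : 0 ≤ ρ) {u : ℝ → Rn n → ℂ}
    {v : Rn n → ℂ} (hu : ∀ t ∈ Ici T, IsFourier (u t) (U t)) (hv : IsFourier v V) :
    Tendsto (fun t => eLpNorm (fun x => u t x - v x) 2 volume) atTop (𝓝 0) := by
  obtain ⟨M, hM, hVM, hUM⟩ := h.bounded
  have h1 := h.tendsto_wl hk
  refine tendsto_of_tendsto_of_tendsto_of_le_of_le' tendsto_const_nhds h1
    (Eventually.of_forall fun _ => zero_le) ?_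
  filter_upwards [eventually_ge_atTop T] with t ht
  have hU := memLp_of_wl hn hk.le hρ (h.measurable t) (ne_top_of_le_ne_top hM (hUM t ht))
  have hV := memLp_of_wl hn hk.le hρ h.measurable_limit (ne_top_of_le_ne_top hM hVM)
  rw [((hu t ht).sub hv).eLpNorm_eq (hU.sub hV), eLpNorm_two_eq]
  exact ltwo_le_wl hn le_rfl hρ _

/-- Gauge equivalence passes to the limit. -/
lemma gauge_limit {T : ℝ} {w w' : ℝ → Rn n → ℂ} {φ φ' : ℝ → Rn n → ℝ} {v v' : Rn n → ℂ}
    {ω : Rn n → ℝ} (hg : GaugeEquiv T w φ w' φ')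
    (hw : ∀ t ∈ Ici T, AEStronglyMeasurable (w t)) (hw' : ∀ t ∈ Ici T, AEStronglyMeasurable (w' t))
    (hv : AEStronglyMeasurable v) (hv' : AEStronglyMeasurable v')
    (h : Tendsto (fun t => eLpNorm (fun x => w t x - v x) 2 volume) atTop (𝓝 0))
    (h' : Tendsto (fun t => eLpNorm (fun x => w' t x - v' x) 2 volume) atTop (𝓝 0))
    (hω : ∀ x, Tendsto (fun t => φ' t x - φ t x) atTop (𝓝 (ω x))) :
    ∀ᵐ x, v' x = v x * Complex.exp (Complex.I * (ω x : ℂ)) := by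
  have hseq : Tendsto (fun i : ℕ => T + i) atTop atTop :=
    tendsto_atTop_add_const_left _ _ tendsto_natCast_atTop_atTop
  have hT : ∀ i : ℕ, T + (i : ℝ) ∈ Ici T := fun i => mem_Ici.2 (by linarith [i.cast_nonneg (α := ℝ)])
  -- Two successive extractions: a subsequence along which w converges almost everywhere, then a
  -- further one for w'.
  obtain ⟨σ, hσ, h1⟩ := (tendstoInMeasure_of_tendsto_eLpNorm two_ne_zero (fun i : ℕ => hw _ (hT i)) hv
    (h.comp hseq)).exists_seq_tendsto_ae
  obtain ⟨σ', hσ', h2⟩ := (tendstoInMeasure_of_tendsto_eLpNorm two_ne_zero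
    (fun i : ℕ => hw' _ (hT (σ i))) hv'
    (h'.comp (hseq.comp hσ.tendsto_atTop))).exists_seq_tendsto_ae
  filter_upwards [h1, h2] with x h3 h4
  have h5 := h3.comp hσ'.tendsto_atTop
  have h6 := (hω x).comp (hseq.comp (hσ.tendsto_atTop.comp hσ'.tendsto_atTop))
  have h7 : Tendsto (fun i : ℕ => w (T + (σ (σ' i) : ℕ)) x * Complex.exp (Complex.I *
      ((φ' (T + (σ (σ' i) : ℕ)) x - φ (T + (σ (σ' i) : ℕ)) x : ℝ) : ℂ))) atTop
      (𝓝 (v x * Complex.exp (Complex.I * (ω x : ℂ)))) :=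
    h5.mul (((by fun_prop : Continuous fun s : ℝ => Complex.exp (Complex.I * (s : ℂ))).tendsto
      (ω x)).comp h6)
  refine tendsto_nhds_unique h4 (h7.congr fun i => ?_)
  have hgi := hg _ (hT (σ (σ' i))) x
  set t := T + ((σ (σ' i) : ℕ) : ℝ)
  calc w t x * Complex.exp (Complex.I * ((φ' t x - φ t x : ℝ) : ℂ))
      = Complex.exp (Complex.I * (φ' t x : ℂ)) *
        (Complex.exp (-Complex.I * (φ t x : ℂ)) * w t x) := by
        rw [← mul_assoc, ← Complex.exp_add, mul_comm]
        congr 2; push_cast; ring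
    _ = _ := by
        rw [hgi, ← mul_assoc, ← Complex.exp_add]
        simp [t]

end GaugeLimit

-- The asymptotic system: measurability and reality

section System

/-- Fourier transforms `a m`, `p m` of functions `w_m`, `φ_m` defined successively by the asymptotic
system, with `a 0` measurable. -/
structure AsymptoticSystem (γ μ κ : ℝ) (a p : ℕ → ℝ → Rn n → ℂ) : Prop where
  const : ∀ t, a 0 t = a 0 1
  measurable_zero : Measurable (a 0 1)
  succ : ∀ m t ξ, a (m + 1) t ξ = -∫ s in Ioi t, (((2 * s ^ 2)⁻¹ : ℝ) : ℂ) *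
    ∑ q ∈ Finset.HasAntidiagonal.antidiagonal m, transportHat (p q.1 s) (a q.2 s) ξ
  phase : ∀ m t ξ, p m t ξ = ∫ s in (1 : ℝ)..t,
    ((((2 * s ^ 2)⁻¹ : ℝ) : ℂ) * ∑ j : Fin m, gradDotHat (p j s) (p (m - 1 - j) s) ξ +
      ((s ^ (-γ) : ℝ) : ℂ) * ∑ q ∈ Finset.HasAntidiagonal.antidiagonal m, gZeroHat κ μ (a q.1 s) (a q.2 s) ξ)

lemma sum_fin_eq_sum_antidiagonal {M : Type*} [AddCommMonoid M] (f : ℕ → ℕ → M) (m : ℕ) :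
    ∑ j : Fin (m + 1), f j (m - j) = ∑ q ∈ Finset.HasAntidiagonal.antidiagonal m, f q.1 q.2 := by
  rw [Finset.Nat.sum_antidiagonal_eq_sum_range_succ f, Finset.sum_range]

lemma conjHat_congr {a a' : Rn n → ℂ} (h : a =ᵐ[volume] a') :
    conjHat a =ᵐ[volume] conjHat a' := by
  filter_upwards [(Measure.measurePreserving_neg (volume : Measure (Rn n))).quasiMeasurePreserving.ae h]
    with ξ hξ
  rw [conjHat, conjHat, hξ]

lemma gradDotHat_congr {a a' b b' : Rn n → ℂ} (ha : a =ᵐ[volume] a') (hb : b =ᵐ[volume] b') :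
    gradDotHat a b = gradDotHat a' b' := by
  funext ξ
  refine Finset.sum_congr rfl fun j _ => congrFun (mulHat_congr ?_ ?_) ξ
  · filter_upwards [ha] with ζ hζ
    rw [derivHat, derivHat, hζ]
  · filter_upwards [hb] with ζ hζ
    rw [derivHat, derivHat, hζ]

lemma transportHat_congr {a a' b b' : Rn n → ℂ} (ha : a =ᵐ[volume] a') (hb : b =ᵐ[volume] b') :
    transportHat a b = transportHat a' b' := by
  funext ξ
  rw [transportHat, transportHat, gradDotHat_congr ha hb, mulHat_congr (a' := laplaceHat a') ?_ hb]
  filter_upwards [ha] with ζ hζ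
  rw [laplaceHat, laplaceHat, hζ]

lemma gZeroHat_congr (κ μ : ℝ) {a a' b b' : Rn n → ℂ} (ha : a =ᵐ[volume] a')
    (hb : b =ᵐ[volume] b') : gZeroHat κ μ a b = gZeroHat κ μ a' b' := by
  funext ξ
  rw [gZeroHat, gZeroHat, mulHat_congr ha (conjHat_congr hb)]

/-- The functions `w_m`, `φ_m` associated with `w₊`, with a measurable representative of `ŵ₊`. -/
lemma exists_asymptoticSystem (γ μ κ : ℝ) {wp a₀ : Rn n → ℂ} (ha₀ : Measurable a₀)
    (h : hat wp =ᵐ[volume] a₀) : ∃ a, AsymptoticSystem γ μ κ a (phaseHat γ μ κ wp) ∧ a 0 1 = a₀ := by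
  -- Only the order 0 is modified, on a null set. The transforms of products do not see null sets,
  -- so the recursion still holds at every ξ.
  set a : ℕ → ℝ → Rn n → ℂ := fun m => if m = 0 then fun _ => a₀ else amplitudeHat γ μ κ wp m with ha
  have hz : ∀ t, a 0 t = a₀ := fun t => by simp [ha]
  have hae : ∀ m t, amplitudeHat γ μ κ wp m t =ᵐ[volume] a m t := fun m t => by
    rcases Nat.eq_zero_or_pos m with rfl | hm
    · rw [hz, amplitudeHat]; exact h
    · simp [ha, hm.ne']
  refine ⟨a, ⟨fun t => by rw [hz, hz], by rw [hz]; exact ha₀, fun m t ξ => ?_, fun m t ξ => ?_⟩, hz 1⟩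
  · have : a (m + 1) t ξ = amplitudeHat γ μ κ wp (m + 1) t ξ := by simp [ha]
    rw [this, amplitudeHat]
    dsimp only
    congr 2; funext s; congr 1
    rw [← sum_fin_eq_sum_antidiagonal (fun i j => transportHat (phaseHat γ μ κ wp i s) (a j s) ξ)]
    exact Finset.sum_congr rfl fun j _ => congrFun
      (transportHat_congr (ae_eq_refl _) (hae _ _)) ξ
  · rw [phaseHat]
    dsimp only
    congr 1; funext s; congr 2
    rw [← sum_fin_eq_sum_antidiagonal (fun i j => gZeroHat κ μ (a i s) (a j s) ξ)]
    exact Finset.sum_congr rfl fun j _ => congrFun (gZeroHat_congr κ μ (hae _ _) (hae _ _)) ξ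

lemma measurable_uncurry_setIntegral {F : ℝ → Rn n → ℂ} (hF : Measurable (Function.uncurry F))
    {S : ℝ → Set ℝ} (hS : MeasurableSet {z : ℝ × ℝ | z.2 ∈ S z.1}) :
    Measurable (Function.uncurry fun t ξ => ∫ s in S t, F s ξ) := by
  have hSt : ∀ t, MeasurableSet (S t) := fun t => (measurable_prodMk_left (x := t)) hS
  have h1 : Measurable (indicator {z : (ℝ × Rn n) × ℝ | z.2 ∈ S z.1.1} fun z => F z.2 z.1.2) := by
    refine Measurable.indicator (hF.comp (measurable_snd.prodMk (measurable_snd.comp measurable_fst)))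
      ?_
    exact (measurable_fst.comp measurable_fst |>.prodMk measurable_snd) hS
  have h2 := (h1.stronglyMeasurable.integral_prod_right' (ν := (volume : Measure ℝ))).measurable
  convert h2 using 1
  funext z
  simp only [Function.uncurry]
  rw [← integral_indicator (hSt z.1)]
  rfl

lemma measurable_uncurry_integral_Ioi {F : ℝ → Rn n → ℂ} (hF : Measurable (Function.uncurry F)) :
    Measurable (Function.uncurry fun t ξ => ∫ s in Ioi t, F s ξ) :=
  measurable_uncurry_setIntegral hF (measurableSet_lt measurable_fst measurable_snd)

lemma measurable_uncurry_intervalIntegral {F : ℝ → Rn n → ℂ} (hF : Measurable (Function.uncurry F))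
    (t₀ : ℝ) : Measurable (Function.uncurry fun t ξ => ∫ s in t₀..t, F s ξ) := by
  have h1 := measurable_uncurry_setIntegral hF (S := fun t => Ioc t₀ t)
    ((measurableSet_lt measurable_const measurable_snd).inter
      (measurableSet_le measurable_snd measurable_fst))
  have h2 := measurable_uncurry_setIntegral hF (S := fun t => Ioc t t₀)
    ((measurableSet_lt measurable_fst measurable_snd).inter
      (measurableSet_le measurable_snd measurable_const))
  exact h1.sub h2

lemma measurable_uncurry_conjHat {a : ℝ → Rn n → ℂ} (ha : Measurable (Function.uncurry a)) :
    Measurable (Function.uncurry fun t => conjHat (a t)) := by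
  have : Measurable fun z : ℝ × Rn n => Function.uncurry a (z.1, -z.2) :=
    ha.comp (measurable_fst.prodMk measurable_snd.neg)
  exact Complex.continuous_conj.measurable.comp this

lemma measurable_uncurry_gZeroHat (κ μ : ℝ) {a b : ℝ → Rn n → ℂ}
    (ha : Measurable (Function.uncurry a)) (hb : Measurable (Function.uncurry b)) :
    Measurable (Function.uncurry fun t => gZeroHat κ μ (a t) (b t)) := by
  have h1 := measurable_uncurry_mulHat ha (measurable_uncurry_conjHat hb)
  have h2 := measurable_uncurry_conjHat h1
  have h3 : Measurable fun z : ℝ × Rn n => (κ : ℂ) * ((‖z.2‖ ^ (μ - n) : ℝ) : ℂ) := by fun_prop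
  exact h3.mul ((h1.add h2).div_const 2)

namespace AsymptoticSystem

variable {γ μ κ : ℝ} {a p : ℕ → ℝ → Rn n → ℂ}

lemma measurable (h : AsymptoticSystem γ μ κ a p) (m : ℕ) :
    Measurable (Function.uncurry (a m)) ∧ Measurable (Function.uncurry (p m)) := by
  induction m using Nat.strong_induction_on with
  | _ m ih =>
  have h2 : Measurable fun z : ℝ × Rn n => (((2 * z.1 ^ 2)⁻¹ : ℝ) : ℂ) := by fun_prop
  have h3 : Measurable fun z : ℝ × Rn n => ((z.1 ^ (-γ) : ℝ) : ℂ) := by fun_prop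
  have ha : Measurable (Function.uncurry (a m)) := by
    rcases m with _ | m
    · have e : Function.uncurry (a 0) = fun z => a 0 1 z.2 := by
        funext z; simp only [Function.uncurry, h.const z.1]
      rw [e]
      exact h.measurable_zero.comp measurable_snd
    · have h1 : Measurable (Function.uncurry fun s ξ => (((2 * s ^ 2)⁻¹ : ℝ) : ℂ) *
          ∑ q ∈ Finset.HasAntidiagonal.antidiagonal m, transportHat (p q.1 s) (a q.2 s) ξ) := by
        refine h2.mul (Finset.measurable_fun_sum _ fun q hq => ?_)
        have hq' := Finset.HasAntidiagonal.mem_antidiagonal.1 hq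
        exact measurable_uncurry_transportHat (ih q.1 (by omega)).2 (ih q.2 (by omega)).1
      convert (measurable_uncurry_integral_Ioi h1).neg using 1
      funext z
      exact h.succ m z.1 z.2
  have hall : ∀ j ≤ m, Measurable (Function.uncurry (a j)) := fun j hj => by
    rcases hj.lt_or_eq with h5 | rfl
    · exact (ih j h5).1
    · exact ha
  refine ⟨ha, ?_⟩
  have h4 : Measurable (Function.uncurry fun s ξ => (((2 * s ^ 2)⁻¹ : ℝ) : ℂ) *
      (∑ j : Fin m, gradDotHat (p j s) (p (m - 1 - j) s) ξ) +
      ((s ^ (-γ) : ℝ) : ℂ) *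
        ∑ q ∈ Finset.HasAntidiagonal.antidiagonal m, gZeroHat κ μ (a q.1 s) (a q.2 s) ξ) := by
    refine (h2.mul (Finset.measurable_fun_sum _ fun j _ => ?_)).add
      (h3.mul (Finset.measurable_fun_sum _ fun q hq => ?_))
    · exact measurable_uncurry_gradDotHat (ih j j.2).2 (ih (m - 1 - j) (by omega)).2
    · have hq' := Finset.HasAntidiagonal.mem_antidiagonal.1 hq
      exact measurable_uncurry_gZeroHat κ μ (hall q.1 (by omega)) (hall q.2 (by omega))
  convert measurable_uncurry_intervalIntegral h4 1 using 1
  funext z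
  exact h.phase m z.1 z.2

end AsymptoticSystem

lemma conjHat_mulHat (a b : Rn n → ℂ) : conjHat (mulHat a b) = mulHat (conjHat a) (conjHat b) := by
  funext ξ
  rw [conjHat, mulHat, mulHat, map_mul, Complex.conj_ofReal, ← integral_conj]
  congr 1
  rw [← integral_neg_eq_self]
  refine integral_congr_ae (ae_of_all _ fun η => ?_)
  simp only [conjHat, map_mul]
  congr 3
  abel_nf

lemma conjHat_derivHat (j : Fin n) (a : Rn n → ℂ) :
    conjHat (derivHat j a) = derivHat j (conjHat a) := by
  funext ξ
  simp [conjHat, derivHat]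

lemma conjHat_laplaceHat (a : Rn n → ℂ) : conjHat (laplaceHat a) = laplaceHat (conjHat a) := by
  funext ξ
  simp [conjHat, laplaceHat]

lemma conjHat_gradDotHat (a b : Rn n → ℂ) :
    conjHat (gradDotHat a b) = gradDotHat (conjHat a) (conjHat b) := by
  funext ξ
  simp only [conjHat, gradDotHat, map_sum]
  refine Finset.sum_congr rfl fun j _ => ?_
  rw [← conjHat_derivHat, ← conjHat_derivHat, ← conjHat_mulHat]
  rfl

lemma conjHat_transportHat (a b : Rn n → ℂ) :
    conjHat (transportHat a b) = transportHat (conjHat a) (conjHat b) := by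
  funext ξ
  rw [transportHat, ← conjHat_gradDotHat, ← conjHat_laplaceHat, ← conjHat_mulHat]
  simp only [conjHat, transportHat, map_add, map_mul, Complex.conj_ofNat]

lemma conjHat_gZeroHat (κ μ : ℝ) (a b : Rn n → ℂ) :
    conjHat (gZeroHat κ μ a b) = gZeroHat κ μ a b := by
  funext ξ
  simp only [conjHat, gZeroHat, reHat, map_mul, Complex.conj_ofReal, norm_neg, map_div₀, map_add,
    neg_neg, Complex.conj_conj]
  rw [add_comm (conj _), Complex.conj_ofNat]

/-- The phases are real. -/
lemma AsymptoticSystem.conjHat_phase {γ μ κ : ℝ} {a p : ℕ → ℝ → Rn n → ℂ}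
    (h : AsymptoticSystem γ μ κ a p) (m : ℕ) : ∀ t, conjHat (p m t) = p m t := by
  induction m using Nat.strong_induction_on with
  | _ m ih =>
  intro t
  funext ξ
  have hg : ∀ j : Fin m, ∀ s, conj (gradDotHat (p j s) (p (m - 1 - j) s) (-ξ)) =
      gradDotHat (p j s) (p (m - 1 - j) s) ξ := fun j s => by
    have := congrFun (conjHat_gradDotHat (p j s) (p (m - 1 - j) s)) ξ
    rwa [ih j j.2, ih (m - 1 - j) (by omega)] at this
  have hz : ∀ (i j : ℕ) s, conj (gZeroHat κ μ (a i s) (a j s) (-ξ)) =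
      gZeroHat κ μ (a i s) (a j s) ξ := fun i j s =>
    congrFun (conjHat_gZeroHat κ μ (a i s) (a j s)) ξ
  rw [conjHat, h.phase, h.phase, ← intervalIntegral.intervalIntegral_conj]
  refine intervalIntegral.integral_congr fun s _ => ?_
  simp only [map_add, map_mul, map_sum, Complex.conj_ofReal, hg, hz]

end System

-- Estimates of the terms of the asymptotic system

section SystemBounds

lemma wl_norm_sq_mul_le (ν a b ρ : ℝ) (F : Rn n → ℝ≥0∞) :
    wl ν a b ρ (fun ξ => ‖ξ‖ₑ ^ 2 * F ξ) ≤ wl ν (a + 2) b ρ F := by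
  simp only [sq, mul_assoc]
  refine (wl_norm_mul_le _ _ _ _ _).trans ((wl_norm_mul_le _ _ _ _ _).trans (le_of_eq ?_))
  rw [add_assoc, one_add_one_eq_two]

/-- The bounds for the terms of `transportHat`. -/
lemma exists_wl_lconv_le (hn : 0 < n) {ν low s s₁ s₂ : ℝ} (h0 : 0 ≤ ν) (h1 : ν ≤ 1)
    (hlow : 0 ≤ low) (hlow' : low < n / 2) (hs : 0 ≤ s) (hs1 : s + 2 ≤ s₁) (hs2 : s + 1 ≤ s₂)
    (hσ : n / 2 < s₁ + s₂ - 2 - s) : ∃ C : ℝ≥0∞, C ≠ ∞ ∧ ∀ (ρ : ℝ) (P A : Rn n → ℝ≥0∞), 0 ≤ ρ →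
      Measurable P → Measurable A →
      wl ν s 0 ρ (lconv (fun ζ => ‖ζ‖ₑ * P ζ) A) ≤ C * wl ν s₁ low ρ P * wl ν s₂ 0 ρ A ∧
      wl ν s 0 ρ (lconv (fun ζ => ‖ζ‖ₑ ^ 2 * P ζ) A) ≤ C * wl ν s₁ low ρ P * wl ν s₂ 0 ρ A ∧
      wl ν s 0 ρ (lconv (fun ζ => ‖ζ‖ₑ * P ζ) (fun η => ‖η‖ₑ * A η)) ≤
        C * wl ν s₁ low ρ P * wl ν s₂ 0 ρ A := by
  obtain ⟨C₁, hC₁, H₁⟩ := exists_product_le (n := n) hn (s := s) (s₁ := s₁ - 1) (s₂ := s₂) (b := 0)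
    (b₁ := low) (b₂ := 0) (β := low) h0 h1 hs (by linarith) (by linarith) (by linarith) hlow hlow'
    (Or.inr ⟨rfl, rfl, rfl⟩)
  obtain ⟨C₂, hC₂, H₂⟩ := exists_product_le (n := n) hn (s := s) (s₁ := s₁ - 2) (s₂ := s₂) (b := 0)
    (b₁ := low) (b₂ := 0) (β := low) h0 h1 hs (by linarith) (by linarith) (by linarith) hlow hlow'
    (Or.inr ⟨rfl, rfl, rfl⟩)
  obtain ⟨C₃, hC₃, H₃⟩ := exists_product_le (n := n) hn (s := s) (s₁ := s₁ - 1) (s₂ := s₂ - 1)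
    (b := 0) (b₁ := low) (b₂ := 0) (β := low) h0 h1 hs (by linarith) (by linarith) (by linarith)
    hlow hlow' (Or.inr ⟨rfl, rfl, rfl⟩)
  refine ⟨C₁ + C₂ + C₃, by finiteness, fun ρ P A hρ hP hA => ?_⟩
  have e1 : wl ν (s₁ - 1) low ρ (fun ζ => ‖ζ‖ₑ * P ζ) ≤ wl ν s₁ low ρ P :=
    (wl_norm_mul_le _ _ _ _ _).trans (by rw [sub_add_cancel])
  have e2 : wl ν (s₁ - 2) low ρ (fun ζ => ‖ζ‖ₑ ^ 2 * P ζ) ≤ wl ν s₁ low ρ P :=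
    (wl_norm_sq_mul_le _ _ _ _ _).trans (by rw [sub_add_cancel])
  have e3 : wl ν (s₂ - 1) 0 ρ (fun ζ => ‖ζ‖ₑ * A ζ) ≤ wl ν s₂ 0 ρ A :=
    (wl_norm_mul_le _ _ _ _ _).trans (by rw [sub_add_cancel])
  refine ⟨(H₁ ρ _ _ hρ (measurable_enorm.mul hP) hA).trans ?_,
    (H₂ ρ _ _ hρ ((measurable_enorm.pow_const 2).mul hP) hA).trans ?_,
    (H₃ ρ _ _ hρ (measurable_enorm.mul hP) (measurable_enorm.mul hA)).trans ?_⟩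
  · exact mul_le_mul' (mul_le_mul' (le_self_add.trans le_self_add) e1) le_rfl
  · exact mul_le_mul' (mul_le_mul' (le_add_self.trans le_self_add) e2) le_rfl
  · exact mul_le_mul' (mul_le_mul' le_add_self e1) e3

lemma exists_wl_gradDotHat_low_le (hn : 0 < n) {ν low s s₁ s₂ : ℝ} (h0 : 0 ≤ ν) (h1 : ν ≤ 1)
    (hlow : 0 ≤ low) (hlow' : low < n / 2) (hs : 0 ≤ s) (hs1 : s + 1 ≤ s₁) (hs2 : s + 1 ≤ s₂)
    (hσ : n / 2 < s₁ + s₂ - 2 - s) : ∃ C : ℝ≥0∞, C ≠ ∞ ∧ ∀ (ρ : ℝ) (P Q : Rn n → ℂ), 0 ≤ ρ →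
      Measurable P → Measurable Q → wl ν s low ρ (fun ξ => ‖gradDotHat P Q ξ‖ₑ) ≤
        C * wl ν s₁ low ρ (fun ξ => ‖P ξ‖ₑ) * wl ν s₂ low ρ (fun ξ => ‖Q ξ‖ₑ) := by
  obtain ⟨C, hC, H⟩ := exists_product_le (n := n) hn (s := s) (s₁ := s₁ - 1) (s₂ := s₂ - 1)
    (b := low) (b₁ := low) (b₂ := low) (β := low) h0 h1 hs (by linarith) (by linarith) (by linarith)
    hlow hlow' (Or.inl ⟨rfl, rfl, rfl⟩)
  refine ⟨n * C, by finiteness, fun ρ P Q hρ hP hQ => ?_⟩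
  have e : ∀ (s : ℝ) (P : Rn n → ℂ), wl ν (s - 1) low ρ (fun ζ => ‖ζ‖ₑ * ‖P ζ‖ₑ) ≤
      wl ν s low ρ fun ζ => ‖P ζ‖ₑ := fun s P =>
    (wl_norm_mul_le _ _ _ _ _).trans (by rw [sub_add_cancel])
  refine (wl_mono (ae_of_all _ fun ξ => enorm_gradDotHat_le P Q ξ)).trans ?_
  rw [wl_const_mul (ENNReal.natCast_ne_top n), mul_assoc, mul_assoc, ← mul_assoc C]
  gcongr
  exact (H ρ _ _ hρ (measurable_enorm.mul hP.enorm) (measurable_enorm.mul hQ.enorm)).trans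
    (mul_le_mul' (mul_le_mul' le_rfl (e _ _)) (e _ _))

lemma ltwo_comp_neg (F : Rn n → ℝ≥0∞) : ltwo volume (fun ξ => F (-ξ)) = ltwo volume F := by
  rw [ltwo, ltwo]
  congr 1
  exact lintegral_neg_eq_self fun ξ => F ξ ^ 2

lemma wl_comp_neg (ν a b ρ : ℝ) (F : Rn n → ℝ≥0∞) :
    wl ν a b ρ (fun ξ => F (-ξ)) = wl ν a b ρ F := by
  rw [wl, wl, ← ltwo_comp_neg]
  simp only [neg_neg]
  congr 1; funext ξ
  rw [ew, ew, weight_eq_radial, weight_eq_radial, norm_neg]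

lemma enorm_conjHat (a : Rn n → ℂ) (ξ : Rn n) : ‖conjHat a ξ‖ₑ = ‖a (-ξ)‖ₑ := by
  rw [conjHat, RCLike.enorm_conj]

lemma measurable_conjHat {a : Rn n → ℂ} (ha : Measurable a) : Measurable (conjHat a) :=
  Complex.continuous_conj.measurable.comp (ha.comp measurable_neg)

lemma wl_conjHat (ν s b ρ : ℝ) (a : Rn n → ℂ) :
    wl ν s b ρ (fun ξ => ‖conjHat a ξ‖ₑ) = wl ν s b ρ fun ξ => ‖a ξ‖ₑ := by
  simp only [enorm_conjHat]
  exact wl_comp_neg ν s b ρ fun ξ => ‖a ξ‖ₑ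

/-- The Riesz potential: integrability at low frequency of bounded functions. -/
lemma exists_wl_riesz_le (hn : 0 < n) {low μ : ℝ} (hlow : n / 2 - μ < low) : ∃ K : ℝ≥0∞, K ≠ ∞ ∧
    ∀ (ν s ρ : ℝ) (F : Rn n → ℝ≥0∞) (S : ℝ≥0∞), 0 ≤ ν → Measurable F → S ≠ ∞ → (∀ ξ, F ξ ≤ S) →
      wl ν (s - (μ - n)) low ρ (fun ξ => ENNReal.ofReal (‖ξ‖ ^ (μ - n)) * F ξ) ≤
        wl ν s 0 ρ F + ENNReal.ofReal (Real.exp ρ) * S * K := by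
  -- Near 0 the function Q is the power low + μ - n, square integrable because low > n/2 - μ; the
  -- decay at infinity is an arbitrary sufficient one.
  set Q : Rn n → ℝ≥0∞ := fun ξ => ENNReal.ofReal (pw (-n) (-(n - μ - low)) ‖ξ‖) with hQ
  have hn0 : (0 : ℝ) < n := by exact_mod_cast hn
  have hQm : Measurable Q := (measurable_pw.comp measurable_norm).ennreal_ofReal
  refine ⟨ltwo volume Q, ltwo_pw_ne_top hn (by linarith) (by linarith), fun ν s ρ F S h0 hF hS hFS => ?_⟩
  have hc : ENNReal.ofReal (Real.exp ρ) * S ≠ ∞ := by finiteness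
  rw [← ltwo_const_mul hc]
  have hFm : Measurable fun ξ => ew ν s 0 ρ ξ * F ξ := by fun_prop
  refine le_trans (ltwo_mono ?_) (ltwo_add_le hFm.aemeasurable (hQm.const_mul _).aemeasurable)
  filter_upwards [ae_ne_zero hn] with ξ hξ
  have hpos : 0 < ‖ξ‖ := norm_pos_iff.2 hξ
  rw [← mul_assoc]
  rcases le_or_gt ‖ξ‖ 1 with h1 | h1
  · refine le_trans ?_ le_add_self
    have e : ew ν (s - (μ - n)) low ρ ξ * ENNReal.ofReal (‖ξ‖ ^ (μ - n)) =
        ENNReal.ofReal (Real.exp ρ) * Q ξ := by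
      rw [hQ, ew, weight_eq_radial, radial, pw_of_le h1, ← ENNReal.ofReal_mul (by positivity),
        ← ENNReal.ofReal_mul (by positivity), pw_of_le h1,
        max_eq_right (Real.rpow_le_one hpos.le h1 h0), mul_one]
      congr 1
      rw [mul_right_comm, ← Real.rpow_add hpos, mul_comm]
      congr 2; ring
    rw [e, mul_assoc, mul_assoc, mul_comm S]
    gcongr
    exact hFS ξ
  · refine le_trans (le_of_eq ?_) le_self_add
    congr 1
    rw [ew, ew, weight_eq_radial, weight_eq_radial, radial, radial, pw_of_gt h1, pw_of_gt h1,
      ← ENNReal.ofReal_mul (by positivity)]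
    congr 1
    rw [mul_right_comm, ← Real.rpow_add hpos]
    congr 2; ring

/-- At high frequency |∇|^{μ-n} only shifts the exponent of the product estimate. At low frequency
it is singular, but the convolution of two L² functions is bounded, and `exists_wl_riesz_le`
applies. The real part adds the reflected convolution. -/
lemma exists_wl_gZeroHat_le (hn : 0 < n) {ν low μ s s₁ s₂ : ℝ} (κ : ℝ) (h0 : 0 ≤ ν) (h1 : ν ≤ 1)
    (hlow : n / 2 - μ < low) {ρ : ℝ} (hρ : 0 ≤ ρ) (hs : 0 ≤ s) (hs1 : s ≤ s₁) (hs2 : s ≤ s₂)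
    (hσ : n / 2 < s₁ + s₂ - s) : ∃ C : ℝ≥0∞, C ≠ ∞ ∧ ∀ (A B : Rn n → ℂ), Measurable A → Measurable B →
      wl ν s₁ 0 ρ (fun ξ => ‖A ξ‖ₑ) ≠ ∞ → wl ν s₂ 0 ρ (fun ξ => ‖B ξ‖ₑ) ≠ ∞ →
      wl ν (s - (μ - n)) low ρ (fun ξ => ‖gZeroHat κ μ A B ξ‖ₑ) ≤
        C * wl ν s₁ 0 ρ (fun ξ => ‖A ξ‖ₑ) * wl ν s₂ 0 ρ (fun ξ => ‖B ξ‖ₑ) := by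
  have hn0 : (0 : ℝ) < n / 2 := by positivity
  obtain ⟨K, hK, hR⟩ := exists_wl_riesz_le hn hlow
  obtain ⟨C, hC, hP⟩ := exists_product_le (n := n) hn (s := s) (s₁ := s₁) (s₂ := s₂)
    (b := 0) (b₁ := 0) (b₂ := 0) (β := 0) h0 h1 hs hs1 hs2 hσ le_rfl hn0 (Or.inl ⟨rfl, rfl, rfl⟩)
  refine ⟨‖(κ : ℂ)‖ₑ * (2 * (C + ENNReal.ofReal (Real.exp ρ) * K)), by finiteness,
    fun A B hA hB hAt hBt => ?_⟩
  have hBc := (measurable_conjHat hB).enorm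
  set N : Rn n → ℝ≥0∞ := lconv (fun ζ => ‖A ζ‖ₑ) (fun η => ‖conjHat B η‖ₑ) with hN
  have hNm : Measurable N := measurable_lconv hA.enorm hBc
  set x := wl ν s₁ 0 ρ fun ξ => ‖A ξ‖ₑ with hx
  set y := wl ν s₂ 0 ρ fun ξ => ‖B ξ‖ₑ with hy
  have hyc : wl ν s₂ 0 ρ (fun ξ => ‖conjHat B ξ‖ₑ) = y := wl_conjHat ..
  have hNS : ∀ ξ, N ξ ≤ x * y := fun ξ => (lconv_le_ltwo hA.enorm hBc ξ).trans (by
    refine mul_le_mul' (ltwo_le_wl hn (hs.trans hs1) hρ _) ?_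
    rw [← hyc]
    exact ltwo_le_wl hn (hs.trans hs2) hρ _)
  have hNwl : wl ν s 0 ρ N ≤ C * x * y := by
    rw [← hyc]
    exact hP ρ _ _ hρ hA.enorm hBc
  have hfin : x * y ≠ ∞ := by finiteness
  have hr1 := hR ν s ρ N (x * y) h0 hNm hfin hNS
  have hr2 := hR ν s ρ (fun ξ => N (-ξ)) (x * y) h0 (hNm.comp measurable_neg) hfin fun ξ => hNS _
  rw [wl_comp_neg] at hr2
  have hm : Measurable fun ξ : Rn n => ENNReal.ofReal (‖ξ‖ ^ (μ - n)) := by fun_prop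
  calc _ ≤ wl ν (s - (μ - n)) low ρ (fun ξ => ‖(κ : ℂ)‖ₑ * (ENNReal.ofReal (‖ξ‖ ^ (μ - n)) * N ξ +
        ENNReal.ofReal (‖ξ‖ ^ (μ - n)) * N (-ξ))) := by
        refine wl_mono (ae_of_all _ fun ξ => ?_)
        dsimp only
        rw [gZeroHat, enorm_mul, enorm_mul, mul_assoc, ← mul_add]
        gcongr
        · rw [← ofReal_norm, Complex.norm_real, Real.norm_of_nonneg (by positivity)]
        · rw [reHat, div_eq_mul_inv, enorm_mul]
          refine (mul_le_of_le_one_right zero_le ?_).trans ((enorm_add_le _ _).trans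
            (add_le_add (enorm_mulHat_le _ _ _) ?_))
          · rw [← ofReal_norm, norm_inv]
            simp only [Complex.norm_ofNat]
            exact ENNReal.ofReal_le_one.2 (by norm_num)
          · rw [enorm_conjHat]
            exact enorm_mulHat_le _ _ _
    _ ≤ ‖(κ : ℂ)‖ₑ * ((C * x * y + ENNReal.ofReal (Real.exp ρ) * (x * y) * K) +
        (C * x * y + ENNReal.ofReal (Real.exp ρ) * (x * y) * K)) := by
        rw [wl_const_mul (by finiteness)]
        gcongr
        refine (wl_add_le (hm.mul hNm).aemeasurable
          (hm.mul (hNm.comp measurable_neg)).aemeasurable).trans (add_le_add ?_ ?_)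
        · exact hr1.trans (by gcongr)
        · exact hr2.trans (by gcongr)
    _ = _ := by ring

lemma exists_wl_sum_le {ι : Type*} (F : Finset ι) {f : ι → ℝ → Rn n → ℂ} {ν a b ρ : ℝ}
    {g : ℝ → ℝ≥0∞} (hf : ∀ i ∈ F, Measurable (Function.uncurry (f i)))
    (h : ∀ i ∈ F, ∃ D : ℝ≥0∞, D ≠ ∞ ∧
      ∀ s ∈ Ici (1 : ℝ), wl ν a b ρ (fun ξ => ‖f i s ξ‖ₑ) ≤ D * g s) :
    ∃ D : ℝ≥0∞, D ≠ ∞ ∧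
      ∀ s ∈ Ici (1 : ℝ), wl ν a b ρ (fun ξ => ‖∑ i ∈ F, f i s ξ‖ₑ) ≤ D * g s := by
  classical
  induction F using Finset.induction_on with
  | empty => exact ⟨0, by simp, fun s _ => by simp [wl, ltwo]⟩
  | insert i F hi ih =>
    obtain ⟨D, hD, hle⟩ := ih (fun j hj => hf j (Finset.mem_insert_of_mem hj))
      fun j hj => h j (Finset.mem_insert_of_mem hj)
    obtain ⟨D', hD', hle'⟩ := h i (Finset.mem_insert_self i F)
    refine ⟨D' + D, by finiteness, fun s hs => ?_⟩
    have hm : ∀ j ∈ insert i F, Measurable (f j s) := fun j hj => (hf j hj).of_uncurry_left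
    have hmF : Measurable fun ξ => ∑ j ∈ F, f j s ξ :=
      Finset.measurable_fun_sum _ fun j hj => hm j (Finset.mem_insert_of_mem hj)
    simp only [Finset.sum_insert hi]
    refine (wl_mono (ae_of_all _ fun ξ => enorm_add_le _ _)).trans
      ((wl_add_le (hm i (Finset.mem_insert_self i F)).enorm.aemeasurable hmF.enorm.aemeasurable).trans
        ?_)
    rw [add_mul]
    exact add_le_add (hle' s hs) (hle s hs)

/-- The growth rate of the phases. -/
def growth (γ t : ℝ) : ℝ≥0∞ := ENNReal.ofReal (t ^ (1 - γ / 2))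

/-- The exponent 1 - γ/2 of `growth` is below 1, which gives this convergence, and above 1 - γ,
which avoids a logarithm when γ = 1. -/
lemma lintegral_invTwoSq_mul_growth_ne_top {γ : ℝ} (hγ : 0 < γ) :
    ∫⁻ s in Ioi (1 : ℝ), invTwoSq s * growth γ s ≠ ∞ := by
  have h1 : IntegrableOn (fun τ : ℝ => τ ^ (-1 - γ / 2)) (Ioi 1) :=
    integrableOn_Ioi_rpow_of_lt (by linarith) one_pos
  refine ne_top_of_le_ne_top h1.lintegral_lt_top.ne
    (setLIntegral_mono' measurableSet_Ioi fun s hs => ?_)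
  have h2 : 0 < s := one_pos.trans hs
  rw [invTwoSq, growth, ← ENNReal.ofReal_mul (by positivity)]
  refine ENNReal.ofReal_le_ofReal ?_
  rw [show -1 - γ / 2 = -2 + (1 - γ / 2) by ring, Real.rpow_add h2, Real.rpow_neg h2.le,
    Real.rpow_two]
  gcongr
  nlinarith [sq_nonneg s]

lemma invTwoSq_mul_growth_sq_le {γ s : ℝ} (hγ : 0 < γ) (hs : 1 ≤ s) :
    invTwoSq s * (growth γ s * growth γ s) ≤ ENNReal.ofReal (s ^ (-γ / 2)) := by
  have h2 : 0 < s := one_pos.trans_le hs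
  rw [invTwoSq, growth, ← ENNReal.ofReal_mul (by positivity), ← ENNReal.ofReal_mul (by positivity)]
  refine ENNReal.ofReal_le_ofReal ?_
  calc _ ≤ (s ^ 2)⁻¹ * (s ^ (1 - γ / 2) * s ^ (1 - γ / 2)) := by
        gcongr
        nlinarith [sq_nonneg s]
    _ = s ^ (-γ) := by
        rw [← Real.rpow_two, ← Real.rpow_neg h2.le, ← Real.rpow_add h2, ← Real.rpow_add h2]
        congr 1; ring
    _ ≤ _ := Real.rpow_le_rpow_of_exponent_le hs (by linarith)

/-- The factor 2 bounds (1 - γ/2)⁻¹, since γ ≤ 1. -/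
lemma lintegral_rpow_le_growth {γ t : ℝ} (hγ : γ ≤ 1) (ht : 1 ≤ t) :
    ∫⁻ s in Ioc 1 t, ENNReal.ofReal (s ^ (-γ / 2)) ≤ 2 * growth γ t := by
  have hi : IntegrableOn (fun s : ℝ => s ^ (-γ / 2)) (Ioc 1 t) := by
    rw [← intervalIntegrable_iff_integrableOn_Ioc_of_le ht]
    exact intervalIntegral.intervalIntegrable_rpow' (by linarith)
  have hnn : 0 ≤ᵐ[volume.restrict (Ioc 1 t)] fun s : ℝ => s ^ (-γ / 2) := by
    filter_upwards [ae_restrict_mem measurableSet_Ioc] with s hs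
    exact Real.rpow_nonneg (zero_le_one.trans hs.1.le) _
  rw [← ofReal_integral_eq_lintegral_ofReal hi hnn, ← intervalIntegral.integral_of_le ht,
    integral_rpow (Or.inl (by linarith)), growth,
    show (2 : ℝ≥0∞) = ENNReal.ofReal 2 by simp, ← ENNReal.ofReal_mul (by norm_num)]
  refine ENNReal.ofReal_le_ofReal ?_
  rw [Real.one_rpow, show -γ / 2 + 1 = 1 - γ / 2 by ring, div_le_iff₀ (by linarith)]
  have := Real.rpow_nonneg (zero_le_one.trans ht) (1 - γ / 2)
  nlinarith

end SystemBounds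

-- Inductive bounds of the asymptotic system

section SystemEstimates

/-- The time derivative of the amplitudes of an asymptotic system. -/
def amplitudeRate (a p : ℕ → ℝ → Rn n → ℂ) : ℕ → ℝ → Rn n → ℂ
  | 0 => fun _ _ => 0
  | m + 1 => fun s ξ => (((2 * s ^ 2)⁻¹ : ℝ) : ℂ) *
      ∑ q ∈ Finset.HasAntidiagonal.antidiagonal m, transportHat (p q.1 s) (a q.2 s) ξ

/-- The square integrability of the terms of `transportHat P A`. -/
structure TransportBound (P A : Rn n → ℂ) : Prop where
  grad : ltwo volume (lconv (fun ζ => ‖ζ‖ₑ * ‖P ζ‖ₑ) fun η => ‖A η‖ₑ) ≠ ∞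
  laplace : ltwo volume (lconv (fun ζ => ‖ζ‖ₑ ^ 2 * ‖P ζ‖ₑ) fun η => ‖A η‖ₑ) ≠ ∞
  gradDot : ltwo volume (lconv (fun ζ => ‖ζ‖ₑ * ‖P ζ‖ₑ) fun η => ‖η‖ₑ * ‖A η‖ₑ) ≠ ∞

/-- The exponents in the estimates of an asymptotic system up to the order `N`. -/
structure SystemExponents (n : ℕ) (γ μ ν low ρ k lam : ℝ) (N : ℕ) : Prop where
  pos : 0 < n
  γ_pos : 0 < γ
  γ_le : γ ≤ 1
  ν_nonneg : 0 ≤ ν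
  ν_le : ν ≤ 1
  low_nonneg : 0 ≤ low
  low_lt : low < n / 2
  lt_low : n / 2 - μ < low
  μ_le : μ ≤ n
  ρ_nonneg : 0 ≤ ρ
  one_le : 1 ≤ lam
  le_lam : μ - n + 2 ≤ lam
  lt_k : n / 2 < k
  le_k : (N + 1) * lam - 1 ≤ k

/-- The estimates of the terms of order `m` of an asymptotic system. -/
structure SystemBound (γ μ ν low ρ k lam : ℝ) (a p : ℕ → ℝ → Rn n → ℂ) (m : ℕ) : Prop where
  amplitude : ∃ A : ℝ≥0∞, A ≠ ∞ ∧
    ∀ t ∈ Ici (1 : ℝ), wl ν (k - m * lam) 0 ρ (fun ξ => ‖a m t ξ‖ₑ) ≤ A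
  phase : ∃ B : ℝ≥0∞, B ≠ ∞ ∧
    ∀ t ∈ Ici (1 : ℝ), wl ν (k - m * lam - (μ - n)) low ρ (fun ξ => ‖p m t ξ‖ₑ) ≤ B * growth γ t

variable {γ μ κ ν low ρ k lam : ℝ} {N : ℕ} {a p : ℕ → ℝ → Rn n → ℂ}

/-- This is where k ≥ (N + 1)λ - 1 enters: at m = N the difference is at least λ - 1 ≥ 0. -/
lemma SystemExponents.nonneg (he : SystemExponents n γ μ ν low ρ k lam N) {m : ℕ} (hm : m ≤ N) :
    0 ≤ k - m * lam := by
  have h1 : (m : ℝ) ≤ N := by exact_mod_cast hm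
  nlinarith [he.le_k, he.one_le]

lemma growth_ne_top (γ t : ℝ) : growth γ t ≠ ∞ := ENNReal.ofReal_ne_top

namespace AsymptoticSystem

lemma measurable_amplitude (h : AsymptoticSystem γ μ κ a p) (m : ℕ) (t : ℝ) : Measurable (a m t) :=
  (h.measurable m).1.of_uncurry_left

lemma measurable_phase (h : AsymptoticSystem γ μ κ a p) (m : ℕ) (t : ℝ) : Measurable (p m t) :=
  (h.measurable m).2.of_uncurry_left

lemma measurable_amplitudeRate (h : AsymptoticSystem γ μ κ a p) (m : ℕ) :
    Measurable (Function.uncurry (amplitudeRate a p m)) := by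
  rcases m with _ | m
  · exact measurable_const
  · have h2 : Measurable fun z : ℝ × Rn n => (((2 * z.1 ^ 2)⁻¹ : ℝ) : ℂ) := by fun_prop
    exact h2.mul (Finset.measurable_fun_sum _ fun q _ =>
      measurable_uncurry_transportHat (h.measurable q.1).2 (h.measurable q.2).1)

/-- One application of the transport operator costs λ in the exponent. Two derivatives of the phase,
which has n - μ derivatives more than the amplitudes, require λ ≥ μ - n + 2, and one derivative of
the amplitude requires λ ≥ 1. The margin of the product estimate is k - (μ - n + 2) + λ ≥ k > n/2.
-/
lemma exists_transport_le (h : AsymptoticSystem γ μ κ a p)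
    (he : SystemExponents n γ μ ν low ρ k lam N) {i j : ℕ} (hij : i + j + 1 ≤ N)
    (hi : SystemBound γ μ ν low ρ k lam a p i) (hj : SystemBound γ μ ν low ρ k lam a p j) :
    ∃ D : ℝ≥0∞, D ≠ ∞ ∧ ∀ s ∈ Ici (1 : ℝ),
      wl ν (k - (i + j + 1 : ℕ) * lam) 0 ρ
        (lconv (fun ζ => ‖ζ‖ₑ * ‖p i s ζ‖ₑ) fun η => ‖a j s η‖ₑ) ≤ D * growth γ s ∧
      wl ν (k - (i + j + 1 : ℕ) * lam) 0 ρ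
        (lconv (fun ζ => ‖ζ‖ₑ ^ 2 * ‖p i s ζ‖ₑ) fun η => ‖a j s η‖ₑ) ≤ D * growth γ s ∧
      wl ν (k - (i + j + 1 : ℕ) * lam) 0 ρ
        (lconv (fun ζ => ‖ζ‖ₑ * ‖p i s ζ‖ₑ) fun η => ‖η‖ₑ * ‖a j s η‖ₑ) ≤ D * growth γ s := by
  obtain ⟨B, hB, hBle⟩ := hi.phase
  obtain ⟨A, hA, hAle⟩ := hj.amplitude
  have hl := he.one_le
  have hl2 := he.le_lam
  have hi0 : (0 : ℝ) ≤ i := i.cast_nonneg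
  have hj0 : (0 : ℝ) ≤ j := j.cast_nonneg
  have hk := he.lt_k
  have hil : 0 ≤ i * lam := by positivity
  have hjl : 0 ≤ j * lam := by positivity
  obtain ⟨C, hC, H⟩ := exists_wl_lconv_le (n := n) he.pos (s := k - (i + j + 1 : ℕ) * lam)
    (s₁ := k - i * lam - (μ - n)) (s₂ := k - j * lam) he.ν_nonneg he.ν_le he.low_nonneg he.low_lt
    (he.nonneg hij) (by push_cast; linarith) (by push_cast; linarith) (by push_cast; linarith)
  refine ⟨C * B * A, by finiteness, fun s hs => ?_⟩
  have key : C * wl ν (k - i * lam - (μ - n)) low ρ (fun ζ => ‖p i s ζ‖ₑ) *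
      wl ν (k - j * lam) 0 ρ (fun η => ‖a j s η‖ₑ) ≤ C * B * A * growth γ s :=
    calc _ ≤ C * (B * growth γ s) * A :=
          mul_le_mul' (mul_le_mul' le_rfl (hBle s hs)) (hAle s hs)
      _ = _ := by ring
  obtain ⟨h1, h2, h3⟩ := H ρ _ _ he.ρ_nonneg (h.measurable_phase i s).enorm
    (h.measurable_amplitude j s).enorm
  exact ⟨h1.trans key, h2.trans key, h3.trans key⟩

lemma transportBound (h : AsymptoticSystem γ μ κ a p)
    (he : SystemExponents n γ μ ν low ρ k lam N) {i j : ℕ} (hij : i + j + 1 ≤ N)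
    (hi : SystemBound γ μ ν low ρ k lam a p i) (hj : SystemBound γ μ ν low ρ k lam a p j) {s : ℝ}
    (hs : 1 ≤ s) : TransportBound (p i s) (a j s) := by
  obtain ⟨D, hD, H⟩ := h.exists_transport_le he hij hi hj
  obtain ⟨h1, h2, h3⟩ := H s hs
  have hfin : D * growth γ s ≠ ∞ := ENNReal.mul_ne_top hD (growth_ne_top _ _)
  have hle := fun F => ltwo_le_wl (ν := ν) he.pos (he.nonneg hij) he.ρ_nonneg F
  exact ⟨ne_top_of_le_ne_top hfin ((hle _).trans h1), ne_top_of_le_ne_top hfin ((hle _).trans h2),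
    ne_top_of_le_ne_top hfin ((hle _).trans h3)⟩

/-- The integrability in time of the derivatives of the amplitudes. -/
lemma lintegral_amplitudeRate_ne_top (h : AsymptoticSystem γ μ κ a p)
    (he : SystemExponents n γ μ ν low ρ k lam N) {m : ℕ} (hm : m ≤ N)
    (hb : ∀ j < m, SystemBound γ μ ν low ρ k lam a p j) :
    ∫⁻ s in Ioi (1 : ℝ), wl ν (k - m * lam) 0 ρ (fun ξ => ‖amplitudeRate a p m s ξ‖ₑ) ≠ ∞ := by
  rcases m with _ | m
  · simp [amplitudeRate, wl, ltwo]
  obtain ⟨D, hD, hle⟩ := exists_wl_sum_le (Finset.HasAntidiagonal.antidiagonal m)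
    (f := fun q s ξ => transportHat (p q.1 s) (a q.2 s) ξ) (ν := ν) (a := k - (m + 1 : ℕ) * lam)
    (b := 0) (ρ := ρ) (g := growth γ)
    (fun q _ => measurable_uncurry_transportHat (h.measurable q.1).2 (h.measurable q.2).1)
    (fun q hq => by
      have hq' : q.1 + q.2 = m := Finset.HasAntidiagonal.mem_antidiagonal.1 hq
      obtain ⟨D, hD, H⟩ := h.exists_transport_le he (i := q.1) (j := q.2) (by omega)
        (hb _ (by omega)) (hb _ (by omega))
      rw [hq'] at H
      refine ⟨2 * (n * D) + D, by finiteness, fun s hs => ?_⟩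
      obtain ⟨-, h2, h3⟩ := H s hs
      have hP := (h.measurable_phase q.1 s).enorm
      have hA := (h.measurable_amplitude q.2 s).enorm
      have hm1 : Measurable (lconv (fun ζ => ‖ζ‖ₑ * ‖p q.1 s ζ‖ₑ) fun η => ‖η‖ₑ * ‖a q.2 s η‖ₑ) :=
        measurable_lconv (measurable_enorm.mul hP) (measurable_enorm.mul hA)
      have hm2 : Measurable (lconv (fun ζ => ‖ζ‖ₑ ^ 2 * ‖p q.1 s ζ‖ₑ) fun η => ‖a q.2 s η‖ₑ) :=
        measurable_lconv ((measurable_enorm.pow_const 2).mul hP) hA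
      refine (wl_mono (ae_of_all _ fun ξ => enorm_transportHat_le _ _ ξ)).trans
        ((wl_add_le ((hm1.const_mul _).const_mul _).aemeasurable hm2.aemeasurable).trans ?_)
      rw [wl_const_mul (by norm_num), wl_const_mul (ENNReal.natCast_ne_top n)]
      calc _ ≤ 2 * (n * (D * growth γ s)) + D * growth γ s := by gcongr
        _ = _ := by ring)
  refine ne_top_of_le_ne_top (b := ∫⁻ s in Ioi (1 : ℝ), D * (invTwoSq s * growth γ s)) ?_
    (setLIntegral_mono' measurableSet_Ioi fun s hs => ?_)
  · rw [lintegral_const_mul' _ _ hD]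
    exact ENNReal.mul_ne_top hD (lintegral_invTwoSq_mul_growth_ne_top he.γ_pos)
  · have e : (fun ξ => ‖amplitudeRate a p (m + 1) s ξ‖ₑ) = fun ξ => invTwoSq s *
        ‖∑ q ∈ Finset.HasAntidiagonal.antidiagonal m, transportHat (p q.1 s) (a q.2 s) ξ‖ₑ := by
      funext ξ
      rw [amplitudeRate, enorm_mul, enorm_ofReal_inv]
    rw [e, wl_const_mul (c := invTwoSq s) ENNReal.ofReal_ne_top]
    calc _ ≤ invTwoSq s * (D * growth γ s) := by
          gcongr
          exact hle s (mem_Ici.2 (le_of_lt hs))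
      _ = _ := by ring

lemma amplitude_le (h : AsymptoticSystem γ μ κ a p)
    (he : SystemExponents n γ μ ν low ρ k lam N) (h0 : wl ν k 0 ρ (fun ξ => ‖a 0 1 ξ‖ₑ) ≠ ∞)
    {m : ℕ} (hm : m ≤ N) (hb : ∀ j < m, SystemBound γ μ ν low ρ k lam a p j) :
    ∃ A : ℝ≥0∞, A ≠ ∞ ∧
      ∀ t ∈ Ici (1 : ℝ), wl ν (k - m * lam) 0 ρ (fun ξ => ‖a m t ξ‖ₑ) ≤ A := by
  have hr := h.lintegral_amplitudeRate_ne_top he hm hb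
  rcases m with _ | m
  · exact ⟨_, h0, fun t _ => by simp [h.const t]⟩
  refine ⟨_, hr, fun t ht => ?_⟩
  calc _ ≤ wl ν (k - (m + 1 : ℕ) * lam) 0 ρ
        (fun ξ => ∫⁻ s in Ioi (1 : ℝ), ‖amplitudeRate a p (m + 1) s ξ‖ₑ) := by
        refine wl_mono (ae_of_all _ fun ξ => ?_)
        dsimp only
        rw [h.succ, enorm_neg]
        exact (enorm_integral_le_lintegral_enorm _).trans (lintegral_mono_set (Ioi_subset_Ioi ht))
    _ ≤ _ := wl_lintegral_le (h.measurable_amplitudeRate (m + 1)).enorm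

/-- In the quadratic term s⁻² times the square of the growth is s^{-γ}, as in the source, where the
amplitudes are bounded. Both are at most s^{-γ/2}, whose integral reproduces the growth. The Riesz
potential provides the n - μ additional derivatives, and μ ≤ n keeps the exponent nonnegative. -/
lemma phase_le (h : AsymptoticSystem γ μ κ a p)
    (he : SystemExponents n γ μ ν low ρ k lam N) {m : ℕ} (hm : m ≤ N)
    (hb : ∀ j < m, SystemBound γ μ ν low ρ k lam a p j)
    (ha : ∀ j ≤ m, ∃ A : ℝ≥0∞, A ≠ ∞ ∧
      ∀ t ∈ Ici (1 : ℝ), wl ν (k - j * lam) 0 ρ (fun ξ => ‖a j t ξ‖ₑ) ≤ A) :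
    ∃ B : ℝ≥0∞, B ≠ ∞ ∧ ∀ t ∈ Ici (1 : ℝ),
      wl ν (k - m * lam - (μ - n)) low ρ (fun ξ => ‖p m t ξ‖ₑ) ≤ B * growth γ t := by
  have hl := he.one_le
  have hl2 := he.le_lam
  have hk := he.lt_k
  have hμ := he.μ_le
  obtain ⟨D₁, hD₁, H₁⟩ := exists_wl_sum_le (Finset.univ : Finset (Fin m))
    (f := fun j s ξ => gradDotHat (p j s) (p (m - 1 - j) s) ξ) (ν := ν)
    (a := k - m * lam - (μ - n)) (b := low) (ρ := ρ) (g := fun s => growth γ s * growth γ s)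
    (fun j _ => measurable_uncurry_gradDotHat (h.measurable j).2 (h.measurable (m - 1 - j)).2)
    (fun j _ => by
      obtain ⟨B, hB, hBle⟩ := (hb j j.2).phase
      obtain ⟨B', hB', hBle'⟩ := (hb (m - 1 - j) (by omega)).phase
      obtain ⟨i, hi⟩ : ∃ i, m = j + i + 1 := ⟨m - 1 - j, by omega⟩
      have hi' : m - 1 - j = i := by omega
      have hi0 : 0 ≤ (i : ℝ) * lam := by positivity
      have hj0 : 0 ≤ ((j : ℕ) : ℝ) * lam := by positivity
      have hm' : (m : ℝ) = (j : ℕ) + i + 1 := by exact_mod_cast hi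
      have hnn := he.nonneg hm
      rw [hi'] at hBle'
      obtain ⟨C, hC, H⟩ := exists_wl_gradDotHat_low_le (n := n) he.pos (s := k - m * lam - (μ - n))
        (s₁ := k - (j : ℕ) * lam - (μ - n)) (s₂ := k - i * lam - (μ - n)) he.ν_nonneg he.ν_le
        he.low_nonneg he.low_lt (by linarith) (by rw [hm']; linarith) (by rw [hm']; linarith)
        (by rw [hm']; linarith)
      refine ⟨C * B * B', by finiteness, fun s hs => ?_⟩
      rw [hi']
      refine (H ρ _ _ he.ρ_nonneg (h.measurable_phase j s) (h.measurable_phase i s)).trans ?_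
      calc _ ≤ C * (B * growth γ s) * (B' * growth γ s) :=
            mul_le_mul' (mul_le_mul' le_rfl (hBle s hs)) (hBle' s hs)
        _ = _ := by ring)
  obtain ⟨D₂, hD₂, H₂⟩ := exists_wl_sum_le (Finset.HasAntidiagonal.antidiagonal m)
    (f := fun q s ξ => gZeroHat κ μ (a q.1 s) (a q.2 s) ξ) (ν := ν)
    (a := k - m * lam - (μ - n)) (b := low) (ρ := ρ) (g := fun _ => 1)
    (fun q _ => measurable_uncurry_gZeroHat κ μ (h.measurable q.1).1 (h.measurable q.2).1)
    (fun q hq => by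
      have hq' : q.1 + q.2 = m := Finset.HasAntidiagonal.mem_antidiagonal.1 hq
      obtain ⟨A, hA, hAle⟩ := ha q.1 (by omega)
      obtain ⟨A', hA', hAle'⟩ := ha q.2 (by omega)
      have hm' : (m : ℝ) = q.1 + q.2 := by exact_mod_cast hq'.symm
      have hi0 : 0 ≤ (q.1 : ℝ) * lam := by positivity
      have hj0 : 0 ≤ (q.2 : ℝ) * lam := by positivity
      obtain ⟨C, hC, H⟩ := exists_wl_gZeroHat_le (n := n) he.pos (ν := ν) (low := low) (μ := μ)
        (s := k - m * lam) (s₁ := k - q.1 * lam) (s₂ := k - q.2 * lam) κ he.ν_nonneg he.ν_le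
        he.lt_low he.ρ_nonneg (he.nonneg hm) (by rw [hm']; linarith) (by rw [hm']; linarith)
        (by rw [hm']; linarith)
      refine ⟨C * A * A', by finiteness, fun s hs => ?_⟩
      refine (H _ _ (h.measurable_amplitude q.1 s) (h.measurable_amplitude q.2 s)
        (ne_top_of_le_ne_top hA (hAle s hs)) (ne_top_of_le_ne_top hA' (hAle' s hs))).trans ?_
      rw [mul_one]
      exact mul_le_mul' (mul_le_mul' le_rfl (hAle s hs)) (hAle' s hs))
  refine ⟨(D₁ + D₂) * 2, by finiteness, fun t ht => ?_⟩
  have h2 : Measurable fun z : ℝ × Rn n => (((2 * z.1 ^ 2)⁻¹ : ℝ) : ℂ) := by fun_prop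
  have h3 : Measurable fun z : ℝ × Rn n => ((z.1 ^ (-γ) : ℝ) : ℂ) := by fun_prop
  have hm1 : Measurable (Function.uncurry fun s ξ => (((2 * s ^ 2)⁻¹ : ℝ) : ℂ) *
      ∑ j : Fin m, gradDotHat (p j s) (p (m - 1 - j) s) ξ) :=
    h2.mul (Finset.measurable_fun_sum _ fun j _ =>
      measurable_uncurry_gradDotHat (h.measurable j).2 (h.measurable (m - 1 - j)).2)
  have hm2 : Measurable (Function.uncurry fun s ξ => ((s ^ (-γ) : ℝ) : ℂ) *
      ∑ q ∈ Finset.HasAntidiagonal.antidiagonal m, gZeroHat κ μ (a q.1 s) (a q.2 s) ξ) :=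
    h3.mul (Finset.measurable_fun_sum _ fun q _ =>
      measurable_uncurry_gZeroHat κ μ (h.measurable q.1).1 (h.measurable q.2).1)
  set f₁ : ℝ → Rn n → ℂ := fun s ξ => (((2 * s ^ 2)⁻¹ : ℝ) : ℂ) *
      ∑ j : Fin m, gradDotHat (p j s) (p (m - 1 - j) s) ξ with hf₁
  set f₂ : ℝ → Rn n → ℂ := fun s ξ => ((s ^ (-γ) : ℝ) : ℂ) *
      ∑ q ∈ Finset.HasAntidiagonal.antidiagonal m, gZeroHat κ μ (a q.1 s) (a q.2 s) ξ with hf₂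
  calc _ ≤ wl ν (k - m * lam - (μ - n)) low ρ (fun ξ => ∫⁻ s in Ioc 1 t, ‖f₁ s ξ + f₂ s ξ‖ₑ) := by
        refine wl_mono (ae_of_all _ fun ξ => ?_)
        dsimp only
        rw [h.phase, intervalIntegral.integral_of_le ht]
        exact enorm_integral_le_lintegral_enorm _
    _ ≤ ∫⁻ s in Ioc 1 t, wl ν (k - m * lam - (μ - n)) low ρ (fun ξ => ‖f₁ s ξ + f₂ s ξ‖ₑ) :=
        wl_lintegral_le (hm1.add hm2).enorm
    _ ≤ ∫⁻ s in Ioc 1 t, (D₁ + D₂) * ENNReal.ofReal (s ^ (-γ / 2)) := by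
        refine setLIntegral_mono' measurableSet_Ioc fun s hs => ?_
        have hs1 : s ∈ Ici (1 : ℝ) := hs.1.le
        have hs0 : 0 < s := one_pos.trans hs.1
        refine (wl_mono (ae_of_all _ fun ξ => enorm_add_le _ _)).trans ((wl_add_le
          hm1.of_uncurry_left.enorm.aemeasurable hm2.of_uncurry_left.enorm.aemeasurable).trans ?_)
        rw [add_mul]
        refine add_le_add ?_ ?_
        · simp only [hf₁, enorm_mul, enorm_ofReal_inv]
          rw [wl_const_mul (c := invTwoSq s) ENNReal.ofReal_ne_top]
          calc _ ≤ invTwoSq s * (D₁ * (growth γ s * growth γ s)) := by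
                gcongr
                exact H₁ s hs1
            _ = D₁ * (invTwoSq s * (growth γ s * growth γ s)) := by ring
            _ ≤ _ := by
                gcongr
                exact invTwoSq_mul_growth_sq_le he.γ_pos hs1
        · have e : ‖((s ^ (-γ) : ℝ) : ℂ)‖ₑ = ENNReal.ofReal (s ^ (-γ)) := by
            rw [← ofReal_norm, Complex.norm_real, Real.norm_of_nonneg (by positivity)]
          simp only [hf₂, enorm_mul, e]
          rw [wl_const_mul ENNReal.ofReal_ne_top, mul_comm]
          refine mul_le_mul' ((H₂ s hs1).trans_eq (mul_one _)) (ENNReal.ofReal_le_ofReal ?_)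
          exact Real.rpow_le_rpow_of_exponent_le hs1 (by linarith [he.γ_pos])
    _ = (D₁ + D₂) * ∫⁻ s in Ioc 1 t, ENNReal.ofReal (s ^ (-γ / 2)) :=
        lintegral_const_mul' _ _ (by finiteness)
    _ ≤ (D₁ + D₂) * (2 * growth γ t) := by
        gcongr
        exact lintegral_rpow_le_growth he.γ_le ht
    _ = _ := by ring

/-- At each order the amplitude involves only lower orders, whereas the phase also involves the
amplitude of the same order; the amplitude is therefore estimated first. -/
lemma systemBound (h : AsymptoticSystem γ μ κ a p)
    (he : SystemExponents n γ μ ν low ρ k lam N) (h0 : wl ν k 0 ρ (fun ξ => ‖a 0 1 ξ‖ₑ) ≠ ∞)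
    (m : ℕ) (hm : m ≤ N) : SystemBound γ μ ν low ρ k lam a p m := by
  induction m using Nat.strong_induction_on with
  | _ m ih =>
  have hb : ∀ j < m, SystemBound γ μ ν low ρ k lam a p j := fun j hj => ih j hj (by omega)
  have ha := h.amplitude_le he h0 hm hb
  exact ⟨ha, h.phase_le he hm hb fun j hj => by
    rcases hj.lt_or_eq with h1 | rfl
    · exact (hb j h1).amplitude
    · exact ha⟩

end AsymptoticSystem

end SystemEstimates

-- The conservation law behind the densities

section Divergence

lemma mulHat_comm (a b : Rn n → ℂ) : mulHat a b = mulHat b a := by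
  funext ξ
  rw [mulHat, mulHat, ← integral_sub_left_eq_self _ _ ξ]
  simp [mul_comm]

/-- With ζ = x - η the symbol of 2∇φ·∇ + Δφ is, up to sign, 2ζ·η + |ζ|² = ζ·(x + η). -/
lemma transportHat_eq_integral {P A : Rn n → ℂ} (hP : Measurable P) (hA : Measurable A) {x : Rn n}
    (h1 : lconv (fun ζ => ‖ζ‖ₑ ^ 2 * ‖P ζ‖ₑ) (fun η => ‖A η‖ₑ) x ≠ ∞)
    (h2 : lconv (fun ζ => ‖ζ‖ₑ * ‖P ζ‖ₑ) (fun η => ‖η‖ₑ * ‖A η‖ₑ) x ≠ ∞) :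
    transportHat P A x = -(unitFactor n : ℂ) *
      ∫ η, ((inner ℝ (x - η) (x + η) : ℝ) : ℂ) * (P (x - η) * A η) := by
  have hPx : Measurable fun η => P (x - η) := hP.comp (measurable_id.const_sub x)
  have i1 : Integrable fun η => ((inner ℝ (x - η) η : ℝ) : ℂ) * (P (x - η) * A η) := by
    refine ⟨Measurable.aestronglyMeasurable (by fun_prop),
      lt_of_le_of_lt (lintegral_mono fun η => ?_) h2.lt_top⟩
    rw [enorm_mul, enorm_mul]
    calc _ ≤ ‖x - η‖ₑ * ‖η‖ₑ * (‖P (x - η)‖ₑ * ‖A η‖ₑ) := by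
          gcongr
          exact enorm_inner_le _ _
      _ = _ := by ring
  have i2 : Integrable fun η => laplaceHat P (x - η) * A η := by
    refine ⟨?_, lt_of_le_of_lt (lintegral_mono fun η => ?_) h1.lt_top⟩
    · unfold laplaceHat
      exact Measurable.aestronglyMeasurable (by fun_prop)
    · rw [enorm_mul, enorm_laplaceHat]
  rw [transportHat, gradDotHat_eq_integral hP hA h2, mulHat, neg_mul, neg_mul, mul_neg,
    ← mul_assoc, mul_comm 2, mul_assoc, ← integral_const_mul, neg_add_eq_sub, ← mul_sub,
    ← integral_sub i2 (i1.const_mul 2), ← mul_neg, ← integral_neg]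
  congr 2
  funext η
  have e : inner ℝ (x - η) (x + η) = ‖x - η‖ ^ 2 + 2 * inner ℝ (x - η) η := by
    rw [← real_inner_self_eq_norm_sq, ← real_inner_smul_right, ← inner_add_right]
    congr 1
    module
  rw [e, laplaceHat]
  push_cast
  ring

/-- The kernel of `(2∇φ·∇ + Δφ)w₁ · w₂` on the Fourier side. -/
def tripleKernel (P A B : Rn n → ℂ) (ξ : Rn n) (z : Rn n × Rn n) : ℂ :=
  ((inner ℝ (ξ - z.1 - z.2) (ξ - z.1 + z.2) : ℝ) : ℂ) * (P (ξ - z.1 - z.2) * A z.2) * B z.1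

/-- Fubini: the kernel is dominated by |ζ|² + 2|ζ||η|, which gives the two triple convolutions
assumed finite. Writing the product as a double integral prepares the exchange of the two
amplitudes. -/
lemma mulHat_transportHat_eq {P A B : Rn n → ℂ} (hP : Measurable P) (hA : Measurable A)
    (hB : Measurable B) {ξ : Rn n}
    (h1 : lconv (lconv (fun ζ => ‖ζ‖ₑ ^ 2 * ‖P ζ‖ₑ) fun η => ‖A η‖ₑ) (fun θ => ‖B θ‖ₑ) ξ ≠ ∞)
    (h2 : lconv (lconv (fun ζ => ‖ζ‖ₑ * ‖P ζ‖ₑ) fun η => ‖η‖ₑ * ‖A η‖ₑ) (fun θ => ‖B θ‖ₑ) ξ ≠ ∞) :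
    Integrable (tripleKernel P A B ξ) (volume.prod volume) ∧
      mulHat (transportHat P A) B ξ = -(unitFactor n : ℂ) ^ 2 *
        ∫ z, tripleKernel P A B ξ z ∂(volume.prod volume) := by
  have hPm : Measurable fun z : Rn n × Rn n => P (ξ - z.1 - z.2) := hP.comp (by fun_prop)
  have hKm : Measurable (tripleKernel P A B ξ) := by unfold tripleKernel; fun_prop
  set L₁ : Rn n → ℝ≥0∞ := lconv (fun ζ => ‖ζ‖ₑ ^ 2 * ‖P ζ‖ₑ) fun η => ‖A η‖ₑ with hL₁
  set L₂ : Rn n → ℝ≥0∞ := lconv (fun ζ => ‖ζ‖ₑ * ‖P ζ‖ₑ) fun η => ‖η‖ₑ * ‖A η‖ₑ with hL₂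
  have hL₁m : Measurable L₁ :=
    measurable_lconv ((measurable_enorm.pow_const 2).mul hP.enorm) hA.enorm
  have hL₂m : Measurable L₂ :=
    measurable_lconv (measurable_enorm.mul hP.enorm) (measurable_enorm.mul hA.enorm)
  have hK : Integrable (tripleKernel P A B ξ) (volume.prod volume) := by
    refine ⟨hKm.aestronglyMeasurable, ?_⟩
    rw [HasFiniteIntegral, lintegral_prod _ hKm.enorm.aemeasurable]
    refine lt_of_le_of_lt (lintegral_mono (g := fun θ => L₁ (ξ - θ) * ‖B θ‖ₑ +
      2 * (L₂ (ξ - θ) * ‖B θ‖ₑ)) fun θ => ?_) ?_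
    · have hPθ : Measurable fun η => P (ξ - θ - η) := hP.comp (measurable_id.const_sub _)
      have e : L₁ (ξ - θ) * ‖B θ‖ₑ + 2 * (L₂ (ξ - θ) * ‖B θ‖ₑ) = ∫⁻ η,
          ((‖ξ - θ - η‖ₑ ^ 2 * ‖P (ξ - θ - η)‖ₑ * ‖A η‖ₑ +
          2 * (‖ξ - θ - η‖ₑ * ‖P (ξ - θ - η)‖ₑ * (‖η‖ₑ * ‖A η‖ₑ))) * ‖B θ‖ₑ) := by
        rw [lintegral_mul_const _ (by fun_prop), lintegral_add_left (by fun_prop),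
          lintegral_const_mul _ (by fun_prop), add_mul, ← mul_assoc]
        rfl
      dsimp only
      rw [e]
      refine lintegral_mono fun η => ?_
      rw [tripleKernel, enorm_mul, enorm_mul, enorm_mul]
      gcongr
      calc _ ≤ ‖ξ - θ - η‖ₑ * (‖ξ - θ - η‖ₑ + 2 * ‖η‖ₑ) * (‖P (ξ - θ - η)‖ₑ * ‖A η‖ₑ) := by
            gcongr
            refine (enorm_inner_le _ _).trans ?_
            gcongr
            calc ‖ξ - θ + η‖ₑ = ‖(ξ - θ - η) + (η + η)‖ₑ := by congr 1; abel
              _ ≤ ‖ξ - θ - η‖ₑ + (‖η‖ₑ + ‖η‖ₑ) :=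
                (enorm_add_le _ _).trans (add_le_add le_rfl (enorm_add_le _ _))
              _ = _ := by rw [two_mul]
        _ = _ := by ring
    · have hm1 : Measurable fun θ => L₁ (ξ - θ) * ‖B θ‖ₑ :=
        (hL₁m.comp (measurable_id.const_sub ξ)).mul hB.enorm
      rw [lintegral_add_left hm1, lintegral_const_mul' _ _ (by norm_num)]
      exact ENNReal.add_lt_top.2 ⟨h1.lt_top, ENNReal.mul_lt_top (by norm_num) h2.lt_top⟩
  refine ⟨hK, ?_⟩
  rw [integral_prod _ hK, mulHat, sq, ← mul_neg, mul_assoc]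
  congr 1
  rw [← integral_const_mul]
  refine integral_congr_ae ?_
  have hm1 : Measurable fun θ => L₁ (ξ - θ) * ‖B θ‖ₑ :=
    (hL₁m.comp (measurable_id.const_sub ξ)).mul hB.enorm
  have hm2 : Measurable fun θ => L₂ (ξ - θ) * ‖B θ‖ₑ :=
    (hL₂m.comp (measurable_id.const_sub ξ)).mul hB.enorm
  filter_upwards [ae_lt_top hm1 h1, ae_lt_top hm2 h2] with θ h3 h4
  by_cases hθ : B θ = 0
  · simp [tripleKernel, hθ]
  have h5 : ‖B θ‖ₑ ≠ 0 := by simpa using hθ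
  have f1 : L₁ (ξ - θ) ≠ ∞ := fun h => by simp [h, ENNReal.top_mul h5] at h3
  have f2 : L₂ (ξ - θ) ≠ ∞ := fun h => by simp [h, ENNReal.top_mul h5] at h4
  rw [transportHat_eq_integral hP hA f1 f2, mul_assoc, ← integral_mul_const]
  rfl

/-- The Fourier transform of `-∇·(N ∇φ)`, where `P`, `M` are those of `φ`, `N`. -/
def fluxHat (P M : Rn n → ℂ) (ξ : Rn n) : ℂ :=
  (unitFactor n : ℂ) * ∫ x, ((inner ℝ (ξ - x) ξ : ℝ) : ℂ) * (P (ξ - x) * M x)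

lemma fluxHat_congr {P P' M M' : Rn n → ℂ} (hP : P =ᵐ[volume] P') (hM : M =ᵐ[volume] M') :
    fluxHat P M = fluxHat P' M' := by
  funext ξ
  rw [fluxHat, fluxHat]
  congr 1
  refine integral_congr_ae ?_
  filter_upwards [(quasiMeasurePreserving_sub_left volume ξ).ae_eq hP, hM] with η h1 h2
  simp only [Function.comp_apply] at h1
  rw [h1, h2]

lemma measurable_mulHat {a b : Rn n → ℂ} (ha : Measurable a) (hb : Measurable b) :
    Measurable (mulHat a b) :=
  (measurable_uncurry_mulHat (a := fun _ => a) (b := fun _ => b) (ha.comp measurable_snd)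
    (hb.comp measurable_snd)).of_uncurry_left (x := (0 : ℝ))

/-- The density is unfolded into its two amplitudes, with the same variables as in
`mulHat_transportHat_eq`, so that the kernels can be compared pointwise. -/
lemma fluxHat_mulHat_eq {P A B : Rn n → ℂ} (hP : Measurable P) (hA : Measurable A)
    (hB : Measurable B) {ξ : Rn n}
    (h : lconv (lconv (fun ζ => ‖ζ‖ₑ * ‖P ζ‖ₑ) fun η => ‖A η‖ₑ) (fun θ => ‖B θ‖ₑ) ξ ≠ ∞) :
    Integrable (fun x => ((inner ℝ (ξ - x) ξ : ℝ) : ℂ) * (P (ξ - x) * mulHat A B x)) ∧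
      fluxHat P (mulHat A B) ξ = (unitFactor n : ℂ) ^ 2 * ∫ θ, ∫ η,
        ((inner ℝ (ξ - θ - η) ξ : ℝ) : ℂ) * (P (ξ - θ - η) * A η) * B θ := by
  have hPx : Measurable fun x => P (ξ - x) := hP.comp (measurable_id.const_sub ξ)
  have m1 : Measurable fun ζ : Rn n => ‖ζ‖ₑ * ‖P ζ‖ₑ := measurable_enorm.mul hP.enorm
  rw [lconv_assoc m1 hA.enorm hB.enorm] at h
  refine ⟨⟨?_, ?_⟩, ?_⟩
  · have := measurable_mulHat hA hB
    exact Measurable.aestronglyMeasurable (by fun_prop)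
  · refine lt_of_le_of_lt (lintegral_mono (g := fun x => ‖ξ‖ₑ * (‖ξ - x‖ₑ * ‖P (ξ - x)‖ₑ *
      lconv (fun η => ‖A η‖ₑ) (fun θ => ‖B θ‖ₑ) x)) fun x => ?_) ?_
    · dsimp only
      rw [enorm_mul, enorm_mul]
      calc _ ≤ ‖ξ - x‖ₑ * ‖ξ‖ₑ * (‖P (ξ - x)‖ₑ * lconv (fun η => ‖A η‖ₑ) (fun θ => ‖B θ‖ₑ) x) := by
            gcongr
            · exact enorm_inner_le _ _
            · exact enorm_mulHat_le _ _ _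
        _ = _ := by ring
    · rw [lintegral_const_mul' _ _ (by finiteness)]
      exact ENNReal.mul_lt_top (by finiteness) h.lt_top
  · set L : Rn n → Rn n → ℂ := fun x θ =>
      ((inner ℝ (ξ - x) ξ : ℝ) : ℂ) * (P (ξ - x) * A (x - θ)) * B θ with hL
    have hPm : Measurable fun z : Rn n × Rn n => P (ξ - z.1) := hPx.comp measurable_fst
    have hAm : Measurable fun z : Rn n × Rn n => A (z.1 - z.2) := hA.comp (by fun_prop)
    have hLm : Measurable (Function.uncurry L) := by
      change Measurable fun z : Rn n × Rn n => ((inner ℝ (ξ - z.1) ξ : ℝ) : ℂ) *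
        (P (ξ - z.1) * A (z.1 - z.2)) * B z.2
      fun_prop
    have hLi : Integrable (Function.uncurry L) (volume.prod volume) := by
      refine ⟨hLm.aestronglyMeasurable, ?_⟩
      rw [HasFiniteIntegral, lintegral_prod _ hLm.enorm.aemeasurable]
      refine lt_of_le_of_lt (lintegral_mono (g := fun x => ‖ξ‖ₑ * (‖ξ - x‖ₑ * ‖P (ξ - x)‖ₑ *
        lconv (fun η => ‖A η‖ₑ) (fun θ => ‖B θ‖ₑ) x)) fun x => ?_) ?_
      · have hAx : Measurable fun θ => A (x - θ) := hA.comp (measurable_id.const_sub x)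
        dsimp only
        rw [lconv, ← lintegral_const_mul _ (by fun_prop), ← lintegral_const_mul _ (by fun_prop)]
        refine lintegral_mono fun θ => ?_
        simp only [Function.uncurry, hL]
        rw [enorm_mul, enorm_mul, enorm_mul]
        calc _ ≤ ‖ξ - x‖ₑ * ‖ξ‖ₑ * (‖P (ξ - x)‖ₑ * ‖A (x - θ)‖ₑ) * ‖B θ‖ₑ := by
              gcongr
              exact enorm_inner_le _ _
          _ = _ := by ring
      · rw [lintegral_const_mul' _ _ (by finiteness)]
        exact ENNReal.mul_lt_top (by finiteness) h.lt_top
    have e1 : ∀ x, ((inner ℝ (ξ - x) ξ : ℝ) : ℂ) * (P (ξ - x) * mulHat A B x) =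
        (unitFactor n : ℂ) * ∫ θ, L x θ := fun x => by
      have e2 : ∀ θ, L x θ = (((inner ℝ (ξ - x) ξ : ℝ) : ℂ) * P (ξ - x)) * (A (x - θ) * B θ) :=
        fun θ => by simp only [hL]; ring
      simp only [e2]
      rw [integral_const_mul, mulHat]
      ring
    rw [fluxHat]
    simp only [e1]
    rw [integral_const_mul, integral_integral_swap hLi, sq, mul_assoc]
    congr 2
    refine integral_congr_ae (ae_of_all _ fun θ => ?_)
    dsimp only
    rw [← integral_add_right_eq_self _ θ]
    refine integral_congr_ae (ae_of_all _ fun η => ?_)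
    simp only [hL, add_sub_cancel_right]
    rw [show ξ - (η + θ) = ξ - θ - η by abel]

lemma lconv_comp_neg (F G : Rn n → ℝ≥0∞) (ξ : Rn n) :
    lconv (fun ζ => F (-ζ)) (fun η => G (-η)) ξ = lconv F G (-ξ) := by
  rw [lconv, lconv, ← lintegral_neg_eq_self]
  refine lintegral_congr fun η => ?_
  simp only [neg_neg]
  congr 2; abel

/-- For a real phase |P| is even, so replacing A by its reflected conjugate only reflects the
convolutions. -/
lemma TransportBound.conjHat {P A : Rn n → ℂ} (h : TransportBound P A)
    (hP : Gevrey.conjHat P = P) : TransportBound P (Gevrey.conjHat A) := by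
  have e : ∀ ζ, ‖P ζ‖ₑ = ‖P (-ζ)‖ₑ := fun ζ => by
    conv_lhs => rw [← hP, enorm_conjHat]
  have key : ∀ F G : Rn n → ℝ≥0∞, (∀ ζ, F ζ = F (-ζ)) →
      ltwo volume (lconv F fun η => G (-η)) = ltwo volume (lconv F G) := fun F G hF => by
    rw [← ltwo_comp_neg (lconv F G)]
    congr 1; funext ξ
    rw [← lconv_comp_neg]
    congr 1; funext ζ; exact hF ζ
  refine ⟨?_, ?_, ?_⟩
  · simp only [enorm_conjHat]
    rw [key _ (fun η => ‖A η‖ₑ) (fun ζ => by rw [enorm_neg, ← e])]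
    exact h.grad
  · simp only [enorm_conjHat]
    rw [key _ (fun η => ‖A η‖ₑ) (fun ζ => by rw [enorm_neg, ← e])]
    exact h.laplace
  · have e2 : (fun η => ‖η‖ₑ * ‖Gevrey.conjHat A η‖ₑ) = fun η : Rn n => ‖-η‖ₑ * ‖A (-η)‖ₑ := by
      funext η; rw [enorm_conjHat, enorm_neg]
    rw [e2, key _ (fun η => ‖η‖ₑ * ‖A η‖ₑ) (fun ζ => by rw [enorm_neg, ← e])]
    exact h.gradDot

lemma ltwo_conjHat (a : Rn n → ℂ) :
    ltwo volume (fun ξ => ‖conjHat a ξ‖ₑ) = ltwo volume fun ξ => ‖a ξ‖ₑ := by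
  simp only [enorm_conjHat]
  exact ltwo_comp_neg fun ξ => ‖a ξ‖ₑ

/-- The conservation law `(Tw₁)w̄₂ + w₁(Tw₂)̄ = 2∇·(w₁w̄₂∇φ)` for `T = 2∇φ·∇ + Δφ`, on the Fourier
side. -/
lemma mulHat_transportHat_add {P A B : Rn n → ℂ} (hP : Measurable P) (hA : Measurable A)
    (hB : Measurable B) (hreal : conjHat P = P) (hPA : TransportBound P A)
    (hPB : TransportBound P B) (hA2 : ltwo volume (fun ξ => ‖A ξ‖ₑ) ≠ ∞)
    (hB2 : ltwo volume (fun ξ => ‖B ξ‖ₑ) ≠ ∞) (ξ : Rn n) :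
    Integrable (fun x => ((inner ℝ (ξ - x) ξ : ℝ) : ℂ) * (P (ξ - x) * mulHat A (conjHat B) x)) ∧
      mulHat (transportHat P A) (conjHat B) ξ + mulHat A (conjHat (transportHat P B)) ξ =
        -2 * fluxHat P (mulHat A (conjHat B)) ξ := by
  rw [conjHat_transportHat, hreal, mulHat_comm A (transportHat P _)]
  have hPB' := hPB.conjHat hreal
  have hB' := measurable_conjHat hB
  rw [← ltwo_conjHat] at hB2
  set B' := conjHat B
  have fin : ∀ {F G : Rn n → ℝ≥0∞}, Measurable F → Measurable G → ltwo volume F ≠ ∞ →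
      ltwo volume G ≠ ∞ → lconv F G ξ ≠ ∞ := fun hF hG h1 h2 =>
    ne_top_of_le_ne_top (ENNReal.mul_ne_top h1 h2) (lconv_le_ltwo hF hG ξ)
  have m1 : Measurable fun ζ : Rn n => ‖ζ‖ₑ * ‖P ζ‖ₑ := measurable_enorm.mul hP.enorm
  have m2 : Measurable fun ζ : Rn n => ‖ζ‖ₑ ^ 2 * ‖P ζ‖ₑ :=
    (measurable_enorm.pow_const 2).mul hP.enorm
  have mA : Measurable fun ζ : Rn n => ‖ζ‖ₑ * ‖A ζ‖ₑ := measurable_enorm.mul hA.enorm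
  have mB : Measurable fun ζ : Rn n => ‖ζ‖ₑ * ‖B' ζ‖ₑ := measurable_enorm.mul hB'.enorm
  obtain ⟨i1, e1⟩ := mulHat_transportHat_eq hP hA hB' (ξ := ξ)
    (fin (measurable_lconv m2 hA.enorm) hB'.enorm hPA.laplace hB2)
    (fin (measurable_lconv m1 mA) hB'.enorm hPA.gradDot hB2)
  obtain ⟨i2, e2⟩ := mulHat_transportHat_eq hP hB' hA (ξ := ξ)
    (fin (measurable_lconv m2 hB'.enorm) hA.enorm hPB'.laplace hA2)
    (fin (measurable_lconv m1 mB) hA.enorm hPB'.gradDot hA2)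
  obtain ⟨i3, e3⟩ := fluxHat_mulHat_eq hP hA hB' (ξ := ξ)
    (fin (measurable_lconv m1 hA.enorm) hB'.enorm hPA.grad hB2)
  refine ⟨i3, ?_⟩
  -- Let ζ = ξ - z₁ - z₂ be the frequency of the phase. The two symbols ζ·(ξ - z₁ + z₂) and ζ·(ξ -
  -- z₂ + z₁) add up to 2ζ·ξ, which is the symbol of a divergence.
  have hsum : ∀ z : Rn n × Rn n, tripleKernel P A B' ξ z + tripleKernel P B' A ξ z.swap =
      2 * (((inner ℝ (ξ - z.1 - z.2) ξ : ℝ) : ℂ) * (P (ξ - z.1 - z.2) * A z.2) * B' z.1) := fun z => by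
    simp only [tripleKernel, Prod.fst_swap, Prod.snd_swap]
    rw [show ξ - z.2 - z.1 = ξ - z.1 - z.2 by abel]
    have e4 : inner ℝ (ξ - z.1 - z.2) (ξ - z.1 + z.2) + inner ℝ (ξ - z.1 - z.2) (ξ - z.2 + z.1) =
        2 * inner ℝ (ξ - z.1 - z.2) ξ := by
      rw [← inner_add_right, ← real_inner_smul_right]
      congr 1
      module
    have e5 : ((inner ℝ (ξ - z.1 - z.2) (ξ - z.1 + z.2) : ℝ) : ℂ) +
        ((inner ℝ (ξ - z.1 - z.2) (ξ - z.2 + z.1) : ℝ) : ℂ) =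
        2 * ((inner ℝ (ξ - z.1 - z.2) ξ : ℝ) : ℂ) := by exact_mod_cast e4
    linear_combination (P (ξ - z.1 - z.2) * A z.2 * B' z.1) * e5
  have i2' : Integrable (fun z : Rn n × Rn n => tripleKernel P B' A ξ z.swap)
    (volume.prod volume) := i2.swap
  have e6 : ∫ z, tripleKernel P B' A ξ z ∂(volume.prod volume) =
      ∫ z, tripleKernel P B' A ξ z.swap ∂(volume.prod volume) :=
    (integral_prod_swap (tripleKernel P B' A ξ)).symm
  have i5 : Integrable (fun z : Rn n × Rn n => ((inner ℝ (ξ - z.1 - z.2) ξ : ℝ) : ℂ) *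
      (P (ξ - z.1 - z.2) * A z.2) * B' z.1) (volume.prod volume) := by
    refine ((i1.add i2').const_mul (1 / 2)).congr (ae_of_all _ fun z => ?_)
    simp only [Pi.add_apply, hsum]
    ring
  rw [e1, e2, e3, e6, ← mul_add, ← integral_add i1 i2']
  simp only [hsum]
  rw [integral_const_mul, integral_prod _ i5]
  ring

end Divergence

-- Product rule for curves prescribed at infinity

section Evolution

/-- The product rule for functions that are integrals from infinity. -/
lemma mul_eq_sub_integral_Ioi {f g F G : ℝ → ℂ} {c d : ℂ} {t : ℝ} (hf : IntegrableOn f (Ioi t))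
    (hg : IntegrableOn g (Ioi t)) (hF : ∀ s, t ≤ s → F s = c - ∫ σ in Ioi s, f σ)
    (hG : ∀ s, t ≤ s → G s = d - ∫ σ in Ioi s, g σ) (hFm : Measurable F) (hGm : Measurable G) :
    F t * G t = c * d - ∫ s in Ioi t, (f s * G s + F s * g s) := by
  have hb : ∀ {f F : ℝ → ℂ} {c : ℂ}, IntegrableOn f (Ioi t) →
      (∀ s, t ≤ s → F s = c - ∫ σ in Ioi s, f σ) → ∀ᵐ s ∂volume.restrict (Ioi t),
      ‖F s‖ ≤ ‖c‖ + ∫ σ in Ioi t, ‖f σ‖ := fun {f F c} hf hF => by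
    filter_upwards [ae_restrict_mem measurableSet_Ioi] with s hs
    rw [hF s (le_of_lt hs)]
    refine (norm_sub_le _ _).trans (add_le_add le_rfl ((norm_integral_le_integral_norm _).trans ?_))
    exact setIntegral_mono_set hf.norm (ae_of_all _ fun _ => norm_nonneg _)
      (LE.le.eventuallyLE (Ioi_subset_Ioi (le_of_lt hs)))
  have i1 : IntegrableOn (fun s => f s * G s) (Ioi t) :=
    hf.mul_bdd hGm.aestronglyMeasurable (hb hg hG)
  have i2 : IntegrableOn (fun s => F s * g s) (Ioi t) :=
    hg.bdd_mul hFm.aestronglyMeasurable (hb hf hF)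
  have e := integral_mul_integral_eq hf hg
  have hr : ∀ (h : ℝ → ℂ), ∀ s ∈ Ioi t, ∫ σ in Ioi s, h σ ∂(volume.restrict (Ioi t)) =
      ∫ σ in Ioi s, h σ := fun h s hs => by
    rw [Measure.restrict_restrict measurableSet_Ioi, inter_eq_left.2 (Ioi_subset_Ioi (le_of_lt hs))]
  have e1 : ∫ s in Ioi t, f s * ∫ σ in Ioi s, g σ ∂(volume.restrict (Ioi t)) =
      (∫ s in Ioi t, f s) * d - ∫ s in Ioi t, f s * G s := by
    rw [← integral_mul_const, ← integral_sub (hf.mul_const d) i1]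
    refine setIntegral_congr_fun measurableSet_Ioi fun s hs => ?_
    simp only [hr g s hs, hG s (le_of_lt hs)]
    ring
  have e2 : ∫ s in Ioi t, g s * ∫ σ in Ioi s, f σ ∂(volume.restrict (Ioi t)) =
      c * (∫ s in Ioi t, g s) - ∫ s in Ioi t, F s * g s := by
    rw [← integral_const_mul, ← integral_sub (hg.const_mul c) i2]
    refine setIntegral_congr_fun measurableSet_Ioi fun s hs => ?_
    simp only [hr f s hs, hF s (le_of_lt hs)]
    ring
  rw [e1, e2] at e
  rw [integral_add i1 i2, hF t le_rfl, hG t le_rfl]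
  linear_combination e

lemma integrable_mul_of_ltwo {A B : Rn n → ℂ} (hA : Measurable A) (hB : Measurable B)
    (hA2 : ltwo volume (fun ξ => ‖A ξ‖ₑ) ≠ ∞) (hB2 : ltwo volume (fun ξ => ‖B ξ‖ₑ) ≠ ∞) (ξ : Rn n) :
    Integrable fun η => A (ξ - η) * B η := by
  refine ⟨((hA.comp (measurable_id.const_sub ξ)).mul hB).aestronglyMeasurable, ?_⟩
  simp only [HasFiniteIntegral, enorm_mul]
  exact lt_of_le_of_lt (lconv_le_ltwo hA.enorm hB.enorm ξ) (ENNReal.mul_lt_top hA2.lt_top hB2.lt_top)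

/-- A curve in `L²` that is an integral from infinity, and its derivative. -/
structure IsTail (c : Rn n → ℂ) (f F : ℝ → Rn n → ℂ) : Prop where
  measurable : Measurable (Function.uncurry F)
  measurable_deriv : Measurable (Function.uncurry f)
  measurable_limit : Measurable c
  eq : ∀ t x, F t x = c x - ∫ s in Ioi t, f s x
  bounded : ∃ A : ℝ≥0∞, A ≠ ∞ ∧ ∀ t ∈ Ici (1 : ℝ), ltwo volume (fun ξ => ‖F t ξ‖ₑ) ≤ A
  limit_ne_top : ltwo volume (fun ξ => ‖c ξ‖ₑ) ≠ ∞
  deriv_ne_top : ∫⁻ s in Ioi (1 : ℝ), ltwo volume (fun ξ => ‖f s ξ‖ₑ) ≠ ∞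

lemma IsTail.ae_integrableOn {c : Rn n → ℂ} {f F : ℝ → Rn n → ℂ} (h : IsTail c f F) {t : ℝ}
    (ht : 1 ≤ t) : ∀ᵐ x, IntegrableOn (fun s => f s x) (Ioi t) := by
  have hm : Measurable fun x => ∫⁻ s in Ioi (1 : ℝ), ‖f s x‖ₑ :=
    Measurable.lintegral_prod_left' (f := fun z : ℝ × Rn n => ‖f z.1 z.2‖ₑ) h.measurable_deriv.enorm
  have h1 : ltwo volume (fun x => ∫⁻ s in Ioi (1 : ℝ), ‖f s x‖ₑ) ≠ ∞ :=
    ne_top_of_le_ne_top h.deriv_ne_top (ltwo_lintegral_le h.measurable_deriv.enorm)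
  have h2 : ∫⁻ x, (∫⁻ s in Ioi (1 : ℝ), ‖f s x‖ₑ) ^ 2 ≠ ∞ := by
    rw [← ltwo_sq]; exact ENNReal.pow_ne_top h1
  filter_upwards [ae_lt_top (hm.pow_const 2) h2] with x hx
  refine ⟨h.measurable_deriv.of_uncurry_right.aestronglyMeasurable, ?_⟩
  refine lt_of_le_of_lt (lintegral_mono_set (Ioi_subset_Ioi ht)) ?_
  by_contra h3
  rw [not_lt, top_le_iff] at h3
  simp [h3] at hx

/-- The derivative of a product of curves, on the Fourier side. -/
lemma IsTail.mulHat_eq {c d : Rn n → ℂ} {f F g G : ℝ → Rn n → ℂ} (hF : IsTail c f F)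
    (hG : IsTail d g G) {t : ℝ} (ht : 1 ≤ t) (ξ : Rn n) :
    IntegrableOn (fun s => mulHat (f s) (G s) ξ + mulHat (F s) (g s) ξ) (Ioi t) ∧
      mulHat (F t) (G t) ξ = mulHat c d ξ -
        ∫ s in Ioi t, (mulHat (f s) (G s) ξ + mulHat (F s) (g s) ξ) := by
  obtain ⟨A, hA, hFA⟩ := hF.bounded
  obtain ⟨B, hB, hGB⟩ := hG.bounded
  have hsub : Measurable fun z : ℝ × Rn n => (z.1, ξ - z.2) := by fun_prop
  have mF : Measurable fun z : ℝ × Rn n => F z.1 (ξ - z.2) := hF.measurable.comp hsub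
  have mf : Measurable fun z : ℝ × Rn n => f z.1 (ξ - z.2) := hF.measurable_deriv.comp hsub
  have mG : Measurable fun z : ℝ × Rn n => G z.1 z.2 := hG.measurable
  have mg : Measurable fun z : ℝ × Rn n => g z.1 z.2 := hG.measurable_deriv
  -- One factor is integrable in time with values in L² and the other is bounded in L²;
  -- Cauchy-Schwarz in frequency makes their convolution integrable in time at every ξ.
  have key : ∀ {u v : ℝ → Rn n → ℂ} {M : ℝ≥0∞}, Measurable (Function.uncurry u) →
      Measurable (Function.uncurry v) →
      (∀ s ∈ Ici (1 : ℝ), ltwo volume (fun ξ => ‖v s ξ‖ₑ) ≤ M) → M ≠ ∞ →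
      ∫⁻ s in Ioi (1 : ℝ), ltwo volume (fun ξ => ‖u s ξ‖ₑ) ≠ ∞ →
      ∫⁻ s in Ioi t, lconv (fun η => ‖u s η‖ₑ) (fun η => ‖v s η‖ₑ) ξ < ∞ := by
    intro u v M hu hv hM hM' hu'
    calc _ ≤ ∫⁻ s in Ioi t, ltwo volume (fun ξ => ‖u s ξ‖ₑ) * M := by
          refine setLIntegral_mono' measurableSet_Ioi fun s hs => ?_
          refine (lconv_le_ltwo hu.of_uncurry_left.enorm hv.of_uncurry_left.enorm ξ).trans ?_
          gcongr
          exact hM s (mem_Ici.2 (ht.trans (le_of_lt hs)))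
      _ = (∫⁻ s in Ioi t, ltwo volume (fun ξ => ‖u s ξ‖ₑ)) * M := lintegral_mul_const' _ _ hM'
      _ < ∞ := ENNReal.mul_lt_top (lt_of_le_of_lt (lintegral_mono_set (Ioi_subset_Ioi ht))
          hu'.lt_top) hM'.lt_top
  have i1 : Integrable (fun z : ℝ × Rn n => f z.1 (ξ - z.2) * G z.1 z.2)
      ((volume.restrict (Ioi t)).prod volume) := by
    have hm : Measurable fun z : ℝ × Rn n => f z.1 (ξ - z.2) * G z.1 z.2 := mf.mul mG
    refine ⟨hm.aestronglyMeasurable, ?_⟩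
    rw [HasFiniteIntegral, lintegral_prod _ hm.enorm.aemeasurable]
    simp only [enorm_mul]
    exact key hF.measurable_deriv hG.measurable hGB hB hF.deriv_ne_top
  have i2 : Integrable (fun z : ℝ × Rn n => F z.1 (ξ - z.2) * g z.1 z.2)
      ((volume.restrict (Ioi t)).prod volume) := by
    have hm : Measurable fun z : ℝ × Rn n => F z.1 (ξ - z.2) * g z.1 z.2 := mF.mul mg
    refine ⟨hm.aestronglyMeasurable, ?_⟩
    rw [HasFiniteIntegral, lintegral_prod _ hm.enorm.aemeasurable]
    simp only [enorm_mul]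
    refine lt_of_le_of_lt (le_of_eq (lintegral_congr fun s => ?_))
      (key hG.measurable_deriv hF.measurable hFA hA hG.deriv_ne_top)
    rw [lconv_comm]
    rfl
  have i3 : Integrable (fun z : ℝ × Rn n => f z.1 (ξ - z.2) * G z.1 z.2 +
      F z.1 (ξ - z.2) * g z.1 z.2) ((volume.restrict (Ioi t)).prod volume) := i1.add i2
  have hpt : ∀ᵐ η, F t (ξ - η) * G t η = c (ξ - η) * d η -
      ∫ s in Ioi t, (f s (ξ - η) * G s η + F s (ξ - η) * g s η) := by
    filter_upwards [(quasiMeasurePreserving_sub_left volume ξ).ae (hF.ae_integrableOn ht),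
      hG.ae_integrableOn ht] with η h1 h2
    exact mul_eq_sub_integral_Ioi h1 h2 (fun s _ => hF.eq s _) (fun s _ => hG.eq s _)
      hF.measurable.of_uncurry_right hG.measurable.of_uncurry_right
  have hs : ∀ᵐ s ∂volume.restrict (Ioi t), mulHat (f s) (G s) ξ + mulHat (F s) (g s) ξ =
      (unitFactor n : ℂ) * ∫ η, (f s (ξ - η) * G s η + F s (ξ - η) * g s η) := by
    filter_upwards [i1.prod_right_ae, i2.prod_right_ae] with s h1 h2
    rw [integral_add h1 h2, mulHat, mulHat, mul_add]
  refine ⟨(i3.integral_prod_left.const_mul (unitFactor n : ℂ)).congr ?_, ?_⟩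
  · filter_upwards [hs] with s h1
    rw [h1]
  · rw [integral_congr_ae hs, integral_const_mul, mulHat, mulHat, integral_congr_ae hpt,
      integral_sub (integrable_mul_of_ltwo hF.measurable_limit hG.measurable_limit hF.limit_ne_top
        hG.limit_ne_top ξ) i3.integral_prod_right, mul_sub]
    congr 2
    exact (integral_integral_swap (f := fun s η => f s (ξ - η) * G s η + F s (ξ - η) * g s η) i3).symm

lemma IsTail.conjHat {c : Rn n → ℂ} {f F : ℝ → Rn n → ℂ} (h : IsTail c f F) :
    IsTail (Gevrey.conjHat c) (fun s => Gevrey.conjHat (f s)) fun s => Gevrey.conjHat (F s) where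
  measurable := measurable_uncurry_conjHat h.measurable
  measurable_deriv := measurable_uncurry_conjHat h.measurable_deriv
  measurable_limit := measurable_conjHat h.measurable_limit
  eq t x := by
    simp only [Gevrey.conjHat]
    rw [h.eq, map_sub, integral_conj]
  bounded := by
    obtain ⟨A, hA, hle⟩ := h.bounded
    exact ⟨A, hA, fun t ht => (ltwo_conjHat _).trans_le (hle t ht)⟩
  limit_ne_top := by rw [ltwo_conjHat]; exact h.limit_ne_top
  deriv_ne_top := by simp only [ltwo_conjHat]; exact h.deriv_ne_top

end Evolution

-- Evolution of the densities

section Density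

lemma sum_antidiagonal_assoc {M : Type*} [AddCommMonoid M] (f : ℕ → ℕ → ℕ → M) (m : ℕ) :
    ∑ q ∈ Finset.HasAntidiagonal.antidiagonal m, ∑ r ∈ Finset.HasAntidiagonal.antidiagonal q.1, f r.1 r.2 q.2 =
      ∑ q ∈ Finset.HasAntidiagonal.antidiagonal m, ∑ r ∈ Finset.HasAntidiagonal.antidiagonal q.2, f q.1 r.1 r.2 := by
  rw [Finset.sum_sigma', Finset.sum_sigma']
  refine Finset.sum_nbij' (fun x => ⟨(x.2.1, x.2.2 + x.1.2), (x.2.2, x.1.2)⟩)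
    (fun x => ⟨(x.1.1 + x.2.1, x.2.2), (x.1.1, x.2.1)⟩) ?_ ?_ ?_ ?_ ?_
  · rintro ⟨⟨a, b⟩, ⟨c, d⟩⟩ h
    simp only [Finset.mem_sigma, Finset.HasAntidiagonal.mem_antidiagonal] at h ⊢
    exact ⟨by omega, trivial⟩
  · rintro ⟨⟨a, b⟩, ⟨c, d⟩⟩ h
    simp only [Finset.mem_sigma, Finset.HasAntidiagonal.mem_antidiagonal] at h ⊢
    exact ⟨by omega, trivial⟩
  · rintro ⟨⟨a, b⟩, ⟨c, d⟩⟩ h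
    simp only [Finset.mem_sigma, Finset.HasAntidiagonal.mem_antidiagonal] at h ⊢
    simp [h.2]
  · rintro ⟨⟨a, b⟩, ⟨c, d⟩⟩ h
    simp only [Finset.mem_sigma, Finset.HasAntidiagonal.mem_antidiagonal] at h ⊢
    simp [h.2]
  · rintro ⟨⟨a, b⟩, ⟨c, d⟩⟩ _
    rfl

lemma sum_antidiagonal_left_comm {M : Type*} [AddCommMonoid M] (f : ℕ → ℕ → ℕ → M) (m : ℕ) :
    ∑ q ∈ Finset.HasAntidiagonal.antidiagonal m, ∑ r ∈ Finset.HasAntidiagonal.antidiagonal q.2, f r.1 q.1 r.2 =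
      ∑ q ∈ Finset.HasAntidiagonal.antidiagonal m, ∑ r ∈ Finset.HasAntidiagonal.antidiagonal q.2, f q.1 r.1 r.2 := by
  rw [← Finset.Nat.sum_antidiagonal_swap]
  refine (sum_antidiagonal_assoc (fun i l j => f i j l) m).trans
    (Finset.sum_congr rfl fun q _ => ?_)
  rw [← Finset.Nat.sum_antidiagonal_swap]
  rfl

lemma mulHat_sum_left {ι : Type*} (F : Finset ι) {f : ι → Rn n → ℂ} {g : Rn n → ℂ} {ξ : Rn n}
    (c : ℂ) (h : ∀ i ∈ F, Integrable fun η => f i (ξ - η) * g η) :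
    mulHat (fun ζ => c * ∑ i ∈ F, f i ζ) g ξ = c * ∑ i ∈ F, mulHat (f i) g ξ := by
  have e : (fun η => (c * ∑ i ∈ F, f i (ξ - η)) * g η) =
      fun η => c * ∑ i ∈ F, f i (ξ - η) * g η := by
    funext η
    rw [mul_assoc, Finset.sum_mul]
  simp only [mulHat]
  rw [← Finset.mul_sum, ← integral_finsetSum _ h, e, integral_const_mul]
  ring

lemma fluxHat_sum_right {ι : Type*} (F : Finset ι) {P : Rn n → ℂ} {M : ι → Rn n → ℂ} {ξ : Rn n}
    (h : ∀ i ∈ F, Integrable fun x => ((inner ℝ (ξ - x) ξ : ℝ) : ℂ) * (P (ξ - x) * M i x)) :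
    fluxHat P (fun x => ∑ i ∈ F, M i x) ξ = ∑ i ∈ F, fluxHat P (M i) ξ := by
  simp only [fluxHat, ← Finset.mul_sum]
  rw [← integral_finsetSum _ h]
  simp only [Finset.mul_sum]

lemma TransportBound.ltwo_ne_top {P A : Rn n → ℂ} (h : TransportBound P A) (hP : Measurable P)
    (hA : Measurable A) : ltwo volume (fun ξ => ‖transportHat P A ξ‖ₑ) ≠ ∞ := by
  have m1 : Measurable fun ζ : Rn n => ‖ζ‖ₑ * ‖P ζ‖ₑ := measurable_enorm.mul hP.enorm
  have m2 : Measurable fun ζ : Rn n => ‖ζ‖ₑ ^ 2 * ‖P ζ‖ₑ :=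
    (measurable_enorm.pow_const 2).mul hP.enorm
  have mA : Measurable fun ζ : Rn n => ‖ζ‖ₑ * ‖A ζ‖ₑ := measurable_enorm.mul hA.enorm
  refine ne_top_of_le_ne_top ?_ ((ltwo_mono (ae_of_all _ fun ξ => enorm_transportHat_le P A ξ)).trans
    (ltwo_add_le (((measurable_lconv m1 mA).const_mul _).const_mul _).aemeasurable
      (measurable_lconv m2 hA.enorm).aemeasurable))
  rw [ltwo_const_mul (by norm_num), ltwo_const_mul (ENNReal.natCast_ne_top n)]
  have f1 := h.gradDot
  have f2 := h.laplace
  finiteness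

/-- The Fourier transforms of the coefficients of `|w|²`, `w = ∑ w_m`. -/
def densityHat (a : ℕ → ℝ → Rn n → ℂ) (m : ℕ) (t : ℝ) (ξ : Rn n) : ℂ :=
  ∑ q ∈ Finset.HasAntidiagonal.antidiagonal m, mulHat (a q.1 t) (conjHat (a q.2 t)) ξ

namespace AsymptoticSystem

variable {γ μ κ ν low ρ k lam : ℝ} {N : ℕ} {a p : ℕ → ℝ → Rn n → ℂ}

/-- At order 0 the curve is constant with rate zero; at positive orders the value at infinity is
zero. In either case the amplitude is an integral from infinity, as required for the product rule.
-/
lemma isTail (h : AsymptoticSystem γ μ κ a p) (he : SystemExponents n γ μ ν low ρ k lam N)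
    (h0 : wl ν k 0 ρ (fun ξ => ‖a 0 1 ξ‖ₑ) ≠ ∞) {m : ℕ} (hm : m ≤ N) :
    IsTail (if m = 0 then a 0 1 else 0) (amplitudeRate a p m) (a m) := by
  have hle := fun F => ltwo_le_wl (ν := ν) he.pos (he.nonneg hm) he.ρ_nonneg F
  obtain ⟨A, hA, hAle⟩ := (h.systemBound he h0 m hm).amplitude
  refine ⟨(h.measurable m).1, h.measurable_amplitudeRate m, ?_, fun t x => ?_,
    ⟨A, hA, fun t ht => (hle _).trans (hAle t ht)⟩, ?_,
    ne_top_of_le_ne_top (h.lintegral_amplitudeRate_ne_top he hm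
      fun j hj => h.systemBound he h0 j (by omega)) (lintegral_mono fun s => hle _)⟩
  · split_ifs
    · exact h.measurable_zero
    · exact measurable_const
  · rcases m with _ | m
    · simp [amplitudeRate, h.const t]
    · simp [amplitudeRate, h.succ]
  · split_ifs with h1
    · subst h1
      exact ne_top_of_le_ne_top hA ((hle _).trans (hAle 1 self_mem_Ici))
    · simp [ltwo]

/-- The conservation law for the densities. -/
lemma sum_mulHat_eq (h : AsymptoticSystem γ μ κ a p)
    (he : SystemExponents n γ μ ν low ρ k lam N) (h0 : wl ν k 0 ρ (fun ξ => ‖a 0 1 ξ‖ₑ) ≠ ∞)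
    {m : ℕ} (hm : m + 1 ≤ N) {s : ℝ} (hs : 1 ≤ s) (ξ : Rn n) :
    ∑ q ∈ Finset.HasAntidiagonal.antidiagonal (m + 1), (mulHat (amplitudeRate a p q.1 s) (conjHat (a q.2 s)) ξ +
      mulHat (a q.1 s) (conjHat (amplitudeRate a p q.2 s)) ξ) =
    (((2 * s ^ 2)⁻¹ : ℝ) : ℂ) * (-2 * ∑ q ∈ Finset.HasAntidiagonal.antidiagonal m,
      fluxHat (p q.1 s) (densityHat a q.2 s) ξ) := by
  have hb := h.systemBound he h0
  have ham := fun j => h.measurable_amplitude j s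
  have hpm := fun j => h.measurable_phase j s
  have hT : ∀ {i j : ℕ}, i + j + 1 ≤ N → TransportBound (p i s) (a j s) := fun {i j} hij =>
    h.transportBound he hij (hb i (by omega)) (hb j (by omega)) hs
  have ha2 : ∀ {j : ℕ}, j ≤ N → ltwo volume (fun ξ => ‖a j s ξ‖ₑ) ≠ ∞ := fun {j} hj => by
    obtain ⟨A, hA, hAle⟩ := (h.isTail he h0 hj).bounded
    exact ne_top_of_le_ne_top hA (hAle s hs)
  have htm : ∀ i j, Measurable (transportHat (p i s) (a j s)) := fun i j =>
    (measurable_uncurry_transportHat (h.measurable i).2 (h.measurable j).1).of_uncurry_left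
  rw [Finset.sum_add_distrib, Finset.Nat.sum_antidiagonal_succ,
    Finset.Nat.sum_antidiagonal_succ' (f := fun q : ℕ × ℕ =>
      mulHat (a q.1 s) (conjHat (amplitudeRate a p q.2 s)) ξ)]
  have z1 : mulHat (amplitudeRate a p 0 s) (conjHat (a (m + 1) s)) ξ = 0 := by
    simp [mulHat, amplitudeRate]
  have z2 : mulHat (a (m + 1) s) (conjHat (amplitudeRate a p 0 s)) ξ = 0 := by
    simp [mulHat, conjHat, amplitudeRate]
  have e1 : ∀ q ∈ Finset.HasAntidiagonal.antidiagonal m, mulHat (amplitudeRate a p (q.1 + 1) s) (conjHat (a q.2 s)) ξ =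
      (((2 * s ^ 2)⁻¹ : ℝ) : ℂ) * ∑ r ∈ Finset.HasAntidiagonal.antidiagonal q.1,
        mulHat (transportHat (p r.1 s) (a r.2 s)) (conjHat (a q.2 s)) ξ := fun q hq => by
    have hq' := Finset.HasAntidiagonal.mem_antidiagonal.1 hq
    refine mulHat_sum_left _ _ fun r hr => ?_
    have hr' := Finset.HasAntidiagonal.mem_antidiagonal.1 hr
    refine integrable_mul_of_ltwo (htm _ _) (measurable_conjHat (ham _))
      ((hT (by omega)).ltwo_ne_top (hpm _) (ham _)) ?_ ξ
    rw [ltwo_conjHat]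
    exact ha2 (by omega)
  have e2 : ∀ q ∈ Finset.HasAntidiagonal.antidiagonal m, mulHat (a q.1 s) (conjHat (amplitudeRate a p (q.2 + 1) s)) ξ =
      (((2 * s ^ 2)⁻¹ : ℝ) : ℂ) * ∑ r ∈ Finset.HasAntidiagonal.antidiagonal q.2,
        mulHat (a q.1 s) (conjHat (transportHat (p r.1 s) (a r.2 s))) ξ := fun q hq => by
    have hq' := Finset.HasAntidiagonal.mem_antidiagonal.1 hq
    simp only [mulHat_comm (a q.1 s)]
    have e3 : conjHat (amplitudeRate a p (q.2 + 1) s) = fun ζ => (((2 * s ^ 2)⁻¹ : ℝ) : ℂ) *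
        ∑ r ∈ Finset.HasAntidiagonal.antidiagonal q.2, conjHat (transportHat (p r.1 s) (a r.2 s)) ζ := by
      funext ζ
      simp only [conjHat, amplitudeRate, map_mul, map_sum, Complex.conj_ofReal]
    rw [e3]
    refine mulHat_sum_left _ _ fun r hr => ?_
    have hr' := Finset.HasAntidiagonal.mem_antidiagonal.1 hr
    refine integrable_mul_of_ltwo (measurable_conjHat (htm _ _)) (ham _) ?_ (ha2 (by omega)) ξ
    rw [ltwo_conjHat]
    exact (hT (by omega)).ltwo_ne_top (hpm _) (ham _)
  rw [z1, z2, zero_add, zero_add, Finset.sum_congr rfl e1, Finset.sum_congr rfl e2,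
    ← Finset.mul_sum, ← Finset.mul_sum, ← mul_add]
  congr 1
  -- Both triple sums are reindexed with the order of the phase outermost and the orders of the two
  -- amplitudes inside, so that the conservation law applies to each term and the inner sum becomes
  -- a density.
  rw [sum_antidiagonal_assoc (fun i j l => mulHat (transportHat (p i s) (a j s)) (conjHat (a l s)) ξ),
    sum_antidiagonal_left_comm
      (fun i j l => mulHat (a j s) (conjHat (transportHat (p i s) (a l s))) ξ),
    ← Finset.sum_add_distrib, Finset.mul_sum]
  refine Finset.sum_congr rfl fun q hq => ?_
  have hq' := Finset.HasAntidiagonal.mem_antidiagonal.1 hq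
  have key : ∀ r ∈ Finset.HasAntidiagonal.antidiagonal q.2, _ := fun r hr => by
    have hr' := Finset.HasAntidiagonal.mem_antidiagonal.1 hr
    exact mulHat_transportHat_add (hpm q.1) (ham r.1) (ham r.2) (h.conjHat_phase q.1 s)
      (hT (by omega)) (hT (by omega)) (ha2 (by omega)) (ha2 (by omega)) ξ
  rw [← Finset.sum_add_distrib, Finset.sum_congr rfl fun r hr => (key r hr).2, ← Finset.mul_sum]
  congr 1
  exact (fluxHat_sum_right _ fun r hr => (key r hr).1).symm

/-- The evolution of the densities. -/
lemma densityHat_succ (h : AsymptoticSystem γ μ κ a p)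
    (he : SystemExponents n γ μ ν low ρ k lam N) (h0 : wl ν k 0 ρ (fun ξ => ‖a 0 1 ξ‖ₑ) ≠ ∞)
    {m : ℕ} (hm : m + 1 ≤ N) {t : ℝ} (ht : 1 ≤ t) (ξ : Rn n) :
    densityHat a (m + 1) t ξ = -∫ s in Ioi t, (((2 * s ^ 2)⁻¹ : ℝ) : ℂ) *
      (-2 * ∑ q ∈ Finset.HasAntidiagonal.antidiagonal m, fluxHat (p q.1 s) (densityHat a q.2 s) ξ) := by
  have key : ∀ q ∈ Finset.HasAntidiagonal.antidiagonal (m + 1), _ := fun q hq => by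
    have hq' := Finset.HasAntidiagonal.mem_antidiagonal.1 hq
    exact (h.isTail he h0 (m := q.1) (by omega)).mulHat_eq
      (h.isTail he h0 (m := q.2) (by omega)).conjHat ht ξ
  -- Orders with a positive sum cannot both be zero, so one factor vanishes at infinity.
  have hz : ∀ q ∈ Finset.HasAntidiagonal.antidiagonal (m + 1), mulHat (if q.1 = 0 then a 0 1 else 0)
      (conjHat (if q.2 = 0 then a 0 1 else 0)) ξ = 0 := fun q hq => by
    have hq' := Finset.HasAntidiagonal.mem_antidiagonal.1 hq
    rcases Nat.eq_zero_or_pos q.1 with h1 | h1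
    · have h2 : q.2 ≠ 0 := by omega
      simp [mulHat, conjHat, h2]
    · simp [mulHat, h1.ne']
  rw [densityHat, Finset.sum_congr rfl fun q hq => (key q hq).2, Finset.sum_sub_distrib,
    Finset.sum_congr rfl hz, Finset.sum_const_zero, zero_sub,
    ← integral_finsetSum _ fun q hq => (key q hq).1]
  congr 1
  exact setIntegral_congr_fun measurableSet_Ioi fun s hs =>
    h.sum_mulHat_eq he h0 hm (ht.trans (le_of_lt hs)) ξ

end AsymptoticSystem

end Density

-- Asymptotic phases depend only on the modulus of w₊

section PhaseStates

namespace AsymptoticSystem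

variable {γ μ κ ν low ρ k lam : ℝ} {N : ℕ} {a p a' p' : ℕ → ℝ → Rn n → ℂ}

lemma sum_gZeroHat (κ μ : ℝ) (a : ℕ → ℝ → Rn n → ℂ) (m : ℕ) (s : ℝ) (ξ : Rn n) :
    ∑ q ∈ Finset.HasAntidiagonal.antidiagonal m, gZeroHat κ μ (a q.1 s) (a q.2 s) ξ =
      (κ : ℂ) * ((‖ξ‖ ^ (μ - n) : ℝ) : ℂ) * reHat (densityHat a m s) ξ := by
  simp only [gZeroHat, reHat, conjHat, densityHat, map_sum]
  rw [← Finset.mul_sum, ← Finset.sum_div, Finset.sum_add_distrib]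

/-- The phases depend on the amplitude at infinity only through its modulus. -/
lemma densityHat_phase_eq (h : AsymptoticSystem γ μ κ a p) (h' : AsymptoticSystem γ μ κ a' p')
    (he : SystemExponents n γ μ ν low ρ k lam N)
    (h0 : wl ν k 0 ρ (fun ξ => ‖a 0 1 ξ‖ₑ) ≠ ∞) (h0' : wl ν k 0 ρ (fun ξ => ‖a' 0 1 ξ‖ₑ) ≠ ∞)
    (hd : mulHat (a 0 1) (conjHat (a 0 1)) =ᵐ[volume] mulHat (a' 0 1) (conjHat (a' 0 1))) {m : ℕ}
    (hm : m ≤ N) : (∀ᵐ ξ, ∀ t, 1 ≤ t → densityHat a m t ξ = densityHat a' m t ξ) ∧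
      ∀ᵐ ξ, ∀ t, 1 ≤ t → p m t ξ = p' m t ξ := by
  induction m using Nat.strong_induction_on with
  | _ m ih =>
    have hD : ∀ᵐ ξ, ∀ t, 1 ≤ t → densityHat a m t ξ = densityHat a' m t ξ := by
      rcases m with _ | m
      · filter_upwards [hd] with ξ hξ t _
        simp only [densityHat, Finset.Nat.antidiagonal_zero,
          Finset.sum_singleton]
        rw [h.const t, h'.const t, hξ]
      -- The flux at order m + 1 contains only densities and phases of order at most m, and it is
      -- insensitive to null sets, so equality holds for every ξ.
      · refine ae_of_all _ fun ξ t ht => ?_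
        rw [h.densityHat_succ he h0 hm ht, h'.densityHat_succ he h0' hm ht]
        congr 1
        refine setIntegral_congr_fun measurableSet_Ioi fun s hs => ?_
        have hs' : 1 ≤ s := ht.trans (le_of_lt hs)
        congr 2
        refine Finset.sum_congr rfl fun q hq => ?_
        have hq' := Finset.HasAntidiagonal.mem_antidiagonal.1 hq
        exact congrFun (fluxHat_congr
          ((ih q.1 (by omega) (by omega)).2.mono fun ζ hζ => hζ s hs')
          ((ih q.2 (by omega) (by omega)).1.mono fun ζ hζ => hζ s hs')) ξ
    refine ⟨hD, ?_⟩
    -- The real part in g₀ involves the density at ξ and at -ξ, so its equality is needed at both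
    -- points.
    filter_upwards [hD, (Measure.measurePreserving_neg
      (volume : Measure (Rn n))).quasiMeasurePreserving.ae hD] with ξ h1 h2 t ht
    rw [h.phase, h'.phase]
    refine intervalIntegral.integral_congr fun s hs => ?_
    rw [uIcc_of_le ht] at hs
    rw [sum_gZeroHat, sum_gZeroHat, reHat, reHat, conjHat, conjHat, h1 s hs.1, h2 s hs.1]
    congr 2
    refine Finset.sum_congr rfl fun j _ => congrFun (gradDotHat_congr ?_ ?_) ξ
    · exact (ih j (by omega) (by omega)).2.mono fun ζ hζ => hζ s hs.1
    · exact (ih (m - 1 - j) (by omega) (by omega)).2.mono fun ζ hζ => hζ s hs.1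

end AsymptoticSystem

-- The choice made in `invHat` depends only on the set of admissible functions, and this set is the
-- same for transforms equal almost everywhere.
open Classical in
lemma invHat_congr {v v' : Rn n → ℂ} (h : v =ᵐ[volume] v') : invHat v = invHat v' := by
  have e : (fun u => IsFourier u v) = fun u => IsFourier u v' :=
    funext fun u => propext ⟨fun hu => hu.congr_right h, fun hu => hu.congr_right h.symm⟩
  have key : ∀ P Q : (Rn n → ℂ) → Prop, P = Q →
      (if h : ∃ u, P u then h.choose else 0) = if h : ∃ u, Q u then h.choose else 0 := by
    rintro P _ rfl
    rfl
  exact key _ _ e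

/-- For integrable v the function `mulHat v (conjHat v)` is the transform of |`invF v`|². By
continuity the moduli agree everywhere, and the inverse transform is injective. -/
lemma mulHat_conjHat_ae_eq {v v' : Rn n → ℂ} (hv : Integrable v) (hv' : Integrable v')
    (h : ∀ᵐ x, ‖invF v x‖ = ‖invF v' x‖) : mulHat v (conjHat v) =ᵐ[volume] mulHat v' (conjHat v') := by
  have h1 : (fun x => ‖invF v x‖) = fun x => ‖invF v' x‖ :=
    ((continuous_invF hv).norm.ae_eq_iff_eq volume (continuous_invF hv').norm).1 h
  refine ae_eq_of_invF_eq (integrable_mulHat hv (integrable_conjHat hv))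
    (integrable_mulHat hv' (integrable_conjHat hv')) (funext fun x => ?_)
  rw [invF_mulHat hv (integrable_conjHat hv), invF_mulHat hv' (integrable_conjHat hv'),
    invF_conjHat, invF_conjHat, Complex.mul_conj', Complex.mul_conj', congrFun h1 x]

/-- Amplitudes at infinity with the same modulus have the same asymptotic phases. -/
lemma phaseSum_eq {γ μ κ ν low ρ k lam : ℝ} {N : ℕ} (he : SystemExponents n γ μ ν low ρ k lam N)
    {wp wp' V V' : Rn n → ℂ} (hV : Measurable V) (hV' : Measurable V')
    (hF : IsFourier wp V) (hF' : IsFourier wp' V')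
    (h0 : wl ν k 0 ρ (fun ξ => ‖V ξ‖ₑ) ≠ ∞) (h0' : wl ν k 0 ρ (fun ξ => ‖V' ξ‖ₑ) ≠ ∞)
    (hw : ∀ᵐ x, ‖wp x‖ = ‖wp' x‖) {t : ℝ} (ht : 1 ≤ t) :
    phaseSum γ μ κ wp N t = phaseSum γ μ κ wp' N t := by
  obtain ⟨C, hC, hle⟩ := exists_lintegral_le_wl he.pos he.lt_k (b := 0)
    (by have := he.pos; positivity)
  have hi : Integrable V := integrable_of_lintegral_enorm hV
    (ne_top_of_le_ne_top (ENNReal.mul_ne_top hC h0) (hle ν ρ _ he.ρ_nonneg hV.enorm))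
  have hi' : Integrable V' := integrable_of_lintegral_enorm hV'
    (ne_top_of_le_ne_top (ENNReal.mul_ne_top hC h0') (hle ν ρ _ he.ρ_nonneg hV'.enorm))
  obtain ⟨a, ha, hz⟩ := exists_asymptoticSystem γ μ κ hV hF.hat_ae_eq
  obtain ⟨a', ha', hz'⟩ := exists_asymptoticSystem γ μ κ hV' hF'.hat_ae_eq
  have hd : mulHat V (conjHat V) =ᵐ[volume] mulHat V' (conjHat V') := by
    refine mulHat_conjHat_ae_eq hi hi' ?_
    filter_upwards [hw, hF.ae_eq_left (isFourier_invF hi), hF'.ae_eq_left (isFourier_invF hi')]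
      with x h1 h2 h3
    rw [← h2, ← h3, h1]
  refine invHat_congr ?_
  have key : ∀ᵐ ξ, ∀ m ∈ Finset.range (N + 1), phaseHat γ μ κ wp m t ξ = phaseHat γ μ κ wp' m t ξ := by
    rw [Filter.eventually_all_finset]
    intro m hm
    refine (ha.densityHat_phase_eq ha' he (by rwa [hz]) (by rwa [hz']) (by rwa [hz, hz'])
      (Nat.lt_succ_iff.1 (Finset.mem_range.1 hm))).2.mono fun ξ hξ => hξ t ht
  exact key.mono fun ξ hξ => Finset.sum_congr rfl hξ

/-- The common asymptotic phase Φ cancels: ψ' - ψ - ω is independent of t and is a combination of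
three terms that tend to zero in L^∞. -/
lemma phaseState_eq {φ φ' : ℝ → Rn n → ℝ} {Φ : ℝ → Rn n → ℂ} {ψ ψ' ω : Rn n → ℝ}
    {ε : ℝ → ℝ≥0∞}
    (h : Tendsto (fun t => eLpNorm (fun x => (φ t x : ℂ) - Φ t x - (ψ x : ℂ)) ∞ volume) atTop (𝓝 0))
    (h' : Tendsto (fun t => eLpNorm (fun x => (φ' t x : ℂ) - Φ t x - (ψ' x : ℂ)) ∞ volume) atTop (𝓝 0))
    (hε : Tendsto ε atTop (𝓝 0))
    (hω : ∀ᶠ t in atTop, ∀ x, ‖((φ' t x - φ t x : ℝ) : ℂ) - (ω x : ℂ)‖ₑ ≤ ε t) :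
    ∀ᵐ x, ψ' x = ψ x + ω x := by
  have key : ∀ᶠ t in atTop, eLpNorm (fun x => (ψ' x : ℂ) - (ψ x + ω x : ℝ)) ∞ volume ≤
      eLpNorm (fun x => (φ t x : ℂ) - Φ t x - (ψ x : ℂ)) ∞ volume +
      eLpNorm (fun x => (φ' t x : ℂ) - Φ t x - (ψ' x : ℂ)) ∞ volume + ε t := by
    filter_upwards [hω] with t ht
    simp only [eLpNorm_exponent_top]
    refine eLpNormEssSup_le_of_ae_enorm_bound ?_
    filter_upwards [ae_le_eLpNormEssSup (f := fun x => (φ t x : ℂ) - Φ t x - (ψ x : ℂ)),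
      ae_le_eLpNormEssSup (f := fun x => (φ' t x : ℂ) - Φ t x - (ψ' x : ℂ))] with x h1 h2
    have e : (ψ' x : ℂ) - (ψ x + ω x : ℝ) = ((φ t x : ℂ) - Φ t x - (ψ x : ℂ)) -
        ((φ' t x : ℂ) - Φ t x - (ψ' x : ℂ)) + (((φ' t x - φ t x : ℝ) : ℂ) - (ω x : ℂ)) := by
      push_cast; ring
    rw [e]
    exact (enorm_add_le _ _).trans (add_le_add ((enorm_sub_le).trans (add_le_add h1 h2)) (ht x))
  have h0 := ge_of_tendsto ((h.add h').add hε) key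
  rw [add_zero, add_zero, nonpos_iff_eq_zero, eLpNorm_exponent_top, eLpNormEssSup_eq_zero_iff] at h0
  filter_upwards [h0] with x hx
  exact_mod_cast sub_eq_zero.1 hx

end PhaseStates

-- Bounds on the integral of the rate

section Gauge

/-- The bound by the integral over (1, ∞) makes the final constant independent of T. -/
lemma lintegral_rate_le {T : ℝ} {r r' : ℝ → ℝ} (hT : 1 ≤ T)
    (h : ∀ t ∈ Ici (1 : ℝ), r t = r' t) :
    ∫⁻ τ in Ioi T, ENNReal.ofReal (r' τ) ≤ ∫⁻ τ in Ioi 1, ENNReal.ofReal (r τ) := by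
  rw [setLIntegral_congr_fun (g := fun τ => ENNReal.ofReal (r τ)) measurableSet_Ioi
    fun τ hτ => by simp only [h τ (hT.trans (le_of_lt hτ))]]
  exact lintegral_mono_set (Ioi_subset_Ioi hT)

lemma IsRate.lintegral_ne_top {γ : ℝ} {r : ℝ → ℝ} (hr : IsRate γ r) :
    ∫⁻ τ in Ioi 1, ENNReal.ofReal (r τ) ≠ ∞ := by
  refine ne_top_of_le_ne_top (hr.integrableOn.mono_set Ioi_subset_Ici_self).2.ne
    (lintegral_mono fun τ => ?_)
  rw [← ofReal_norm]
  exact ENNReal.ofReal_le_ofReal (le_abs_self _)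

end Gauge

end Gevrey

end

-- Proof of the theorem

open Gevrey in
theorem proposition7p2 {n : ℕ} (γ μ κ ν low k ℓ : ℝ)
    (hγ : 0 < γ) (hγ_le : γ ≤ 1) (hμ : 0 < μ) (hμ_le : μ ≤ n) (hν : 0 < ν) (hν_le : ν ≤ 1)
    (hlow : 0 ≤ low) (hlow_lt : low < n / 2) (hlow_gt : n / 2 - μ < low)
    (hk : 0 ≤ k) (hℓ : n / 2 - ν < ℓ)
    (r : ℝ → ℝ) (hr : Gevrey.IsRate γ r) :
    ∃ c : ℝ, 0 < c ∧ ∃ C : ℝ, 0 < C ∧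
      ∀ h₀ h₁ : ℝ → ℝ, Gevrey.IsEstimating γ r h₀ h₁ →
      ∀ t₀ ρ₀ T : ℝ, 1 ≤ t₀ → t₀ ≤ T → (∀ t, t₀ ≤ t → 0 ≤ Gevrey.rho r t₀ ρ₀ t) →
      ∀ (w : ℝ → Rn n → ℂ) (φ : ℝ → Rn n → ℝ) (w' : ℝ → Rn n → ℂ) (φ' : ℝ → Rn n → ℝ),
      Gevrey.IsSolution γ μ κ T w φ → Gevrey.IsSolution γ μ κ T w' φ' →
      Gevrey.PairMemX ν low k ℓ r (Gevrey.rho r t₀ ρ₀) T w (fun t x => (h₀ t)⁻¹ * φ t x) →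
      Gevrey.PairMemX ν low k ℓ r (Gevrey.rho r t₀ ρ₀) T w' (fun t x => (h₀ t)⁻¹ * φ' t x) →
      Gevrey.GaugeEquiv T w φ w' φ' →
      ∃ ω : Rn n → ℝ,
        -- (1) existence of the limit `ω`, and the rate of convergence
        (Gevrey.IsPhaseLimit ν low (Gevrey.rhoInf r t₀ ρ₀) (ℓ - 1 + ν)
            (fun t x => φ' t x - φ t x) ω ∧
          ∀ b : ENNReal,
            b = max (Gevrey.normZ ν low ℓ r (Gevrey.rho r t₀ ρ₀) T h₀ φ)
              (Gevrey.normZ ν low ℓ r (Gevrey.rho r t₀ ρ₀) T h₀ φ') →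
            ∀ T₁ : ℝ, T ≤ T₁ → b * ENNReal.ofReal (h₁ T₁) ≤ ENNReal.ofReal c →
            ∀ t : ℝ, T₁ ≤ t →
              Gevrey.normY ν low (Gevrey.rhoInf r t₀ ρ₀) (ℓ - 2 + ν)
                  (fun x => φ' t x - φ t x - ω x) ≤
                ENNReal.ofReal C * b *
                  Gevrey.normY ν low (Gevrey.rho r t₀ ρ₀ T₁) (ℓ - 1 + ν)
                    (fun x => φ' T₁ x - φ T₁ x) *
                  ENNReal.ofReal (h₁ t)) ∧
        -- (2) the limits of the amplitudes
        (1 - ν / 2 ≤ k → k ≤ ℓ + 1 →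
          ∃ wp wp' : Rn n → ℂ,
            Gevrey.IsAmplitudeLimit ν (Gevrey.rhoInf r t₀ ρ₀) k w wp ∧
            Gevrey.IsAmplitudeLimit ν (Gevrey.rhoInf r t₀ ρ₀) k w' wp' ∧
            (∀ᵐ x, wp' x = wp x * Complex.exp (Complex.I * (ω x : ℂ))) ∧
            -- (3) the asymptotic states of the phases
            ∀ (p : ℕ) (kp : ℝ), n / 2 < kp → (p + 1) * max (μ - n + 2) 1 - 1 ≤ kp →
              Gevrey.normK ν (Gevrey.rhoInf r t₀ ρ₀) kp wp < ⊤ →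
              Gevrey.normK ν (Gevrey.rhoInf r t₀ ρ₀) kp wp' < ⊤ →
              ∀ ψ ψ' : Rn n → ℝ,
                Gevrey.IsPhaseState γ μ κ wp p φ ψ → Gevrey.IsPhaseState γ μ κ wp' p φ' ψ' →
                ∀ᵐ x, ψ' x = ψ x + ω x) := by
  have hn : 0 < n := by
    have : (0 : ℝ) < n := by linarith
    exact_mod_cast this
  obtain ⟨c, hc, C, hC, hlim⟩ := exists_phase_limit hn hν hν_le hlow hlow_lt hℓ
  have hR := hr.lintegral_ne_top
  set R : ENNReal := ∫⁻ τ in Ioi 1, ENNReal.ofReal (r τ) with hRdef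
  -- R is the total integral of r from time 1, so this constant does not depend on T, h₀, h₁ or the
  -- solutions; the 1 is there for positivity.
  refine ⟨c, hc, (C * R).toReal + 1, by positivity, ?_⟩
  intro h₀ h₁ hh t₀ ρ₀ T ht₀ hT hρ w φ w' φ' hs hs' hX hX' hg
  have hT1 : 1 ≤ T := ht₀.trans hT
  have hIci : ∀ {t}, t ∈ Ici T → t ∈ Ici (1 : ℝ) := fun ht => hT1.trans ht
  obtain ⟨r', ρ', h₀', h₁', htw, hm₀, hrr, hρρ, hhh, hhh₁⟩ := exists_timeWeights hr hh ht₀ hT hρ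
  have hρm := htw.continuous_ρ.measurable
  have hphase : ∀ {χ : ℝ → Rn n → ℝ}, MemX ν (ℓ + 2) low r (rho r t₀ ρ₀) T
      (fun t x => (((h₀ t)⁻¹ * χ t x : ℝ) : ℂ)) → _ := fun {χ} h =>
    exists_controlled hn (u := fun t x => (χ t x : ℂ)) hρm hm₀ hρρ (fun t ht => hrr t (hIci ht))
      (fun t ht => hhh t (hIci ht)) (fun t ht => hh.pos_zero t (hIci ht))
      (by simpa only [Complex.ofReal_mul, Complex.ofReal_inv] using h)
  have hampl : ∀ {z : ℝ → Rn n → ℂ}, MemX ν k 0 r (rho r t₀ ρ₀) T z → _ := fun {z} h =>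
    exists_controlled hn (u := z) (h := fun _ => 1) (h' := fun _ => 1) hρm measurable_const hρρ
      (fun t ht => hrr t (hIci ht)) (fun _ _ => rfl) (fun _ _ => one_pos)
      (by simpa only [Complex.ofReal_one, inv_one, one_mul] using h)
  obtain ⟨hb, p, hF, hp⟩ := hphase hX.2
  obtain ⟨hb', p', hF', hp'⟩ := hphase hX'.2
  obtain ⟨hB, a, hFa, ha⟩ := hampl hX.1
  obtain ⟨hB', a', hFa', ha'⟩ := hampl hX'.1
  set b : ENNReal := max (normZ ν low ℓ r (rho r t₀ ρ₀) T h₀ φ)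
    (normZ ν low ℓ r (rho r t₀ ρ₀) T h₀ φ') with hbdef
  have hbt : b ≠ ⊤ := by
    rw [hbdef, ne_eq, max_eq_top, not_or]
    exact ⟨hb, hb'⟩
  have hcp := hp b (le_max_left _ _)
  have hcp' := hp' b (le_max_right _ _)
  obtain ⟨V, hVm, hbd, htend, hrate⟩ := hlim γ μ κ r' ρ' (rhoInf r t₀ ρ₀) T _ _ b w w' φ φ' p p'
    htw hbt hs hs' hg hcp hcp' hF hF'
  have hρ0 := htw.ρinf_nonneg
  have hconv : ConvergesTo ν (ℓ - 1 + ν + 2) low (rhoInf r t₀ ρ₀) T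
      (fun t ξ => p' t ξ - p t ξ) V := by
    refine ⟨fun t => hcp'.measurable.of_uncurry_left.sub hcp.measurable.of_uncurry_left, hVm, ?_,
      _, htend⟩
    rwa [show ℓ - 1 + ν + 2 = ℓ + 1 + ν by ring]
  have hdiff : ∀ t ∈ Ici T, IsFourier (fun x => ((φ' t x - φ t x : ℝ) : ℂ))
      (fun ξ => p' t ξ - p t ξ) := fun t ht => by
    simpa only [Complex.ofReal_sub] using (hF' t ht).sub (hF t ht)
  -- The exponent ℓ + 1 + ν exceeds n/2, so the transforms converge in L¹ and the phase difference
  -- converges uniformly to a continuous real function.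
  obtain ⟨ω, hωc, hωF, hωle⟩ := hconv.exists_real_limit hn hρ0 (by linarith) hlow_lt hdiff
    fun t ht => (hs'.contDiff_φ t ht).continuous.sub (hs.contDiff_φ t ht).continuous
  have hε := hconv.tendsto_lintegral hn hρ0 (by linarith) hlow_lt
  refine ⟨ω, ⟨hconv.isPhaseLimit hdiff hωF, ?_⟩, ?_⟩
  · rintro _ rfl T₁ hT₁ hbc t ht
    have e1 := ((hdiff t (hT₁.trans ht)).sub hωF).wnorm_eq ν (ℓ - 2 + ν + 2) low (rhoInf r t₀ ρ₀)
    have e2 := (hdiff T₁ hT₁).wnorm_eq ν (ℓ - 1 + ν + 2) low (rho r t₀ ρ₀ T₁)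
    simp only [normY, Complex.ofReal_sub] at e1 e2 ⊢
    rw [e1, e2, show ℓ - 2 + ν + 2 = ℓ + ν by ring, show ℓ - 1 + ν + 2 = ℓ + 1 + ν by ring,
      hρρ T₁ hT₁, hhh₁ t (hIci (hT₁.trans ht))]
    rw [hhh₁ T₁ (hIci hT₁)] at hbc
    refine (hrate T₁ hT₁ hbc t ht).trans ?_
    gcongr ?_ * _ * _
    rw [mul_right_comm]
    gcongr
    rw [ENNReal.ofReal_add ENNReal.toReal_nonneg zero_le_one, ENNReal.ofReal_toReal (by finiteness)]
    exact le_add_right (mul_le_mul' le_rfl (lintegral_rate_le hT1 hrr))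
  · intro hk1 _
    have hk0 : 0 < k := by linarith
    have hca := ha _ le_rfl
    have hca' := ha' _ le_rfl
    simp only [ENNReal.ofReal_one] at hca hca'
    obtain ⟨W, hW⟩ := exists_amplitude_limit hn hν hν_le hlow hlow_lt hℓ hk1 hbt hB htw hs hcp hca hF hFa
    obtain ⟨W', hW'⟩ := exists_amplitude_limit hn hν hν_le hlow hlow_lt hℓ hk1 hbt hB' htw hs' hcp'
      hca' hF' hFa'
    have hL : ∀ {U : ℝ → Rn n → ℂ} {Z : Rn n → ℂ}, ConvergesTo ν k 0 (rhoInf r t₀ ρ₀) T U Z →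
        MemLp Z 2 volume := fun h => by
      obtain ⟨M, hM, hZ, -⟩ := h.bounded
      exact memLp_of_wl hn hk0.le hρ0 h.measurable_limit (ne_top_of_le_ne_top hM hZ)
    -- Since k > 0 and ρ(∞) ≥ 0, the limits of the transforms lie in L², and Plancherel's theorem
    -- provides the functions.
    obtain ⟨wp, hwp, hwpL, -⟩ := exists_isFourier_of_memLp (hL hW)
    obtain ⟨wp', hwp', hwpL', -⟩ := exists_isFourier_of_memLp (hL hW')
    have hgl : ∀ᵐ x, wp' x = wp x * Complex.exp (Complex.I * (ω x : ℂ)) := by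
      refine gauge_limit hg (fun t ht => (hs.contDiff_w t ht).continuous.aestronglyMeasurable)
        (fun t ht => (hs'.contDiff_w t ht).continuous.aestronglyMeasurable) hwpL.1 hwpL'.1
        (hW.tendsto_eLpNorm hn hk0 hρ0 hFa hwp) (hW'.tendsto_eLpNorm hn hk0 hρ0 hFa' hwp')
        fun x => ?_
      rw [tendsto_iff_edist_tendsto_0]
      refine tendsto_of_tendsto_of_tendsto_of_le_of_le' tendsto_const_nhds hε
        (Eventually.of_forall fun _ => zero_le) ?_
      filter_upwards [eventually_ge_atTop T] with t ht
      refine le_trans (le_of_eq ?_) (hωle t ht x)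
      rw [edist_eq_enorm_sub, ← Complex.ofReal_sub, ← ofReal_norm, ← ofReal_norm, Complex.norm_real]
    refine ⟨wp, wp', hW.isAmplitudeLimit hFa hwp, hW'.isAmplitudeLimit hFa' hwp', hgl, ?_⟩
    intro N kp hkp hkN hm hm' ψ ψ' hψ hψ'
    rw [normK, hwp.wnorm_eq] at hm
    rw [normK, hwp'.wnorm_eq] at hm'
    -- The asymptotic system is estimated with the fixed radius ρ(∞), which may vanish; the powers
    -- of |ξ| alone suffice there.
    have he : SystemExponents n γ μ ν low (rhoInf r t₀ ρ₀) kp (max (μ - n + 2) 1) N :=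
      ⟨hn, hγ, hγ_le, hν.le, hν_le, hlow, hlow_lt, hlow_gt, hμ_le, hρ0, le_max_right _ _,
        le_max_left _ _, hkp, hkN⟩
    have hnorm : ∀ᵐ x, ‖wp x‖ = ‖wp' x‖ := by
      filter_upwards [hgl] with x hx
      rw [hx, norm_mul, mul_comm Complex.I, Complex.norm_exp_ofReal_mul_I, mul_one]
    -- The partial sums built from the two amplitudes coincide, so the second limit may be taken
    -- with the first partial sum.
    refine phaseState_eq (φ' := φ') hψ (hψ'.congr' ?_) hε ?_
    · filter_upwards [eventually_ge_atTop 1] with t ht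
      rw [phaseSum_eq he hW.measurable_limit hW'.measurable_limit hwp hwp' hm.ne hm'.ne hnorm ht]
    · filter_upwards [eventually_ge_atTop T] with t ht
      exact hωle t ht
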